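/- Let $\ell\ge 1$ and $0\le m\le \ell$ be integers. **Conventions.** A *generalized Frobenius manifold of charge $d$* is a complex manifold with a holomorphic flat metric $\eta$, a commutative associative holomorphic multiplication on the tangent spaces with unit vector field $e$ and $\eta(X\cdot Y,Z)=\eta(X,Y\cdot Z)$, such that for $c(X,Y,Z)=\eta(X\cdot Y,Z)$ the tensor $\nabla c$ is totally symmetric, and an Euler vector field $E$ with $\nabla\nabla E=0$, $\mathcal L_E(X\cdot Y)=\mathcal L_EX\cdot Y+X\cdot\mathcal L_EY+X\cdot Y$ and $\mathcal L_E\bigl(\eta(X,Y)\bigr)=\eta(\mathcal L_EX,Y)+\eta(X,\mathcal L_EY)+(2-d)\,\eta(X,Y)$ ($e$ need not be flat). Its *intersection form* is $g(\omega_1,\omega_2)=i_E(\omega_1\cdot\omega_2)$ on covectors. **The space $\widetilde{\mathcal M}_{\ell,m}$.** For $a=(a_1,\dots,a_\ell)\in\mathbb C^\ell$ let $\Lambda(p)=\frac{p^2-1}{p^{2m}}\sum_{j=1}^{\ell}a_jp^{2(\ell-j)}$. Let $\widetilde{\mathcal M}_{\ell,m}\subset\mathbb C^\ell$ be given by $a_1\ne0$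 if $m<\ell$ and $a_\ell\neq0$ if $m>0$. Put $$\tilde\eta(\partial',\partial'')=\sum_{\Lambda'(q)=0}\operatorname*{Res}_{p=q}\frac{\partial'\Lambda\,\partial''\Lambda}{\Lambda'(p)}\frac{dp}{(p^2-1)^2},\qquad \tilde c(\partial',\partial'',\partial''')=\sum_{\Lambda'(q)=0}\operatorname*{Res}_{p=q}\frac{\partial'\Lambda\,\partial''\Lambda\,\partial'''\Lambda}{\Lambda'(p)}\frac{dp}{(p^2-1)^2},$$ summed over the critical points of $\Lambda$ (including $p=\infty$ if $m=\ell$), and define the multiplication by $\tilde\eta(\partial'\cdot\partial'',\partial''')=\tilde c(\partial',\partial'',\partial''')$. Let $\tilde E=\sum_j a_j\partial_{a_j}$ and $\tilde e=-\tfrac12\operatorname{grad}_{\tilde\eta}\log(a_1+\dots+a_\ell)$. **The orbit space $\mathcal M_{\ell,m}$.** In the space with orthonormal basis $e_1,\dots,e_\ell$ consider the coroots $\alpha_j^\vee=e_j-e_{j+1}$ $(j<\ell)$, $\alpha_\ell^\vee=e_\ell$, and the weights $\omega_j=e_1+\dots+e_j$ of the root system $C_\ell$, with Weyl group $W$ (the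 signed permutations). For $\mathbf x=c\,\omega_1+\sum_j x^j\alpha_j^\vee$ (complexified) and $\lambda=e^{-2\pi ic}$ let $y^j=\frac{\lambda}{N_j}\sum_{w\in W}e^{2\pi i(\omega_j,w(\mathbf x))}$, with $N_j$ the order of the stabilizer of $\omega_j$, and $z^j=y^j+c_j\lambda$, where $\sum_{j=1}^{\ell}c_ju^{\ell-j}=u^\ell-(u+2)^m(u-2)^{\ell-m}$. In the coordinates $z^1,\dots,z^\ell$ on the orbit space $\mathbb C^\ell$, the contravariant metric $\frac1{4\pi^2}\sum_{r,s}\frac{\partial z^i}{\partial x^r}a^{rs}\frac{\partial z^j}{\partial x^s}$, $(a^{rs})=((\alpha_r^\vee,\alpha_s^\vee))^{-1}$, has the form $g^{ij}(z)+\lambda\eta^{ij}(z)$. Let $\mathcal M_{\ell,m}=\{\det(\eta^{ij})\neq0\}$, $E=\sum_j z^j\partial_{z^j}$, $e=-\operatorname{grad}_\eta\log z^1$. The multiplication on $\mathcal M_{\ell,m}$ is the holomorphic one which, where $\det(g^{ij})\ne0$, is given in local flat coordinates $t^\alpha$ of $\eta$ with $E=\sum_\alpha d_\alpha t^\alpha\partial_{t^\alpha}$,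 $d_\alpha>0$, by $\partial_{t^\alpha}\cdot\partial_{t^\beta}=c_{\alpha\beta}^\gamma\partial_{t^\gamma}$, $c_{\alpha\beta}^\gamma=\frac1{d_\rho}\eta_{\alpha\nu}\eta_{\beta\rho}\eta^{\gamma\zeta}\Gamma^{\nu\rho}_\zeta$, with $\Gamma^{\nu\rho}_\zeta=-g^{\nu\sigma}\Gamma^\rho_{\sigma\zeta}$ the contravariant Christoffel symbols of $g$. **Theorem.** 1. On $\widetilde{\mathcal M}_{\ell,m}\cap\{a_1+\dots+a_\ell\neq0\}$ the data $(\tilde\eta,\cdot,\tilde e,\tilde E)$ form a generalized Frobenius manifold of charge $1$. 2. On $\widetilde{\mathcal M}_{\ell,m}$, for any local continuous branches of $a_1^{1/(2(\ell-m))}$ and $(-a_\ell)^{1/(2m)}$, with $\Lambda^{1/(2(\ell-m))}\sim a_1^{1/(2(\ell-m))}p$ as $p\to\infty$ and $\Lambda^{1/(2m)}\sim(-a_\ell)^{1/(2m)}p^{-1}$ as $p\to0$, flat coordinates of $\tilde\eta$ are $$\tilde t^\alpha=\tfrac{1}{2(\ell-m-\alpha)+1}\operatorname*{Res}_{p=\infty}\Lambda^{\frac{2(\ell-m-\alpha)+1}{2(\ell-m)}}\tfrac{dp}{p^2-1}\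 (1\le\alpha\le\ell-m),\qquad \tilde t^\beta=\tfrac{1}{2(\ell-\beta)+1}\operatorname*{Res}_{p=0}\Lambda^{\frac{2(\ell-\beta)+1}{2m}}\tfrac{dp}{p^2-1}\ (\ell-m<\beta\le\ell).$$ In them $(\tilde\eta_{\alpha\beta})$ is block diagonal with anti-diagonal blocks of sizes $\ell-m$ and $m$ and entries $2(\ell-m)$ and $2m$, and $\tilde E\tilde t^\alpha=\frac{2(\ell-m-\alpha)+1}{2(\ell-m)}\tilde t^\alpha$, $\tilde E\tilde t^\beta=\frac{2(\ell-\beta)+1}{2m}\tilde t^\beta$. 3. Where $\Lambda$ and $\Lambda'$ have no common zero (for $m=\ell$ also $a_1\ne 0$), the inverse of the intersection form $\tilde g$ is $\sum_{\Lambda'(q)=0}\operatorname{Res}_{p=q}\frac{\partial'\Lambda\,\partial''\Lambda}{\Lambda\,\Lambda'}\frac{dp}{(p^2-1)^2}$. 4. The functions $g^{ij},\eta^{ij}$ and the multiplication on $\mathcal M_{\ell,m}$ exist; $(\eta,\cdot,e,E)$ is a generalized Frobenius manifold of charge $1$ on $\mathcal M_{\ell,m}\cap\{z^1\ne0\}$,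 and its intersection form is $g$ (the latter on all of $\mathcal M_{\ell,m}$). 5. Let $h(a)=(z^1,\dots,z^\ell)$ with $$z^j=-4\,[s^{\ell-j}]\Bigl(\sum_{k=1}^\ell a_k(s-2)^{\ell-k}(s+2)^{k-1}\Bigr),$$ where $[s^k]f$ is the coefficient of $s^k$ in $f$, and let $\bar h$ be $h$ followed by $z^j\mapsto(-1)^jz^j$. Then $h\colon\widetilde{\mathcal M}_{\ell,\ell-m}\to\mathcal M_{\ell,m}$ and $\bar h\colon\widetilde{\mathcal M}_{\ell,m}\to\mathcal M_{\ell,m}$ are isomorphisms of the above structures, up to a factor $2$ in the metrics: they are biholomorphic, map $\{a_1+\dots+a_\ell\ne0\}$ onto $\{z^1\neq0\}$, carry the multiplication, the Euler field and (there) the unit field to those of $\mathcal M_{\ell,m}$, and carry the contravariant metrics $\tilde\eta$, $\tilde g$ to $2\eta$, $2g$. -/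

import Mathlib

open scoped Matrix Topology

noncomputable section

namespace GenFrob

/-! ### Tensors on open subsets of `ℂⁿ`, and local coordinates

A tensor field is given by its components in the standard coordinates of `ℂⁿ`: a covariant or
contravariant metric is a field of matrices, a multiplication on the tangent spaces is a field of
structure constants `C x i j k` (the coefficient of `∂_k` in `∂_i · ∂_j`). -/

variable {n : ℕ}

/-- The bilinear form with matrix `M`. -/
def bil (M : Matrix (Fin n) (Fin n) ℂ) (X Y : Fin n → ℂ) : ℂ := X ⬝ᵥ (M *ᵥ Y)

/-- The product of two tangent vectors for the structure constants `C`. -/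
def prod (C : Fin n → Fin n → Fin n → ℂ) (X Y : Fin n → ℂ) : Fin n → ℂ :=
  fun k => ∑ i, ∑ j, X i * Y j * C i j k

/-- Jacobian matrix `∂t^α/∂x^i`. -/
def jac (t : (Fin n → ℂ) → (Fin n → ℂ)) (x : Fin n → ℂ) : Matrix (Fin n) (Fin n) ℂ :=
  Matrix.of fun α i => fderiv ℂ t x (Pi.single i 1) α

/-- The coordinate vector field `∂/∂t^α` at `x`. -/
def frame (t : (Fin n → ℂ) → (Fin n → ℂ)) (x : Fin n → ℂ) (α : Fin n) : Fin n → ℂ :=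
  fun i => (jac t x)⁻¹ i α

/-- The partial derivative `∂f/∂t^α` at `x`. -/
def pder (t : (Fin n → ℂ) → (Fin n → ℂ)) (f : (Fin n → ℂ) → ℂ) (x : Fin n → ℂ) (α : Fin n) : ℂ :=
  fderiv ℂ f x (frame t x α)

/-- `t` is holomorphic on the open set `V` with invertible Jacobian, i.e. (by the inverse function
theorem) a holomorphic coordinate system near each point of `V`. -/
structure IsLocalCoords (V : Set (Fin n → ℂ)) (t : (Fin n → ℂ) → (Fin n → ℂ)) : Prop where
  isOpen : IsOpen V
  holo : DifferentiableOn ℂ t V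
  jac_ne : ∀ x ∈ V, (jac t x).det ≠ 0

/-- `t` are flat coordinates on `V` of the covariant metric `η`: its components
`η(∂/∂t^α, ∂/∂t^β)` are constant. -/
def IsFlatCoords (η : (Fin n → ℂ) → Matrix (Fin n) (Fin n) ℂ) (V : Set (Fin n → ℂ))
    (t : (Fin n → ℂ) → (Fin n → ℂ)) : Prop :=
  IsLocalCoords V t ∧ ∃ A : Matrix (Fin n) (Fin n) ℂ,
    ∀ x ∈ V, ∀ α β, bil (η x) (frame t x α) (frame t x β) = A α β

/-- Components in the coordinates `t` of a contravariant metric `g`. -/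
def upper (t : (Fin n → ℂ) → (Fin n → ℂ)) (g : (Fin n → ℂ) → Matrix (Fin n) (Fin n) ℂ)
    (x : Fin n → ℂ) : Matrix (Fin n) (Fin n) ℂ :=
  jac t x * g x * (jac t x)ᵀ

/-- Components in the coordinates `t` of the covariant metric inverse to a contravariant
metric `g`. -/
def lower (t : (Fin n → ℂ) → (Fin n → ℂ)) (g : (Fin n → ℂ) → Matrix (Fin n) (Fin n) ℂ)
    (x : Fin n → ℂ) : Matrix (Fin n) (Fin n) ℂ :=
  Matrix.of fun α β => bil (g x)⁻¹ (frame t x α) (frame t x β)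

/-- Christoffel symbols `Γ^γ_{αβ}`, in the coordinates `t`, of the Levi-Civita connection of the
contravariant metric `g`. -/
def christoffel (t : (Fin n → ℂ) → (Fin n → ℂ)) (g : (Fin n → ℂ) → Matrix (Fin n) (Fin n) ℂ)
    (x : Fin n → ℂ) (γ α β : Fin n) : ℂ :=
  (1 / 2) * ∑ δ, upper t g x γ δ *
    (pder t (fun y => lower t g y δ β) x α + pder t (fun y => lower t g y δ α) x β
      - pder t (fun y => lower t g y α β) x δ)

/-- Contravariant Christoffel symbols `Γ^{αβ}_γ = -g^{αρ} Γ^β_{ργ}` in the coordinates `t`. -/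
def conChristoffel (t : (Fin n → ℂ) → (Fin n → ℂ))
    (g : (Fin n → ℂ) → Matrix (Fin n) (Fin n) ℂ) (x : Fin n → ℂ) (α β γ : Fin n) : ℂ :=
  -∑ ρ, upper t g x α ρ * christoffel t g x β ρ γ

/-- The gradient of `log f` for the contravariant metric `η`. -/
def gradLog (η : (Fin n → ℂ) → Matrix (Fin n) (Fin n) ℂ) (f : (Fin n → ℂ) → ℂ)
    (x : Fin n → ℂ) : Fin n → ℂ :=
  (f x)⁻¹ • (η x *ᵥ fun j => fderiv ℂ f x (Pi.single j 1))

/-- The intersection form `g(ω₁, ω₂) = i_E (ω₁ · ω₂)`, a symmetric form on covectors. Covectors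
are multiplied through their identification with vectors by the covariant metric `η`. -/
def intersectionForm (η : (Fin n → ℂ) → Matrix (Fin n) (Fin n) ℂ)
    (C : (Fin n → ℂ) → Fin n → Fin n → Fin n → ℂ) (E : (Fin n → ℂ) → (Fin n → ℂ))
    (x : Fin n → ℂ) : Matrix (Fin n) (Fin n) ℂ :=
  Matrix.of fun i j => bil (η x) (prod (C x) ((η x)⁻¹ i) ((η x)⁻¹ j)) (E x)

/-- Generalized Frobenius manifold structure of charge `d` on the open set `U`: all axioms of a
Frobenius manifold, except that the unit vector field `e` need not be flat. `η` is the covariant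
metric, `C` the multiplication, `E` the Euler vector field.

The conditions on Lie derivatives are tensorial, so they are required on constant vector fields;
so is the symmetry of `∇c`, which is required in some flat coordinates near each point. -/
structure IsGenFrobenius (U : Set (Fin n → ℂ)) (η : (Fin n → ℂ) → Matrix (Fin n) (Fin n) ℂ)
    (C : (Fin n → ℂ) → Fin n → Fin n → Fin n → ℂ) (e E : (Fin n → ℂ) → (Fin n → ℂ))
    (d : ℝ) : Prop where
  isOpen : IsOpen U
  holo_metric : ∀ i j, DifferentiableOn ℂ (fun x => η x i j) U
  holo_mul : ∀ i j k, DifferentiableOn ℂ (fun x => C x i j k) U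
  holo_unit : DifferentiableOn ℂ e U
  holo_euler : DifferentiableOn ℂ E U
  symm : ∀ x ∈ U, (η x).IsSymm
  nondeg : ∀ x ∈ U, (η x).det ≠ 0
  comm : ∀ x ∈ U, ∀ X Y, prod (C x) X Y = prod (C x) Y X
  assoc : ∀ x ∈ U, ∀ X Y Z, prod (C x) (prod (C x) X Y) Z = prod (C x) X (prod (C x) Y Z)
  one_mul : ∀ x ∈ U, ∀ X, prod (C x) (e x) X = X
  invariant : ∀ x ∈ U, ∀ X Y Z,
    bil (η x) (prod (C x) X Y) Z = bil (η x) X (prod (C x) Y Z)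
  /-- Flatness of `η`, symmetry of `∂_ξ c_{αβγ}`, and `∇∇E = 0`. -/
  flat : ∀ x₀ ∈ U, ∃ (V : Set (Fin n → ℂ)) (t : (Fin n → ℂ) → (Fin n → ℂ)),
    x₀ ∈ V ∧ V ⊆ U ∧ IsFlatCoords η V t ∧
    (∀ x ∈ V, ∀ α β γ ξ,
      pder t (fun y => bil (η y) (prod (C y) (frame t y α) (frame t y β)) (frame t y γ)) x ξ =
      pder t (fun y => bil (η y) (prod (C y) (frame t y ξ) (frame t y β)) (frame t y γ)) x α) ∧
    ∃ (A : Matrix (Fin n) (Fin n) ℂ) (b : Fin n → ℂ),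
      ∀ x ∈ V, fderiv ℂ t x (E x) = A *ᵥ t x + b
  /-- `Lie_E (X · Y) = (Lie_E X) · Y + X · (Lie_E Y) + X · Y`. -/
  lie_mul : ∀ x ∈ U, ∀ X Y : Fin n → ℂ,
    VectorField.lieBracket ℂ E (fun y => prod (C y) X Y) x =
      prod (C x) (VectorField.lieBracket ℂ E (fun _ => X) x) Y
        + prod (C x) X (VectorField.lieBracket ℂ E (fun _ => Y) x) + prod (C x) X Y
  /-- `E η(X, Y) = η(Lie_E X, Y) + η(X, Lie_E Y) + (2 - d) η(X, Y)`. -/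
  lie_metric : ∀ x ∈ U, ∀ X Y : Fin n → ℂ,
    fderiv ℂ (fun y => bil (η y) X Y) x (E x) =
      bil (η x) (VectorField.lieBracket ℂ E (fun _ => X) x) Y
        + bil (η x) X (VectorField.lieBracket ℂ E (fun _ => Y) x)
        + (2 - (d : ℂ)) * bil (η x) X Y

/-- `h : U → U'` is a biholomorphism carrying `(C, E)` to `(C', E')`, pulling the covariant metric
`η'` back to `s • η`, and carrying the unit `e` on `U₀ ⊆ U` to the unit `e'` on `U₀' ⊆ U'`. -/
structure IsFrobeniusIso (h : (Fin n → ℂ) → (Fin n → ℂ)) (s : ℂ)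
    (U U₀ : Set (Fin n → ℂ)) (η : (Fin n → ℂ) → Matrix (Fin n) (Fin n) ℂ)
    (C : (Fin n → ℂ) → Fin n → Fin n → Fin n → ℂ) (e E : (Fin n → ℂ) → (Fin n → ℂ))
    (U' U₀' : Set (Fin n → ℂ)) (η' : (Fin n → ℂ) → Matrix (Fin n) (Fin n) ℂ)
    (C' : (Fin n → ℂ) → Fin n → Fin n → Fin n → ℂ) (e' E' : (Fin n → ℂ) → (Fin n → ℂ)) :
    Prop where
  bij : Set.BijOn h U U'
  bij_unit : Set.BijOn h U₀ U₀'
  coords : IsLocalCoords U h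
  metric : ∀ x ∈ U, ∀ X Y,
    bil (η' (h x)) (fderiv ℂ h x X) (fderiv ℂ h x Y) = s * bil (η x) X Y
  mul : ∀ x ∈ U, ∀ X Y,
    fderiv ℂ h x (prod (C x) X Y) = prod (C' (h x)) (fderiv ℂ h x X) (fderiv ℂ h x Y)
  euler : ∀ x ∈ U, fderiv ℂ h x (E x) = E' (h x)
  unit : ∀ x ∈ U₀, fderiv ℂ h x (e x) = e' (h x)

/-- The `k`-th entry of `v`, counted from `0`. -/
def entry (v : Fin n → ℂ) (k : ℕ) : ℂ := if h : k < n then v ⟨k, h⟩ else 0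

/-! ### Residues -/

/-- Residue at `q` of a function that is holomorphic on a punctured neighbourhood of `q`. -/
def residueAt (f : ℂ → ℂ) (q : ℂ) : ℂ :=
  Filter.limUnder (𝓝[>] (0 : ℝ)) fun ε => (2 * Real.pi * Complex.I)⁻¹ * ∮ z in C(q, ε), f z

/-- Residue at `p = ∞` of `f(p) dp`, in the local parameter `w = 1/p`. -/
def residueInfty (f : ℂ → ℂ) : ℂ := residueAt (fun w => -f w⁻¹ / w ^ 2) 0

/-! ### The Landau-Ginzburg side

Vectors are indexed from `0`: the entry `a j` is `a_{j+1}`. -/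

/-- `Λ(p) = (p² - 1) p^{-2m} ∑_{j=1}^ℓ a_j p^{2(ℓ-j)}`. -/
def superpotential (ℓ m : ℕ) (a : Fin ℓ → ℂ) (p : ℂ) : ℂ :=
  (p ^ 2 - 1) / p ^ (2 * m) * ∑ j : Fin ℓ, a j * p ^ (2 * (ℓ - 1 - (j : ℕ)))

/-- The derivative of `Λ(p)` along the tangent vector `X`, with `p` fixed. -/
def dSuper (ℓ m : ℕ) (a X : Fin ℓ → ℂ) (p : ℂ) : ℂ :=
  lineDeriv ℂ (fun b => superpotential ℓ m b p) a X

/-- The critical points of `Λ` in `ℂ`; the point `0` is a pole of `Λ` when `m > 0`. -/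
def critPts (ℓ m : ℕ) (a : Fin ℓ → ℂ) : Set ℂ :=
  {q | (q ≠ 0 ∨ m = 0) ∧ deriv (superpotential ℓ m a) q = 0}

/-- The sum of the residues of `f(p) dp` at the critical points of `Λ`, including the critical
point at infinity when `m = ℓ`. -/
def critResidue (ℓ m : ℕ) (a : Fin ℓ → ℂ) (f : ℂ → ℂ) : ℂ :=
  (∑ᶠ q ∈ critPts ℓ m a, residueAt f q) + if m = ℓ then residueInfty f else 0

def etaLG (ℓ m : ℕ) (a X Y : Fin ℓ → ℂ) : ℂ :=
  critResidue ℓ m a fun p =>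
    dSuper ℓ m a X p * dSuper ℓ m a Y p / deriv (superpotential ℓ m a) p / (p ^ 2 - 1) ^ 2

def cLG (ℓ m : ℕ) (a X Y Z : Fin ℓ → ℂ) : ℂ :=
  critResidue ℓ m a fun p =>
    dSuper ℓ m a X p * dSuper ℓ m a Y p * dSuper ℓ m a Z p
      / deriv (superpotential ℓ m a) p / (p ^ 2 - 1) ^ 2

/-- The residue formula for the intersection form, as a form on vectors. -/
def gLG (ℓ m : ℕ) (a X Y : Fin ℓ → ℂ) : ℂ :=
  critResidue ℓ m a fun p =>
    dSuper ℓ m a X p * dSuper ℓ m a Y p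
      / (superpotential ℓ m a p * deriv (superpotential ℓ m a) p) / (p ^ 2 - 1) ^ 2

def etaMatLG (ℓ m : ℕ) (a : Fin ℓ → ℂ) : Matrix (Fin ℓ) (Fin ℓ) ℂ :=
  Matrix.of fun i j => etaLG ℓ m a (Pi.single i 1) (Pi.single j 1)

def gMatLG (ℓ m : ℕ) (a : Fin ℓ → ℂ) : Matrix (Fin ℓ) (Fin ℓ) ℂ :=
  Matrix.of fun i j => gLG ℓ m a (Pi.single i 1) (Pi.single j 1)

/-- The multiplication determined by `η̃(X · Y, Z) = c̃(X, Y, Z)`. -/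
def mulLG (ℓ m : ℕ) (a : Fin ℓ → ℂ) (i j k : Fin ℓ) : ℂ :=
  ∑ s, cLG ℓ m a (Pi.single i 1) (Pi.single j 1) (Pi.single s 1) * (etaMatLG ℓ m a)⁻¹ s k

/-- `ẽ = -(1/2) grad_η̃ log (a₁ + ⋯ + a_ℓ)`. -/
def unitLG (ℓ m : ℕ) (a : Fin ℓ → ℂ) : Fin ℓ → ℂ :=
  (-(1 / 2) : ℂ) • gradLog (fun b => (etaMatLG ℓ m b)⁻¹) (fun b => ∑ j, b j) a

/-- The space of superpotentials: `Λ` has poles of the full orders `2(ℓ-m)` at `∞` (if `m < ℓ`)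
and `2m` at `0` (if `m > 0`). -/
def spaceLG (ℓ m : ℕ) : Set (Fin ℓ → ℂ) :=
  {a | (m < ℓ → entry a 0 ≠ 0) ∧ (0 < m → entry a (ℓ - 1) ≠ 0)}

/-- The part of `spaceLG` where `a₁ + ⋯ + a_ℓ ≠ 0`, on which the unit vector field exists. -/
def spaceLGUnit (ℓ m : ℕ) : Set (Fin ℓ → ℂ) := {a ∈ spaceLG ℓ m | ∑ j, a j ≠ 0}

/-- `r₁ = a₁^{1/(2(ℓ-m))}` and `r₂ = (-a_ℓ)^{1/(2m)}` are continuous branches on the open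
set `V` (with no condition on `r₁` if `m = ℓ`, and none on `r₂` if `m = 0`). -/
structure IsRootBranch (ℓ m : ℕ) (V : Set (Fin ℓ → ℂ)) (r₁ r₂ : (Fin ℓ → ℂ) → ℂ) : Prop where
  isOpen : IsOpen V
  subset : V ⊆ spaceLG ℓ m
  cont₁ : ContinuousOn r₁ V
  cont₂ : ContinuousOn r₂ V
  pow₁ : m < ℓ → ∀ a ∈ V, r₁ a ^ (2 * (ℓ - m)) = entry a 0
  pow₂ : 0 < m → ∀ a ∈ V, r₂ a ^ (2 * m) = -entry a (ℓ - 1)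

/-- The branch `Λ^{1/(2(ℓ-m))} = r₁ p (1 + O(1/p))` near `p = ∞`. -/
def rootAtInfty (ℓ m : ℕ) (r₁ : (Fin ℓ → ℂ) → ℂ) (a : Fin ℓ → ℂ) (p : ℂ) : ℂ :=
  r₁ a * p * (superpotential ℓ m a p / (entry a 0 * p ^ (2 * (ℓ - m)))) ^
    (1 / (2 * ((ℓ : ℂ) - m)))

/-- The branch `Λ^{1/(2m)} = r₂ p⁻¹ (1 + O(p))` near `p = 0`. -/
def rootAtZero (ℓ m : ℕ) (r₂ : (Fin ℓ → ℂ) → ℂ) (a : Fin ℓ → ℂ) (p : ℂ) : ℂ :=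
  r₂ a * p⁻¹ * (superpotential ℓ m a p * p ^ (2 * m) / (-entry a (ℓ - 1))) ^
    (1 / (2 * (m : ℂ)))

/-- The flat coordinates `t̃^1, …, t̃^ℓ`. The index `i` stands for `α = i + 1`, so that
`2(ℓ-m-α)+1` is `2(ℓ-m-1-i)+1`, and `2(ℓ-β)+1` is `2(ℓ-1-i)+1`. -/
def flatLG (ℓ m : ℕ) (r₁ r₂ : (Fin ℓ → ℂ) → ℂ) (a : Fin ℓ → ℂ) : Fin ℓ → ℂ := fun i =>
  if (i : ℕ) < ℓ - m then
    1 / (2 * (ℓ - m - 1 - (i : ℕ)) + 1 : ℕ) *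
      residueInfty fun p => rootAtInfty ℓ m r₁ a p ^ (2 * (ℓ - m - 1 - (i : ℕ)) + 1) / (p ^ 2 - 1)
  else
    1 / (2 * (ℓ - 1 - (i : ℕ)) + 1 : ℕ) *
      residueAt (fun p => rootAtZero ℓ m r₂ a p ^ (2 * (ℓ - 1 - (i : ℕ)) + 1) / (p ^ 2 - 1)) 0

/-- The matrix of `η̃` in the flat coordinates: two anti-diagonal blocks, of sizes `ℓ-m` and `m`,
with entries `2(ℓ-m)` and `2m`. -/
def flatGramLG (ℓ m : ℕ) : Matrix (Fin ℓ) (Fin ℓ) ℂ := Matrix.of fun α β =>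
  if (α : ℕ) < ℓ - m ∧ (β : ℕ) < ℓ - m ∧ (α : ℕ) + β + 1 = ℓ - m then 2 * ((ℓ - m : ℕ) : ℂ)
  else if ℓ - m ≤ (α : ℕ) ∧ ℓ - m ≤ (β : ℕ) ∧ (α - (ℓ - m) : ℕ) + (β - (ℓ - m)) + 1 = m then
    2 * (m : ℂ)
  else 0

/-- The degrees of the flat coordinates. -/
def degLG (ℓ m : ℕ) (i : Fin ℓ) : ℝ :=
  if (i : ℕ) < ℓ - m then ((2 * (ℓ - m - 1 - (i : ℕ)) + 1 : ℕ) : ℝ) / (2 * (ℓ - m) : ℕ)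
  else ((2 * (ℓ - 1 - (i : ℕ)) + 1 : ℕ) : ℝ) / (2 * m : ℕ)

/-! ### The orbit space of the affine Weyl group of type `C_ℓ`, with the weight `ω₁`

The roots live in the space with orthonormal basis `e_1, …, e_ℓ`; everything is complexified, and
`(·,·)` is the dot product. -/

/-- The fundamental weight `e_1 + ⋯ + e_{j+1}`. -/
def weight (ℓ j : ℕ) : Fin ℓ → ℂ := fun k => if (k : ℕ) ≤ j then 1 else 0

/-- The simple coroots `e_j - e_{j+1}` (`j < ℓ`) and `e_ℓ`. -/
def coroot (ℓ : ℕ) (j : Fin ℓ) : Fin ℓ → ℂ :=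
  fun k => if k = j then 1 else if (k : ℕ) = j + 1 then -1 else 0

/-- The point `c ω₁ + x^1 α_1^∨ + ⋯ + x^ℓ α_ℓ^∨`. -/
def point (ℓ : ℕ) (c : ℂ) (x : Fin ℓ → ℂ) : Fin ℓ → ℂ :=
  c • weight ℓ 0 + ∑ j, x j • coroot ℓ j

/-- The action of the Weyl group of type `C_ℓ`, the group of signed permutations. -/
def weylAct (ℓ : ℕ) (w : Equiv.Perm (Fin ℓ) × (Fin ℓ → ℤˣ)) (v : Fin ℓ → ℂ) : Fin ℓ → ℂ :=
  fun k => ((w.2 k : ℤ) : ℂ) * v (w.1 k)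

/-- `λ = e^{-2πic}`. -/
def lam (c : ℂ) : ℂ := Complex.exp (-(2 * Real.pi * Complex.I * c))

/-- The basic generators
`y^j = λ N_j⁻¹ ∑_w e^{2πi (ω_j, w(x))}`, with `N_j` the order of the stabilizer of `ω_j`. -/
def basicGen (ℓ : ℕ) (c : ℂ) (x : Fin ℓ → ℂ) (j : Fin ℓ) : ℂ :=
  lam c * ((Nat.card {w // weylAct ℓ w (weight ℓ j) = weight ℓ j} : ℂ)⁻¹ *
    ∑ w, Complex.exp (2 * Real.pi * Complex.I * (weight ℓ j ⬝ᵥ weylAct ℓ w (point ℓ c x))))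

/-- The constants `c_j`, with `∑_j c_j u^{ℓ-j} = u^ℓ - (u+2)^m (u-2)^{ℓ-m}`. -/
def shiftCoeff (ℓ m : ℕ) (j : Fin ℓ) : ℂ :=
  ((Polynomial.X ^ ℓ - (Polynomial.X + Polynomial.C 2) ^ m *
    (Polynomial.X - Polynomial.C 2) ^ (ℓ - m) : Polynomial ℂ)).coeff (ℓ - 1 - (j : ℕ))

/-- The pencil generators `z^j = y^j + c_j λ`. -/
def pencilGen (ℓ m : ℕ) (c : ℂ) (x : Fin ℓ → ℂ) : Fin ℓ → ℂ :=
  fun j => basicGen ℓ c x j + shiftCoeff ℓ m j * lam c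

/-- The components `(1/4π²) ∑ (∂z^i/∂x^r) a^{rs} (∂z^j/∂x^s)` of the metric `g_λ` at the image
of `x`, where `(a^{rs})` is inverse to the Gram matrix of the simple coroots. -/
def pushMetric (ℓ m : ℕ) (c : ℂ) (x : Fin ℓ → ℂ) : Matrix (Fin ℓ) (Fin ℓ) ℂ :=
  (1 / (4 * (Real.pi : ℂ) ^ 2)) • (jac (pencilGen ℓ m c) x *
    (Matrix.of fun r s => coroot ℓ r ⬝ᵥ coroot ℓ s)⁻¹ * (jac (pencilGen ℓ m c) x)ᵀ)

/-- `g_λ = g + λ η` as contravariant metrics in the coordinates `z` on the orbit space `ℂ^ℓ`.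
This determines `g` and `η`, because for each `c` every point of `ℂ^ℓ` is a value of the
generators `z`. -/
def IsMetricPencil (ℓ m : ℕ) (g η : (Fin ℓ → ℂ) → Matrix (Fin ℓ) (Fin ℓ) ℂ) : Prop :=
  ∀ c x, pushMetric ℓ m c x = g (pencilGen ℓ m c x) + lam c • η (pencilGen ℓ m c x)

/-- The unit vector field `-grad_η log z^1`. -/
def unitOrbit {ℓ : ℕ} (η : (Fin ℓ → ℂ) → Matrix (Fin ℓ) (Fin ℓ) ℂ) (z : Fin ℓ → ℂ) : Fin ℓ → ℂ :=
  -gradLog η (fun y => entry y 0) z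

/-- The multiplication defined by the pencil `(g, η)` of contravariant metrics: it is holomorphic
on `U`, and where `g` is nondegenerate it is given, in flat coordinates `t` of `η` in which
`E = ∑ d_α t^α ∂/∂t^α`, by
`c_{αβ}^γ = d_ρ⁻¹ η_{αν} η_{βρ} η^{γζ} Γ^{νρ}_ζ`, with `Γ` the contravariant Christoffel symbols
of `g`. -/
def IsPencilMul {ℓ : ℕ} (U : Set (Fin ℓ → ℂ)) (g η : (Fin ℓ → ℂ) → Matrix (Fin ℓ) (Fin ℓ) ℂ)
    (E : (Fin ℓ → ℂ) → (Fin ℓ → ℂ)) (C : (Fin ℓ → ℂ) → Fin ℓ → Fin ℓ → Fin ℓ → ℂ) : Prop :=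
  (∀ i j k, DifferentiableOn ℂ (fun z => C z i j k) U) ∧
  ∀ z₀ ∈ U, (g z₀).det ≠ 0 →
    ∃ (V : Set (Fin ℓ → ℂ)) (t : (Fin ℓ → ℂ) → (Fin ℓ → ℂ)) (d : Fin ℓ → ℝ),
      z₀ ∈ V ∧ V ⊆ U ∧ (∀ z ∈ V, (g z).det ≠ 0) ∧ IsFlatCoords (fun z => (η z)⁻¹) V t ∧
      (∀ α, 0 < d α) ∧ (∀ z ∈ V, ∀ α, fderiv ℂ t z (E z) α = d α * t z α) ∧
      ∀ z ∈ V, ∀ α β,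
        prod (C z) (frame t z α) (frame t z β) =
          ∑ γ, (∑ ν, ∑ ρ, ∑ ζ, (1 / (d ρ : ℂ)) * lower t η z α ν * lower t η z β ρ *
            upper t η z γ ζ * conChristoffel t g z ν ρ ζ) • frame t z γ

/-! ### The maps -/

/-- `z^j = -4 [s^{ℓ-j}] ∑_k a_k (s-2)^{ℓ-k} (s+2)^{k-1}`. -/
def hMap (ℓ : ℕ) (a : Fin ℓ → ℂ) : Fin ℓ → ℂ := fun j =>
  -4 * (∑ k : Fin ℓ, Polynomial.C (a k) * (Polynomial.X - Polynomial.C 2) ^ (ℓ - 1 - (k : ℕ)) *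
    (Polynomial.X + Polynomial.C 2) ^ (k : ℕ) : Polynomial ℂ).coeff (ℓ - 1 - (j : ℕ))

/-- `hMap` followed by the reflection `z^j ↦ (-1)^j z^j`. -/
def hMapRefl (ℓ : ℕ) (a : Fin ℓ → ℂ) : Fin ℓ → ℂ := fun j => (-1) ^ ((j : ℕ) + 1) * hMap ℓ a j

end GenFrob

end

/-! Put u = p². Then Λ = b(u)/u^m with b = (u-1)A and A = Σ a_j u^{ℓ-j}. A tangent vector is a
polynomial V of degree < ℓ, with ∂_VΛ = (u-1)V/u^m, and Λ'(p) = 2D(u)/p^{2m+1}, where D = u b' - m b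
is linear in a. Everything rests on one division: at a point of the space of superpotentials, each
polynomial of degree < 2ℓ is u^m S + D G for unique S, G of degree < ℓ (`eq_zero_of_X_pow_mul_eq`,
`divSol_spec`). It is applied to (u-1)VW = u^m S(V,W) + D G(V,W).

Residues. The integrand of the metric is half of p S/((p²-1)D) + p G/((p²-1)p^{2m}). The residue
theorem on the sphere moves the sum over the critical points to p = ±1, where it gives η(V,W) =
G(1)/2 (`critResidue_eq`, `etaLG_eq`). Modulo D the functions ∂Λ multiply, so the product of V and W
is S(V,W), and c(V,W,Z) is half the value at 1 of the quotient H in (u-1)²VWZ = u^{2m}S' + D H.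
Associativity and invariance follow from uniqueness of this two-step division (`sh_eq`). The vector
ξ_s = 2(s^m D(u) - u^m D(s))/(u-s) is η-dual to evaluation at s (`etaF_xiVec`); it gives
nondegeneracy, the inverse metric, the unit (s = 1), and the intersection form as the Bezoutian of b
and D.

Flatness. Near p = 0 let ψ = b^{1/(2m)} as a power series in u. The flat coordinates are
coefficients of powers of ψ over u-1, with differentials dt_j(V) proportional to [u^j]
ψ^{-2(m-1-j)-1}V. A residue of an exact form vanishes, whence a dual basis (`coeff_tBasis`), and the
m low coefficients of G add up to an anti-diagonal form in the dt_j (`IsBranchAt.sum_coeff_gmap`).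
The ℓ-m high coefficients are treated in the same way at p = ∞, through the reflection p ↦ 1/p
(`sig`). The second derivatives of the t_j are dt_j(Γ(Z,V)) with Γ = -(1/2 + u d/du - m)G, so Γ is
the Levi-Civita connection. Symmetry of ∇c results from applying u d/du - m to the symmetry of H
(`nabla_smap_symm`), homogeneity from linearity of D in a.

Orbit space. With ξ_k = 2cos(2πv_k), the generators y are λ times the coefficients of ∏(s+ξ_k) below
s^ℓ, and the metric g_λ has as generating function the Bezoutian of P and LP, where P = λ∏(s+ξ_k)
and LP = (4-s²)P' + ℓsP. Now P = P_z + λB with B = (s+2)^m(s-2)^{ℓ-m} an eigenvector of L, so the λ²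
term drops and g_λ = g + λη (`isMetricPencil`). The Cayley substitution u = (s-2)/(s+2) carries b to
P_z and D to LP_z plus a multiple of P_z; hence the linear map `hMap` identifies both metrics with
those of the superpotentials, up to the factor 2 (`orbitEta_hMap`, `orbitG_hMap`), and the Frobenius
structure is transported along it. The second map is `hMap` after `sig`. Finally, in homogeneous
flat coordinates the derivatives of g^{αβ} are (d_α+d_β)c^{αβ}_γ, which forces Γ^{αβ}_γ = d_β
c^{αβ}_γ for the contravariant Christoffel symbols of g (`IsFrobChart.conChristoffel_eq`); so the
transported product is the one defined by the pencil. -/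

noncomputable section
namespace GenFrob
open Polynomial

/-! ### Vectors as polynomials of degree less than `ℓ` -/

/-- The polynomial `∑_j v_j u^{ℓ-j}` of a vector. -/
def vp (ℓ : ℕ) : (Fin ℓ → ℂ) →ₗ[ℂ] ℂ[X] where
  toFun v := ∑ j : Fin ℓ, C (v j) * X ^ (ℓ - 1 - (j : ℕ))
  map_add' v w := by simp [add_mul, Finset.sum_add_distrib]
  map_smul' c v := by simp [Finset.smul_sum, smul_eq_C_mul, mul_assoc]

theorem vp_apply {ℓ : ℕ} (v : Fin ℓ → ℂ) :
    vp ℓ v = ∑ j : Fin ℓ, C (v j) * X ^ (ℓ - 1 - (j : ℕ)) := rfl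

theorem eval_vp {ℓ : ℕ} (v : Fin ℓ → ℂ) (s : ℂ) :
    (vp ℓ v).eval s = ∑ j : Fin ℓ, v j * s ^ (ℓ - 1 - (j : ℕ)) := by
  simp [vp_apply, eval_finsetSum]

theorem coeff_vp {ℓ : ℕ} (v : Fin ℓ → ℂ) (k : ℕ) :
    (vp ℓ v).coeff k = if k < ℓ then entry v (ℓ - 1 - k) else 0 := by
  rw [vp_apply, finsetSum_coeff]
  simp only [coeff_C_mul, coeff_X_pow]
  split_ifs with h
  · rw [Finset.sum_eq_single ⟨ℓ - 1 - k, by omega⟩]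
    · have : k = ℓ - 1 - (ℓ - 1 - k) := by omega
      simp [entry, show ℓ - 1 - k < ℓ by omega, ← this]
    · intro b _ hb
      rw [if_neg, mul_zero]
      intro hk
      apply hb
      ext
      simp only
      omega
    · simp
  · apply Finset.sum_eq_zero
    intro b _
    rw [if_neg (by omega), mul_zero]

theorem coeff_vp_fin {ℓ : ℕ} (v : Fin ℓ → ℂ) (j : Fin ℓ) :
    (vp ℓ v).coeff (ℓ - 1 - (j : ℕ)) = v j := by
  rw [coeff_vp, if_pos (by omega), entry, dif_pos (by omega)]
  congr
  omega

theorem degree_vp_lt {ℓ : ℕ} (v : Fin ℓ → ℂ) : (vp ℓ v).degree < ℓ := by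
  rw [degree_lt_iff_coeff_zero]
  intro k hk
  rw [coeff_vp, if_neg (by omega)]

theorem natDegree_vp_le {ℓ : ℕ} (v : Fin ℓ → ℂ) : (vp ℓ v).natDegree ≤ ℓ - 1 := by
  rw [natDegree_le_iff_coeff_eq_zero]
  intro k hk
  rw [coeff_vp, if_neg (by omega)]

theorem vp_injective (ℓ : ℕ) : Function.Injective (vp ℓ) := by
  intro v w h
  ext j
  rw [← coeff_vp_fin v, h, coeff_vp_fin]

/-- The vector of coefficients of a polynomial. -/
def vec (ℓ : ℕ) (P : ℂ[X]) : Fin ℓ → ℂ := fun j => P.coeff (ℓ - 1 - (j : ℕ))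

theorem vp_vec {ℓ : ℕ} {P : ℂ[X]} (hP : P.degree < ℓ) : vp ℓ (vec ℓ P) = P := by
  ext k
  rw [coeff_vp]
  split_ifs with h
  · simp only [entry, vec, show ℓ - 1 - k < ℓ by omega, dite_true]
    congr 1
    omega
  · exact (coeff_eq_zero_of_degree_lt (lt_of_lt_of_le hP (by exact_mod_cast not_lt.mp h))).symm

theorem exists_vp_eq {ℓ : ℕ} {P : ℂ[X]} (hP : P.degree < ℓ) : ∃ v, vp ℓ v = P :=
  ⟨_, vp_vec hP⟩

/-! ### The operator `u d/du - m` and the polynomial `D = u^{m+1} dΛ/du` -/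

/-- The operator `f ↦ u f' - m f`. -/
def mop (m : ℕ) : ℂ[X] →ₗ[ℂ] ℂ[X] where
  toFun f := X * derivative f - C (m : ℂ) * f
  map_add' f g := by simp only [derivative_add]; ring
  map_smul' c f := by simp only [smul_eq_C_mul, RingHom.id_apply, derivative_C_mul]; ring

theorem mop_apply (m : ℕ) (f : ℂ[X]) : mop m f = X * derivative f - C (m : ℂ) * f := rfl

theorem coeff_mop (m : ℕ) (f : ℂ[X]) (k : ℕ) : (mop m f).coeff k = ((k : ℂ) - m) * f.coeff k := by
  rw [mop_apply, coeff_sub, coeff_C_mul]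
  cases k with
  | zero => simp
  | succ k => rw [coeff_X_mul, coeff_derivative]; push_cast; ring

theorem mop_mul (m : ℕ) (f g : ℂ[X]) :
    mop m (f * g) = f * mop m g + g * mop m f + C (m : ℂ) * (f * g) := by
  simp only [mop_apply, derivative_mul]; ring

theorem mop_X_pow (m : ℕ) : mop m (X ^ m) = 0 := by
  ext k
  rw [coeff_mop, coeff_X_pow]
  split_ifs with h
  · simp [h]
  · simp

theorem degree_mop_le (m : ℕ) (f : ℂ[X]) : (mop m f).degree ≤ f.degree := by
  rw [degree_le_iff_coeff_zero]
  intro k hk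
  rw [coeff_mop, coeff_eq_zero_of_degree_lt hk, mul_zero]

/-- The polynomial `b(u) = (u - 1) ∑_j a_j u^{ℓ-j} = u^m Λ`. -/
def bPoly {ℓ : ℕ} (a : Fin ℓ → ℂ) : ℂ[X] := (X - 1) * vp ℓ a

/-- The polynomial `D = u^{m+1} dΛ/du`. -/
def dPoly {ℓ : ℕ} (m : ℕ) (a : Fin ℓ → ℂ) : ℂ[X] := mop m (bPoly a)

theorem degree_bPoly_le {ℓ : ℕ} (a : Fin ℓ → ℂ) : (bPoly a).degree ≤ ℓ := by
  rw [degree_le_iff_coeff_zero]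
  intro k hk
  have hk : ℓ < k := by exact_mod_cast hk
  rw [bPoly, sub_mul, one_mul, coeff_sub, coeff_vp, if_neg (by omega)]
  obtain ⟨k, rfl⟩ : ∃ k', k = k' + 1 := ⟨k - 1, by omega⟩
  rw [coeff_X_mul, coeff_vp, if_neg (by omega)]
  simp

theorem degree_dPoly_le {ℓ : ℕ} (m : ℕ) (a : Fin ℓ → ℂ) : (dPoly m a).degree ≤ ℓ :=
  (degree_mop_le _ _).trans (degree_bPoly_le a)

theorem coeff_bPoly_zero {ℓ : ℕ} (hℓ : 1 ≤ ℓ) (a : Fin ℓ → ℂ) :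
    (bPoly a).coeff 0 = -entry a (ℓ - 1) := by
  simp [bPoly, sub_mul, coeff_vp, show 0 < ℓ by omega]

theorem coeff_bPoly_top {ℓ : ℕ} (hℓ : 1 ≤ ℓ) (a : Fin ℓ → ℂ) :
    (bPoly a).coeff ℓ = entry a 0 := by
  obtain ⟨k, rfl⟩ : ∃ k', ℓ = k' + 1 := ⟨ℓ - 1, by omega⟩
  rw [bPoly, sub_mul, one_mul, coeff_sub, coeff_X_mul, coeff_vp, coeff_vp]
  simp

theorem coeff_dPoly_zero {ℓ : ℕ} (m : ℕ) (hℓ : 1 ≤ ℓ) (a : Fin ℓ → ℂ) :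
    (dPoly m a).coeff 0 = m * entry a (ℓ - 1) := by
  rw [dPoly, coeff_mop, coeff_bPoly_zero hℓ]; push_cast; ring

theorem coeff_dPoly_top {ℓ : ℕ} (m : ℕ) (hℓ : 1 ≤ ℓ) (a : Fin ℓ → ℂ) :
    (dPoly m a).coeff ℓ = ((ℓ : ℂ) - m) * entry a 0 := by
  rw [dPoly, coeff_mop, coeff_bPoly_top hℓ]

/-- Since b = (u-1)A vanishes at 1, only b'(1) = A(1) survives. Hence the product has a unit as long
as u = 1 is not a root of D. -/
theorem eval_dPoly_one {ℓ : ℕ} (m : ℕ) (a : Fin ℓ → ℂ) : (dPoly m a).eval 1 = ∑ j, a j := by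
  simp [dPoly, mop_apply, bPoly, eval_vp]

/-- This and the next lemma are the form in which membership in the space is used: u does not divide
D if m > 0, and D has degree exactly ℓ if m < ℓ. -/
theorem coeff_dPoly_zero_ne {ℓ m : ℕ} (hm : m ≤ ℓ) {a : Fin ℓ → ℂ} (ha : a ∈ spaceLG ℓ m)
    (h : 0 < m) : (dPoly m a).coeff 0 ≠ 0 := by
  rw [coeff_dPoly_zero _ (by omega)]
  exact mul_ne_zero (by exact_mod_cast h.ne') (ha.2 h)

theorem coeff_dPoly_top_ne {ℓ m : ℕ} {a : Fin ℓ → ℂ} (ha : a ∈ spaceLG ℓ m)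
    (h : m < ℓ) : (dPoly m a).coeff ℓ ≠ 0 := by
  rw [coeff_dPoly_top _ (by omega)]
  refine mul_ne_zero (sub_ne_zero.mpr ?_) (ha.1 h)
  exact_mod_cast h.ne'

theorem dPoly_ne_zero {ℓ m : ℕ} (hℓ : 1 ≤ ℓ) (hm : m ≤ ℓ) {a : Fin ℓ → ℂ} (ha : a ∈ spaceLG ℓ m) :
    dPoly m a ≠ 0 := by
  intro h
  rcases Nat.eq_zero_or_pos m with h0 | h0
  · exact coeff_dPoly_top_ne ha (by omega) (by rw [h, coeff_zero])
  · exact coeff_dPoly_zero_ne hm ha h0 (by rw [h, coeff_zero])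

/-- Uniqueness of the decomposition `P = u^{jm} S + D G`. -/
theorem eq_zero_of_X_pow_mul_eq {ℓ m : ℕ} (hm : m ≤ ℓ) {a : Fin ℓ → ℂ} (ha : a ∈ spaceLG ℓ m)
    (j : ℕ) {n q : ℂ[X]} (hn : n.degree < ℓ) (hq : q.degree < (j * ℓ : ℕ))
    (h : X ^ (j * m) * n = dPoly m a * q) : n = 0 ∧ q = 0 := by
  -- For m > 0 the powers of u are coprime to D, so they divide the other factor; for m = 0 there is
  -- nothing to divide by.
  have hdvd : (X : ℂ[X]) ^ (j * m) ∣ q := by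
    rcases Nat.eq_zero_or_pos m with h0 | h0
    · subst h0; simp
    · have hc : IsCoprime ((X : ℂ[X]) ^ (j * m)) (dPoly m a) := by
        apply IsCoprime.pow_left
        rw [(prime_X (R := ℂ)).irreducible.coprime_iff_not_dvd, X_dvd_iff]
        exact coeff_dPoly_zero_ne hm ha h0
      exact hc.dvd_of_dvd_mul_left ⟨n, h.symm⟩
  obtain ⟨q', rfl⟩ := hdvd
  have hn' : n = dPoly m a * q' := by
    apply mul_left_cancel₀ (pow_ne_zero (j * m) (X_ne_zero (R := ℂ)))
    rw [h]; ring
  by_cases hq' : q' = 0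
  · subst hq'; simp [hn']
  exfalso
  -- For m = ℓ the divisor u^{jℓ} already exceeds the degree of q; for m < ℓ the degree ℓ of D
  -- exceeds that of n.
  rcases hm.eq_or_lt with rfl | hlt
  · rw [degree_mul, degree_X_pow, degree_eq_natDegree hq'] at hq
    have : j * m + q'.natDegree < j * m := by exact_mod_cast hq
    omega
  · rw [hn', degree_mul, degree_eq_natDegree hq'] at hn
    have hd : (ℓ : WithBot ℕ) ≤ (dPoly m a).degree := le_degree_of_ne_zero (coeff_dPoly_top_ne ha hlt)
    have h2 : (ℓ : WithBot ℕ) + (q'.natDegree : ℕ) < ℓ :=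
      lt_of_le_of_lt (by gcongr) hn
    have : ℓ + q'.natDegree < ℓ := by exact_mod_cast h2
    omega

/-! ### The decomposition `P = u^m S + D G` -/

/-- The coefficients of `u^m S + D(a) G`. -/
def sylAux (ℓ m : ℕ) : (Fin ℓ → ℂ) →ₗ[ℂ] ((Fin ℓ → ℂ) × (Fin ℓ → ℂ)) →ₗ[ℂ] (Fin (ℓ + ℓ) → ℂ) :=
  LinearMap.mk₂ ℂ (fun a p k => (vp ℓ p.2 * dPoly m a).coeff k)
    (by intro a b p; ext k; simp [dPoly, bPoly, mul_add])
    (by intro c a p; ext k; simp [dPoly, bPoly])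
    (by intro a p q; ext k; simp [add_mul])
    (by intro c a p; ext k; simp)

def sylConst (ℓ m : ℕ) : ((Fin ℓ → ℂ) × (Fin ℓ → ℂ)) →ₗ[ℂ] (Fin (ℓ + ℓ) → ℂ) where
  toFun p k := (X ^ m * vp ℓ p.1).coeff k
  map_add' p q := by ext k; simp only [Prod.fst_add, map_add, mul_add, coeff_add, Pi.add_apply]
  map_smul' c p := by ext k; simp

/-- The continuous linear map `(S, G) ↦ u^m S + D(a) G`. -/
def syl (ℓ m : ℕ) (a : Fin ℓ → ℂ) :
    ((Fin ℓ → ℂ) × (Fin ℓ → ℂ)) →L[ℂ] (Fin (ℓ + ℓ) → ℂ) :=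
  LinearMap.toContinuousLinearMap (sylConst ℓ m + sylAux ℓ m a)

theorem syl_apply (ℓ m : ℕ) (a : Fin ℓ → ℂ) (p) (k : Fin (ℓ + ℓ)) :
    syl ℓ m a p k = (X ^ m * vp ℓ p.1 + vp ℓ p.2 * dPoly m a).coeff k := by
  simp [syl, sylConst, sylAux]

theorem differentiable_syl (ℓ m : ℕ) : Differentiable ℂ (syl ℓ m) := by
  have h : syl ℓ m = fun a => LinearMap.toContinuousLinearMap (sylConst ℓ m) +
      (LinearMap.toContinuousLinearMap
        ((LinearMap.toContinuousLinearMap :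
          (((Fin ℓ → ℂ) × (Fin ℓ → ℂ)) →ₗ[ℂ] (Fin (ℓ + ℓ) → ℂ)) ≃ₗ[ℂ] _).toLinearMap ∘ₗ
          sylAux ℓ m)) a := by
    funext a
    refine ContinuousLinearMap.ext fun p => ?_
    simp [syl]
  rw [h]
  fun_prop

theorem degree_mul_dPoly_lt {ℓ m : ℕ} (a v : Fin ℓ → ℂ) :
    (vp ℓ v * dPoly m a).degree < (ℓ + ℓ : ℕ) := by
  by_cases hv : vp ℓ v = 0
  · simp [hv]
  by_cases hd : dPoly m a = 0
  · simp [hd]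
  have h1 := degree_vp_lt v
  have h2 := degree_dPoly_le m a
  rw [degree_eq_natDegree hv] at h1
  rw [degree_eq_natDegree hd] at h2
  rw [degree_mul, degree_eq_natDegree hv, degree_eq_natDegree hd]
  norm_cast at h1 h2 ⊢
  omega

theorem degree_X_pow_mul_vp_lt {ℓ m k : ℕ} (hm : m ≤ k) (v : Fin ℓ → ℂ) :
    (X ^ m * vp ℓ v).degree < ((k + ℓ : ℕ) : WithBot ℕ) := by
  by_cases hv : vp ℓ v = 0
  · simp [hv]
  have h1 := degree_vp_lt v
  rw [degree_eq_natDegree hv] at h1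
  rw [degree_mul, degree_X_pow, degree_eq_natDegree hv]
  norm_cast at h1 ⊢
  omega

theorem syl_injective {ℓ m : ℕ} (hm : m ≤ ℓ) {a : Fin ℓ → ℂ} (ha : a ∈ spaceLG ℓ m) :
    Function.Injective (syl ℓ m a) := by
  rw [injective_iff_map_eq_zero]
  rintro ⟨S, G⟩ h
  have h0 : X ^ m * vp ℓ S + vp ℓ G * dPoly m a = 0 := by
    ext k
    by_cases hk : k < ℓ + ℓ
    · have := congrFun h ⟨k, hk⟩
      rw [syl_apply] at this
      simpa using this
    · rw [coeff_zero]
      apply coeff_eq_zero_of_degree_lt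
      refine lt_of_lt_of_le (b := ((ℓ + ℓ : ℕ) : WithBot ℕ)) ?_ (by exact_mod_cast not_lt.mp hk)
      exact lt_of_le_of_lt (degree_add_le _ _)
        (max_lt (degree_X_pow_mul_vp_lt hm S) (degree_mul_dPoly_lt a G))
  have := eq_zero_of_X_pow_mul_eq hm ha 1 (n := vp ℓ S) (q := -vp ℓ G) (degree_vp_lt S)
    (by rw [degree_neg, one_mul]; exact degree_vp_lt G) (by rw [one_mul]; linear_combination h0)
  have h1 : S = 0 := vp_injective ℓ (by rw [this.1, map_zero])
  have h2 : G = 0 := vp_injective ℓ (by rw [neg_eq_zero.mp this.2, map_zero])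
  rw [h1, h2]; rfl

/-- Both sides have dimension 2ℓ, so uniqueness of the decomposition gives existence. -/
theorem exists_sylEquiv {ℓ m : ℕ} (hm : m ≤ ℓ) {a : Fin ℓ → ℂ} (ha : a ∈ spaceLG ℓ m) :
    ∃ e : ((Fin ℓ → ℂ) × (Fin ℓ → ℂ)) ≃L[ℂ] (Fin (ℓ + ℓ) → ℂ), (e : _ →L[ℂ] _) = syl ℓ m a := by
  refine ⟨(LinearEquiv.ofInjectiveOfFinrankEq (syl ℓ m a).toLinearMap (syl_injective hm ha)
    (by simp)).toContinuousLinearEquiv, ?_⟩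
  exact ContinuousLinearMap.ext fun p => rfl

/-- The solution `(S, G)` of `P = u^m S + D(a) G`. -/
def divSol {ℓ : ℕ} (m : ℕ) (a : Fin ℓ → ℂ) (P : ℂ[X]) : (Fin ℓ → ℂ) × (Fin ℓ → ℂ) :=
  (syl ℓ m a).inverse fun k : Fin (ℓ + ℓ) => P.coeff (k : ℕ)

/-- The operator (S, G) ↦ u^m S + D(a)G is affine in a, and inversion of operators is smooth at an
invertible one. So S and G are holomorphic in a even where roots of D collide, and no canonical
coordinates are needed. -/
theorem differentiableAt_divSol {ℓ m : ℕ} (hm : m ≤ ℓ) {a : Fin ℓ → ℂ} (ha : a ∈ spaceLG ℓ m)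
    (P : ℂ[X]) : DifferentiableAt ℂ (fun b => divSol m b P) a := by
  obtain ⟨e, he⟩ := exists_sylEquiv hm ha
  have h := (contDiffAt_map_inverse (𝕜 := ℂ) (n := 1) e).differentiableAt (by simp)
  rw [he] at h
  exact (h.comp a (differentiable_syl ℓ m a)).clm_apply (differentiableAt_const _)

theorem divSol_spec {ℓ m : ℕ} (hm : m ≤ ℓ) {a : Fin ℓ → ℂ} (ha : a ∈ spaceLG ℓ m)
    {P : ℂ[X]} (hP : P.degree < ((ℓ + ℓ : ℕ) : WithBot ℕ)) :
    X ^ m * vp ℓ (divSol m a P).1 + vp ℓ (divSol m a P).2 * dPoly m a = P := by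
  obtain ⟨e, he⟩ := exists_sylEquiv hm ha
  have h : syl ℓ m a (divSol m a P) = fun k : Fin (ℓ + ℓ) => P.coeff (k : ℕ) := by
    rw [divSol, ← he, ContinuousLinearMap.inverse_equiv]
    simp
  ext k
  by_cases hk : k < ℓ + ℓ
  · have := congrFun h ⟨k, hk⟩
    rw [syl_apply] at this
    simpa using this
  · have hk' : ((ℓ + ℓ : ℕ) : WithBot ℕ) ≤ k := by exact_mod_cast not_lt.mp hk
    rw [coeff_eq_zero_of_degree_lt (lt_of_lt_of_le hP hk')]
    apply coeff_eq_zero_of_degree_lt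
    refine lt_of_lt_of_le ?_ hk'
    exact lt_of_le_of_lt (degree_add_le _ _)
        (max_lt (degree_X_pow_mul_vp_lt hm _) (degree_mul_dPoly_lt a _))

theorem divSol_unique {ℓ m : ℕ} (hm : m ≤ ℓ) {a : Fin ℓ → ℂ} (ha : a ∈ spaceLG ℓ m)
    {P : ℂ[X]} {S G : Fin ℓ → ℂ} (h : X ^ m * vp ℓ S + vp ℓ G * dPoly m a = P) :
    divSol m a P = (S, G) := by
  obtain ⟨e, he⟩ := exists_sylEquiv hm ha
  have h1 : (fun k : Fin (ℓ + ℓ) => P.coeff (k : ℕ)) = syl ℓ m a (S, G) := by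
    ext k
    rw [syl_apply, ← h]
  rw [divSol, h1, ← he, ContinuousLinearMap.inverse_equiv]
  simp

end GenFrob
end

/-! ### The product S and the quotient G of two tangent vectors. -/

noncomputable section
namespace GenFrob
open Polynomial

theorem divSol_add {ℓ : ℕ} (m : ℕ) (a : Fin ℓ → ℂ) (P Q : ℂ[X]) :
    divSol m a (P + Q) = divSol m a P + divSol m a Q := by
  simp only [divSol, ← map_add]
  congr 1

theorem divSol_smul {ℓ : ℕ} (m : ℕ) (a : Fin ℓ → ℂ) (c : ℂ) (P : ℂ[X]) :
    divSol m a (c • P) = c • divSol m a P := by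
  simp only [divSol, ← map_smul]
  congr 1

theorem bPoly_add {ℓ : ℕ} (a b : Fin ℓ → ℂ) : bPoly (a + b) = bPoly a + bPoly b := by
  simp [bPoly, mul_add]

theorem bPoly_smul {ℓ : ℕ} (c : ℂ) (a : Fin ℓ → ℂ) : bPoly (c • a) = c • bPoly a := by
  simp [bPoly]

/-- The product `S` in the decomposition `(u - 1) V W = u^m S + D G`. -/
def smap (ℓ m : ℕ) (a : Fin ℓ → ℂ) : (Fin ℓ → ℂ) →ₗ[ℂ] (Fin ℓ → ℂ) →ₗ[ℂ] (Fin ℓ → ℂ) :=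
  LinearMap.mk₂ ℂ (fun V W => (divSol m a (bPoly V * vp ℓ W)).1)
    (by intro V V' W; rw [bPoly_add, add_mul, divSol_add]; rfl)
    (by intro c V W; rw [bPoly_smul, smul_mul_assoc, divSol_smul]; rfl)
    (by intro V W W'; rw [map_add, mul_add, divSol_add]; rfl)
    (by intro c V W; rw [map_smul, mul_smul_comm, divSol_smul]; rfl)

/-- The quotient `G` in the decomposition `(u - 1) V W = u^m S + D G`. -/
def gmap (ℓ m : ℕ) (a : Fin ℓ → ℂ) : (Fin ℓ → ℂ) →ₗ[ℂ] (Fin ℓ → ℂ) →ₗ[ℂ] (Fin ℓ → ℂ) :=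
  LinearMap.mk₂ ℂ (fun V W => (divSol m a (bPoly V * vp ℓ W)).2)
    (by intro V V' W; rw [bPoly_add, add_mul, divSol_add]; rfl)
    (by intro c V W; rw [bPoly_smul, smul_mul_assoc, divSol_smul]; rfl)
    (by intro V W W'; rw [map_add, mul_add, divSol_add]; rfl)
    (by intro c V W; rw [map_smul, mul_smul_comm, divSol_smul]; rfl)

section
variable {ℓ m : ℕ} {a : Fin ℓ → ℂ}

theorem degree_bPoly_mul_vp_lt (V W : Fin ℓ → ℂ) :
    (bPoly V * vp ℓ W).degree < ((ℓ + ℓ : ℕ) : WithBot ℕ) := by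
  by_cases hv : vp ℓ W = 0
  · simp [hv]
  by_cases hd : bPoly V = 0
  · simp [hd]
  have h1 := degree_vp_lt W
  have h2 := degree_bPoly_le V
  rw [degree_eq_natDegree hv] at h1
  rw [degree_eq_natDegree hd] at h2
  rw [degree_mul, degree_eq_natDegree hv, degree_eq_natDegree hd]
  norm_cast at h1 h2 ⊢
  omega

theorem sg_spec (hm : m ≤ ℓ) (ha : a ∈ spaceLG ℓ m) (V W : Fin ℓ → ℂ) :
    X ^ m * vp ℓ (smap ℓ m a V W) + vp ℓ (gmap ℓ m a V W) * dPoly m a = bPoly V * vp ℓ W :=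
  divSol_spec hm ha (degree_bPoly_mul_vp_lt V W)

theorem sg_unique (hm : m ≤ ℓ) (ha : a ∈ spaceLG ℓ m) {V W S G : Fin ℓ → ℂ}
    (h : X ^ m * vp ℓ S + vp ℓ G * dPoly m a = bPoly V * vp ℓ W) :
    smap ℓ m a V W = S ∧ gmap ℓ m a V W = G := by
  have := divSol_unique hm ha h
  exact ⟨congrArg Prod.fst this, congrArg Prod.snd this⟩

theorem sg_unique_poly (hm : m ≤ ℓ) (ha : a ∈ spaceLG ℓ m) {V W : Fin ℓ → ℂ} {S G : ℂ[X]}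
    (hS : S.degree < ℓ) (hG : G.degree < ℓ) (h : X ^ m * S + G * dPoly m a = bPoly V * vp ℓ W) :
    vp ℓ (smap ℓ m a V W) = S ∧ vp ℓ (gmap ℓ m a V W) = G := by
  obtain ⟨S, rfl⟩ := exists_vp_eq hS
  obtain ⟨G, rfl⟩ := exists_vp_eq hG
  obtain ⟨h1, h2⟩ := sg_unique hm ha h
  rw [h1, h2]; exact ⟨rfl, rfl⟩

theorem bPoly_mul_vp_comm (V W : Fin ℓ → ℂ) : bPoly V * vp ℓ W = bPoly W * vp ℓ V := by
  simp only [bPoly]; ring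

theorem smap_comm (V W : Fin ℓ → ℂ) : smap ℓ m a V W = smap ℓ m a W V := by
  rw [smap, LinearMap.mk₂_apply, LinearMap.mk₂_apply, bPoly_mul_vp_comm]

theorem gmap_comm (V W : Fin ℓ → ℂ) : gmap ℓ m a V W = gmap ℓ m a W V := by
  rw [gmap, LinearMap.mk₂_apply, LinearMap.mk₂_apply, bPoly_mul_vp_comm]

attribute [irreducible] smap gmap

/-- The numerator `u^m G(S(V,W), Z) + (u - 1) Z G(V,W)` in
`(u - 1)² V W Z = u^{2m} S(S(V,W), Z) + D H`. -/
def hPoly (m : ℕ) (a V W Z : Fin ℓ → ℂ) : ℂ[X] :=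
  X ^ m * vp ℓ (gmap ℓ m a (smap ℓ m a V W) Z) + bPoly Z * vp ℓ (gmap ℓ m a V W)

theorem sh_spec (hm : m ≤ ℓ) (ha : a ∈ spaceLG ℓ m) (V W Z : Fin ℓ → ℂ) :
    X ^ (2 * m) * vp ℓ (smap ℓ m a (smap ℓ m a V W) Z) + hPoly m a V W Z * dPoly m a =
      bPoly V * vp ℓ W * bPoly Z := by
  have h1 := sg_spec hm ha V W
  have h2 := sg_spec hm ha (smap ℓ m a V W) Z
  have h3 : bPoly (smap ℓ m a V W) * vp ℓ Z = vp ℓ (smap ℓ m a V W) * bPoly Z := by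
    simp only [bPoly]; ring
  rw [h3] at h2
  rw [hPoly, pow_mul', sq]
  linear_combination X ^ m * h2 + bPoly Z * h1

theorem degree_hPoly_lt (hm : m ≤ ℓ) (V W Z : Fin ℓ → ℂ) :
    (hPoly m a V W Z).degree < ((2 * ℓ : ℕ) : WithBot ℕ) := by
  rw [two_mul]
  exact lt_of_le_of_lt (degree_add_le _ _)
    (max_lt (degree_X_pow_mul_vp_lt hm _) (degree_bPoly_mul_vp_lt _ _))

/-- Uniqueness of the decomposition with j = 2: both S(S(V,W),Z) and H depend only on the product
(u-1)²VWZ, hence are symmetric in the three vectors. Associativity, invariance of the metric and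
symmetry of the covariant derivative all come from here. -/
theorem sh_eq (hm : m ≤ ℓ) (ha : a ∈ spaceLG ℓ m) (V W Z V' W' Z' : Fin ℓ → ℂ)
    (h : bPoly V * vp ℓ W * bPoly Z = bPoly V' * vp ℓ W' * bPoly Z') :
    smap ℓ m a (smap ℓ m a V W) Z = smap ℓ m a (smap ℓ m a V' W') Z' ∧
      hPoly m a V W Z = hPoly m a V' W' Z' := by
  have h1 := sh_spec hm ha V W Z
  have h2 := sh_spec hm ha V' W' Z'
  have := eq_zero_of_X_pow_mul_eq hm ha 2
    (n := vp ℓ (smap ℓ m a (smap ℓ m a V W) Z - smap ℓ m a (smap ℓ m a V' W') Z'))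
    (q := hPoly m a V' W' Z' - hPoly m a V W Z) (degree_vp_lt _)
    (lt_of_le_of_lt (degree_sub_le _ _) (max_lt (degree_hPoly_lt hm _ _ _) (degree_hPoly_lt hm _ _ _)))
    (by rw [map_sub]; linear_combination h1 - h2 + h)
  constructor
  · exact sub_eq_zero.mp (vp_injective ℓ (by rw [this.1, map_zero]))
  · exact (sub_eq_zero.mp this.2).symm

theorem smap_assoc (hm : m ≤ ℓ) (ha : a ∈ spaceLG ℓ m) (V W Z : Fin ℓ → ℂ) :
    smap ℓ m a (smap ℓ m a V W) Z = smap ℓ m a V (smap ℓ m a W Z) := by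
  rw [smap_comm V (smap ℓ m a W Z)]
  exact (sh_eq hm ha V W Z W Z V (by simp only [bPoly]; ring)).1

/-! ### The metric -/

/-- The metric `η(V, W) = G(V, W)(1) / 2`. -/
def etaF (ℓ m : ℕ) (a : Fin ℓ → ℂ) (V W : Fin ℓ → ℂ) : ℂ :=
  (1 / 2) * (vp ℓ (gmap ℓ m a V W)).eval 1

theorem etaF_comm (V W : Fin ℓ → ℂ) : etaF ℓ m a V W = etaF ℓ m a W V := by
  rw [etaF, gmap_comm, etaF]

/-- The summand (u-1)Z·G(V,W) of H vanishes at u = 1, and u^m becomes 1 there. -/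
theorem etaF_smap (V W Z : Fin ℓ → ℂ) :
    etaF ℓ m a (smap ℓ m a V W) Z = (1 / 2) * (hPoly m a V W Z).eval 1 := by
  simp [etaF, hPoly, bPoly]

theorem etaF_invariant (hm : m ≤ ℓ) (ha : a ∈ spaceLG ℓ m) (V W Z : Fin ℓ → ℂ) :
    etaF ℓ m a (smap ℓ m a V W) Z = etaF ℓ m a V (smap ℓ m a W Z) := by
  rw [etaF_comm V, etaF_smap, etaF_smap,
    (sh_eq hm ha V W Z W Z V (by simp only [bPoly]; ring)).2]

/-! ### The inverse metric -/

/-- The quotient `(f(u) - f(s)) / (u - s)`. -/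
def dq (s : ℂ) (f : ℂ[X]) : ℂ[X] := f /ₘ (X - C s)

theorem mul_dq (s : ℂ) (f : ℂ[X]) : (X - C s) * dq s f = f - C (f.eval s) := by
  have := modByMonic_add_div f (X - C s)
  rw [modByMonic_X_sub_C_eq_C_eval] at this
  rw [dq]
  linear_combination this

theorem eval_dq (s t : ℂ) (f : ℂ[X]) : (t - s) * (dq s f).eval t = f.eval t - f.eval s := by
  have := congrArg (eval t) (mul_dq s f)
  simpa using this

theorem degree_dq_lt {s : ℂ} {f : ℂ[X]} {k : ℕ} (hk : 1 ≤ k) (hf : f.degree ≤ k) :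
    (dq s f).degree < k := by
  by_cases h0 : dq s f = 0
  · rw [h0, degree_zero]; exact WithBot.bot_lt_coe _
  rw [degree_eq_natDegree h0, dq, natDegree_divByMonic _ (monic_X_sub_C s), natDegree_X_sub_C]
  have : f.natDegree ≤ k := natDegree_le_of_degree_le hf
  norm_cast
  omega

/-- The polynomial `2 (s^m D(u) - u^m D(s)) / (u - s)`, dual to the evaluation at `s`. -/
def xiPoly {ℓ : ℕ} (m : ℕ) (a : Fin ℓ → ℂ) (s : ℂ) : ℂ[X] :=
  C 2 * (C (s ^ m) * dq s (dPoly m a) - C ((dPoly m a).eval s) * dq s (X ^ m))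

def xiVec {ℓ : ℕ} (m : ℕ) (a : Fin ℓ → ℂ) (s : ℂ) : Fin ℓ → ℂ := vec ℓ (xiPoly m a s)

theorem degree_C_mul_lt {k : ℕ} (c : ℂ) {f : ℂ[X]} (h : f.degree < k) : (C c * f).degree < k :=
  lt_of_le_of_lt (by rw [← smul_eq_C_mul]; exact degree_smul_le _ _) h

theorem degree_sub_lt' {k : ℕ} {f g : ℂ[X]} (hf : f.degree < k) (hg : g.degree < k) :
    (f - g).degree < k :=
  lt_of_le_of_lt (degree_sub_le _ _) (max_lt hf hg)

theorem degree_add_lt' {k : ℕ} {f g : ℂ[X]} (hf : f.degree < k) (hg : g.degree < k) :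
    (f + g).degree < k :=
  lt_of_le_of_lt (degree_add_le _ _) (max_lt hf hg)

theorem degree_dq_X_pow_lt (hℓ : 1 ≤ ℓ) (hm : m ≤ ℓ) (s : ℂ) : (dq s (X ^ m)).degree < ℓ := by
  apply degree_dq_lt hℓ
  rw [degree_X_pow]
  exact_mod_cast hm

theorem vp_xiVec (hℓ : 1 ≤ ℓ) (hm : m ≤ ℓ) (s : ℂ) : vp ℓ (xiVec m a s) = xiPoly m a s := by
  apply vp_vec
  apply degree_C_mul_lt
  apply degree_sub_lt' <;> apply degree_C_mul_lt
  · exact degree_dq_lt hℓ (degree_dPoly_le m a)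
  · exact degree_dq_X_pow_lt hℓ hm s

/-- Put β = (u-1)Y. The combination Y + (s-1)·(Y(u)-Y(s))/(u-s) is the divided difference of β
written without raising the degree. So S is 2(β(s)D(u) - β(u)D(s))/(u-s), and G is 2(s^m β(u) - u^m
β(s))/(u-s). The terms β(s)u^m D(u) cancel in u^m S + D G, which leaves β(u) times ξ_s. -/
theorem sg_xiVec (hℓ : 1 ≤ ℓ) (hm : m ≤ ℓ) (ha : a ∈ spaceLG ℓ m) (s : ℂ) (Y : Fin ℓ → ℂ) :
    vp ℓ (smap ℓ m a (xiVec m a s) Y) =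
      C (-2 * (dPoly m a).eval s) * (vp ℓ Y + C (s - 1) * dq s (vp ℓ Y)) +
        C (2 * (vp ℓ Y).eval s * (s - 1)) * dq s (dPoly m a) ∧
    vp ℓ (gmap ℓ m a (xiVec m a s) Y) =
      C (2 * s ^ m) * (vp ℓ Y + C (s - 1) * dq s (vp ℓ Y)) -
        C (2 * (vp ℓ Y).eval s * (s - 1)) * dq s (X ^ m) := by
  have hq : (dq s (vp ℓ Y)).degree < ℓ := degree_dq_lt hℓ (degree_vp_lt Y).le
  apply sg_unique_poly hm ha
  · apply degree_add_lt' <;> apply degree_C_mul_lt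
    · exact degree_add_lt' (degree_vp_lt Y) (degree_C_mul_lt _ hq)
    · exact degree_dq_lt hℓ (degree_dPoly_le m a)
  · apply degree_sub_lt' <;> apply degree_C_mul_lt
    · exact degree_add_lt' (degree_vp_lt Y) (degree_C_mul_lt _ hq)
    · exact degree_dq_X_pow_lt hℓ hm s
  · have h1 := mul_dq s (dPoly m a)
    have h2 := mul_dq s (X ^ m)
    have h3 := mul_dq s (vp ℓ Y)
    rw [bPoly, vp_xiVec hℓ hm, xiPoly]
    -- After multiplication by u - s the divided differences disappear, and a polynomial identity in
    -- independent symbols remains.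
    apply mul_left_cancel₀ (X_sub_C_ne_zero s)
    simp only [eval_pow, eval_X, map_mul, map_sub, map_one, map_neg, map_ofNat, C_pow] at *
    generalize dPoly m a = D at *
    generalize vp ℓ Y = y at *
    generalize dq s D = qD at *
    generalize dq s y = qY at *
    generalize dq s (X ^ m) = qm at *
    generalize C (eval s D) = Ds at *
    generalize C (eval s y) = Ys at *
    generalize (X : ℂ[X]) ^ m = xm at *
    generalize C s ^ m = sm at *
    generalize C s = s' at *
    linear_combination (xm * (-2 * Ds) * (s' - 1) + D * 2 * sm * (s' - 1)) * h3 +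
      (xm * 2 * Ys * (s' - 1) - (X - 1) * 2 * sm * y) * h1 +
      ((X - 1) * 2 * Ds * y - D * 2 * Ys * (s' - 1)) * h2

/-- In the closed form of G the term with (u-1)Y(u) vanishes at u = 1, and what is left is 2Y(s).
Thus ξ_s reproduces evaluation at s. -/
theorem etaF_xiVec (hℓ : 1 ≤ ℓ) (hm : m ≤ ℓ) (ha : a ∈ spaceLG ℓ m) (s : ℂ) (Y : Fin ℓ → ℂ) :
    etaF ℓ m a (xiVec m a s) Y = (vp ℓ Y).eval s := by
  rw [etaF, (sg_xiVec hℓ hm ha s Y).2]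
  have h1 := eval_dq s 1 (vp ℓ Y)
  have h2 := eval_dq s 1 (X ^ m)
  simp only [eval_sub, eval_add, eval_mul, eval_C, eval_pow, eval_X, one_pow] at h2 ⊢
  linear_combination (-s ^ m) * h1 + (vp ℓ Y).eval s * h2

/-- The Bezoutian of b and D: the generating function of the intersection form, to be compared with
the metric g of the orbit space. -/
theorem eval_smap_xiVec (hℓ : 1 ≤ ℓ) (hm : m ≤ ℓ) (ha : a ∈ spaceLG ℓ m) (s t : ℂ) :
    (t - s) * (vp ℓ (smap ℓ m a (xiVec m a s) a)).eval t =
      2 * ((bPoly a).eval s * (dPoly m a).eval t - (bPoly a).eval t * (dPoly m a).eval s) := by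
  rw [(sg_xiVec hℓ hm ha s a).1]
  have h1 := eval_dq s t (vp ℓ a)
  have h2 := eval_dq s t (dPoly m a)
  simp only [eval_add, eval_mul, eval_C, bPoly, eval_sub, eval_X, eval_one]
  linear_combination (-2 * (dPoly m a).eval s * (s - 1)) * h1 +
    (2 * (vp ℓ a).eval s * (s - 1)) * h2

theorem eval_xiVec (hℓ : 1 ≤ ℓ) (hm : m ≤ ℓ) (s t : ℂ) :
    (t - s) * (vp ℓ (xiVec m a s)).eval t =
      2 * (s ^ m * (dPoly m a).eval t - t ^ m * (dPoly m a).eval s) := by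
  rw [vp_xiVec hℓ hm, xiPoly]
  have h1 := eval_dq s t (dPoly m a)
  have h2 := eval_dq s t (X ^ m)
  simp only [eval_mul, eval_C, eval_sub, eval_X, eval_pow] at *
  linear_combination (2 * s ^ m) * h1 - (2 * (dPoly m a).eval s) * h2

/-- At s = 1 the terms with the factor s - 1 drop out and S = -2D(1)Y, so ξ_1 is a multiple of the
unit. -/
theorem smap_xiVec_one (hℓ : 1 ≤ ℓ) (hm : m ≤ ℓ) (ha : a ∈ spaceLG ℓ m) (Y : Fin ℓ → ℂ) :
    smap ℓ m a (xiVec m a 1) Y = (-2 * ∑ j, a j) • Y := by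
  apply vp_injective
  rw [(sg_xiVec hℓ hm ha 1 Y).1, eval_dPoly_one, map_smul, smul_eq_C_mul]
  simp

theorem vp_eq_zero_of_eval {v : Fin ℓ → ℂ} (h : ∀ s, (vp ℓ v).eval s = 0) : v = 0 :=
  vp_injective ℓ (by rw [map_zero]; exact Polynomial.funext fun s => by rw [h, eval_zero])

theorem etaF_nondeg (hℓ : 1 ≤ ℓ) (hm : m ≤ ℓ) (ha : a ∈ spaceLG ℓ m) {Y : Fin ℓ → ℂ}
    (h : ∀ V, etaF ℓ m a V Y = 0) : Y = 0 :=
  vp_eq_zero_of_eval fun s => by rw [← etaF_xiVec hℓ hm ha s Y, h]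

/-! ### Matrices and structure constants -/

/-- `η` as a bilinear form. -/
def etaL (ℓ m : ℕ) (a : Fin ℓ → ℂ) : (Fin ℓ → ℂ) →ₗ[ℂ] (Fin ℓ → ℂ) →ₗ[ℂ] ℂ :=
  LinearMap.mk₂ ℂ (etaF ℓ m a) (by intros; simp [etaF, mul_add]) (by intros; simp [etaF]; ring)
    (by intros; simp [etaF, mul_add]) (by intros; simp [etaF]; ring)

theorem etaL_apply (V W : Fin ℓ → ℂ) : etaL ℓ m a V W = etaF ℓ m a V W := rfl

end

theorem bil_of_bilin {n : ℕ} (B : (Fin n → ℂ) →ₗ[ℂ] (Fin n → ℂ) →ₗ[ℂ] ℂ) (V W : Fin n → ℂ) :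
    bil (Matrix.of fun i j => B (Pi.single i 1) (Pi.single j 1)) V W = B V W := by
  conv_rhs => rw [pi_eq_sum_univ' V, pi_eq_sum_univ' W]
  simp only [bil, dotProduct, Matrix.mulVec, Matrix.of_apply, map_sum, map_smul,
    LinearMap.sum_apply, LinearMap.smul_apply, smul_eq_mul, Finset.mul_sum]
  rw [Finset.sum_comm]
  refine Finset.sum_congr rfl fun i _ => Finset.sum_congr rfl fun j _ => ?_
  ring

theorem prod_of_bilin {n : ℕ} (B : (Fin n → ℂ) →ₗ[ℂ] (Fin n → ℂ) →ₗ[ℂ] (Fin n → ℂ))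
    (V W : Fin n → ℂ) :
    prod (fun i j => B (Pi.single i 1) (Pi.single j 1)) V W = B V W := by
  conv_rhs => rw [pi_eq_sum_univ' V, pi_eq_sum_univ' W]
  ext k
  simp only [prod, map_sum, map_smul,
    LinearMap.sum_apply, LinearMap.smul_apply, smul_eq_mul, Finset.mul_sum,
    Finset.sum_apply, Pi.smul_apply]
  rw [Finset.sum_comm]
  refine Finset.sum_congr rfl fun i _ => Finset.sum_congr rfl fun j _ => ?_
  ring

end GenFrob
end

noncomputable section
namespace GenFrob
open Polynomial

/-! ### Residues of rational functions -/

/-- The integrals of `f` over small circles around `q` are `2πi r`. -/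
def HasRes (f : ℂ → ℂ) (q r : ℂ) : Prop :=
  ∀ᶠ ε in 𝓝[>] (0 : ℝ), CircleIntegrable f q ε ∧
    (2 * Real.pi * Complex.I)⁻¹ * ∮ z in C(q, ε), f z = r

/-- The residue at infinity of `f(p) dp` is `r`. -/
def HasResInfty (f : ℂ → ℂ) (r : ℂ) : Prop := HasRes (fun w => -f w⁻¹ / w ^ 2) 0 r

theorem HasRes.residueAt_eq {f : ℂ → ℂ} {q r : ℂ} (h : HasRes f q r) : residueAt f q = r :=
  (tendsto_const_nhds.congr' (h.mono fun _ hx => hx.2.symm)).limUnder_eq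

theorem HasResInfty.residueInfty_eq {f : ℂ → ℂ} {r : ℂ} (h : HasResInfty f r) :
    residueInfty f = r :=
  HasRes.residueAt_eq h

theorem eventually_sphere {q : ℂ} {p : ℂ → Prop} (h : ∀ᶠ z in 𝓝[≠] q, p z) :
    ∀ᶠ ε in 𝓝[>] (0 : ℝ), ∀ z ∈ Metric.sphere q ε, p z := by
  rw [eventually_nhdsWithin_iff, Metric.eventually_nhds_iff] at h
  obtain ⟨δ, hδ, h⟩ := h
  filter_upwards [Ioo_mem_nhdsGT hδ] with ε hε z hz
  refine h (by rw [Metric.mem_sphere.mp hz]; exact hε.2) ?_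
  rintro rfl
  rw [Metric.mem_sphere, dist_self] at hz
  exact hε.1.ne hz

theorem HasRes.congr {f g : ℂ → ℂ} {q r : ℂ} (h : HasRes f q r) (hfg : f =ᶠ[𝓝[≠] q] g) :
    HasRes g q r := by
  filter_upwards [h, eventually_sphere hfg, self_mem_nhdsWithin] with ε h1 h2 h3
  have hpos : (0 : ℝ) < ε := h3
  refine ⟨(circleIntegrable_congr ?_).mp h1.1, ?_⟩
  · rw [abs_of_pos hpos]; exact fun z hz => h2 z hz
  · rw [← h1.2, circleIntegral.integral_congr hpos.le fun z hz => h2 z hz]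

theorem HasRes.unique {f : ℂ → ℂ} {q r s : ℂ} (h : HasRes f q r) (h' : HasRes f q s) : r = s := by
  rw [← h.residueAt_eq, h'.residueAt_eq]

theorem HasRes.add {f g : ℂ → ℂ} {q r s : ℂ} (hf : HasRes f q r) (hg : HasRes g q s) :
    HasRes (fun z => f z + g z) q (r + s) := by
  filter_upwards [hf, hg] with ε h1 h2
  refine ⟨h1.1.add h2.1, ?_⟩
  rw [circleIntegral.integral_add h1.1 h2.1, mul_add, h1.2, h2.2]

theorem HasRes.const_mul {f : ℂ → ℂ} {q r : ℂ} (hf : HasRes f q r) (c : ℂ) :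
    HasRes (fun z => c * f z) q (c * r) := by
  filter_upwards [hf] with ε h1
  refine ⟨?_, ?_⟩
  · have := h1.1.const_smul (a := c)
    exact this
  · rw [circleIntegral.integral_const_mul, mul_left_comm, h1.2]

theorem hasRes_div_sub {g : ℂ → ℂ} {q : ℂ} (hg : AnalyticAt ℂ g q) :
    HasRes (fun z => g z / (z - q)) q (g q) := by
  obtain ⟨δ, hδ, h⟩ := Metric.eventually_nhds_iff.mp hg.eventually_analyticAt
  filter_upwards [Ioo_mem_nhdsGT hδ] with ε hε
  have hd : ∀ z ∈ Metric.closedBall q ε, DifferentiableAt ℂ g z := fun z hz =>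
    (h (lt_of_le_of_lt hz hε.2)).differentiableAt
  refine ⟨ContinuousOn.circleIntegrable hε.1.le ?_, ?_⟩
  · intro z hz
    refine ((hd z (Metric.sphere_subset_closedBall hz)).continuousAt.div (by fun_prop)
      ?_).continuousWithinAt
    intro h0
    rw [sub_eq_zero.mp h0, Metric.mem_sphere, dist_self] at hz
    exact hε.1.ne hz
  · have := Complex.two_pi_I_inv_smul_circleIntegral_sub_inv_smul_of_differentiable_on_off_countable
      (w := q) Set.countable_empty (Metric.mem_ball_self hε.1)
      (fun z hz => (hd z hz).continuousAt.continuousWithinAt)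
      (fun z hz => hd z (Metric.ball_subset_closedBall hz.1))
    rw [smul_eq_mul] at this
    rw [← this]
    congr 2
    ext z
    rw [smul_eq_mul, div_eq_inv_mul]

theorem AnalyticAt.hasRes_zero {g : ℂ → ℂ} {q : ℂ} (hg : AnalyticAt ℂ g q) : HasRes g q 0 := by
  have h : AnalyticAt ℂ (fun z => (z - q) * g z) q := by fun_prop
  have := hasRes_div_sub h
  simp only [sub_self, zero_mul] at this
  refine this.congr ?_
  filter_upwards [self_mem_nhdsWithin] with z hz
  field_simp [sub_ne_zero.mpr hz]

theorem hasRes_inv_pow (q : ℂ) (k : ℕ) :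
    HasRes (fun z => ((z - q) ^ (k + 1))⁻¹) q (if k = 0 then 1 else 0) := by
  split_ifs with hk
  · subst hk
    have := hasRes_div_sub (g := fun _ => (1 : ℂ)) (q := q) analyticAt_const
    simpa using this
  · filter_upwards [self_mem_nhdsWithin] with ε hε
    have hpos : (0 : ℝ) < ε := hε
    have he : (fun z : ℂ => ((z - q) ^ (k + 1))⁻¹) = fun z => (z - q) ^ (-((k : ℤ) + 1)) := by
      ext z
      rw [zpow_neg]
      norm_cast
    rw [he]
    refine ⟨?_, ?_⟩
    · rw [circleIntegrable_sub_zpow_iff]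
      right; right
      rw [Metric.mem_sphere, dist_self, abs_of_pos hpos]
      exact hpos.ne
    · rw [circleIntegral.integral_sub_zpow_of_ne (by omega), mul_zero]

theorem eventually_cofinite_inv {p : ℂ → Prop} (h : ∀ᶠ z in Filter.cofinite, p z) :
    ∀ᶠ w in Filter.cofinite, p w⁻¹ :=
  inv_injective.tendsto_cofinite.eventually h

theorem HasRes.congr_cofinite {f g : ℂ → ℂ} {q r : ℂ} (h : HasRes f q r)
    (hfg : f =ᶠ[Filter.cofinite] g) : HasRes g q r :=
  h.congr (hfg.filter_mono (nhdsNE_le_cofinite q))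

theorem HasResInfty.congr_cofinite {f g : ℂ → ℂ} {r : ℂ} (h : HasResInfty f r)
    (hfg : f =ᶠ[Filter.cofinite] g) : HasResInfty g r := by
  refine HasRes.congr_cofinite h ?_
  filter_upwards [eventually_cofinite_inv hfg] with w hw
  rw [hw]

theorem HasResInfty.add {f g : ℂ → ℂ} {r s : ℂ} (hf : HasResInfty f r) (hg : HasResInfty g s) :
    HasResInfty (fun z => f z + g z) (r + s) := by
  have := HasRes.add hf hg
  refine this.congr_cofinite (Filter.Eventually.of_forall fun w => ?_)
  simp only
  ring

theorem HasResInfty.const_mul {f : ℂ → ℂ} {r : ℂ} (hf : HasResInfty f r) (c : ℂ) :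
    HasResInfty (fun z => c * f z) (c * r) := by
  have := HasRes.const_mul hf c
  refine this.congr_cofinite (Filter.Eventually.of_forall fun w => ?_)
  simp only
  ring

/-! ### The residue theorem for rational functions, by partial fractions. -/

/-- `f` has finitely many residues on the Riemann sphere, and they add up to `0`. -/
def HasResSum (f : ℂ → ℂ) (ρ : ℂ →₀ ℂ) : Prop :=
  (∀ q, HasRes f q (ρ q)) ∧ HasResInfty f (-ρ.sum fun _ r => r)

theorem HasResSum.add {f g : ℂ → ℂ} {ρ σ : ℂ →₀ ℂ} (hf : HasResSum f ρ) (hg : HasResSum g σ) :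
    HasResSum (fun z => f z + g z) (ρ + σ) := by
  refine ⟨fun q => (hf.1 q).add (hg.1 q), ?_⟩
  have := hf.2.add hg.2
  rwa [Finsupp.sum_add_index (by simp) (by simp), neg_add]

theorem HasResSum.const_mul {f : ℂ → ℂ} {ρ : ℂ →₀ ℂ} (hf : HasResSum f ρ) (c : ℂ) :
    HasResSum (fun z => c * f z) (c • ρ) := by
  refine ⟨fun q => (hf.1 q).const_mul c, ?_⟩
  have := hf.2.const_mul c
  rwa [Finsupp.sum_smul_index' (by simp), ← Finsupp.smul_sum, smul_eq_mul, ← mul_neg]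

theorem HasResSum.congr {f g : ℂ → ℂ} {ρ : ℂ →₀ ℂ} (hf : HasResSum f ρ)
    (h : f =ᶠ[Filter.cofinite] g) : HasResSum g ρ :=
  ⟨fun q => (hf.1 q).congr_cofinite h, hf.2.congr_cofinite h⟩

theorem hasResSum_pow (k : ℕ) : HasResSum (fun z => z ^ k) 0 := by
  refine ⟨fun q => AnalyticAt.hasRes_zero (by fun_prop), ?_⟩
  have := (hasRes_inv_pow 0 (k + 1)).const_mul (-1)
  simp only [sub_zero, Nat.add_eq_zero_iff, one_ne_zero, and_false, if_false, mul_zero] at this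
  simp only [Finsupp.sum_zero_index, neg_zero]
  refine this.congr_cofinite (Filter.Eventually.of_forall fun w => ?_)
  simp only [inv_pow, div_eq_mul_inv, show k + 1 + 1 = k + 2 from rfl, pow_add, mul_inv]
  ring

theorem hasResSum_inv_pow (q : ℂ) (k : ℕ) :
    HasResSum (fun z => ((z - q) ^ (k + 1))⁻¹) (Finsupp.single q (if k = 0 then 1 else 0)) := by
  refine ⟨fun r => ?_, ?_⟩
  · by_cases h : r = q
    · subst h
      rw [Finsupp.single_eq_same]
      exact hasRes_inv_pow r k
    · rw [Finsupp.single_eq_of_ne h]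
      refine AnalyticAt.hasRes_zero ?_
      have : (r - q) ^ (k + 1) ≠ 0 := pow_ne_zero _ (sub_ne_zero.mpr h)
      fun_prop (disch := assumption)
  · rw [Finsupp.sum_single_index rfl]
    -- In the parameter w = 1/z the form is -w^k/(1-qw)^{k+1} dw/w, a simple pole whose residue is
    -- the value of the first factor at 0.
    have hg : AnalyticAt ℂ (fun w : ℂ => -(w ^ k) / (1 - q * w) ^ (k + 1)) 0 := by
      have : (1 - q * 0) ^ (k + 1) ≠ 0 := by simp
      fun_prop (disch := assumption)
    have h := hasRes_div_sub hg
    have he : -(0 ^ k : ℂ) / (1 - q * 0) ^ (k + 1) = -if k = 0 then 1 else 0 := by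
      rcases Nat.eq_zero_or_pos k with rfl | hk
      · simp
      · simp [hk.ne']
    rw [he] at h
    refine h.congr ?_
    filter_upwards [self_mem_nhdsWithin] with w hw
    have hw : w ≠ 0 := hw
    have h1 : w⁻¹ - q = (1 - q * w) / w := by field_simp
    rw [h1, sub_zero, div_pow, inv_div]
    by_cases h2 : (1 - q * w) ^ (k + 1) = 0
    · simp [h2]
    · field_simp
      ring

/-- The functions which have, up to finitely many values, a partial fraction expansion. -/
inductive PartialFrac : (ℂ → ℂ) → Prop
  | pow (k : ℕ) : PartialFrac fun z => z ^ k
  | pole (q : ℂ) (k : ℕ) : PartialFrac fun z => ((z - q) ^ (k + 1))⁻¹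
  | add {f g : ℂ → ℂ} : PartialFrac f → PartialFrac g → PartialFrac fun z => f z + g z
  | smul {f : ℂ → ℂ} (c : ℂ) : PartialFrac f → PartialFrac fun z => c * f z
  | congr {f g : ℂ → ℂ} : PartialFrac f → f =ᶠ[Filter.cofinite] g → PartialFrac g

theorem PartialFrac.exists_hasResSum {f : ℂ → ℂ} (h : PartialFrac f) : ∃ ρ, HasResSum f ρ := by
  induction h with
  | pow k => exact ⟨_, hasResSum_pow k⟩
  | pole q k => exact ⟨_, hasResSum_inv_pow q k⟩
  | add _ _ h1 h2 => obtain ⟨_, h1⟩ := h1; obtain ⟨_, h2⟩ := h2; exact ⟨_, h1.add h2⟩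
  | smul c _ h => obtain ⟨_, h⟩ := h; exact ⟨_, h.const_mul c⟩
  | congr _ hc h => obtain ⟨_, h⟩ := h; exact ⟨_, h.congr hc⟩

theorem eventually_ne_cofinite (q : ℂ) : ∀ᶠ z : ℂ in Filter.cofinite, z ≠ q :=
  (Set.finite_singleton q).eventually_cofinite_notMem

/-- The induction rests on z^{k+1}/(z-q) = z^k + q z^k/(z-q), and on 1/((z-r)(z-q)) = (1/(z-q) -
1/(z-r))/(q-r), applied repeatedly to a pole of higher order at r ≠ q. -/
theorem PartialFrac.mul_inv_sub {f : ℂ → ℂ} (h : PartialFrac f) (q : ℂ) :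
    PartialFrac fun z => f z * (z - q)⁻¹ := by
  induction h with
  | pow k =>
    induction k with
    | zero =>
      refine (PartialFrac.pole q 0).congr (Filter.Eventually.of_forall fun z => ?_)
      simp
    | succ k ih =>
      refine ((PartialFrac.pow k).add (ih.smul q)).congr ?_
      filter_upwards [eventually_ne_cofinite q] with z hz
      have := sub_ne_zero.mpr hz
      field_simp
      ring
  | pole r k =>
    by_cases hr : r = q
    · subst hr
      refine (PartialFrac.pole r (k + 1)).congr (Filter.Eventually.of_forall fun z => ?_)
      simp only
      rw [pow_succ (z - r) (k + 1), mul_inv]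
    · have hqr : q - r ≠ 0 := sub_ne_zero.mpr (Ne.symm hr)
      induction k with
      | zero =>
        refine (((PartialFrac.pole q 0).add ((PartialFrac.pole r 0).smul (-1))).smul
          (q - r)⁻¹).congr ?_
        filter_upwards [eventually_ne_cofinite q, eventually_ne_cofinite r] with z hz hz'
        have := sub_ne_zero.mpr hz
        have := sub_ne_zero.mpr hz'
        simp only [zero_add, pow_one]
        field_simp
        ring
      | succ k ih =>
        refine ((ih.add ((PartialFrac.pole r (k + 1)).smul (-1))).smul (q - r)⁻¹).congr ?_
        filter_upwards [eventually_ne_cofinite q, eventually_ne_cofinite r] with z hz hz'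
        have := sub_ne_zero.mpr hz
        have := sub_ne_zero.mpr hz'
        rw [pow_succ (z - r) (k + 1)]
        field_simp
        ring
  | add _ _ h1 h2 =>
    refine (h1.add h2).congr (Filter.Eventually.of_forall fun z => ?_)
    simp only
    ring
  | smul c _ h =>
    refine (h.smul c).congr (Filter.Eventually.of_forall fun z => ?_)
    simp only
    ring
  | congr _ hc h =>
    refine h.congr ?_
    filter_upwards [hc] with z hz
    rw [hz]

theorem PartialFrac.poly (P : ℂ[X]) : PartialFrac fun z => P.eval z := by
  induction P using Polynomial.induction_on' with
  | add P Q h1 h2 =>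
    refine (h1.add h2).congr (Filter.Eventually.of_forall fun z => ?_)
    simp
  | monomial k c =>
    refine ((PartialFrac.pow k).smul c).congr (Filter.Eventually.of_forall fun z => ?_)
    simp

/-- The roots of Q are split off one at a time, each dividing the expansion by one more z - q. -/
theorem PartialFrac.rat (P : ℂ[X]) {Q : ℂ[X]} (hQ : Q ≠ 0) :
    PartialFrac fun z => P.eval z / Q.eval z := by
  induction hn : Q.natDegree generalizing Q with
  | zero =>
    obtain ⟨c, rfl⟩ := natDegree_eq_zero.mp hn
    refine ((PartialFrac.poly P).smul c⁻¹).congr (Filter.Eventually.of_forall fun z => ?_)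
    simp [div_eq_inv_mul]
  | succ n ih =>
    obtain ⟨q, hq⟩ := IsAlgClosed.exists_root Q
      (by rw [degree_eq_natDegree hQ, hn]; exact_mod_cast n.succ_ne_zero)
    obtain ⟨R, rfl⟩ := dvd_iff_isRoot.mpr hq
    have hR : R ≠ 0 := right_ne_zero_of_mul hQ
    have hdeg : R.natDegree = n := by
      rw [natDegree_mul (X_sub_C_ne_zero q) hR, natDegree_X_sub_C] at hn
      omega
    refine ((ih hR hdeg).mul_inv_sub q).congr (Filter.Eventually.of_forall fun z => ?_)
    simp only [eval_mul, eval_sub, eval_X, eval_C]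
    rw [← div_eq_mul_inv, div_div, mul_comm (z - q)]

theorem exists_hasResSum_rat (P : ℂ[X]) {Q : ℂ[X]} (hQ : Q ≠ 0) :
    ∃ ρ, HasResSum (fun z => P.eval z / Q.eval z) ρ :=
  (PartialFrac.rat P hQ).exists_hasResSum

theorem hasRes_rat_zero (P : ℂ[X]) {Q : ℂ[X]} {q : ℂ} (hq : Q.eval q ≠ 0) :
    HasRes (fun z => P.eval z / Q.eval z) q 0 := by
  apply AnalyticAt.hasRes_zero
  exact (AnalyticAt.aeval_polynomial analyticAt_id P).div (AnalyticAt.aeval_polynomial analyticAt_id Q) hq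

theorem eval_inv_eq_reflect {N : ℕ} {f : ℂ[X]} (hf : f.natDegree ≤ N) {w : ℂ} (hw : w ≠ 0) :
    f.eval w⁻¹ = (reflect N f).eval w / w ^ N := by
  let _ := invertibleOfNonzero (inv_ne_zero hw)
  have := eval₂_reflect_mul_pow (RingHom.id ℂ) w⁻¹ N f hf
  simp only [invOf_eq_inv, inv_inv] at this
  rw [eval, ← this, div_eq_mul_inv, inv_pow, eval]

/-- A degree drop of at least 2 makes f(p) dp holomorphic at infinity: in w = 1/p it is a quotient
of reversed polynomials whose denominator does not vanish at 0. -/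
theorem hasResInfty_rat_zero (P : ℂ[X]) {Q : ℂ[X]} (hQ : Q ≠ 0)
    (h : P.natDegree + 2 ≤ Q.natDegree) : HasResInfty (fun z => P.eval z / Q.eval z) 0 := by
  set N := Q.natDegree with hN
  have hR : (reflect N Q).eval 0 ≠ 0 := by
    rw [← coeff_zero_eq_eval_zero, coeff_reflect, revAt_zero]
    exact leadingCoeff_ne_zero.mpr hQ
  have ha := hasRes_rat_zero (-reflect (N - 2) P) hR
  refine ha.congr ?_
  filter_upwards [self_mem_nhdsWithin] with w hw
  have hw : w ≠ 0 := hw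
  rw [eval_inv_eq_reflect (f := P) (N := N - 2) (by omega) hw, eval_inv_eq_reflect (f := Q) le_rfl hw,
    ← hN]
  obtain ⟨M, hM⟩ : ∃ M, N = M + 2 := ⟨N - 2, by omega⟩
  rw [hM, eval_neg]
  simp only [Nat.add_sub_cancel]
  by_cases h0 : (reflect (M + 2) Q).eval w = 0
  · simp [h0]
  · field_simp
    ring

theorem eventually_eval_ne_zero {Q : ℂ[X]} (hQ : Q ≠ 0) : ∀ᶠ z in Filter.cofinite, Q.eval z ≠ 0 := by
  have : {z | Q.IsRoot z}.Finite := finite_setOfPred_isRoot hQ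
  exact this.eventually_cofinite_notMem

end GenFrob
end

/-! ### The superpotential in the variable u = p², and residue sums over its critical points. -/

noncomputable section
namespace GenFrob
open Polynomial

section
variable {ℓ m : ℕ} {a : Fin ℓ → ℂ}

theorem superpotential_eq (a : Fin ℓ → ℂ) (p : ℂ) :
    superpotential ℓ m a p = (bPoly a).eval (p ^ 2) / p ^ (2 * m) := by
  simp only [superpotential, bPoly, eval_mul, eval_sub, eval_X, eval_one, eval_vp, pow_mul]
  ring

theorem dSuper_eq (a V : Fin ℓ → ℂ) (p : ℂ) :
    dSuper ℓ m a V p = (bPoly V).eval (p ^ 2) / p ^ (2 * m) := by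
  rw [dSuper, lineDeriv]
  have h : (fun t : ℂ => superpotential ℓ m (a + t • V) p) = fun t =>
      (bPoly a).eval (p ^ 2) / p ^ (2 * m) + t * ((bPoly V).eval (p ^ 2) / p ^ (2 * m)) := by
    ext t
    rw [superpotential_eq, bPoly_add, bPoly_smul, eval_add, eval_smul, smul_eq_mul]
    ring
  rw [h]
  simp

theorem hasDerivAt_superpotential (a : Fin ℓ → ℂ) {p : ℂ} (hp : p ≠ 0) :
    HasDerivAt (superpotential ℓ m a) (2 * (dPoly m a).eval (p ^ 2) / p ^ (2 * m + 1)) p := by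
  have h : superpotential ℓ m a = fun p => (bPoly a).eval (p ^ 2) / p ^ (2 * m) :=
    funext (superpotential_eq a)
  rw [h]
  have h1 : HasDerivAt (fun p : ℂ => (bPoly a).eval (p ^ 2))
      ((derivative (bPoly a)).eval (p ^ 2) * (2 * p)) p := by
    have := ((bPoly a).hasDerivAt (p ^ 2)).comp p (hasDerivAt_pow 2 p)
    simpa [Function.comp_def] using this
  have h2 := h1.div (hasDerivAt_pow (2 * m) p) (pow_ne_zero _ hp)
  refine h2.congr_deriv ?_
  rw [dPoly, mop_apply, eval_sub, eval_mul, eval_X, eval_mul, eval_C]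
  rcases Nat.eq_zero_or_pos m with rfl | hm
  · simp
    field_simp
  · obtain ⟨k, rfl⟩ : ∃ k, m = k + 1 := ⟨m - 1, by omega⟩
    rw [show 2 * (k + 1) - 1 = 2 * k + 1 by omega]
    push_cast
    field_simp
    ring

theorem deriv_superpotential (a : Fin ℓ → ℂ) {p : ℂ} (hp : p ≠ 0) :
    deriv (superpotential ℓ m a) p = 2 * (dPoly m a).eval (p ^ 2) / p ^ (2 * m + 1) :=
  (hasDerivAt_superpotential a hp).deriv

/-- Away from 0 this is Λ' = 2D(p²)/p^{2m+1}. The origin counts only for m = 0; there Λ is a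
polynomial in p² and D = u b', so both conditions hold. -/
theorem mem_critPts (a : Fin ℓ → ℂ) (q : ℂ) :
    q ∈ critPts ℓ m a ↔ (q ≠ 0 ∨ m = 0) ∧ (dPoly m a).eval (q ^ 2) = 0 := by
  by_cases hq : q = 0
  · subst hq
    simp only [critPts, Set.mem_ofPred_eq, ne_eq, not_true, false_or, and_congr_right_iff]
    rintro rfl
    have h1 : (dPoly 0 a).eval (0 ^ 2) = 0 := by simp [dPoly, mop_apply]
    have h2 : deriv (superpotential ℓ 0 a) 0 = 0 := by
      have h : superpotential ℓ 0 a = fun p => (bPoly a).eval (p ^ 2) := by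
        ext p; rw [superpotential_eq]; simp
      rw [h]
      have := (((bPoly a).hasDerivAt (0 ^ 2)).comp 0 (hasDerivAt_pow 2 (0 : ℂ))).deriv
      simpa [Function.comp_def] using this
    simp only [h1, h2]
  · simp only [critPts, Set.mem_ofPred_eq, deriv_superpotential a hq, ne_eq, hq, not_false_eq_true,
      true_or, true_and, div_eq_zero_iff, mul_eq_zero, OfNat.ofNat_ne_zero, false_or,
      pow_eq_zero_iff', false_and, or_false]

theorem expand_ne_zero {Q : ℂ[X]} (h : Q ≠ 0) : expand ℂ 2 Q ≠ 0 :=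
  fun h0 => h ((expand_eq_zero (by norm_num)).mp h0)

theorem finite_critPts (hℓ : 1 ≤ ℓ) (hm : m ≤ ℓ) (ha : a ∈ spaceLG ℓ m) : (critPts ℓ m a).Finite := by
  refine (finite_setOfPred_isRoot (expand_ne_zero (dPoly_ne_zero hℓ hm ha))).subset fun q hq => ?_
  rw [Set.mem_ofPred_eq, IsRoot, expand_eval]
  exact ((mem_critPts a q).mp hq).2

theorem critResidue_of_hasRes {f : ℂ → ℂ} {ρ : ℂ → ℂ} {r : ℂ}
    (h : ∀ q ∈ critPts ℓ m a, HasRes f q (ρ q)) (h' : m = ℓ → HasResInfty f r) :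
    critResidue ℓ m a f = (∑ᶠ q ∈ critPts ℓ m a, ρ q) + if m = ℓ then r else 0 := by
  rw [critResidue, finsum_mem_congr rfl fun q hq => (h q hq).residueAt_eq]
  split_ifs with h1
  · rw [(h' h1).residueInfty_eq]
  · rfl

theorem critResidue_eq_zero {f : ℂ → ℂ} 
    (h : ∀ q ∈ critPts ℓ m a, HasRes f q 0) (h' : m = ℓ → HasResInfty f 0) :
    critResidue ℓ m a f = 0 := by
  rw [critResidue_of_hasRes h h']
  simp

/-- Residues ignore the values at finitely many points, in particular the conventional values of
quotients at poles; so integrands need only be compared at generic p. -/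
theorem critResidue_congr {f g : ℂ → ℂ} {ρ : ℂ →₀ ℂ} (hf : HasResSum f ρ)
    (h : f =ᶠ[Filter.cofinite] g) : critResidue ℓ m a f = critResidue ℓ m a g := by
  rw [critResidue_of_hasRes (fun q _ => hf.1 q) fun _ => hf.2,
    critResidue_of_hasRes (fun q _ => (hf.congr h).1 q) fun _ => (hf.congr h).2]

theorem critResidue_add (hℓ : 1 ≤ ℓ) (hm : m ≤ ℓ) (ha : a ∈ spaceLG ℓ m) {f g : ℂ → ℂ}
    {ρ σ : ℂ →₀ ℂ} (hf : HasResSum f ρ) (hg : HasResSum g σ) :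
    critResidue ℓ m a (fun z => f z + g z) = critResidue ℓ m a f + critResidue ℓ m a g := by
  rw [critResidue_of_hasRes (fun q _ => hf.1 q) fun _ => hf.2,
    critResidue_of_hasRes (fun q _ => hg.1 q) fun _ => hg.2,
    critResidue_of_hasRes (fun q _ => (hf.1 q).add (hg.1 q)) fun _ => hf.2.add hg.2,
    finsum_mem_add_distrib (finite_critPts hℓ hm ha)]
  split_ifs <;> ring

theorem natDegree_dPoly (ha : a ∈ spaceLG ℓ m) (h : m < ℓ) :
    (dPoly m a).natDegree = ℓ :=
  natDegree_eq_of_le_of_coeff_ne_zero (natDegree_le_of_degree_le (degree_dPoly_le m a))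
    (coeff_dPoly_top_ne ha h)

/-- The total residue of `p P(p²) / (p^{2jm} D(p²))` at the critical points, in terms of the
decomposition `(u - 1) P = u^{jm} S + D H`. -/
theorem critResidue_eq (hℓ : 1 ≤ ℓ) (hm : m ≤ ℓ) (ha : a ∈ spaceLG ℓ m) {j : ℕ}
    {P S H : ℂ[X]} (hS : S.natDegree < ℓ) (hH : H.natDegree < j * ℓ)
    (h : (X - 1) * P = X ^ (j * m) * S + H * dPoly m a) :
    critResidue ℓ m a (fun p => p * P.eval (p ^ 2) / (p ^ (2 * (j * m)) * (dPoly m a).eval (p ^ 2)))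
      = H.eval 1 := by
  have hD := dPoly_ne_zero hℓ hm ha
  set D := dPoly m a with hDdef
  have hX1 : (X ^ 2 - 1 : ℂ[X]) ≠ 0 := (monic_X_pow_sub_C (1 : ℂ) two_ne_zero).ne_zero
  have hX1d : (X ^ 2 - 1 : ℂ[X]).natDegree = 2 := natDegree_X_pow_sub_C (r := (1 : ℂ))
  have hXk : ∀ k : ℕ, (X ^ k : ℂ[X]) ≠ 0 := fun k => pow_ne_zero _ X_ne_zero
  -- The integrand is the sum of p S/((p²-1)D(p²)) and p H/((p²-1)p^{2jm}), with residues θ and σ.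
  -- At ±1 the two parts have poles that cancel unless D(1) = 0; the critical points belong to the
  -- first part, the pole at 0 to the second.
  obtain ⟨θ, hθ⟩ := exists_hasResSum_rat (X * expand ℂ 2 S) (mul_ne_zero hX1 (expand_ne_zero hD))
  obtain ⟨σ, hσ⟩ := exists_hasResSum_rat (X * expand ℂ 2 H)
    (mul_ne_zero hX1 (hXk (2 * (j * m))))
  have hρ := hθ.add hσ
  set ρ := θ + σ with hρdef
  -- the residues of the sum
  have hf : HasResSum (fun p => p * P.eval (p ^ 2) / (p ^ (2 * (j * m)) * D.eval (p ^ 2))) ρ := by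
    refine hρ.congr ?_
    filter_upwards [eventually_eval_ne_zero hX1, eventually_eval_ne_zero (expand_ne_zero hD),
      eventually_ne_cofinite 0] with p h1 h2 h3
    have := congrArg (eval (p ^ 2)) h
    simp only [eval_mul, eval_sub, eval_X, eval_one, eval_add, eval_pow, expand_eval] at this h1 h2 ⊢
    rw [← pow_mul, show 2 * (j * m) = 2 * (j * m) from rfl] at this
    field_simp
    linear_combination (-1) * this
  have hρ0 : ∀ q, q ∉ critPts ℓ m a → ¬ (q = 0 ∧ 0 < m) → ρ q = 0 := by
    intro q hq hq0
    refine (hf.1 q).unique ?_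
    have hev : (X ^ (2 * (j * m)) * expand ℂ 2 D).eval q ≠ 0 := by
      rw [mem_critPts] at hq
      simp only [eval_mul, eval_pow, eval_X, expand_eval]
      rcases Nat.eq_zero_or_pos m with rfl | hm0
      · simpa using hq
      · have : q ≠ 0 := fun h => hq0 ⟨h, hm0⟩
        exact mul_ne_zero (pow_ne_zero _ this) fun h => hq ⟨Or.inl this, h⟩
    refine (hasRes_rat_zero (X * expand ℂ 2 P) hev).congr_cofinite
      (Filter.Eventually.of_forall fun p => ?_)
    simp [expand_eval]
  have hθ0 : 0 < m → θ 0 = 0 := by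
    intro hm0
    refine (hθ.1 0).unique (hasRes_rat_zero _ ?_)
    have := coeff_dPoly_zero_ne hm ha hm0
    rw [coeff_zero_eq_eval_zero] at this
    simpa [expand_eval] using this
  -- For m < ℓ the denominator has degree 2 + 2ℓ, which forces the residue at infinity to vanish,
  -- and with it the sum of all finite residues. For m = ℓ the second summand has this property
  -- instead.
  have hθs : m < ℓ → (θ.sum fun _ r => r) = 0 := by
    intro hml
    have h0 := hθ.2.unique (hasResInfty_rat_zero (X * expand ℂ 2 S)
      (mul_ne_zero hX1 (expand_ne_zero hD)) ?_)
    · exact neg_eq_zero.mp h0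
    · rw [natDegree_mul hX1 (expand_ne_zero hD), hX1d, natDegree_expand,
        natDegree_dPoly ha hml]
      have := natDegree_mul_le (p := (X : ℂ[X])) (q := expand ℂ 2 S)
      rw [natDegree_X, natDegree_expand] at this
      omega
  have hσs : m = ℓ → (σ.sum fun _ r => r) = 0 := by
    intro hml
    have h0 := hσ.2.unique (hasResInfty_rat_zero (X * expand ℂ 2 H)
      (mul_ne_zero hX1 (hXk (2 * (j * m)))) ?_)
    · exact neg_eq_zero.mp h0
    · rw [natDegree_mul hX1 (hXk _), hX1d, natDegree_X_pow]
      have := natDegree_mul_le (p := (X : ℂ[X])) (q := expand ℂ 2 H)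
      rw [natDegree_X, natDegree_expand] at this
      subst hml
      omega
  have hσ1 : σ 1 = H.eval 1 / 2 := by
    refine (hσ.1 1).unique ?_
    have hg : AnalyticAt ℂ (fun p : ℂ => (X * expand ℂ 2 H).eval p /
        ((X + 1) * X ^ (2 * (j * m)) : ℂ[X]).eval p) 1 :=
      (AnalyticAt.aeval_polynomial analyticAt_id _).div
        (AnalyticAt.aeval_polynomial analyticAt_id _) (by norm_num)
    have h1 := hasRes_div_sub hg
    simp only [eval_mul, eval_add, eval_X, eval_one, eval_pow, one_pow, expand_eval] at h1
    convert h1.congr_cofinite (Filter.Eventually.of_forall fun p => ?_) using 1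
    · norm_num
    · simp only [eval_mul, eval_X, eval_one, eval_pow, expand_eval, eval_sub]
      rw [div_div]
      congr 1
      ring
  -- The points 1 and -1 contribute equally, since both lie over u = 1; together they give H(1).
  have hσ2 : σ (-1) = H.eval 1 / 2 := by
    refine (hσ.1 (-1)).unique ?_
    have hg : AnalyticAt ℂ (fun p : ℂ => (X * expand ℂ 2 H).eval p /
        ((X - 1) * X ^ (2 * (j * m)) : ℂ[X]).eval p) (-1) :=
      (AnalyticAt.aeval_polynomial analyticAt_id _).div
        (AnalyticAt.aeval_polynomial analyticAt_id _) (by norm_num)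
    have h1 := hasRes_div_sub hg
    simp only [eval_mul, eval_sub, eval_X, eval_one, eval_pow, expand_eval] at h1
    convert h1.congr_cofinite (Filter.Eventually.of_forall fun p => ?_) using 1
    · rw [pow_mul]
      norm_num
    · simp only [eval_mul, eval_X, eval_one, eval_pow, expand_eval, eval_sub]
      rw [div_div]
      congr 1
      ring
  have hσ0 : ∀ q, q ≠ 1 → q ≠ -1 → q ≠ 0 → σ q = 0 := by
    intro q h1 h2 h3
    refine (hσ.1 q).unique (hasRes_rat_zero _ ?_)
    simp only [eval_mul, eval_sub, eval_pow, eval_X, eval_one]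
    refine mul_ne_zero ?_ (pow_ne_zero _ h3)
    rw [sub_ne_zero]
    intro h4
    rcases sq_eq_one_iff.mp h4 with h | h
    · exact h1 h
    · exact h2 h
  have hσ00 : m = 0 → σ 0 = 0 := by
    rintro rfl
    exact (hσ.1 0).unique (hasRes_rat_zero _ (by simp))
  have hσsum : (σ.sum fun _ r => r) = H.eval 1 + σ 0 := by
    have hsub : σ.support ⊆ {1, -1, 0} := by
      intro q hq
      by_contra hq'
      simp only [Finset.mem_insert, Finset.mem_singleton, not_or] at hq'
      exact Finsupp.mem_support_iff.mp hq (hσ0 q hq'.1 hq'.2.1 hq'.2.2)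
    rw [Finsupp.sum_of_support_subset _ hsub _ (by simp)]
    rw [Finset.sum_insert (by norm_num), Finset.sum_insert (by norm_num), Finset.sum_singleton,
      hσ1, hσ2]
    ring
  have hρsum : (ρ.sum fun _ r => r) = (θ.sum fun _ r => r) + (σ.sum fun _ r => r) :=
    Finsupp.sum_add_index (by simp) (by simp)
  have hcrit : (∑ᶠ q ∈ critPts ℓ m a, ρ q) = (ρ.sum fun _ r => r) - if 0 < m then ρ 0 else 0 := by
    by_cases hm0 : 0 < m
    · have h0 : (0 : ℂ) ∉ critPts ℓ m a := by
        rw [mem_critPts]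
        rintro ⟨h | h, -⟩
        · exact h rfl
        · omega
      rw [if_pos hm0, finsum_mem_eq_sum_of_inter_support_eq (t := ρ.support.erase 0),
        eq_sub_iff_add_eq]
      · by_cases h00 : (0 : ℂ) ∈ ρ.support
        · rw [Finset.sum_erase_add _ _ h00]; rfl
        · rw [Finset.erase_eq_of_notMem h00, Finsupp.notMem_support_iff.mp h00, add_zero]; rfl
      · ext q
        simp only [Set.mem_inter_iff, Function.mem_support, Finset.mem_coe, Finset.mem_erase,
          Finsupp.mem_support_iff]
        constructor
        · rintro ⟨h1, h2⟩
          exact ⟨⟨fun h => h0 (h ▸ h1), h2⟩, h2⟩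
        · rintro ⟨⟨h1, -⟩, h2⟩
          refine ⟨?_, h2⟩
          by_contra hq'
          exact h2 (hρ0 q hq' fun h => h1 h.1)
    · rw [if_neg hm0, sub_zero, finsum_mem_eq_sum_of_inter_support_eq (t := ρ.support)]
      · rfl
      · ext q
        simp only [Set.mem_inter_iff, Function.mem_support, Finset.mem_coe, Finsupp.mem_support_iff,
          and_self, and_iff_right_iff_imp]
        intro hq
        by_contra hq'
        exact hq (hρ0 q hq' fun h => hm0 h.2)
  rw [critResidue_of_hasRes (fun q _ => hf.1 q) fun _ => hf.2, hcrit, hρsum, hσsum]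
  have hρ00 : ρ 0 = θ 0 + σ 0 := rfl
  -- For m = 0 all poles are counted and the total is Σσ = H(1). For 0 < m < ℓ the pole at 0 is left
  -- out, which removes σ(0) from H(1) + σ(0). For m = ℓ the residue at infinity cancels the finite
  -- sum, leaving -σ(0), and Σσ = 0 says that this is H(1).
  rcases Nat.eq_zero_or_pos m with hm0 | hm0
  · rw [if_neg (by omega), if_neg (by omega), hθs (by omega), hσ00 hm0]; ring
  · rw [if_pos hm0, hρ00, hθ0 hm0]
    rcases hm.eq_or_lt with hml | hml
    · rw [if_pos hml]
      have := hσs hml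
      rw [hσsum] at this
      linear_combination (-1) * this
    · rw [if_neg hml.ne, hθs hml]; ring

end
end GenFrob
end

/-! ### The residue tensors in terms of S and G. -/

noncomputable section
namespace GenFrob
open Polynomial

section
variable {ℓ m : ℕ} {a : Fin ℓ → ℂ}

theorem natDegree_vp_lt (hℓ : 1 ≤ ℓ) (v : Fin ℓ → ℂ) : (vp ℓ v).natDegree < ℓ :=
  lt_of_le_of_lt (natDegree_vp_le v) (by omega)

/-- Generic points of the `p`-plane. -/
theorem eventually_generic (hℓ : 1 ≤ ℓ) (hm : m ≤ ℓ) (ha : a ∈ spaceLG ℓ m) :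
    ∀ᶠ p : ℂ in Filter.cofinite, p ≠ 0 ∧ p ^ 2 - 1 ≠ 0 ∧ (dPoly m a).eval (p ^ 2) ≠ 0 := by
  have hX1 : (X ^ 2 - 1 : ℂ[X]) ≠ 0 := (monic_X_pow_sub_C (1 : ℂ) two_ne_zero).ne_zero
  filter_upwards [eventually_eval_ne_zero hX1,
    eventually_eval_ne_zero (expand_ne_zero (dPoly_ne_zero hℓ hm ha)),
    eventually_ne_cofinite 0] with p h1 h2 h3
  simp only [eval_sub, eval_pow, eval_X, eval_one, expand_eval] at h1 h2
  exact ⟨h3, h1, h2⟩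

theorem exists_hasResSum_crit (hℓ : 1 ≤ ℓ) (hm : m ≤ ℓ) (ha : a ∈ spaceLG ℓ m) (P : ℂ[X]) (k : ℕ) :
    ∃ ρ, HasResSum (fun p => p * P.eval (p ^ 2) / (p ^ k * (dPoly m a).eval (p ^ 2))) ρ := by
  obtain ⟨ρ, hρ⟩ := exists_hasResSum_rat (X * expand ℂ 2 P) (Q := X ^ k * expand ℂ 2 (dPoly m a))
    (mul_ne_zero (pow_ne_zero _ X_ne_zero) (expand_ne_zero (dPoly_ne_zero hℓ hm ha)))
  refine ⟨ρ, hρ.congr (Filter.Eventually.of_forall fun p => ?_)⟩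
  simp [expand_eval]

/-- The case j = 1 of `critResidue_eq`: the factors (p²-1)² cancel, and the 1/2 comes from Λ' =
2D(p²)/p^{2m+1}. -/
theorem etaLG_eq (hℓ : 1 ≤ ℓ) (hm : m ≤ ℓ) (ha : a ∈ spaceLG ℓ m) (V W : Fin ℓ → ℂ) :
    etaLG ℓ m a V W = etaF ℓ m a V W := by
  have hsg := sg_spec hm ha V W
  have key := critResidue_eq hℓ hm ha (j := 1) (P := C (1 / 2) * vp ℓ V * vp ℓ W)
    (S := C (1 / 2) * vp ℓ (smap ℓ m a V W)) (H := C (1 / 2) * vp ℓ (gmap ℓ m a V W))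
    (lt_of_le_of_lt (natDegree_C_mul_le _ _) (natDegree_vp_lt hℓ _))
    (lt_of_le_of_lt (natDegree_C_mul_le _ _) (by simpa using natDegree_vp_lt hℓ _))
    (by rw [one_mul, bPoly] at *; linear_combination (-C (1 / 2)) * hsg)
  rw [eval_mul, eval_C] at key
  rw [etaF, ← key, etaLG]
  obtain ⟨ρ, hρ⟩ := exists_hasResSum_crit hℓ hm ha (C (1 / 2) * vp ℓ V * vp ℓ W) (2 * (1 * m))
  refine (critResidue_congr hρ ?_).symm
  filter_upwards [eventually_generic hℓ hm ha] with p hp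
  obtain ⟨h0, h1, h2⟩ := hp
  rw [dSuper_eq, dSuper_eq, deriv_superpotential a h0]
  simp only [bPoly, eval_mul, eval_C, eval_sub, eval_X, eval_one, one_mul]
  field_simp
  ring

/-- The case j = 2 of `critResidue_eq`, with H for the quotient; one factor u - 1 of the three
survives in the numerator. -/
theorem cLG_eq (hℓ : 1 ≤ ℓ) (hm : m ≤ ℓ) (ha : a ∈ spaceLG ℓ m) (V W Z : Fin ℓ → ℂ) :
    cLG ℓ m a V W Z = etaF ℓ m a (smap ℓ m a V W) Z := by
  have hsg := sh_spec hm ha V W Z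
  have hdeg : (hPoly m a V W Z).natDegree < 2 * ℓ := by
    by_cases h0 : hPoly m a V W Z = 0
    · rw [h0, natDegree_zero]; omega
    · exact (natDegree_lt_iff_degree_lt h0).mpr (degree_hPoly_lt hm V W Z)
  have key := critResidue_eq hℓ hm ha (j := 2)
    (P := C (1 / 2) * ((X - 1) * vp ℓ V * vp ℓ W * vp ℓ Z))
    (S := C (1 / 2) * vp ℓ (smap ℓ m a (smap ℓ m a V W) Z)) (H := C (1 / 2) * hPoly m a V W Z)
    (lt_of_le_of_lt (natDegree_C_mul_le _ _) (natDegree_vp_lt hℓ _))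
    (lt_of_le_of_lt (natDegree_C_mul_le _ _) hdeg)
    (by simp only [bPoly] at hsg; linear_combination (-C (1 / 2)) * hsg)
  rw [eval_mul, eval_C] at key
  rw [etaF_smap, ← key, cLG]
  obtain ⟨ρ, hρ⟩ := exists_hasResSum_crit hℓ hm ha
    (C (1 / 2) * ((X - 1) * vp ℓ V * vp ℓ W * vp ℓ Z)) (2 * (2 * m))
  refine (critResidue_congr hρ ?_).symm
  filter_upwards [eventually_generic hℓ hm ha] with p hp
  obtain ⟨h0, h1, h2⟩ := hp
  rw [dSuper_eq, dSuper_eq, dSuper_eq, deriv_superpotential a h0]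
  simp only [bPoly, eval_mul, eval_C, eval_sub, eval_X, eval_one]
  field_simp
  ring

theorem etaMatLG_eq (hℓ : 1 ≤ ℓ) (hm : m ≤ ℓ) (ha : a ∈ spaceLG ℓ m) :
    etaMatLG ℓ m a = Matrix.of fun i j => etaL ℓ m a (Pi.single i 1) (Pi.single j 1) := by
  ext i j
  exact etaLG_eq hℓ hm ha _ _

theorem bil_etaMatLG (hℓ : 1 ≤ ℓ) (hm : m ≤ ℓ) (ha : a ∈ spaceLG ℓ m) (V W : Fin ℓ → ℂ) :
    bil (etaMatLG ℓ m a) V W = etaF ℓ m a V W := by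
  rw [etaMatLG_eq hℓ hm ha, bil_of_bilin]; rfl

theorem det_etaMatLG_ne_zero (hℓ : 1 ≤ ℓ) (hm : m ≤ ℓ) (ha : a ∈ spaceLG ℓ m) :
    (etaMatLG ℓ m a).det ≠ 0 := by
  intro h
  obtain ⟨v, hv, h0⟩ := Matrix.exists_mulVec_eq_zero_iff.mpr h
  refine hv (etaF_nondeg hℓ hm ha fun V => ?_)
  rw [← bil_etaMatLG hℓ hm ha, bil, h0, dotProduct_zero]

theorem etaMatLG_symm (hℓ : 1 ≤ ℓ) (hm : m ≤ ℓ) (ha : a ∈ spaceLG ℓ m) :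
    (etaMatLG ℓ m a).IsSymm := by
  ext i j
  rw [Matrix.transpose_apply, etaMatLG_eq hℓ hm ha, Matrix.of_apply, Matrix.of_apply, etaL_apply,
    etaL_apply, etaF_comm]

end

theorem bil_single_right {n : ℕ} (M : Matrix (Fin n) (Fin n) ℂ) (V : Fin n → ℂ) (s : Fin n) :
    bil M V (Pi.single s 1) = (V ᵥ* M) s := by
  rw [bil, Matrix.dotProduct_mulVec, dotProduct_single, mul_one]

section
variable {ℓ m : ℕ} {a : Fin ℓ → ℂ}

theorem mulLG_eq (hℓ : 1 ≤ ℓ) (hm : m ≤ ℓ) (ha : a ∈ spaceLG ℓ m) :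
    mulLG ℓ m a = fun i j => smap ℓ m a (Pi.single i 1) (Pi.single j 1) := by
  ext i j k
  have h : (fun s => cLG ℓ m a (Pi.single i 1) (Pi.single j 1) (Pi.single s 1)) =
      smap ℓ m a (Pi.single i 1) (Pi.single j 1) ᵥ* etaMatLG ℓ m a := by
    ext s
    rw [cLG_eq hℓ hm ha, ← bil_etaMatLG hℓ hm ha, bil_single_right]
  have h2 : mulLG ℓ m a i j = (fun s => cLG ℓ m a (Pi.single i 1) (Pi.single j 1) (Pi.single s 1)) ᵥ*
      (etaMatLG ℓ m a)⁻¹ := rfl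
  rw [h2, h, Matrix.vecMul_vecMul, Matrix.mul_nonsing_inv _
    (det_etaMatLG_ne_zero hℓ hm ha).isUnit, Matrix.vecMul_one]

theorem prod_mulLG (hℓ : 1 ≤ ℓ) (hm : m ≤ ℓ) (ha : a ∈ spaceLG ℓ m) (V W : Fin ℓ → ℂ) :
    prod (mulLG ℓ m a) V W = smap ℓ m a V W := by
  rw [mulLG_eq hℓ hm ha, prod_of_bilin]

end

theorem inv_mulVec_eq {n : ℕ} {M : Matrix (Fin n) (Fin n) ℂ} (hM : M.det ≠ 0) {v w : Fin n → ℂ}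
    (h : M *ᵥ v = w) : M⁻¹ *ᵥ w = v := by
  rw [← h, Matrix.mulVec_mulVec, Matrix.nonsing_inv_mul _ hM.isUnit, Matrix.one_mulVec]

section
variable {ℓ m : ℕ} {a : Fin ℓ → ℂ}

/-- The vector `(s^{ℓ-1}, …, s, 1)` of the evaluation at `s`. -/
def evVec (ℓ : ℕ) (s : ℂ) : Fin ℓ → ℂ := fun j => s ^ (ℓ - 1 - (j : ℕ))

theorem evVec_dotProduct (s : ℂ) (v : Fin ℓ → ℂ) : evVec ℓ s ⬝ᵥ v = (vp ℓ v).eval s := by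
  rw [eval_vp, dotProduct]
  exact Finset.sum_congr rfl fun j _ => mul_comm _ _

/-- By `etaF_xiVec`, ξ_s is the gradient of the evaluation at s. Evaluations span the covectors, so
this determines the inverse metric. -/
theorem etaMatLG_inv_mulVec (hℓ : 1 ≤ ℓ) (hm : m ≤ ℓ) (ha : a ∈ spaceLG ℓ m) (s : ℂ) :
    (etaMatLG ℓ m a)⁻¹ *ᵥ evVec ℓ s = xiVec m a s := by
  apply inv_mulVec_eq (det_etaMatLG_ne_zero hℓ hm ha)
  have : ∀ V : Fin ℓ → ℂ, V ⬝ᵥ (etaMatLG ℓ m a *ᵥ xiVec m a s) = V ⬝ᵥ evVec ℓ s := by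
    intro V
    rw [dotProduct_comm V (evVec ℓ s), evVec_dotProduct, ← etaF_xiVec hℓ hm ha, etaF_comm,
      ← bil_etaMatLG hℓ hm ha, bil]
  ext i
  simpa using this (Pi.single i 1)

/-- The differential of a_1 + ⋯ + a_ℓ is the evaluation at 1, whose gradient is ξ_1. -/
theorem unitLG_eq (hℓ : 1 ≤ ℓ) (hm : m ≤ ℓ) (ha : a ∈ spaceLG ℓ m) :
    unitLG ℓ m a = (-(1 / 2) * (∑ j, a j)⁻¹) • xiVec m a 1 := by
  have h : (fun j => fderiv ℂ (fun b : Fin ℓ → ℂ => ∑ j, b j) a (Pi.single j 1)) = evVec ℓ 1 := by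
    ext j
    have : HasFDerivAt (fun b : Fin ℓ → ℂ => ∑ j, b j)
        (∑ j, ContinuousLinearMap.proj (R := ℂ) (φ := fun _ : Fin ℓ => ℂ) j) a :=
      HasFDerivAt.fun_sum fun i _ => (ContinuousLinearMap.proj (R := ℂ) (φ := fun _ : Fin ℓ => ℂ) i).hasFDerivAt
    rw [this.fderiv]
    simp [evVec, Finset.sum_pi_single']
  rw [unitLG, gradLog, h, etaMatLG_inv_mulVec hℓ hm ha, smul_smul]

theorem smap_unitLG (hℓ : 1 ≤ ℓ) (hm : m ≤ ℓ) (ha : a ∈ spaceLGUnit ℓ m) (Y : Fin ℓ → ℂ) :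
    smap ℓ m a (unitLG ℓ m a) Y = Y := by
  rw [unitLG_eq hℓ hm ha.1, map_smul, LinearMap.smul_apply, smap_xiVec_one hℓ hm ha.1, smul_smul]
  have := ha.2
  rw [show -(1 / 2) * (∑ j, a j)⁻¹ * (-2 * ∑ j, a j) = 1 by field_simp, one_smul]

/-! ### The residue formula for the intersection form -/

/-- At a critical point the derivative of Λ along S(a,Z) equals Λ·∂_ZΛ, because Λ is itself its
derivative along a. The difference of the two integrands is p V G(a,Z)/(2p^{2m}(p²-1)A(p²)) up to
sign, with no factor Λ' left below, so it has no residue at the critical points when Λ does not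
vanish there. -/
theorem gLG_smap (hℓ : 1 ≤ ℓ) (hm : m ≤ ℓ) (ha : a ∈ spaceLG ℓ m)
    (hc : ∀ q ∈ critPts ℓ m a, superpotential ℓ m a q ≠ 0) (h0 : m = ℓ → entry a 0 ≠ 0)
    (V Z : Fin ℓ → ℂ) : gLG ℓ m a V (smap ℓ m a a Z) = etaF ℓ m a V Z := by
  have hA : vp ℓ a ≠ 0 := by
    -- If A were zero then D would be zero, which does not happen on the space.
    intro h
    refine dPoly_ne_zero hℓ hm ha ?_
    rw [dPoly, bPoly, h, mul_zero, map_zero]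
  have hX1 : (X ^ 2 - 1 : ℂ[X]) ≠ 0 := (monic_X_pow_sub_C (1 : ℂ) two_ne_zero).ne_zero
  have hX1d : (X ^ 2 - 1 : ℂ[X]).natDegree = 2 := natDegree_X_pow_sub_C (r := (1 : ℂ))
  have hQ : (X ^ (2 * m) * ((X ^ 2 - 1) * expand ℂ 2 (vp ℓ a)) : ℂ[X]) ≠ 0 :=
    mul_ne_zero (pow_ne_zero _ X_ne_zero) (mul_ne_zero hX1 (expand_ne_zero hA))
  obtain ⟨ρ, hρ⟩ := exists_hasResSum_crit hℓ hm ha (C (1 / 2) * vp ℓ V * vp ℓ Z) (2 * m)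
  obtain ⟨σ, hσ⟩ := exists_hasResSum_rat
    (C (-1 / 2) * (X * expand ℂ 2 (vp ℓ V * vp ℓ (gmap ℓ m a a Z)))) hQ
  have hzero := critResidue_eq_zero (ℓ := ℓ) (m := m) (a := a) (f := fun p =>
    (C (-1 / 2) * (X * expand ℂ 2 (vp ℓ V * vp ℓ (gmap ℓ m a a Z)))).eval p /
      (X ^ (2 * m) * ((X ^ 2 - 1) * expand ℂ 2 (vp ℓ a)) : ℂ[X]).eval p) ?_ ?_
  · rw [← etaLG_eq hℓ hm ha, etaLG, gLG]
    have h1 := eventually_generic hℓ hm ha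
    have e1 : (fun p => p * (C (1 / 2) * vp ℓ V * vp ℓ Z).eval (p ^ 2) /
        (p ^ (2 * m) * (dPoly m a).eval (p ^ 2))) =ᶠ[Filter.cofinite] fun p =>
        dSuper ℓ m a V p * dSuper ℓ m a Z p / deriv (superpotential ℓ m a) p / (p ^ 2 - 1) ^ 2 := by
      filter_upwards [h1] with p hp
      obtain ⟨h0, h1, h2⟩ := hp
      rw [dSuper_eq, dSuper_eq, deriv_superpotential a h0]
      simp only [bPoly, eval_mul, eval_C, eval_sub, eval_X, eval_one]
      field_simp
      ring
    have h2 := critResidue_add hℓ hm ha (hρ.congr e1) hσ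
    rw [hzero, add_zero] at h2
    rw [← h2]
    refine (critResidue_congr ((hρ.congr e1).add hσ) ?_).symm
    filter_upwards [h1, eventually_eval_ne_zero (expand_ne_zero hA)] with p hp h3
    obtain ⟨h0, h1, h2⟩ := hp
    have hsg := congrArg (eval (p ^ 2)) (sg_spec hm ha a Z)
    rw [superpotential_eq, dSuper_eq, dSuper_eq, dSuper_eq, deriv_superpotential a h0]
    simp only [bPoly, eval_mul, eval_C, eval_sub, eval_X, eval_one, expand_eval, eval_pow,
      eval_add] at hsg h3 ⊢
    rw [← pow_mul] at hsg
    field_simp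
    linear_combination (-(vp ℓ V).eval (p ^ 2) * p * p ^ (2 * m)) * hsg
  · intro q hq
    have hq' := hc q hq
    rw [superpotential_eq, bPoly, eval_mul, eval_sub, eval_X, eval_one] at hq'
    apply hasRes_rat_zero
    simp only [eval_mul, eval_sub, eval_X, eval_one, expand_eval, eval_pow]
    refine mul_ne_zero ?_ fun h => hq' (by rw [h, zero_div])
    rcases ((mem_critPts a q).mp hq).1 with h | h
    · exact pow_ne_zero _ h
    · simp [h]
  -- For m = ℓ the correction must also be regular at infinity. Since a_1 ≠ 0, A has degree exactly
  -- ℓ-1 and the denominator has degree 4ℓ, against at most 4ℓ-3 above.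
  · intro hml
    have hAd : (vp ℓ a).natDegree = ℓ - 1 := by
      refine natDegree_eq_of_le_of_coeff_ne_zero (natDegree_vp_le a) ?_
      rw [coeff_vp, if_pos (by omega), Nat.sub_self]
      exact h0 hml
    apply hasResInfty_rat_zero _ hQ
    rw [natDegree_mul (pow_ne_zero _ X_ne_zero) (mul_ne_zero hX1 (expand_ne_zero hA)),
      natDegree_mul hX1 (expand_ne_zero hA), hX1d, natDegree_expand, hAd, natDegree_X_pow]
    refine (Nat.add_le_add_right ((natDegree_C_mul_le _ _).trans natDegree_mul_le) 2).trans ?_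
    rw [natDegree_X, natDegree_expand]
    have h1 := natDegree_mul_le (p := vp ℓ V) (q := vp ℓ (gmap ℓ m a a Z))
    have h2 := natDegree_vp_le V
    have h3 := natDegree_vp_le (gmap ℓ m a a Z)
    omega

end
end GenFrob
end

/-! ### Derivatives of the product along the space, and the Levi-Civita connection. -/

noncomputable section
namespace GenFrob
open Polynomial

section
variable {ℓ m : ℕ} {a : Fin ℓ → ℂ}

theorem continuous_entry {n : ℕ} (k : ℕ) : Continuous fun v : Fin n → ℂ => entry v k := by
  unfold entry
  split_ifs with h
  · exact continuous_apply _
  · exact continuous_const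

theorem isOpen_spaceLG (ℓ m : ℕ) : IsOpen (spaceLG ℓ m) := by
  have : spaceLG ℓ m = {a | m < ℓ → entry a 0 ≠ 0} ∩ {a | 0 < m → entry a (ℓ - 1) ≠ 0} := rfl
  rw [this]
  apply IsOpen.inter
  · by_cases h : m < ℓ
    · simp only [h, forall_const]
      exact isOpen_ne_fun (continuous_entry _) continuous_const
    · simp [h]
  · by_cases h : 0 < m
    · simp only [h, forall_const]
      exact isOpen_ne_fun (continuous_entry _) continuous_const
    · simp [h]

theorem differentiableAt_smap (hm : m ≤ ℓ) (ha : a ∈ spaceLG ℓ m) (V W : Fin ℓ → ℂ) :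
    DifferentiableAt ℂ (fun b => smap ℓ m b V W) a := by
  have := (differentiableAt_divSol hm ha (bPoly V * vp ℓ W)).fst
  unfold smap
  exact this

theorem differentiableAt_gmap (hm : m ≤ ℓ) (ha : a ∈ spaceLG ℓ m) (V W : Fin ℓ → ℂ) :
    DifferentiableAt ℂ (fun b => gmap ℓ m b V W) a := by
  have := (differentiableAt_divSol hm ha (bPoly V * vp ℓ W)).snd
  unfold gmap
  exact this

/-- The derivative of the product `S(V, W)` along `Z`. -/
def dsmap (ℓ m : ℕ) (a V W Z : Fin ℓ → ℂ) : Fin ℓ → ℂ := fderiv ℂ (fun b => smap ℓ m b V W) a Z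

/-- The derivative of the quotient `G(V, W)` along `Z`. -/
def dgmap (ℓ m : ℕ) (a V W Z : Fin ℓ → ℂ) : Fin ℓ → ℂ := fderiv ℂ (fun b => gmap ℓ m b V W) a Z

/-- Evaluation of `vp` at a point, as a continuous linear map. -/
def evCLM (ℓ : ℕ) (s : ℂ) : (Fin ℓ → ℂ) →L[ℂ] ℂ :=
  LinearMap.toContinuousLinearMap (Polynomial.leval s ∘ₗ vp ℓ)

/-- `a ↦ D(a)(s)` as a continuous linear map. -/
def evDCLM (ℓ m : ℕ) (s : ℂ) : (Fin ℓ → ℂ) →L[ℂ] ℂ :=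
  LinearMap.toContinuousLinearMap
    { toFun := fun a => (dPoly m a).eval s
      map_add' := fun a b => by simp [dPoly, bPoly_add]
      map_smul' := fun c a => by simp [dPoly, bPoly_smul] }

theorem evCLM_apply (s : ℂ) (v : Fin ℓ → ℂ) : evCLM ℓ s v = (vp ℓ v).eval s := rfl

theorem evDCLM_apply (s : ℂ) (v : Fin ℓ → ℂ) : evDCLM ℓ m s v = (dPoly m v).eval s := rfl

/-- The decomposition of the fixed polynomial (u-1)VW is differentiated in a along Z; D is linear in
a, so its derivative is D evaluated at Z. -/
theorem dsmap_dgmap (hm : m ≤ ℓ) (ha : a ∈ spaceLG ℓ m) (V W Z : Fin ℓ → ℂ) :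
    X ^ m * vp ℓ (dsmap ℓ m a V W Z) + vp ℓ (dgmap ℓ m a V W Z) * dPoly m a +
      vp ℓ (gmap ℓ m a V W) * dPoly m Z = 0 := by
  refine Polynomial.funext fun s => ?_
  have h1 := ((evCLM ℓ s).hasFDerivAt.comp a (differentiableAt_smap hm ha V W).hasFDerivAt).const_mul
    (s ^ m)
  have h2 := ((evCLM ℓ s).hasFDerivAt.comp a (differentiableAt_gmap hm ha V W).hasFDerivAt).mul
    (evDCLM ℓ m s).hasFDerivAt
  have h3 := h1.add h2
  have h4 := h3.congr_of_eventuallyEq (f₁ := fun _ => (bPoly V * vp ℓ W).eval s) (by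
    filter_upwards [(isOpen_spaceLG ℓ m).mem_nhds ha] with b hb
    have := congrArg (eval s) (sg_spec hm hb V W)
    simp only [eval_add, eval_mul, eval_pow, eval_X] at this
    simp only [Function.comp, evCLM_apply, evDCLM_apply, Pi.add_apply, Pi.mul_apply]
    rw [this, eval_mul])
  have h5 := h4.unique (hasFDerivAt_const _ _)
  have h6 := congrArg (fun L : (Fin ℓ → ℂ) →L[ℂ] ℂ => L Z) h5
  simp only [add_apply, smul_apply,
    ContinuousLinearMap.comp_apply, Function.comp_apply, evCLM_apply, evDCLM_apply, smul_eq_mul,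
    zero_apply] at h6
  simp only [eval_add, eval_mul, eval_pow, eval_X, eval_zero, dsmap, dgmap]
  linear_combination h6

/-- The operator `V ↦ -(V/2 + u V' - m V)`. -/
def lop (ℓ m : ℕ) : (Fin ℓ → ℂ) →ₗ[ℂ] (Fin ℓ → ℂ) where
  toFun V j := -(1 / 2 - m + (ℓ - 1 - (j : ℕ) : ℕ)) * V j
  map_add' V W := by ext j; simp only [Pi.add_apply]; ring
  map_smul' c V := by ext j; simp only [Pi.smul_apply, smul_eq_mul, RingHom.id_apply]; ring

theorem lop_apply (V : Fin ℓ → ℂ) (j : Fin ℓ) :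
    lop ℓ m V j = -(1 / 2 - m + (ℓ - 1 - (j : ℕ) : ℕ)) * V j := rfl

theorem vp_lop (V : Fin ℓ → ℂ) :
    vp ℓ (lop ℓ m V) = -(C (1 / 2) * vp ℓ V + mop m (vp ℓ V)) := by
  ext k
  rw [coeff_neg, coeff_add, coeff_C_mul, coeff_mop, coeff_vp, coeff_vp]
  split_ifs with h
  · simp only [entry, show ℓ - 1 - k < ℓ by omega, dite_true, lop_apply,
      show ℓ - 1 - (ℓ - 1 - k) = k by omega]
    ring
  · simp

/-- The Christoffel symbols of the metric `η`. -/
def gam (ℓ m : ℕ) (a : Fin ℓ → ℂ) (V W : Fin ℓ → ℂ) : Fin ℓ → ℂ := lop ℓ m (gmap ℓ m a V W)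

theorem gam_comm (V W : Fin ℓ → ℂ) : gam ℓ m a V W = gam ℓ m a W V := by
  rw [gam, gmap_comm, gam]

/-- The symmetry of the covariant derivative of the product. -/
theorem nabla_smap_symm (hm : m ≤ ℓ) (ha : a ∈ spaceLG ℓ m) (W V Y : Fin ℓ → ℂ) :
    dsmap ℓ m a V Y W + gam ℓ m a W (smap ℓ m a V Y) - smap ℓ m a V (gam ℓ m a W Y) =
      dsmap ℓ m a W Y V + gam ℓ m a V (smap ℓ m a W Y) - smap ℓ m a W (gam ℓ m a V Y) := by
  have e1 := dsmap_dgmap hm ha V Y W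
  have e2 := dsmap_dgmap hm ha W Y V
  have s1 := sg_spec hm ha V (gam ℓ m a W Y)
  have s2 := sg_spec hm ha W (gam ℓ m a V Y)
  -- Both sides are quotients for the same triple product.
  have hH : hPoly m a V Y W = hPoly m a W Y V :=
    (sh_eq hm ha V Y W W Y V (by simp only [bPoly]; ring)).2
  simp only [hPoly] at hH
  rw [gmap_comm _ W, gmap_comm _ V] at hH
  -- The operator u d/du - m takes (u-1)W to D(W), which is precisely the derivative of D along W in
  -- e1; this is what makes the derivatives of the product match the Christoffel terms.
  have hM := congrArg (mop m) hH
  simp only [map_add, mop_X_pow, mop_mul, mul_zero, add_zero] at hM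
  -- The defect of symmetry times u^m is exhibited as a multiple of D, so it vanishes by uniqueness.
  have key := eq_zero_of_X_pow_mul_eq hm ha 1
    (n := vp ℓ (dsmap ℓ m a V Y W + gam ℓ m a W (smap ℓ m a V Y) - smap ℓ m a V (gam ℓ m a W Y) -
      (dsmap ℓ m a W Y V + gam ℓ m a V (smap ℓ m a W Y) - smap ℓ m a W (gam ℓ m a V Y))))
    (q := vp ℓ (-dgmap ℓ m a V Y W + dgmap ℓ m a W Y V + gmap ℓ m a V (gam ℓ m a W Y) -
      gmap ℓ m a W (gam ℓ m a V Y))) (degree_vp_lt _) (by rw [one_mul]; exact degree_vp_lt _) ?_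
  · exact sub_eq_zero.mp (vp_injective ℓ (by rw [key.1, map_zero]))
  · simp only [map_add, map_sub, map_neg, gam, vp_lop, one_mul, dPoly] at *
    linear_combination e1 - e2 - s1 + s2 - hM + (C (m : ℂ) - C (1 / 2)) * hH

/-! ### Homogeneity -/

/-- Along the Euler field D is homogeneous of degree 1 and (u-1)VW is constant, so S has degree 0
and G has degree -1. -/
theorem dsmap_self (hm : m ≤ ℓ) (ha : a ∈ spaceLG ℓ m) (V W : Fin ℓ → ℂ) :
    dsmap ℓ m a V W a = 0 ∧ dgmap ℓ m a V W a = -gmap ℓ m a V W := by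
  have e := dsmap_dgmap hm ha V W a
  have := eq_zero_of_X_pow_mul_eq hm ha 1 (n := vp ℓ (dsmap ℓ m a V W a))
    (q := vp ℓ (-dgmap ℓ m a V W a - gmap ℓ m a V W)) (degree_vp_lt _)
    (by rw [one_mul]; exact degree_vp_lt _)
    (by rw [map_sub, map_neg, one_mul]; linear_combination e)
  constructor
  · exact vp_injective ℓ (by rw [this.1, map_zero])
  · have h2 : -dgmap ℓ m a V W a - gmap ℓ m a V W = 0 := vp_injective ℓ (by rw [this.2, map_zero])
    have h3 := sub_eq_zero.mp h2
    rw [← h3, neg_neg]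

end
end GenFrob
end

noncomputable section
namespace GenFrob
open PowerSeries

/-! ### Power series identities for flat coordinates -/

/-- The series `ψ - 2 u ψ'`. -/
def kap (ψ : ℂ⟦X⟧) : ℂ⟦X⟧ := ψ - 2 * X * derivative ℂ ψ

theorem constantCoeff_kap (ψ : ℂ⟦X⟧) : constantCoeff (kap ψ) = constantCoeff ψ := by
  simp [kap]

theorem coeff_X_mul_derivative (f : ℂ⟦X⟧) (e : ℕ) : coeff e (X * derivative ℂ f) = e * coeff e f := by
  cases e with
  | zero => simp
  | succ e => rw [coeff_succ_X_mul, coeff_derivative]; push_cast; ring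

/-- Up to the factor -(e+1), the form (ψ - 2uψ')ψ^{2e+1} u^{-e-2} du is the differential of
(ψ²/u)^{e+1}, so its residue is zero. -/
theorem coeff_kap_mul_pow (ψ : ℂ⟦X⟧) (e : ℕ) : coeff (e + 1) (kap ψ * ψ ^ (2 * e + 1)) = 0 := by
  have h : ((e + 1 : ℕ) : ℂ⟦X⟧) * (kap ψ * ψ ^ (2 * e + 1)) =
      ((e + 1 : ℕ) : ℂ⟦X⟧) * ψ ^ (2 * (e + 1)) - X * derivative ℂ (ψ ^ (2 * (e + 1))) := by
    rw [derivative_pow, kap, show 2 * (e + 1) - 1 = 2 * e + 1 by omega]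
    push_cast
    ring
  have h2 := congrArg (coeff (e + 1)) h
  rw [map_sub, coeff_X_mul_derivative] at h2
  have hc : ∀ f : ℂ⟦X⟧, coeff (e + 1) (((e + 1 : ℕ) : ℂ⟦X⟧) * f) = ((e + 1 : ℕ) : ℂ) * coeff (e + 1) f := by
    intro f
    rw [← coeff_C_mul]
    simp
  rw [hc, hc, sub_self] at h2
  exact (mul_eq_zero.mp h2).resolve_left (by exact_mod_cast e.succ_ne_zero)

section
variable {ψ χ κi : ℂ⟦X⟧} {m : ℕ}

/-- The basis dual to the differentials of the flat coordinates. -/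
def tBasis (m : ℕ) (ψ χ : ℂ⟦X⟧) (c : ℕ) : ℂ⟦X⟧ := X ^ c * (χ ^ (2 * c) * kap ψ * ψ ^ (2 * m - 2))

/-- All powers of ψ collapse to (ψ - 2uψ')ψ^{2(b-c)-1}. For b > c its coefficient is the residue of
an exact form, for b = c the constant term is 1, and for b < c the factor u^c kills it. -/
theorem coeff_tBasis (hχ : ψ * χ = 1) {b c : ℕ} (hb : b < m) (hc : c < m) :
    coeff b (χ ^ (2 * (m - 1 - b) + 1) * tBasis m ψ χ c) = if b = c then 1 else 0 := by
  obtain ⟨i, rfl⟩ : ∃ i, m = b + i + 1 := ⟨m - 1 - b, by omega⟩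
  rw [tBasis, show b + i + 1 - 1 - b = i by omega, mul_left_comm, coeff_X_pow_mul',
    show 2 * (b + i + 1) - 2 = 2 * b + 2 * i by omega]
  have hpow : ∀ k, ψ ^ k * χ ^ k = 1 := fun k => by rw [← mul_pow, hχ, one_pow]
  split_ifs with h1 h2 h2
  · subst h2
    have : χ ^ (2 * i + 1) * (χ ^ (2 * b) * kap ψ * ψ ^ (2 * b + 2 * i)) = kap ψ * χ := by
      calc _ = kap ψ * χ * (ψ ^ (2 * b + 2 * i) * χ ^ (2 * b + 2 * i)) := by ring
        _ = _ := by rw [hpow, mul_one]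
    rw [this, Nat.sub_self, coeff_zero_eq_constantCoeff_apply, map_mul, constantCoeff_kap, ← map_mul,
      hχ, map_one]
  · obtain ⟨e, rfl⟩ : ∃ e, b = c + (e + 1) := ⟨b - c - 1, by omega⟩
    have : χ ^ (2 * i + 1) * (χ ^ (2 * c) * kap ψ * ψ ^ (2 * (c + (e + 1)) + 2 * i)) =
        kap ψ * ψ ^ (2 * e + 1) := by
      calc _ = kap ψ * ψ ^ (2 * e + 1) * (ψ ^ (2 * c + 2 * i + 1) * χ ^ (2 * c + 2 * i + 1)) := by ring
        _ = _ := by rw [hpow, mul_one]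
    rw [this, Nat.add_sub_cancel_left, coeff_kap_mul_pow]
  · omega
  · rfl

/-- Each basis series is u^c times an invertible series, so the coefficients are eliminated in
increasing order. -/
theorem exists_tBasis_expansion (hχ : ψ * χ = 1) (m : ℕ) (Y : ℂ⟦X⟧) (k : ℕ) :
    ∃ (y : ℕ → ℂ) (R : ℂ⟦X⟧), Y = ∑ c ∈ Finset.range k, C (y c) * tBasis m ψ χ c + X ^ k * R := by
  have h0 : constantCoeff ψ * constantCoeff χ = 1 := by rw [← map_mul, hχ, map_one]
  have h1 : constantCoeff ψ ≠ 0 := left_ne_zero_of_mul_eq_one h0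
  have h2 : constantCoeff χ ≠ 0 := right_ne_zero_of_mul_eq_one h0
  induction k with
  | zero => exact ⟨0, Y, by simp⟩
  | succ k ih =>
    obtain ⟨y, R, hY⟩ := ih
    set U : ℂ⟦X⟧ := χ ^ (2 * k) * kap ψ * ψ ^ (2 * m - 2) with hU
    have hUc : constantCoeff U ≠ 0 := by
      simp only [hU, map_mul, map_pow, constantCoeff_kap]
      exact mul_ne_zero (mul_ne_zero (pow_ne_zero _ h2) h1) (pow_ne_zero _ h1)
    set r := constantCoeff R / constantCoeff U with hr
    obtain ⟨R', hR'⟩ : (X : ℂ⟦X⟧) ∣ R - C r * U := by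
      rw [X_dvd_iff, map_sub, map_mul, constantCoeff_C, hr, div_mul_cancel₀ _ hUc, sub_self]
    refine ⟨Function.update y k r, R', ?_⟩
    rw [Finset.sum_range_succ, Function.update_self, Finset.sum_congr rfl fun c hc => by
      rw [Function.update_of_ne (Finset.mem_range.mp hc).ne]]
    rw [tBasis, ← hU]
    nth_rewrite 1 [hY]
    rw [pow_succ]
    linear_combination X ^ k * hR'

theorem coeff_mul_X_pow_of_lt {b k : ℕ} (h : b < k) (f g : ℂ⟦X⟧) : coeff b (f * (X ^ k * g)) = 0 := by
  rw [mul_left_comm, coeff_X_pow_mul', if_neg (by omega)]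

/-- The residue pairing in the flat coordinates. -/
theorem coeff_pairing (hχ : ψ * χ = 1) (hκ : kap ψ * κi = 1) (hm : 1 ≤ m) (Y Z : ℂ⟦X⟧) :
    coeff (m - 1) (χ ^ (2 * m - 1) * κi * Y * Z) = ∑ b ∈ Finset.range m,
      coeff b (χ ^ (2 * (m - 1 - b) + 1) * Y) * coeff (m - 1 - b) (χ ^ (2 * b + 1) * Z) := by
  obtain ⟨y, R, hY⟩ := exists_tBasis_expansion hχ m Y m
  have hy : ∀ b ∈ Finset.range m, coeff b (χ ^ (2 * (m - 1 - b) + 1) * Y) = y b := by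
    intro b hb
    have hb' := Finset.mem_range.mp hb
    rw [hY, mul_add, map_add, coeff_mul_X_pow_of_lt hb', add_zero, Finset.mul_sum, map_sum,
      Finset.sum_eq_single b]
    · rw [mul_left_comm, coeff_C_mul, coeff_tBasis hχ hb' hb', if_pos rfl, mul_one]
    · intro c hc hcb
      rw [mul_left_comm, coeff_C_mul, coeff_tBasis hχ hb' (Finset.mem_range.mp hc),
        if_neg (Ne.symm hcb), mul_zero]
    · exact fun h => absurd hb h
  rw [Finset.sum_congr rfl fun b hb => by rw [hy b hb]]
  nth_rewrite 1 [hY]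
  have e : χ ^ (2 * m - 1) * κi * (∑ c ∈ Finset.range m, C (y c) * tBasis m ψ χ c + X ^ m * R) * Z =
      ∑ c ∈ Finset.range m, C (y c) * (X ^ c * (χ ^ (2 * c + 1) * Z)) +
        (χ ^ (2 * m - 1) * κi * Z) * (X ^ m * R) := by
    rw [mul_add, add_mul, Finset.mul_sum, Finset.sum_mul]
    congr 1
    · refine Finset.sum_congr rfl fun c _ => ?_
      have hp : ψ ^ (2 * m - 2) * χ ^ (2 * m - 2) = 1 := by rw [← mul_pow, hχ, one_pow]
      rw [tBasis, show 2 * m - 1 = (2 * m - 2) + 1 by omega]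
      calc _ = C (y c) * (X ^ c * (χ ^ (2 * c + 1) * Z)) * (ψ ^ (2 * m - 2) * χ ^ (2 * m - 2)) *
            (kap ψ * κi) := by ring
        _ = _ := by rw [hp, hκ, mul_one, mul_one]
    · ring
  rw [e, map_add, coeff_mul_X_pow_of_lt (by omega), add_zero, map_sum]
  refine Finset.sum_congr rfl fun c hc => ?_
  have := Finset.mem_range.mp hc
  rw [coeff_C_mul, coeff_X_pow_mul', if_pos (by omega)]

theorem derivative_inv_of_mul_eq_one (hχ : ψ * χ = 1) :
    derivative ℂ χ = -(χ ^ 2 * derivative ℂ ψ) := by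
  have h := congrArg (derivative ℂ) hχ
  rw [Derivation.leibniz, derivative_one, smul_eq_mul, smul_eq_mul] at h
  linear_combination χ * h - derivative ℂ χ * hχ

/-- The second derivatives of the flat coordinates. -/
theorem coeff_hessian (hχ : ψ * χ = 1) {j : ℕ} (hj : j < m) (g : ℂ⟦X⟧) :
    coeff j (χ ^ (2 * (m - 1 - j) + 1) * (C (1 / 2) * g + (X * derivative ℂ g - C (m : ℂ) * g))) =
      -(2 * (m - 1 - j : ℕ) + 1) / 2 * coeff j (χ ^ (2 * (m - 1 - j) + 2) * (kap ψ * g)) := by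
  obtain ⟨i, rfl⟩ : ∃ i, m = j + i + 1 := ⟨m - 1 - j, by omega⟩
  rw [show j + i + 1 - 1 - j = i by omega]
  -- Taking [u^j] of u d/du(χ^{2i+1}g) in two ways trades the derivative of g for that of χ, and the
  -- latter assembles into ψ - 2uψ'.
  have h1 := coeff_X_mul_derivative (χ ^ (2 * i + 1) * g) j
  rw [Derivation.leibniz, derivative_pow, derivative_inv_of_mul_eq_one hχ, smul_eq_mul,
    smul_eq_mul, Nat.add_sub_cancel] at h1
  rw [← coeff_C_mul] at h1 ⊢
  have h2 : C (j : ℂ) = (j : ℂ⟦X⟧) := by simp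
  have h3 : C ((j + i + 1 : ℕ) : ℂ) = (j + i + 1 : ℂ⟦X⟧) := by simp
  have h4 : C (-(2 * (i : ℂ) + 1) / 2) = -(2 * i + 1) * C (1 / 2 : ℂ) := by
    rw [div_eq_mul_one_div, map_mul, map_neg, map_add, map_mul, map_natCast, map_one, map_ofNat]
  have h5 : (2 : ℂ⟦X⟧) * C (1 / 2 : ℂ) = 1 := by
    rw [← map_ofNat (C (R := ℂ)) 2, ← map_mul]; norm_num
  rw [← sub_eq_zero, ← map_sub] at h1 ⊢
  rw [← h1]
  congr 1
  rw [h2, h3, h4, kap]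
  push_cast
  linear_combination (2 * i + 1) * C (1 / 2 : ℂ) * χ ^ (2 * i + 1) * g * hχ +
    ((i + 1) * χ ^ (2 * i + 1) * g -
      (2 * i + 1) * χ ^ (2 * i + 2) * X * derivative ℂ ψ * g) * h5

end

/-! ### Families of power series -/

/-- The coefficients of `f` are differentiable at `a`, with derivatives given by `f'`. -/
def HasPSDeriv {E : Type*} [NormedAddCommGroup E] [NormedSpace ℂ E] (f : E → ℂ⟦X⟧) (f' : E → ℂ⟦X⟧)
    (a : E) : Prop :=
  ∀ k, ∃ L : E →L[ℂ] ℂ, HasFDerivAt (fun b => coeff k (f b)) L a ∧ ∀ Z, L Z = coeff k (f' Z)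

section
variable {E : Type*} [NormedAddCommGroup E] [NormedSpace ℂ E] {f g f' g' : E → ℂ⟦X⟧} {a : E}

theorem HasPSDeriv.mul (hf : HasPSDeriv f f' a) (hg : HasPSDeriv g g' a) :
    HasPSDeriv (fun b => f b * g b) (fun Z => f a * g' Z + f' Z * g a) a := by
  intro k
  choose L hL hL' using hf
  choose M hM hM' using hg
  refine ⟨∑ p ∈ Finset.HasAntidiagonal.antidiagonal k, (coeff p.1 (f a) • M p.2 + coeff p.2 (g a) • L p.1), ?_, ?_⟩
  · simp only [coeff_mul]
    exact HasFDerivAt.fun_sum fun p _ => (hL p.1).mul (hM p.2)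
  · intro Z
    rw [map_add, coeff_mul, coeff_mul, ← Finset.sum_add_distrib, sum_apply]
    refine Finset.sum_congr rfl fun p _ => ?_
    simp only [add_apply, smul_apply, hL', hM', smul_eq_mul]
    ring

theorem HasPSDeriv.unique (hf : HasPSDeriv f f' a) (hf' : HasPSDeriv f g' a) : f' = g' := by
  ext Z k
  obtain ⟨L, hL, hL'⟩ := hf k
  obtain ⟨M, hM, hM'⟩ := hf' k
  rw [← hL', ← hM', hL.unique hM]

theorem hasPSDeriv_const (c : ℂ⟦X⟧) : HasPSDeriv (fun _ : E => c) 0 a :=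
  fun k => ⟨0, hasFDerivAt_const _ _, by simp⟩

theorem HasPSDeriv.pow (hf : HasPSDeriv f f' a) (n : ℕ) :
    HasPSDeriv (fun b => f b ^ n) (fun Z => n * f a ^ (n - 1) * f' Z) a := by
  induction n with
  | zero =>
    convert hasPSDeriv_const (1 : ℂ⟦X⟧) using 1
    · simp
    · ext Z k; simp
  | succ n ih =>
    convert ih.mul hf using 1
    ext Z k
    congr 1
    push_cast
    cases n with
    | zero => simp
    | succ n => simp only [Nat.add_sub_cancel, Nat.cast_add, Nat.cast_one]; ring_nf

theorem hasPSDeriv_of_differentiableAt (h : ∀ k, DifferentiableAt ℂ (fun b => coeff k (f b)) a) :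
    HasPSDeriv f (fun Z => mk fun k => fderiv ℂ (fun b => coeff k (f b)) a Z) a :=
  fun k => ⟨_, (h k).hasFDerivAt, by simp⟩

theorem HasPSDeriv.congr (hf : HasPSDeriv f f' a) (h : f =ᶠ[𝓝 a] g) : HasPSDeriv g f' a := by
  intro k
  obtain ⟨L, hL, hL'⟩ := hf k
  exact ⟨L, hL.congr_of_eventuallyEq (h.symm.fun_comp (coeff k)), hL'⟩

theorem HasPSDeriv.hasFDerivAt (hf : HasPSDeriv f f' a) (k : ℕ) (Z : E) :
    fderiv ℂ (fun b => coeff k (f b)) a Z = coeff k (f' Z) := by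
  obtain ⟨L, hL, hL'⟩ := hf k
  rw [hL.fderiv, hL']

theorem HasPSDeriv.differentiableAt (hf : HasPSDeriv f f' a) (k : ℕ) :
    DifferentiableAt ℂ (fun b => coeff k (f b)) a := by
  obtain ⟨L, hL, -⟩ := hf k
  exact hL.differentiableAt

/-- The inverse of a differentiable family of power series. -/
theorem HasPSDeriv.inv (hf : HasPSDeriv f f' a) (hU : ∀ᶠ b in 𝓝 a, f b * g b = 1) :
    HasPSDeriv g (fun Z => -(g a ^ 2 * f' Z)) a := by
  have hd : ∀ k, DifferentiableAt ℂ (fun b => coeff k (g b)) a := by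
    intro k
    induction k using Nat.strong_induction_on with
    | _ k ih =>
      have hc : constantCoeff (f a) ≠ 0 := by
        have := congrArg constantCoeff hU.self_of_nhds
        rw [map_mul, map_one] at this
        exact left_ne_zero_of_mul_eq_one this
      -- The recursion for the coefficients of an inverse series expresses each through earlier
      -- ones, hence differentiability by strong induction.
      have he : (fun b => coeff k (g b)) =ᶠ[𝓝 a] fun b => if k = 0 then (coeff 0 (f b))⁻¹ else
          -(coeff 0 (f b))⁻¹ * ∑ x ∈ Finset.HasAntidiagonal.antidiagonal k,
            if x.2 < k then coeff x.1 (f b) * coeff x.2 (g b) else 0 := by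
        filter_upwards [hU] with b hb
        have hcb : constantCoeff (f b) ≠ 0 := by
          have := congrArg constantCoeff hb
          rw [map_mul, map_one] at this
          exact left_ne_zero_of_mul_eq_one this
        have hg : g b = (f b)⁻¹ := by
          rw [eq_inv_iff_mul_eq_one hcb, mul_comm, hb]
        rw [hg, coeff_inv, coeff_zero_eq_constantCoeff_apply]
      refine DifferentiableAt.congr_of_eventuallyEq ?_ he
      have h0 : DifferentiableAt ℂ (fun b => (coeff 0 (f b))⁻¹) a :=
        (hf.differentiableAt 0).fun_inv (by rwa [coeff_zero_eq_constantCoeff_apply])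
      split_ifs
      · exact h0
      · refine h0.fun_neg.fun_mul (DifferentiableAt.fun_sum fun x _ => ?_)
        split_ifs with hx
        · exact (hf.differentiableAt _).fun_mul (ih _ hx)
        · exact differentiableAt_const _
  have hg := hasPSDeriv_of_differentiableAt hd
  have h1 := (hf.mul hg).congr (g := fun _ => 1) hU
  have h2 := h1.unique (hasPSDeriv_const 1)
  convert hg using 2 with Z
  have h3 := congrFun h2 Z
  have h4 := hU.self_of_nhds
  simp only [Pi.zero_apply] at h3
  linear_combination (mk fun k => fderiv ℂ (fun b => coeff k (g b)) a Z) * h4 - g a * h3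

/-- The root of a differentiable family of power series. -/
theorem HasPSDeriv.root {n : ℕ} (hn : 1 ≤ n) (hB : HasPSDeriv g g' a)
    (hU : ∀ᶠ b in 𝓝 a, f b ^ n = g b) (h0 : DifferentiableAt ℂ (fun b => coeff 0 (f b)) a)
    (hc : coeff 0 (f a) ≠ 0) :
    ∃ f', HasPSDeriv f f' a ∧ ∀ Z, n * f a ^ (n - 1) * f' Z = g' Z := by
  have hd : ∀ k, DifferentiableAt ℂ (fun b => coeff k (f b)) a := by
    intro k
    induction k using Nat.strong_induction_on with
    | _ k ih =>
      rcases Nat.eq_zero_or_pos k with rfl | hk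
      · exact h0
      -- the part of lower order
      set T : E → ℂ⟦X⟧ := fun b => mk fun i => if i < k then coeff i (f b) else 0 with hT
      have hTd : ∀ i, DifferentiableAt ℂ (fun b => coeff i (T b)) a := by
        intro i
        simp only [hT, coeff_mk]
        split_ifs with hi
        · exact ih i hi
        · exact differentiableAt_const _
      have hTn := (hasPSDeriv_of_differentiableAt hTd).pow n
      -- The k-th coefficient of f enters that of f^n only linearly, with factor n f_0^{n-1} ≠ 0,
      -- and can be solved for in terms of earlier coefficients.
      have key : ∀ b, coeff k (f b ^ n) =
          coeff k (T b ^ n) + n * coeff 0 (f b) ^ (n - 1) * coeff k (f b) := by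
        intro b
        have h1 : f b = T b + X ^ k * mk fun i => coeff (i + k) (f b) := by
          ext i
          rw [map_add, coeff_X_pow_mul']
          simp only [hT, coeff_mk]
          split_ifs with h1 h2 h2
          · omega
          · rw [add_zero]
          · rw [zero_add, Nat.sub_add_cancel h2]
          · omega
        have h2 : constantCoeff (T b) = coeff 0 (f b) := by
          rw [← coeff_zero_eq_constantCoeff_apply]
          simp only [hT, coeff_mk, hk, if_true]
        obtain ⟨r, hr⟩ := Polynomial.powAddExpansion (T b) (X ^ k * mk fun i => coeff (i + k) (f b)) n
        rw [← h1] at hr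
        have e1 : (n : ℂ⟦X⟧) * T b ^ (n - 1) * (X ^ k * mk fun i => coeff (i + k) (f b)) =
          X ^ k * (C (n : ℂ) * T b ^ (n - 1) * mk fun i => coeff (i + k) (f b)) := by
          simp only [map_natCast]; ring
        have e2 : r * (X ^ k * mk fun i => coeff (i + k) (f b)) ^ 2 =
          X ^ k * (X ^ k * (r * (mk fun i => coeff (i + k) (f b)) ^ 2)) := by ring
        have e3 : coeff 0 (C (n : ℂ) * T b ^ (n - 1) * mk fun i => coeff (i + k) (f b)) =
            n * coeff 0 (f b) ^ (n - 1) * coeff k (f b) := by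
          rw [← h2, coeff_zero_eq_constantCoeff_apply, map_mul, map_mul, map_pow, constantCoeff_C,
            ← coeff_zero_eq_constantCoeff_apply (mk fun i => coeff (i + k) (f b)), coeff_mk,
            zero_add]
        rw [hr, e1, e2, map_add, map_add, coeff_X_pow_mul', coeff_X_pow_mul', if_pos le_rfl,
          if_pos le_rfl, Nat.sub_self, e3, coeff_X_pow_mul', if_neg (by omega), add_zero]
      have hne : ∀ᶠ b in 𝓝 a, coeff 0 (f b) ≠ 0 := h0.continuousAt.eventually_ne hc
      have hn0 : (n : ℂ) ≠ 0 := by exact_mod_cast (by omega : n ≠ 0)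
      have he : (fun b => coeff k (f b)) =ᶠ[𝓝 a] fun b =>
          (coeff k (g b) - coeff k (T b ^ n)) * (n * coeff 0 (f b) ^ (n - 1))⁻¹ := by
        filter_upwards [hU, hne] with b hb hb'
        rw [← hb, key]
        have : coeff 0 (f b) ^ (n - 1) ≠ 0 := pow_ne_zero _ hb'
        field_simp
        ring
      refine DifferentiableAt.congr_of_eventuallyEq ?_ he
      refine ((hB.differentiableAt k).fun_sub (hTn.differentiableAt k)).fun_mul ?_
      exact ((h0.fun_pow _).const_mul _).fun_inv (mul_ne_zero hn0 (pow_ne_zero _ hc))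
  have hf := hasPSDeriv_of_differentiableAt hd
  refine ⟨_, hf, fun Z => ?_⟩
  exact congrFun (((hf.pow n).congr hU).unique hB) Z

end

/-- A continuous branch of a root agrees locally with a local inverse of z ↦ z^n, so it is
holomorphic. -/
theorem differentiableAt_of_pow {E : Type*} [NormedAddCommGroup E] [NormedSpace ℂ E] {r g : E → ℂ}
    {a : E} {n : ℕ} (hn : 1 ≤ n) (hr : ContinuousAt r a) (hg : DifferentiableAt ℂ g a)
    (hU : ∀ᶠ b in 𝓝 a, r b ^ n = g b) (h0 : r a ≠ 0) : DifferentiableAt ℂ r a := by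
  have hd : HasStrictDerivAt (fun z : ℂ => z ^ n) (n * r a ^ (n - 1)) (r a) := by
    simpa using hasStrictDerivAt_pow n (r a)
  have hne : (n : ℂ) * r a ^ (n - 1) ≠ 0 :=
    mul_ne_zero (by exact_mod_cast (by omega : n ≠ 0)) (pow_ne_zero _ h0)
  have h1 := hd.eventually_left_inverse hne
  have h2 : DifferentiableAt ℂ (hd.localInverse _ _ _ hne) (g a) := by
    rw [← hU.self_of_nhds]
    exact (hd.to_localInverse hne).hasDerivAt.differentiableAt
  refine (h2.comp a hg).congr_of_eventuallyEq ?_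
  filter_upwards [hU, hr.eventually h1] with b hb hb'
  rw [Function.comp_apply, ← hb, hb']

end GenFrob
end

noncomputable section
namespace GenFrob
open PowerSeries

/-! ### Taylor series at the origin -/

/-- The Taylor series of `f` at `0`. -/
def tay (f : ℂ → ℂ) : ℂ⟦X⟧ := mk fun k => iteratedDeriv k f 0 / (k.factorial : ℂ)

theorem coeff_tay (f : ℂ → ℂ) (k : ℕ) :
    coeff k (tay f) = iteratedDeriv k f 0 / (k.factorial : ℂ) := coeff_mk _ _

theorem coeff_zero_tay (f : ℂ → ℂ) : coeff 0 (tay f) = f 0 := by simp [coeff_tay]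

theorem tay_congr {f g : ℂ → ℂ} (h : f =ᶠ[𝓝 0] g) : tay f = tay g := by
  ext k
  rw [coeff_tay, coeff_tay, h.iteratedDeriv_eq]

theorem tay_mul {f g : ℂ → ℂ} (hf : AnalyticAt ℂ f 0) (hg : AnalyticAt ℂ g 0) :
    tay (fun z => f z * g z) = tay f * tay g := by
  ext k
  have h := iteratedDerivWithin_mul (n := k) (Set.mem_univ (0 : ℂ)) uniqueDiffOn_univ
    hf.contDiffAt.contDiffWithinAt hg.contDiffAt.contDiffWithinAt
  simp only [iteratedDerivWithin_univ] at h
  rw [coeff_tay, show (fun z => f z * g z) = f * g from rfl, h, coeff_mul,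
    Finset.Nat.sum_antidiagonal_eq_sum_range_succ
      (fun i j => coeff i (tay f) * coeff j (tay g)), Finset.sum_div]
  refine Finset.sum_congr rfl fun i hi => ?_
  have hik : i ≤ k := by have := Finset.mem_range.mp hi; omega
  rw [coeff_tay, coeff_tay, Nat.choose_eq_factorial_div_factorial hik,
    Nat.cast_div (Nat.factorial_mul_factorial_dvd_factorial hik)
      (by exact_mod_cast mul_ne_zero i.factorial_ne_zero (k - i).factorial_ne_zero)]
  have h1 : (k.factorial : ℂ) ≠ 0 := by exact_mod_cast k.factorial_ne_zero
  push_cast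
  field_simp

theorem tay_const (c : ℂ) : tay (fun _ => c) = C c := by
  ext k
  rw [coeff_tay, iteratedDeriv_const, coeff_C]
  split_ifs with h
  · simp [h]
  · simp

theorem tay_pow {f : ℂ → ℂ} (hf : AnalyticAt ℂ f 0) (n : ℕ) :
    tay (fun z => f z ^ n) = tay f ^ n := by
  induction n with
  | zero => simpa using tay_const 1
  | succ n ih =>
    rw [pow_succ, ← ih, ← tay_mul (hf.fun_pow n) hf]
    simp only [pow_succ]

theorem iteratedDeriv_polynomial (P : Polynomial ℂ) (k : ℕ) :
    iteratedDeriv k (fun z => P.eval z) = fun z => (Polynomial.derivative^[k] P).eval z := by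
  induction k generalizing P with
  | zero => simp
  | succ k ih =>
    rw [iteratedDeriv_succ', Function.iterate_succ_apply, ← ih]
    congr 1
    ext z
    exact P.deriv

theorem tay_polynomial (P : Polynomial ℂ) : tay (fun z => P.eval z) = (P : ℂ⟦X⟧) := by
  ext k
  rw [coeff_tay, iteratedDeriv_polynomial]
  beta_reduce
  rw [← Polynomial.coeff_zero_eq_eval_zero,
    Polynomial.coeff_iterate_derivative, zero_add, Nat.descFactorial_self, Polynomial.coeff_coe,
    nsmul_eq_mul, mul_div_cancel_left₀]
  exact_mod_cast k.factorial_ne_zero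

theorem HasRes.sum {ι : Type*} (s : Finset ι) {f : ι → ℂ → ℂ} {q : ℂ} {r : ι → ℂ}
    (h : ∀ i ∈ s, HasRes (f i) q (r i)) : HasRes (fun z => ∑ i ∈ s, f i z) q (∑ i ∈ s, r i) := by
  classical
  induction s using Finset.induction_on with
  | empty => simpa using AnalyticAt.hasRes_zero (g := fun _ => (0 : ℂ)) (q := q) analyticAt_const
  | insert i s hi ih =>
    simp only [Finset.sum_insert hi]
    exact (h i (Finset.mem_insert_self _ _)).add
      (ih fun j hj => h j (Finset.mem_insert_of_mem hj))

/-- Residues of even functions divided by an odd power, as Taylor coefficients. -/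
theorem hasRes_even_div_pow {H : ℂ → ℂ} (hH : AnalyticAt ℂ H 0) (j : ℕ) :
    HasRes (fun v => (v ^ (2 * j + 1))⁻¹ * H (v ^ 2)) 0 (coeff j (tay H)) := by
  -- At u = v² the Taylor remainder becomes v F(v²) after division by v^{2j+1}; of the remaining odd
  -- powers of v only the one with i = j has a residue.
  obtain ⟨F, hF, hE⟩ := hH.exists_eventuallyEq_sum_add_pow_mul (j + 1)
  have h1 := HasRes.sum (Finset.range (j + 1)) (q := 0)
    (f := fun i v => coeff i (tay H) * ((v - 0) ^ (2 * (j - i) + 1))⁻¹)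
    (r := fun i => coeff i (tay H) * if 2 * (j - i) = 0 then 1 else 0)
    fun i _ => (hasRes_inv_pow 0 _).const_mul _
  have h2 : AnalyticAt ℂ (fun v => v * F (v ^ 2)) 0 := by
    refine analyticAt_id.mul (AnalyticAt.fun_comp (g := F) ?_ (by fun_prop))
    simpa using hF
  have h3 := h1.add (AnalyticAt.hasRes_zero h2)
  have e : ∑ i ∈ Finset.range (j + 1), (coeff i (tay H) * if 2 * (j - i) = 0 then 1 else 0) + 0 =
      coeff j (tay H) := by
    rw [add_zero, Finset.sum_range_succ, Finset.sum_eq_zero, Nat.sub_self]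
    · simp
    · intro i hi
      have := Finset.mem_range.mp hi
      rw [if_neg (by omega), mul_zero]
  rw [e] at h3
  refine h3.congr ?_
  have ht : Filter.Tendsto (fun v : ℂ => v ^ 2) (𝓝[≠] 0) (𝓝 0) := by
    have : Filter.Tendsto (fun v : ℂ => v ^ 2) (𝓝 0) (𝓝 (0 ^ 2)) := (continuous_pow 2).tendsto 0
    rw [zero_pow two_ne_zero] at this
    exact this.mono_left nhdsWithin_le_nhds
  filter_upwards [ht.eventually hE, self_mem_nhdsWithin] with v hv hv0
  have hv0 : v ≠ 0 := hv0
  rw [hv, mul_add, Finset.mul_sum]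
  congr 1
  · refine Finset.sum_congr rfl fun i hi => ?_
    obtain ⟨k, rfl⟩ : ∃ k, j = i + k := ⟨j - i, by have := Finset.mem_range.mp hi; omega⟩
    rw [sub_zero, coeff_tay, smul_eq_mul, Nat.add_sub_cancel_left]
    field_simp
    ring
  · rw [smul_eq_mul]
    field_simp
    ring

/-! ### The expansion of the root of the superpotential -/

/-- The inverse of `u - 1`. -/
def delta : ℂ⟦X⟧ := -mk 1

theorem delta_mul : (X - 1) * delta = 1 := by
  have := mk_one_mul_one_sub_eq_one ℂ
  rw [delta]
  linear_combination this

theorem tay_inv_sub_one : tay (fun u => (u - 1)⁻¹) = delta := by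
  have ha : AnalyticAt ℂ (fun u : ℂ => u - 1) 0 := by fun_prop
  have h := tay_mul ha (ha.fun_inv (by simp))
  have h1 : tay (fun u => u - 1) = X - 1 := by
    have := tay_polynomial (Polynomial.X - 1)
    simpa using this
  have h2 : tay (fun u : ℂ => (u - 1) * (u - 1)⁻¹) = 1 := by
    rw [tay_congr (g := fun _ => 1), tay_const, map_one]
    have : ∀ᶠ u : ℂ in 𝓝 0, u - 1 ≠ 0 := ha.continuousAt.eventually_ne (by simp)
    filter_upwards [this] with u hu
    rw [mul_inv_cancel₀ hu]
  rw [h1, h2] at h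
  linear_combination (-delta) * h - tay (fun u => (u - 1)⁻¹) * delta_mul

/-- Multiplication by 1/(1-u) forms partial sums of the coefficients; the sign is that of 1/(u-1).
-/
theorem sum_range_coeff (f : ℂ⟦X⟧) (k : ℕ) :
    ∑ i ∈ Finset.range (k + 1), coeff i f = -coeff k (f * delta) := by
  rw [delta, mul_neg, map_neg, neg_neg, coeff_mul,
    Finset.Nat.sum_antidiagonal_eq_sum_range_succ (fun i j => coeff i f * coeff j (mk 1))]
  simp

section
variable {ℓ m : ℕ}

/-- The function `u ↦ r (b(u) / b(0))^{1/(2m)}`. -/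
def rootFun (m : ℕ) (r : (Fin ℓ → ℂ) → ℂ) (a : Fin ℓ → ℂ) (u : ℂ) : ℂ :=
  r a * ((bPoly a).eval u / (-entry a (ℓ - 1))) ^ (1 / (2 * (m : ℂ)))

/-- The power series `ψ` with `ψ^{2m} = b`. -/
def psi (m : ℕ) (r : (Fin ℓ → ℂ) → ℂ) (a : Fin ℓ → ℂ) : ℂ⟦X⟧ := tay (rootFun m r a)

theorem rootAtZero_eq (r : (Fin ℓ → ℂ) → ℂ) (a : Fin ℓ → ℂ) {p : ℂ} (hp : p ≠ 0) :
    rootAtZero ℓ m r a p = p⁻¹ * rootFun m r a (p ^ 2) := by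
  rw [rootAtZero, rootFun, superpotential_eq, div_mul_cancel₀ _ (pow_ne_zero _ hp)]
  ring

variable {r : (Fin ℓ → ℂ) → ℂ} {a : Fin ℓ → ℂ}

theorem eval_zero_bPoly (hℓ : 1 ≤ ℓ) (a : Fin ℓ → ℂ) : (bPoly a).eval 0 = -entry a (ℓ - 1) := by
  rw [← Polynomial.coeff_zero_eq_eval_zero, coeff_bPoly_zero hℓ]

theorem analyticAt_rootFun (hℓ : 1 ≤ ℓ) (h0 : entry a (ℓ - 1) ≠ 0) :
    AnalyticAt ℂ (rootFun m r a) 0 := by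
  have h1 : AnalyticAt ℂ (fun u => (bPoly a).eval u / (-entry a (ℓ - 1))) 0 :=
    (AnalyticAt.aeval_polynomial analyticAt_id (bPoly a)).div analyticAt_const (neg_ne_zero.mpr h0)
  refine analyticAt_const.mul (h1.cpow analyticAt_const ?_)
  rw [eval_zero_bPoly hℓ, div_self (neg_ne_zero.mpr h0)]
  exact Complex.one_mem_slitPlane

theorem rootFun_zero (hℓ : 1 ≤ ℓ) (h0 : entry a (ℓ - 1) ≠ 0) : rootFun m r a 0 = r a := by
  rw [rootFun, eval_zero_bPoly hℓ, div_self (neg_ne_zero.mpr h0), Complex.one_cpow, mul_one]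

theorem coeff_zero_psi (hℓ : 1 ≤ ℓ) (h0 : entry a (ℓ - 1) ≠ 0) : coeff 0 (psi m r a) = r a := by
  rw [psi, coeff_zero_tay, rootFun_zero hℓ h0]

/-- The principal root is taken of b(u)/b(0), which is 1 at u = 0; the choice of branch sits
entirely in the constant r. -/
theorem psi_pow (hℓ : 1 ≤ ℓ) (hm : 1 ≤ m) (h0 : entry a (ℓ - 1) ≠ 0)
    (hr : r a ^ (2 * m) = -entry a (ℓ - 1)) : psi m r a ^ (2 * m) = (bPoly a : ℂ⟦X⟧) := by
  rw [psi, ← tay_pow (analyticAt_rootFun hℓ h0), ← tay_polynomial]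
  congr 1
  ext u
  have hm0 : (2 * (m : ℂ)) ≠ 0 := by exact_mod_cast (by omega : 2 * m ≠ 0)
  rw [rootFun, mul_pow, hr, ← Complex.cpow_nat_mul]
  push_cast
  rw [mul_one_div_cancel hm0, Complex.cpow_one, mul_div_cancel₀ _ (neg_ne_zero.mpr h0)]

/-- The flat coordinate at `p = 0` as a Taylor coefficient. -/
theorem residueAt_rootAtZero (hℓ : 1 ≤ ℓ) (h0 : entry a (ℓ - 1) ≠ 0) (j : ℕ) :
    HasRes (fun p => rootAtZero ℓ m r a p ^ (2 * j + 1) / (p ^ 2 - 1)) 0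
      (coeff j (psi m r a ^ (2 * j + 1) * delta)) := by
  have h1 := analyticAt_rootFun (m := m) (r := r) hℓ h0
  have h2 : AnalyticAt ℂ (fun u : ℂ => (u - 1)⁻¹) 0 := by
    have : AnalyticAt ℂ (fun u : ℂ => u - 1) 0 := by fun_prop
    exact this.fun_inv (by simp)
  have h := hasRes_even_div_pow ((h1.fun_pow (2 * j + 1)).mul h2) j
  have e : tay (((fun u => rootFun m r a u ^ (2 * j + 1)) * fun u => (u - 1)⁻¹)) =
      psi m r a ^ (2 * j + 1) * delta := by
    rw [← tay_inv_sub_one, psi, ← tay_pow h1, ← tay_mul (h1.fun_pow _) h2]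
    rfl
  rw [e] at h
  refine h.congr ?_
  filter_upwards [self_mem_nhdsWithin] with p hp
  have hp : p ≠ 0 := hp
  rw [rootAtZero_eq r a hp, mul_pow, inv_pow, div_eq_mul_inv, Pi.mul_apply, mul_assoc]

/-- The differential of the `j`-th flat coordinate at `p = 0`. -/
def dtZero (m : ℕ) (χ : ℂ⟦X⟧) (j : ℕ) (V : Fin ℓ → ℂ) : ℂ :=
  1 / (2 * m) * coeff j (χ ^ (2 * (m - 1 - j) + 1) * (vp ℓ V : ℂ⟦X⟧))

/-- The data of a branch of `(-a_ℓ)^{1/(2m)}` near `a`. -/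
structure IsBranchAt (m : ℕ) (r : (Fin ℓ → ℂ) → ℂ) (a : Fin ℓ → ℂ) : Prop where
  pos : 1 ≤ m
  dim : 1 ≤ ℓ
  ne : entry a (ℓ - 1) ≠ 0
  cont : ContinuousAt r a
  pow : ∀ᶠ b in 𝓝 a, r b ^ (2 * m) = -entry b (ℓ - 1)

theorem differentiable_entry {n : ℕ} (k : ℕ) : Differentiable ℂ fun v : Fin n → ℂ => entry v k := by
  unfold entry
  split_ifs with h
  · exact differentiable_apply _
  · exact differentiable_const _

theorem IsBranchAt.eventually_ne (h : IsBranchAt m r a) : ∀ᶠ b in 𝓝 a, entry b (ℓ - 1) ≠ 0 :=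
  (continuous_entry _).continuousAt.eventually_ne h.ne

theorem IsBranchAt.root_ne (h : IsBranchAt m r a) : r a ≠ 0 := by
  intro h0
  have := h.pow.self_of_nhds
  rw [h0, zero_pow (by have := h.pos; omega)] at this
  exact h.ne (neg_eq_zero.mp this.symm)

theorem IsBranchAt.differentiableAt (h : IsBranchAt m r a) : DifferentiableAt ℂ r a :=
  differentiableAt_of_pow (by have := h.pos; omega) h.cont
    (differentiable_entry _ a).fun_neg h.pow h.root_ne

theorem hasPSDeriv_bPoly (a : Fin ℓ → ℂ) :
    HasPSDeriv (fun b : Fin ℓ → ℂ => (bPoly b : ℂ⟦X⟧)) (fun Z => (bPoly Z : ℂ⟦X⟧)) a := by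
  intro k
  let L : (Fin ℓ → ℂ) →ₗ[ℂ] ℂ :=
    { toFun := fun b => (bPoly b).coeff k
      map_add' := fun b c => by rw [bPoly_add, Polynomial.coeff_add]
      map_smul' := fun c b => by rw [bPoly_smul, Polynomial.coeff_smul]; rfl }
  refine ⟨LinearMap.toContinuousLinearMap L, ?_, fun Z => ?_⟩
  · simp only [Polynomial.coeff_coe]
    exact (LinearMap.toContinuousLinearMap L).hasFDerivAt
  · simp only [Polynomial.coeff_coe]
    rfl

theorem IsBranchAt.hasPSDeriv_psi (h : IsBranchAt m r a) :
    ∃ ψ', HasPSDeriv (psi m r) ψ' a ∧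
      ∀ Z, ((2 * m : ℕ) : ℂ⟦X⟧) * psi m r a ^ (2 * m - 1) * ψ' Z = (bPoly Z : ℂ⟦X⟧) := by
  refine (hasPSDeriv_bPoly a).root (by have := h.pos; omega) ?_ ?_ ?_
  · filter_upwards [h.pow, h.eventually_ne] with b h1 h2
    exact psi_pow h.dim h.pos h2 h1
  · refine h.differentiableAt.congr_of_eventuallyEq ?_
    filter_upwards [h.eventually_ne] with b h2
    exact coeff_zero_psi h.dim h2
  · rw [coeff_zero_psi h.dim h.ne]
    exact h.root_ne

/-- The power series `ψ⁻¹`. -/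
def chi (m : ℕ) (r : (Fin ℓ → ℂ) → ℂ) (a : Fin ℓ → ℂ) : ℂ⟦X⟧ := (psi m r a)⁻¹

theorem IsBranchAt.psi_mul_chi (h : IsBranchAt m r a) : ∀ᶠ b in 𝓝 a, psi m r b * chi m r b = 1 := by
  filter_upwards [h.eventually_ne, h.differentiableAt.continuousAt.eventually_ne h.root_ne]
    with b h1 h2
  exact PowerSeries.mul_inv_cancel _
    (by rw [← coeff_zero_eq_constantCoeff_apply, coeff_zero_psi h.dim h1]; exact h2)

theorem IsBranchAt.derivative_psi (h : IsBranchAt m r a) {Z : Fin ℓ → ℂ} {P : ℂ⟦X⟧}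
    (hP : ((2 * m : ℕ) : ℂ⟦X⟧) * psi m r a ^ (2 * m - 1) * P = (bPoly Z : ℂ⟦X⟧)) :
    P = C (1 / (2 * m : ℂ)) * (chi m r a ^ (2 * m - 1) * (bPoly Z : ℂ⟦X⟧)) := by
  have hχ := h.psi_mul_chi.self_of_nhds
  have hp : psi m r a ^ (2 * m - 1) * chi m r a ^ (2 * m - 1) = 1 := by
    rw [← mul_pow, hχ, one_pow]
  have hm : (2 * m : ℂ) ≠ 0 := by have := h.pos; exact_mod_cast (by omega : 2 * m ≠ 0)
  have hc : C (1 / (2 * m : ℂ)) * ((2 * m : ℕ) : ℂ⟦X⟧) = 1 := by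
    rw [← map_natCast (C (R := ℂ)), ← map_mul]
    push_cast
    rw [one_div_mul_cancel hm, map_one]
  rw [← hP]
  linear_combination (-P) * hc - P * C (1 / (2 * m : ℂ)) * ((2 * m : ℕ) : ℂ⟦X⟧) * hp

theorem coe_bPoly (V : Fin ℓ → ℂ) : (bPoly V : ℂ⟦X⟧) = (X - 1) * (vp ℓ V : ℂ⟦X⟧) := by
  rw [bPoly, Polynomial.coe_mul, Polynomial.coe_sub, Polynomial.coe_X, Polynomial.coe_one]

/-- From ψ^{2m} = b, the variation of ψ along V is ψ^{1-2m}(u-1)V/(2m). The factor u-1 cancels that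
in the definition of the coordinate, leaving ψ^{-2(m-1-j)-1}V/(2m). -/
theorem IsBranchAt.fderiv_coord (h : IsBranchAt m r a) {j : ℕ} (hj : j < m) :
    DifferentiableAt ℂ (fun b => 1 / ((2 * j + 1 : ℕ) : ℂ) * coeff j (psi m r b ^ (2 * j + 1) * delta)) a ∧
    ∀ V, fderiv ℂ (fun b => 1 / ((2 * j + 1 : ℕ) : ℂ) *
      coeff j (psi m r b ^ (2 * j + 1) * delta)) a V = dtZero m (chi m r a) j V := by
  obtain ⟨ψ', h1, h2⟩ := h.hasPSDeriv_psi
  have h3 := (h1.pow (2 * j + 1)).mul (hasPSDeriv_const delta)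
  refine ⟨(h3.differentiableAt j).const_mul _, fun V => ?_⟩
  rw [fderiv_const_mul (h3.differentiableAt j), smul_apply, h3.hasFDerivAt,
    h.derivative_psi (h2 V), dtZero, coe_bPoly, smul_eq_mul]
  have hχ := h.psi_mul_chi.self_of_nhds
  obtain ⟨i, rfl⟩ : ∃ i, m = j + i + 1 := ⟨m - 1 - j, by omega⟩
  rw [show j + i + 1 - 1 - j = i by omega, show 2 * (j + i + 1) - 1 = 2 * j + (2 * i + 1) by omega,
    Nat.add_sub_cancel]
  have hp : psi (j + i + 1) r a ^ (2 * j) * chi (j + i + 1) r a ^ (2 * j) = 1 := by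
    rw [← mul_pow, hχ, one_pow]
  have hd := delta_mul
  generalize hW : (vp ℓ V : ℂ⟦X⟧) = W
  have e : psi (j + i + 1) r a ^ (2 * j + 1) * (0 : (Fin ℓ → ℂ) → ℂ⟦X⟧) V +
      ((2 * j + 1 : ℕ) : ℂ⟦X⟧) * psi (j + i + 1) r a ^ (2 * j) *
        (C (1 / (2 * ((j + i + 1 : ℕ) : ℂ))) *
          (chi (j + i + 1) r a ^ (2 * j + (2 * i + 1)) * ((X - 1) * W))) * delta =
      C ((2 * j + 1 : ℕ) * (1 / (2 * ((j + i + 1 : ℕ) : ℂ)))) *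
        (chi (j + i + 1) r a ^ (2 * i + 1) * W) := by
    rw [Pi.zero_apply, mul_zero, zero_add, pow_add, map_mul, map_natCast]
    generalize ((2 * j + 1 : ℕ) : ℂ⟦X⟧) = N
    linear_combination N * C (1 / (2 * ((j + i + 1 : ℕ) : ℂ))) *
      chi (j + i + 1) r a ^ (2 * i + 1) * W * ((X - 1) * delta * hp + hd)
  rw [e, coeff_C_mul, ← mul_assoc, ← mul_assoc, one_div_mul_cancel, one_mul]
  exact_mod_cast (2 * j).succ_ne_zero

/-- The operator u d/du - m on ψ^{2m} gives mψ^{2m-1}(2uψ' - ψ); this links the division by D with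
the series ψ. -/
theorem IsBranchAt.coe_dPoly (h : IsBranchAt m r a) :
    (dPoly m a : ℂ⟦X⟧) = -(m : ℂ⟦X⟧) * psi m r a ^ (2 * m - 1) * kap (psi m r a) := by
  have hb := psi_pow h.dim h.pos h.ne h.pow.self_of_nhds
  have : (Polynomial.derivative (bPoly a) : ℂ⟦X⟧) = derivative ℂ (bPoly a : ℂ⟦X⟧) :=
    (derivative_coe _).symm
  rw [dPoly, mop_apply, Polynomial.coe_sub, Polynomial.coe_mul, Polynomial.coe_X,
    Polynomial.coe_mul, Polynomial.coe_C, this, ← hb, derivative_pow, map_natCast, kap]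
  obtain ⟨k, rfl⟩ : ∃ k, m = k + 1 := ⟨m - 1, by have := h.pos; omega⟩
  rw [show 2 * (k + 1) - 1 = 2 * k + 1 by omega, show 2 * (k + 1) = 2 * k + 1 + 1 by omega, pow_succ]
  push_cast
  ring

/-- The second derivatives of the flat coordinates are given by the Christoffel symbols. -/
theorem IsBranchAt.fderiv_dtZero (h : IsBranchAt m r a) (hm : m ≤ ℓ) (ha : a ∈ spaceLG ℓ m) {j : ℕ}
    (hj : j < m) (V Z : Fin ℓ → ℂ) :
    DifferentiableAt ℂ (fun b => dtZero m (chi m r b) j V) a ∧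
      fderiv ℂ (fun b => dtZero m (chi m r b) j V) a Z =
        dtZero m (chi m r a) j (gam ℓ m a Z V) := by
  obtain ⟨ψ', h1, h2⟩ := h.hasPSDeriv_psi
  have hχ := h.psi_mul_chi.self_of_nhds
  have h3 := ((h1.inv h.psi_mul_chi).pow (2 * (m - 1 - j) + 1)).mul
    (hasPSDeriv_const (vp ℓ V : ℂ⟦X⟧))
  refine ⟨(h3.differentiableAt j).const_mul _, ?_⟩
  unfold dtZero
  rw [fderiv_const_mul (h3.differentiableAt j), smul_apply, h3.hasFDerivAt,
    h.derivative_psi (h2 Z), smul_eq_mul, gam, vp_lop]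
  congr 1
  have hs := congrArg (fun P : Polynomial ℂ => (P : ℂ⟦X⟧)) (sg_spec hm ha Z V)
  simp only [Polynomial.coe_add, Polynomial.coe_mul, Polynomial.coe_pow, Polynomial.coe_X] at hs
  rw [h.coe_dPoly] at hs
  have hG := coeff_hessian (m := m) hχ hj (vp ℓ (gmap ℓ m a Z V) : ℂ⟦X⟧)
  rw [mop_apply, Polynomial.coe_neg, Polynomial.coe_add, Polynomial.coe_sub, Polynomial.coe_mul,
    Polynomial.coe_mul, Polynomial.coe_mul, Polynomial.coe_C, Polynomial.coe_C, Polynomial.coe_X,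
    ← derivative_coe, mul_neg (chi m r a ^ (2 * (m - 1 - j) + 1)), map_neg, hG, Nat.add_sub_cancel]
  obtain ⟨i, rfl⟩ : ∃ i, m = j + i + 1 := ⟨m - 1 - j, by omega⟩
  rw [show j + i + 1 - 1 - j = i by omega] at *
  set ψ := psi (j + i + 1) r a
  set χ := chi (j + i + 1) r a
  set K := kap ψ
  set G : ℂ⟦X⟧ := (vp ℓ (gmap ℓ (j + i + 1) a Z V) : ℂ⟦X⟧)
  set B : ℂ⟦X⟧ := (bPoly Z : ℂ⟦X⟧)
  set W : ℂ⟦X⟧ := (vp ℓ V : ℂ⟦X⟧)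
  set S : ℂ⟦X⟧ := (vp ℓ (smap ℓ (j + i + 1) a Z V) : ℂ⟦X⟧)
  rw [show 2 * (j + i + 1) - 1 = 2 * (j + i) + 1 by omega] at *
  have hp : ψ ^ (2 * (j + i) + 1) * χ ^ (2 * (j + i) + 1) = 1 := by rw [← mul_pow, hχ, one_pow]
  set M : ℂ⟦X⟧ := ((j + i + 1 : ℕ) : ℂ⟦X⟧) with hM
  set c : ℂ := 1 / (2 * ((j + i + 1 : ℕ) : ℂ)) with hc
  have hcM : C c * M = C (1 / 2) := by
    rw [hM, ← map_natCast (C (R := ℂ)), ← map_mul, hc]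
    congr 1
    have : ((j + i + 1 : ℕ) : ℂ) ≠ 0 := by exact_mod_cast (j + i).succ_ne_zero
    field_simp
  -- In (u-1)ZV = u^m S + D G the term with S is divisible by u^m and does not reach the coefficient
  -- of u^j, j < m; the term with G is turned by `coeff_hessian` into the differential of the
  -- coordinate at Γ.
  have e : χ ^ (2 * i + 1) * (0 : (Fin ℓ → ℂ) → ℂ⟦X⟧) Z +
      ((2 * i + 1 : ℕ) : ℂ⟦X⟧) * χ ^ (2 * i) *
        -(χ ^ 2 * (C c * (χ ^ (2 * (j + i) + 1) * B))) * W =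
      C (((2 * i + 1 : ℕ) : ℂ) * (1 / 2)) * (χ ^ (2 * i + 2) * (K * G)) +
        (-((2 * i + 1 : ℕ) : ℂ⟦X⟧) * χ ^ (2 * i + 2) * C c * χ ^ (2 * (j + i) + 1)) *
          (X ^ (j + i + 1) * S) := by
    rw [Pi.zero_apply, mul_zero, zero_add, map_mul, map_natCast]
    generalize ((2 * i + 1 : ℕ) : ℂ⟦X⟧) = N
    linear_combination N * χ ^ (2 * i + 2) * C c * χ ^ (2 * (j + i) + 1) * hs +
      N * χ ^ (2 * i + 2) * C c * M * K * G * hp + N * χ ^ (2 * i + 2) * (K * G) * hcM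
  rw [e, map_add, coeff_mul_X_pow_of_lt hj, add_zero, coeff_C_mul]
  push_cast
  ring

/-- The part of the metric supported at `p = 0`. -/
theorem IsBranchAt.sum_coeff_gmap (h : IsBranchAt m r a) (hm : m ≤ ℓ) (ha : a ∈ spaceLG ℓ m)
    (V W : Fin ℓ → ℂ) :
    (1 / 2) * ∑ k ∈ Finset.range m, (vp ℓ (gmap ℓ m a V W)).coeff k =
      ∑ b ∈ Finset.range m, 2 * m * dtZero m (chi m r a) b V * dtZero m (chi m r a) (m - 1 - b) W := by
  have hχ := h.psi_mul_chi.self_of_nhds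
  have hκ : kap (psi m r a) * (kap (psi m r a))⁻¹ = 1 := by
    refine PowerSeries.mul_inv_cancel _ ?_
    rw [constantCoeff_kap, ← coeff_zero_eq_constantCoeff_apply, coeff_zero_psi h.dim h.ne]
    exact h.root_ne
  have hs := congrArg (fun P : Polynomial ℂ => (P : ℂ⟦X⟧)) (sg_spec hm ha V W)
  simp only [Polynomial.coe_add, Polynomial.coe_mul, Polynomial.coe_pow, Polynomial.coe_X] at hs
  rw [h.coe_dPoly, coe_bPoly] at hs
  have hpair := coeff_pairing hχ hκ h.pos (vp ℓ V : ℂ⟦X⟧) (vp ℓ W : ℂ⟦X⟧)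
  obtain ⟨k, rfl⟩ : ∃ k, m = k + 1 := ⟨m - 1, by have := h.pos; omega⟩
  rw [show 2 * (k + 1) - 1 = 2 * k + 1 by omega, Nat.add_sub_cancel] at *
  -- The sum of the m low coefficients of G is -[u^{m-1}] G/(u-1).
  have hsum := sum_range_coeff (vp ℓ (gmap ℓ (k + 1) a V W) : ℂ⟦X⟧) k
  simp only [Polynomial.coeff_coe] at hsum
  rw [hsum]
  set ψ := psi (k + 1) r a
  set χ := chi (k + 1) r a
  set K := kap ψ
  set G : ℂ⟦X⟧ := (vp ℓ (gmap ℓ (k + 1) a V W) : ℂ⟦X⟧)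
  set S : ℂ⟦X⟧ := (vp ℓ (smap ℓ (k + 1) a V W) : ℂ⟦X⟧)
  have hp : ψ ^ (2 * k + 1) * χ ^ (2 * k + 1) = 1 := by rw [← mul_pow, hχ, one_pow]
  have hd := delta_mul
  have hM0 : ((k + 1 : ℕ) : ℂ) ≠ 0 := by exact_mod_cast k.succ_ne_zero
  have hcM : C (1 / ((k + 1 : ℕ) : ℂ)) * ((k + 1 : ℕ) : ℂ⟦X⟧) = 1 := by
    rw [← map_natCast (C (R := ℂ)), ← map_mul, one_div_mul_cancel hM0, map_one]
  -- Modulo u^m the decomposition reads D G = (u-1)VW, so G/(u-1) = VW/D = -ψ^{1-2m}VW/(m(ψ -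
  -- 2uψ')), to which `coeff_pairing` applies.
  have e : G * delta = C (-(1 / ((k + 1 : ℕ) : ℂ))) * (χ ^ (2 * k + 1) * K⁻¹ * (vp ℓ V : ℂ⟦X⟧) * (vp ℓ W : ℂ⟦X⟧)) +
      (C (1 / ((k + 1 : ℕ) : ℂ)) * χ ^ (2 * k + 1) * K⁻¹ * delta) * (X ^ (k + 1) * S) := by
    rw [map_neg]
    generalize ((k + 1 : ℕ) : ℂ⟦X⟧) = M at *
    generalize C (1 / ((k + 1 : ℕ) : ℂ)) = c at *
    linear_combination (-(G * delta)) * hcM - G * delta * c * M * hp -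
      G * delta * c * M * ψ ^ (2 * k + 1) * χ ^ (2 * k + 1) * hκ -
      c * χ ^ (2 * k + 1) * K⁻¹ * delta * hs -
      c * χ ^ (2 * k + 1) * K⁻¹ * (vp ℓ V : ℂ⟦X⟧) * (vp ℓ W : ℂ⟦X⟧) * hd
  rw [e, map_add, coeff_mul_X_pow_of_lt (Nat.lt_succ_self k), add_zero, coeff_C_mul, hpair,
    Finset.mul_sum, ← Finset.sum_neg_distrib, Finset.mul_sum]
  refine Finset.sum_congr rfl fun b hb => ?_
  have hb' := Finset.mem_range.mp hb
  rw [dtZero, dtZero, Nat.add_sub_cancel, show k - (k - b) = b by omega]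
  field_simp

end

end GenFrob
end

noncomputable section
namespace GenFrob
open Polynomial

/-! ### The symmetry exchanging `p = 0` and `p = ∞` -/

/-- The reflection `a_j ↦ -a_{ℓ+1-j}`. -/
def sig (ℓ : ℕ) : (Fin ℓ → ℂ) →L[ℂ] (Fin ℓ → ℂ) :=
  LinearMap.toContinuousLinearMap
    { toFun := fun a j => -a (Fin.rev j)
      map_add' := fun a b => by ext j; simp; ring
      map_smul' := fun c a => by ext j; simp }

section
variable {ℓ m : ℕ} {a : Fin ℓ → ℂ}

theorem sig_apply (a : Fin ℓ → ℂ) (j : Fin ℓ) : sig ℓ a j = -a (Fin.rev j) := rfl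

theorem sig_sig (a : Fin ℓ → ℂ) : sig ℓ (sig ℓ a) = a := by
  ext j
  simp [sig_apply]

theorem entry_sig {k : ℕ} (hk : k < ℓ) (a : Fin ℓ → ℂ) :
    entry (sig ℓ a) k = -entry a (ℓ - 1 - k) := by
  rw [entry, dif_pos hk, entry, dif_pos (by omega), sig_apply]
  congr
  simp only [Fin.ext_iff, Fin.val_rev]
  omega

theorem vp_sig (a : Fin ℓ → ℂ) : vp ℓ (sig ℓ a) = -reflect (ℓ - 1) (vp ℓ a) := by
  ext k
  rw [coeff_neg, coeff_reflect, coeff_vp, coeff_vp]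
  split_ifs with h1 h2 h2
  · rw [entry_sig (by omega), revAt_le (by omega)]
  · rw [revAt_le (by omega)] at h2; omega
  · exfalso
    rw [revAt_eq_self_of_lt (by omega)] at h2
    omega
  · simp

theorem natDegree_bPoly_le (a : Fin ℓ → ℂ) : (bPoly a).natDegree ≤ ℓ :=
  natDegree_le_of_degree_le (degree_bPoly_le a)

/-- Thus Λ(1/p) is the superpotential of the reflected point with ℓ-m in place of m. The minus sign
in the reflection compensates u-1 ↦ 1-u. -/
theorem bPoly_sig (hℓ : 1 ≤ ℓ) (a : Fin ℓ → ℂ) : bPoly (sig ℓ a) = reflect ℓ (bPoly a) := by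
  have h1 : reflect 1 (X - 1 : ℂ[X]) = 1 - X := by
    rw [reflect_sub, show (X : ℂ[X]) = X ^ 1 by rw [pow_one], reflect_monomial, reflect_one,
      revAt_le le_rfl]
    simp
  have h := reflect_mul (X - 1 : ℂ[X]) (vp ℓ a) (F := 1) (G := ℓ - 1)
    (by simpa using natDegree_X_sub_C_le (1 : ℂ)) (natDegree_vp_le a)
  rw [show 1 + (ℓ - 1) = ℓ by omega, h1] at h
  rw [bPoly, bPoly, vp_sig, h]
  ring

theorem dPoly_sig (hℓ : 1 ≤ ℓ) (hm : m ≤ ℓ) (a : Fin ℓ → ℂ) :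
    dPoly (ℓ - m) (sig ℓ a) = -reflect ℓ (dPoly m a) := by
  ext k
  rw [coeff_neg, coeff_reflect, dPoly, dPoly, coeff_mop, coeff_mop, bPoly_sig hℓ, coeff_reflect]
  by_cases hk : k ≤ ℓ
  · rw [revAt_le hk]
    push_cast [hk, hm]
    ring
  · rw [coeff_eq_zero_of_natDegree_lt (n := revAt ℓ k), mul_zero, mul_zero, neg_zero]
    rw [revAt_eq_self_of_lt (by omega)]
    exact lt_of_le_of_lt (natDegree_bPoly_le a) (by omega)

theorem sig_mem_spaceLG (hℓ : 1 ≤ ℓ) (hm : m ≤ ℓ) (ha : a ∈ spaceLG ℓ m) :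
    sig ℓ a ∈ spaceLG ℓ (ℓ - m) := by
  constructor
  · intro h
    rw [entry_sig (by omega), neg_ne_zero, Nat.sub_zero]
    exact ha.2 (by omega)
  · intro h
    rw [entry_sig (by omega), neg_ne_zero, show ℓ - 1 - (ℓ - 1) = 0 by omega]
    exact ha.1 (by omega)

/-- Reversing coefficients in degree 2ℓ-1 takes u^m to u^{ℓ-m} and D to minus the reflected D;
uniqueness identifies the new S and G. -/
theorem sg_sig (hℓ : 1 ≤ ℓ) (hm : m ≤ ℓ) (ha : a ∈ spaceLG ℓ m) (V W : Fin ℓ → ℂ) :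
    smap ℓ (ℓ - m) (sig ℓ a) (sig ℓ V) (sig ℓ W) = sig ℓ (smap ℓ m a V W) ∧
      gmap ℓ (ℓ - m) (sig ℓ a) (sig ℓ V) (sig ℓ W) = -sig ℓ (gmap ℓ m a V W) := by
  apply sg_unique (Nat.sub_le _ _) (sig_mem_spaceLG hℓ hm ha)
  have h := congrArg (reflect (ℓ + (ℓ - 1))) (sg_spec hm ha V W)
  rw [reflect_add, reflect_mul _ _ (natDegree_bPoly_le V) (natDegree_vp_le W),
    reflect_mul _ _ ((natDegree_X_pow_le m).trans hm) (natDegree_vp_le _), add_comm ℓ (ℓ - 1),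
    reflect_mul _ _ (natDegree_vp_le _) (natDegree_le_of_degree_le (degree_dPoly_le m a)),
    reflect_monomial, revAt_le hm] at h
  rw [map_neg, vp_sig, vp_sig, vp_sig, dPoly_sig hℓ hm, bPoly_sig hℓ]
  linear_combination -h

theorem eval_one_vp_sig (V : Fin ℓ → ℂ) : (vp ℓ (sig ℓ V)).eval 1 = -(vp ℓ V).eval 1 := by
  simp only [eval_vp, one_pow, mul_one, sig_apply, Finset.sum_neg_distrib]
  rw [← Equiv.sum_comp Fin.revPerm fun j => V j]
  rfl

theorem etaF_sig (hℓ : 1 ≤ ℓ) (hm : m ≤ ℓ) (ha : a ∈ spaceLG ℓ m) (V W : Fin ℓ → ℂ) :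
    etaF ℓ (ℓ - m) (sig ℓ a) (sig ℓ V) (sig ℓ W) = etaF ℓ m a V W := by
  rw [etaF, (sg_sig hℓ hm ha V W).2, map_neg, eval_neg, eval_one_vp_sig, neg_neg, etaF]

/-- The factor -(1/2 - m + k) of u^k changes sign under k ↦ ℓ-1-k, m ↦ ℓ-m, which undoes the sign of
G. -/
theorem gam_sig (hℓ : 1 ≤ ℓ) (hm : m ≤ ℓ) (ha : a ∈ spaceLG ℓ m) (V W : Fin ℓ → ℂ) :
    gam ℓ (ℓ - m) (sig ℓ a) (sig ℓ V) (sig ℓ W) = sig ℓ (gam ℓ m a V W) := by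
  ext j
  have hj := j.isLt
  rw [gam, (sg_sig hℓ hm ha V W).2, lop_apply, Pi.neg_apply, sig_apply, sig_apply, gam, lop_apply,
    Fin.val_rev, show ℓ - 1 - (ℓ - ((j : ℕ) + 1)) = j by omega, Nat.sub_sub]
  push_cast [hm, (by omega : 1 + (j : ℕ) ≤ ℓ)]
  ring

theorem coeff_vp_gmap_sig (hℓ : 1 ≤ ℓ) (hm : m ≤ ℓ) (ha : a ∈ spaceLG ℓ m) (V W : Fin ℓ → ℂ) {k : ℕ}
    (hk : k < ℓ) :
    (vp ℓ (gmap ℓ (ℓ - m) (sig ℓ a) (sig ℓ V) (sig ℓ W))).coeff k =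
      (vp ℓ (gmap ℓ m a V W)).coeff (ℓ - 1 - k) := by
  rw [(sg_sig hℓ hm ha V W).2, map_neg, vp_sig, neg_neg, coeff_reflect, revAt_le (by omega)]

/-! ### Flat coordinates -/

/-- The `j`-th flat coordinate at `p = 0`. -/
def tZero (m : ℕ) (r : (Fin ℓ → ℂ) → ℂ) (j : ℕ) (a : Fin ℓ → ℂ) : ℂ :=
  1 / ((2 * j + 1 : ℕ) : ℂ) * PowerSeries.coeff j (psi m r a ^ (2 * j + 1) * delta)

variable {r₁ r₂ : (Fin ℓ → ℂ) → ℂ} {U : Set (Fin ℓ → ℂ)}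

/-- In the parameter w = 1/p the root at infinity is the root at zero of the reflected
superpotential, so the expansion at 0 serves both poles. -/
theorem rootAtInfty_inv (hℓ : 1 ≤ ℓ) (hm : m ≤ ℓ) (r : (Fin ℓ → ℂ) → ℂ) (a : Fin ℓ → ℂ) {w : ℂ}
    (hw : w ≠ 0) :
    rootAtInfty ℓ m r a w⁻¹ = rootAtZero ℓ (ℓ - m) (fun b => r (sig ℓ b)) (sig ℓ a) w := by
  have h1 : superpotential ℓ m a w⁻¹ / (entry a 0 * w⁻¹ ^ (2 * (ℓ - m))) =
      superpotential ℓ (ℓ - m) (sig ℓ a) w * w ^ (2 * (ℓ - m)) / (-entry (sig ℓ a) (ℓ - 1)) := by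
    rw [superpotential_eq, superpotential_eq, bPoly_sig hℓ, entry_sig (by omega), neg_neg,
      show ℓ - 1 - (ℓ - 1) = 0 by omega, div_mul_cancel₀ _ (pow_ne_zero _ hw), inv_pow,
      eval_inv_eq_reflect (natDegree_bPoly_le a) (pow_ne_zero 2 hw), inv_pow, inv_pow, ← pow_mul]
    obtain ⟨k, rfl⟩ : ∃ k, ℓ = m + k := ⟨ℓ - m, by omega⟩
    rw [Nat.add_sub_cancel_left, mul_add, pow_add]
    by_cases h0 : entry a 0 = 0
    · simp [h0]
    · field_simp
  rw [rootAtInfty, rootAtZero, h1, sig_sig, Nat.cast_sub hm]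

theorem flatLG_lt (hℓ : 1 ≤ ℓ) (hm : m ≤ ℓ) (h0 : entry a 0 ≠ 0) {i : Fin ℓ} (hi : (i : ℕ) < ℓ - m) :
    flatLG ℓ m r₁ r₂ a i =
      tZero (ℓ - m) (fun b => r₁ (sig ℓ b)) (ℓ - m - 1 - i) (sig ℓ a) := by
  have h1 : entry (sig ℓ a) (ℓ - 1) ≠ 0 := by
    rw [entry_sig (by omega), neg_ne_zero, show ℓ - 1 - (ℓ - 1) = 0 by omega]
    exact h0
  have h := residueAt_rootAtZero (m := ℓ - m) (r := fun b => r₁ (sig ℓ b)) hℓ h1 (ℓ - m - 1 - i)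
  have h2 : HasResInfty (fun p => rootAtInfty ℓ m r₁ a p ^ (2 * (ℓ - m - 1 - (i : ℕ)) + 1) /
      (p ^ 2 - 1)) (PowerSeries.coeff (ℓ - m - 1 - (i : ℕ)) (psi (ℓ - m) (fun b => r₁ (sig ℓ b))
        (sig ℓ a) ^ (2 * (ℓ - m - 1 - (i : ℕ)) + 1) * delta)) := by
    refine h.congr ?_
    filter_upwards [self_mem_nhdsWithin] with w hw
    have hw : w ≠ 0 := hw
    rw [rootAtInfty_inv hℓ hm _ _ hw, ← neg_div, ← div_mul_eq_div_div, neg_div, ← div_neg]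
    congr 1
    field_simp
    ring
  rw [flatLG, if_pos hi, h2.residueInfty_eq, tZero]

theorem flatLG_ge (hℓ : 1 ≤ ℓ) (h0 : entry a (ℓ - 1) ≠ 0) {i : Fin ℓ} (hi : ¬ (i : ℕ) < ℓ - m) :
    flatLG ℓ m r₁ r₂ a i = tZero m r₂ (ℓ - 1 - i) a := by
  rw [flatLG, if_neg hi, (residueAt_rootAtZero hℓ h0 _).residueAt_eq, tZero]

theorem IsRootBranch.branch₂ (hℓ : 1 ≤ ℓ) (h : IsRootBranch ℓ m U r₁ r₂) (ha : a ∈ U) (hm : 0 < m) :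
    IsBranchAt m r₂ a where
  pos := hm
  dim := hℓ
  ne := (h.subset ha).2 hm
  cont := h.cont₂.continuousAt (h.isOpen.mem_nhds ha)
  pow := by filter_upwards [h.isOpen.mem_nhds ha] with b hb using h.pow₂ hm b hb

theorem IsRootBranch.branch₁ (hℓ : 1 ≤ ℓ) (h : IsRootBranch ℓ m U r₁ r₂) (ha : a ∈ U) (hm : m < ℓ) :
    IsBranchAt (ℓ - m) (fun b => r₁ (sig ℓ b)) (sig ℓ a) where
  pos := by omega
  dim := hℓ
  ne := by
    rw [entry_sig (by omega), neg_ne_zero, show ℓ - 1 - (ℓ - 1) = 0 by omega]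
    exact (h.subset ha).1 hm
  cont := by
    have : ContinuousAt r₁ (sig ℓ (sig ℓ a)) := by
      rw [sig_sig]; exact h.cont₁.continuousAt (h.isOpen.mem_nhds ha)
    exact ContinuousAt.comp (f := sig ℓ) (g := r₁) this (sig ℓ).continuous.continuousAt
  pow := by
    have hs : U ∈ 𝓝 (sig ℓ (sig ℓ a)) := by rw [sig_sig]; exact h.isOpen.mem_nhds ha
    filter_upwards [(sig ℓ).continuous.continuousAt.eventually hs] with b hb
    rw [h.pow₁ hm _ hb, entry_sig (by omega)]
    rfl

/-- The differentials of the flat coordinates. -/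
def dt (ℓ m : ℕ) (r₁ r₂ : (Fin ℓ → ℂ) → ℂ) (a : Fin ℓ → ℂ) (i : Fin ℓ) (V : Fin ℓ → ℂ) : ℂ :=
  if (i : ℕ) < ℓ - m then
    dtZero (ℓ - m) (chi (ℓ - m) (fun b => r₁ (sig ℓ b)) (sig ℓ a)) (ℓ - m - 1 - i) (sig ℓ V)
  else dtZero m (chi m r₂ a) (ℓ - 1 - i) V

theorem fderiv_comp_sig {F : (Fin ℓ → ℂ) → ℂ} (h : DifferentiableAt ℂ F (sig ℓ a)) :
    DifferentiableAt ℂ (fun b => F (sig ℓ b)) a ∧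
      ∀ V, fderiv ℂ (fun b => F (sig ℓ b)) a V = fderiv ℂ F (sig ℓ a) (sig ℓ V) := by
  have h1 := h.hasFDerivAt.comp a (sig ℓ).hasFDerivAt
  exact ⟨h1.differentiableAt, fun V => by
    rw [show (fun b => F (sig ℓ b)) = F ∘ sig ℓ from rfl, h1.fderiv]; rfl⟩

theorem IsRootBranch.fderiv_flatLG (hℓ : 1 ≤ ℓ) (hm : m ≤ ℓ) (h : IsRootBranch ℓ m U r₁ r₂)
    (ha : a ∈ U) (i : Fin ℓ) :
    DifferentiableAt ℂ (fun b => flatLG ℓ m r₁ r₂ b i) a ∧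
      ∀ V, fderiv ℂ (fun b => flatLG ℓ m r₁ r₂ b i) a V = dt ℓ m r₁ r₂ a i V := by
  have hi := i.isLt
  by_cases hlt : (i : ℕ) < ℓ - m
  · have hB := h.branch₁ hℓ ha (by omega)
    have h1 := hB.fderiv_coord (j := ℓ - m - 1 - i) (by omega)
    have h2 := fderiv_comp_sig h1.1
    have he : (fun b => flatLG ℓ m r₁ r₂ b i) =ᶠ[𝓝 a] fun b =>
        tZero (ℓ - m) (fun b => r₁ (sig ℓ b)) (ℓ - m - 1 - i) (sig ℓ b) := by
      filter_upwards [h.isOpen.mem_nhds ha] with b hb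
      exact flatLG_lt hℓ hm ((h.subset hb).1 (by omega)) hlt
    refine ⟨h2.1.congr_of_eventuallyEq he, fun V => ?_⟩
    rw [he.fderiv_eq, dt, if_pos hlt, ← h1.2]
    exact h2.2 V
  · have hB := h.branch₂ hℓ ha (by omega)
    have h1 := hB.fderiv_coord (j := ℓ - 1 - i) (by omega)
    have he : (fun b => flatLG ℓ m r₁ r₂ b i) =ᶠ[𝓝 a] tZero m r₂ (ℓ - 1 - i) := by
      filter_upwards [h.isOpen.mem_nhds ha] with b hb
      exact flatLG_ge hℓ ((h.subset hb).2 (by omega)) hlt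
    refine ⟨h1.1.congr_of_eventuallyEq he, fun V => ?_⟩
    rw [he.fderiv_eq, dt, if_neg hlt, ← h1.2]
    rfl

theorem IsRootBranch.fderiv_dt (hℓ : 1 ≤ ℓ) (hm : m ≤ ℓ) (h : IsRootBranch ℓ m U r₁ r₂)
    (ha : a ∈ U) (i : Fin ℓ) (V : Fin ℓ → ℂ) :
    DifferentiableAt ℂ (fun b => dt ℓ m r₁ r₂ b i V) a ∧
      ∀ Z, fderiv ℂ (fun b => dt ℓ m r₁ r₂ b i V) a Z = dt ℓ m r₁ r₂ a i (gam ℓ m a Z V) := by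
  have hi := i.isLt
  by_cases hlt : (i : ℕ) < ℓ - m
  · have hB := h.branch₁ hℓ ha (by omega)
    have h1 := fun Z => hB.fderiv_dtZero (Nat.sub_le _ _) (sig_mem_spaceLG hℓ hm (h.subset ha))
      (j := ℓ - m - 1 - i) (by omega) (sig ℓ V) Z
    have h2 := fderiv_comp_sig (h1 0).1
    have he : (fun b => dt ℓ m r₁ r₂ b i V) = fun b =>
      dtZero (ℓ - m) (chi (ℓ - m) (fun b => r₁ (sig ℓ b)) (sig ℓ b)) (ℓ - m - 1 - i) (sig ℓ V) := by
      ext b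
      rw [dt, if_pos hlt]
    rw [he]
    refine ⟨h2.1, fun Z => ?_⟩
    rw [h2.2, (h1 _).2, dt, if_pos hlt, gam_sig hℓ hm (h.subset ha)]
  · have hB := h.branch₂ hℓ ha (by omega)
    have h1 := fun Z => hB.fderiv_dtZero hm (h.subset ha) (j := ℓ - 1 - i) (by omega) V Z
    have he : (fun b => dt ℓ m r₁ r₂ b i V) = fun b =>
      dtZero m (chi m r₂ b) (ℓ - 1 - i) V := by
      ext b
      rw [dt, if_neg hlt]
    rw [he]
    refine ⟨(h1 0).1, fun Z => ?_⟩
    rw [(h1 Z).2, dt, if_neg hlt]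

/-- Since A = ψ^{2m}/(u-1), the series ψ^{-2i-1}A is ψ^{2j+1}/(u-1) for i + j + 1 = m, so the
differential at the Euler vector is the coordinate itself up to its degree. -/
theorem IsBranchAt.dtZero_self {r : (Fin ℓ → ℂ) → ℂ} (h : IsBranchAt m r a) {j : ℕ} (hj : j < m) :
    dtZero m (chi m r a) j a = ((2 * j + 1 : ℕ) : ℂ) / ((2 * m : ℕ) : ℂ) * tZero m r j a := by
  have hχ := h.psi_mul_chi.self_of_nhds
  have hb := psi_pow h.dim h.pos h.ne h.pow.self_of_nhds
  have hd := delta_mul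
  rw [coe_bPoly] at hb
  obtain ⟨i, rfl⟩ : ∃ i, m = j + i + 1 := ⟨m - 1 - j, by omega⟩
  have hp : psi (j + i + 1) r a ^ (2 * i + 1) * chi (j + i + 1) r a ^ (2 * i + 1) = 1 := by
    rw [← mul_pow, hχ, one_pow]
  rw [dtZero, tZero, show j + i + 1 - 1 - j = i by omega]
  rw [show 2 * (j + i + 1) = (2 * j + 1) + (2 * i + 1) by ring, pow_add] at hb
  have e : chi (j + i + 1) r a ^ (2 * i + 1) * (vp ℓ a : PowerSeries ℂ) =
      psi (j + i + 1) r a ^ (2 * j + 1) * delta := by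
    linear_combination (-(chi (j + i + 1) r a ^ (2 * i + 1) * (vp ℓ a : PowerSeries ℂ))) * hd -
      chi (j + i + 1) r a ^ (2 * i + 1) * delta * hb +
      delta * psi (j + i + 1) r a ^ (2 * j + 1) * hp
  rw [e]
  have h1 : ((2 * j + 1 : ℕ) : ℂ) ≠ 0 := by exact_mod_cast (2 * j).succ_ne_zero
  push_cast at *
  field_simp

theorem IsRootBranch.dt_self (hℓ : 1 ≤ ℓ) (hm : m ≤ ℓ) (h : IsRootBranch ℓ m U r₁ r₂)
    (ha : a ∈ U) (i : Fin ℓ) :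
    dt ℓ m r₁ r₂ a i a = degLG ℓ m i * flatLG ℓ m r₁ r₂ a i := by
  have hi := i.isLt
  by_cases hlt : (i : ℕ) < ℓ - m
  · have hB := h.branch₁ hℓ ha (by omega)
    rw [dt, if_pos hlt, degLG, if_pos hlt, flatLG_lt hℓ hm ((h.subset ha).1 (by omega)) hlt,
      hB.dtZero_self (by omega)]
    push_cast
    rfl
  · have hB := h.branch₂ hℓ ha (by omega)
    rw [dt, if_neg hlt, degLG, if_neg hlt, flatLG_ge hℓ ((h.subset ha).2 (by omega)) hlt,
      hB.dtZero_self (by omega)]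
    push_cast
    rfl

/-- The index paired with `i` by the metric. -/
def dualIdx (ℓ m : ℕ) (i : Fin ℓ) : Fin ℓ :=
  ⟨if (i : ℕ) < ℓ - m then ℓ - m - 1 - i else ℓ - 1 + (ℓ - m) - i, by
    have := i.isLt
    split_ifs <;> omega⟩

theorem flatGramLG_apply (hm : m ≤ ℓ) (α β : Fin ℓ) : flatGramLG ℓ m α β =
    if β = dualIdx ℓ m α then (if (α : ℕ) < ℓ - m then 2 * ((ℓ - m : ℕ) : ℂ) else 2 * (m : ℂ))
    else 0 := by
  have h1 := α.isLt
  have h2 := β.isLt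
  simp only [flatGramLG, Matrix.of_apply, dualIdx, Fin.ext_iff]
  split_ifs <;> first | rfl | omega

theorem flatGramLG_sum (hm : m ≤ ℓ) (x y : Fin ℓ → ℂ) :
    bil (flatGramLG ℓ m) x y = ∑ α : Fin ℓ, (if (α : ℕ) < ℓ - m then 2 * ((ℓ - m : ℕ) : ℂ) else 2 * (m : ℂ)) *
      x α * y (dualIdx ℓ m α) := by
  simp only [bil, dotProduct, Matrix.mulVec, flatGramLG_apply hm, ite_mul, zero_mul,
    Finset.sum_ite_eq', Finset.mem_univ, if_true]
  refine Finset.sum_congr rfl fun α _ => ?_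
  split_ifs <;> ring

/-- The metric in the flat coordinates. -/
theorem IsRootBranch.etaF_eq (hℓ : 1 ≤ ℓ) (hm : m ≤ ℓ) (h : IsRootBranch ℓ m U r₁ r₂)
    (ha : a ∈ U) (V W : Fin ℓ → ℂ) :
    etaF ℓ m a V W = bil (flatGramLG ℓ m) (fun i => dt ℓ m r₁ r₂ a i V)
      fun i => dt ℓ m r₁ r₂ a i W := by
  set χ := chi m r₂ a
  set χ' := chi (ℓ - m) (fun b => r₁ (sig ℓ b)) (sig ℓ a)
  set k := ℓ - m with hk
  let F : ℕ → ℂ := fun i => if i < k then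
      2 * (k : ℂ) * dtZero k χ' (k - 1 - i) (sig ℓ V) * dtZero k χ' i (sig ℓ W)
    else 2 * (m : ℂ) * dtZero m χ (ℓ - 1 - i) V * dtZero m χ (i - k) W
  have h1 : bil (flatGramLG ℓ m) (fun i => dt ℓ m r₁ r₂ a i V) (fun i => dt ℓ m r₁ r₂ a i W) =
      ∑ i ∈ Finset.range ℓ, F i := by
    rw [flatGramLG_sum hm, ← Fin.sum_univ_eq_sum_range]
    refine Finset.sum_congr rfl fun i _ => ?_
    have hi := i.isLt
    by_cases hlt : (i : ℕ) < k
    · have h2 : ((dualIdx ℓ m i : Fin ℓ) : ℕ) = k - 1 - i := by simp [dualIdx, ← hk, hlt]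
      simp only [F, if_pos hlt, dt, h2, ← hk]
      rw [if_pos (by omega), show k - 1 - (k - 1 - (i : ℕ)) = i by omega]
    · have h2 : ((dualIdx ℓ m i : Fin ℓ) : ℕ) = ℓ - 1 + k - i := by simp [dualIdx, ← hk, hlt]
      simp only [F, if_neg hlt, dt, h2, ← hk]
      rw [if_neg (by omega), show ℓ - 1 - (ℓ - 1 + k - (i : ℕ)) = i - k by omega]
  have hℓk : ℓ = k + m := by omega
  have h2 : ∑ i ∈ Finset.range ℓ, F i = ∑ i ∈ Finset.range k,
      2 * (k : ℂ) * dtZero k χ' i (sig ℓ V) * dtZero k χ' (k - 1 - i) (sig ℓ W) +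
      ∑ i ∈ Finset.range m, 2 * (m : ℂ) * dtZero m χ i V * dtZero m χ (m - 1 - i) W := by
    nth_rewrite 1 [hℓk]
    rw [Finset.sum_range_add, ← Finset.sum_range_reflect _ k, ← Finset.sum_range_reflect _ m]
    congr 1
    · refine Finset.sum_congr rfl fun i hi => ?_
      have := Finset.mem_range.mp hi
      simp only [F]
      rw [if_pos (by omega), show k - 1 - (k - 1 - i) = i by omega]
    · refine Finset.sum_congr rfl fun i hi => ?_
      have := Finset.mem_range.mp hi
      simp only [F]
      rw [if_neg (by omega), show ℓ - 1 - (k + (m - 1 - i)) = i by omega, Nat.add_sub_cancel_left]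
  -- G(1) is the sum of the coefficients of G. The m low ones give the block at p = 0; the ℓ-m high
  -- ones are the low ones at the reflected point and give the block at p = ∞.
  have h3 : etaF ℓ m a V W = (1 / 2) * ∑ i ∈ Finset.range k,
      (vp ℓ (gmap ℓ k (sig ℓ a) (sig ℓ V) (sig ℓ W))).coeff i +
      (1 / 2) * ∑ i ∈ Finset.range m, (vp ℓ (gmap ℓ m a V W)).coeff i := by
    rw [etaF, eval_eq_sum_range' (natDegree_vp_lt hℓ _), ← mul_add]
    congr 1
    simp only [one_pow, mul_one]
    nth_rewrite 1 [show ℓ = m + k by omega]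
    rw [Finset.sum_range_add, add_comm]
    congr 1
    rw [← Finset.sum_range_reflect _ k]
    refine Finset.sum_congr rfl fun i hi => ?_
    have := Finset.mem_range.mp hi
    rw [coeff_vp_gmap_sig hℓ hm (h.subset ha) V W (by omega)]
    congr 1
    omega
  rw [h1, h2, h3]
  congr 1
  · rcases Nat.eq_zero_or_pos k with h0 | h0
    · simp [h0]
    · exact (h.branch₁ hℓ ha (by omega)).sum_coeff_gmap (Nat.sub_le _ _)
        (sig_mem_spaceLG hℓ hm (h.subset ha)) _ _
  · rcases Nat.eq_zero_or_pos m with h0 | h0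
    · simp [h0]
    · exact (h.branch₂ hℓ ha h0).sum_coeff_gmap hm (h.subset ha) _ _

end

end GenFrob
end

noncomputable section
namespace GenFrob

/-! ### Bilinear forms, products and frames -/

section
variable {n : ℕ}

/-- `bil M` as a bilinear map. -/
def bilL (M : Matrix (Fin n) (Fin n) ℂ) : (Fin n → ℂ) →ₗ[ℂ] (Fin n → ℂ) →ₗ[ℂ] ℂ :=
  LinearMap.mk₂ ℂ (bil M)
    (fun X X' Y => by simp only [bil, add_dotProduct])
    (fun c X Y => by simp only [bil, smul_dotProduct])
    (fun X Y Y' => by simp only [bil, Matrix.mulVec_add, dotProduct_add])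
    (fun c X Y => by simp only [bil, Matrix.mulVec_smul, dotProduct_smul])

theorem bilL_apply (M : Matrix (Fin n) (Fin n) ℂ) (X Y : Fin n → ℂ) : bilL M X Y = bil M X Y := rfl

/-- `prod C` as a bilinear map. -/
def prodL (C : Fin n → Fin n → Fin n → ℂ) : (Fin n → ℂ) →ₗ[ℂ] (Fin n → ℂ) →ₗ[ℂ] (Fin n → ℂ) :=
  LinearMap.mk₂ ℂ (prod C)
    (fun X X' Y => by
      ext k; simp only [prod, Pi.add_apply, add_mul, Finset.sum_add_distrib])
    (fun c X Y => by
      ext k; simp only [prod, Pi.smul_apply, smul_eq_mul, Finset.mul_sum, mul_assoc])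
    (fun X Y Y' => by
      ext k; simp only [prod, Pi.add_apply, mul_add, add_mul, Finset.sum_add_distrib])
    (fun c X Y => by
      ext k
      simp only [prod, Pi.smul_apply, smul_eq_mul, Finset.mul_sum]
      exact Finset.sum_congr rfl fun i _ => Finset.sum_congr rfl fun j _ => by ring)

theorem prodL_apply (C : Fin n → Fin n → Fin n → ℂ) (X Y : Fin n → ℂ) :
    prodL C X Y = prod C X Y := rfl

theorem bil_single (M : Matrix (Fin n) (Fin n) ℂ) (i j : Fin n) :
    bil M (Pi.single i 1) (Pi.single j 1) = M i j := by
  simp [bil]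

theorem prod_single (C : Fin n → Fin n → Fin n → ℂ) (i j : Fin n) :
    prod C (Pi.single i 1) (Pi.single j 1) = C i j := by
  ext k
  rw [prod, Finset.sum_eq_single i, Finset.sum_eq_single j]
  · simp
  · intro b _ hb; simp [Pi.single_eq_of_ne hb]
  · simp
  · intro b _ hb; simp [Pi.single_eq_of_ne hb]
  · simp

theorem bil_comm {M : Matrix (Fin n) (Fin n) ℂ} (hM : M.IsSymm) (X Y : Fin n → ℂ) :
    bil M X Y = bil M Y X := by
  rw [bil, bil, Matrix.dotProduct_mulVec, ← Matrix.mulVec_transpose, hM.eq, dotProduct_comm]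

theorem bil_nondeg {M : Matrix (Fin n) (Fin n) ℂ} (hM : M.det ≠ 0) {Y : Fin n → ℂ}
    (h : ∀ X, bil M X Y = 0) : Y = 0 := by
  by_contra hY
  refine hM (Matrix.exists_mulVec_eq_zero_iff.mp ⟨Y, hY, ?_⟩)
  ext i
  have := h (Pi.single i 1)
  rwa [bil, single_dotProduct, one_mul] at this

variable {t : (Fin n → ℂ) → (Fin n → ℂ)} {x : Fin n → ℂ}

theorem fderiv_eq_jac_mulVec (t : (Fin n → ℂ) → (Fin n → ℂ)) (x V : Fin n → ℂ) :
    fderiv ℂ t x V = jac t x *ᵥ V := by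
  conv_lhs => rw [pi_eq_sum_univ' V]
  ext α
  simp only [map_sum, map_smul, Finset.sum_apply, Pi.smul_apply, smul_eq_mul, Matrix.mulVec,
    dotProduct, jac, Matrix.of_apply]
  exact Finset.sum_congr rfl fun i _ => mul_comm _ _

theorem fderiv_frame (h : (jac t x).det ≠ 0) (α : Fin n) :
    fderiv ℂ t x (frame t x α) = Pi.single α 1 := by
  have : frame t x α = (jac t x)⁻¹ *ᵥ Pi.single α 1 := by
    ext i; simp [frame]
  rw [fderiv_eq_jac_mulVec, this, Matrix.mulVec_mulVec,
    Matrix.mul_nonsing_inv _ (isUnit_iff_ne_zero.mpr h), Matrix.one_mulVec]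

theorem jac_injective (h : (jac t x).det ≠ 0) {V W : Fin n → ℂ}
    (hVW : fderiv ℂ t x V = fderiv ℂ t x W) : V = W := by
  rw [fderiv_eq_jac_mulVec, fderiv_eq_jac_mulVec] at hVW
  exact Matrix.mulVec_injective_of_isUnit ((Matrix.isUnit_iff_isUnit_det _).mpr
    (isUnit_iff_ne_zero.mpr h)) hVW

theorem frame_unique (h : (jac t x).det ≠ 0) {α : Fin n} {V : Fin n → ℂ}
    (hV : fderiv ℂ t x V = Pi.single α 1) : frame t x α = V :=
  jac_injective h (by rw [fderiv_frame h, hV])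

theorem sum_frame (h : (jac t x).det ≠ 0) (V : Fin n → ℂ) :
    ∑ α, fderiv ℂ t x V α • frame t x α = V := by
  apply jac_injective h
  rw [map_sum]
  simp only [map_smul, fderiv_frame h]
  exact (pi_eq_sum_univ' _).symm

theorem det_jac_ne_zero (h : ∀ V, fderiv ℂ t x V = 0 → V = 0) : (jac t x).det ≠ 0 := by
  intro h0
  obtain ⟨v, hv, h1⟩ := Matrix.exists_mulVec_eq_zero_iff.mpr h0
  exact hv (h v (by rw [fderiv_eq_jac_mulVec, h1]))

theorem differentiableAt_det {k : ℕ} {M : (Fin n → ℂ) → Matrix (Fin k) (Fin k) ℂ}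
    (h : ∀ i j, DifferentiableAt ℂ (fun y => M y i j) x) :
    DifferentiableAt ℂ (fun y => (M y).det) x := by
  simp only [Matrix.det_apply']
  exact DifferentiableAt.fun_sum fun σ _ =>
    (HasFDerivAt.finsetProd (g := fun i y => M y (σ i) i)
      fun i _ => (h (σ i) i).hasFDerivAt).differentiableAt.const_mul _

theorem differentiableAt_matrix_inv {k : ℕ} {M : (Fin n → ℂ) → Matrix (Fin k) (Fin k) ℂ}
    (h : ∀ i j, DifferentiableAt ℂ (fun y => M y i j) x) (h0 : (M x).det ≠ 0) (i j : Fin k) :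
    DifferentiableAt ℂ (fun y => (M y)⁻¹ i j) x := by
  simp only [Matrix.inv_def, Ring.inverse_eq_inv', Matrix.smul_apply, smul_eq_mul,
    Matrix.adjugate_apply]
  refine ((differentiableAt_det h).fun_inv h0).fun_mul (differentiableAt_det fun a b => ?_)
  by_cases ha : a = j
  · subst ha
    simp only [Matrix.updateRow_self]
    exact differentiableAt_const _
  · simp only [Matrix.updateRow_ne ha]
    exact h a b

theorem differentiableAt_frame (h : ∀ α i, DifferentiableAt ℂ (fun y => jac t y α i) x)
    (h0 : (jac t x).det ≠ 0) (α : Fin n) : DifferentiableAt ℂ (fun y => frame t y α) x :=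
  differentiableAt_pi.mpr fun i => differentiableAt_matrix_inv h h0 i α

/-- The product rule for a field of bilinear maps. -/
theorem fderiv_bilin {E F : Type*} [NormedAddCommGroup E] [NormedSpace ℂ E] [NormedAddCommGroup F]
    [NormedSpace ℂ F] {B : E → (Fin n → ℂ) →ₗ[ℂ] (Fin n → ℂ) →ₗ[ℂ] F} {u v : E → Fin n → ℂ} {a : E}
    (hB : ∀ V W, DifferentiableAt ℂ (fun y => B y V W) a) (hu : DifferentiableAt ℂ u a)
    (hv : DifferentiableAt ℂ v a) :
    DifferentiableAt ℂ (fun y => B y (u y) (v y)) a ∧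
      ∀ Z, fderiv ℂ (fun y => B y (u y) (v y)) a Z = fderiv ℂ (fun y => B y (u a) (v a)) a Z +
        B a (fderiv ℂ u a Z) (v a) + B a (u a) (fderiv ℂ v a Z) := by
  have key : ∀ (y : E) (V W : Fin n → ℂ), B y V W =
      ∑ i, ∑ j, (V i * W j) • B y (Pi.single i 1) (Pi.single j 1) := by
    intro y V W
    conv_lhs => rw [pi_eq_sum_univ' V, pi_eq_sum_univ' W]
    simp only [map_sum, map_smul, LinearMap.sum_apply, LinearMap.smul_apply, Finset.smul_sum,
      smul_smul]
    rw [Finset.sum_comm]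
    simp only [mul_comm]
  have hu' := fun i => (hasFDerivAt_pi'.mp hu.hasFDerivAt) i
  have hv' := fun i => (hasFDerivAt_pi'.mp hv.hasFDerivAt) i
  have h1 : HasFDerivAt (fun y => B y (u y) (v y)) (∑ i, ∑ j, (((u a i * v a j) •
      fderiv ℂ (fun y => B y (Pi.single i 1) (Pi.single j 1)) a +
      (u a i • (ContinuousLinearMap.proj j ∘L fderiv ℂ v a) +
        v a j • (ContinuousLinearMap.proj i ∘L fderiv ℂ u a)).smulRight
          (B a (Pi.single i 1) (Pi.single j 1))))) a := by
    simp only [key _ (u _) (v _)]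
    refine HasFDerivAt.fun_sum fun i _ => HasFDerivAt.fun_sum fun j _ => ?_
    exact ((hu' i).mul (hv' j)).smul (hB _ _).hasFDerivAt
  have h2 : HasFDerivAt (fun y => B y (u a) (v a)) (∑ i, ∑ j, ((u a i * v a j) •
      fderiv ℂ (fun y => B y (Pi.single i 1) (Pi.single j 1)) a)) a := by
    simp only [key _ (u a) (v a)]
    refine HasFDerivAt.fun_sum fun i _ => HasFDerivAt.fun_sum fun j _ => ?_
    exact (hB _ _).hasFDerivAt.const_smul _
  refine ⟨h1.differentiableAt, fun Z => ?_⟩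
  rw [h1.fderiv, h2.fderiv, key a (fderiv ℂ u a Z), key a (u a) (fderiv ℂ v a Z)]
  simp only [sum_apply, add_apply, ← Finset.sum_add_distrib]
  refine Finset.sum_congr rfl fun i _ => Finset.sum_congr rfl fun j _ => ?_
  simp only [ContinuousLinearMap.smulRight_apply, add_apply, smul_apply,
    ContinuousLinearMap.comp_apply, ContinuousLinearMap.proj_apply, smul_eq_mul, add_smul]
  rw [mul_comm (v a j)]
  abel

end

/-! ### Flat charts of Frobenius structures -/

section
variable {n : ℕ}

/-- The component `c_{αβγ}` in the coordinates `t`. -/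
def cfun (η : (Fin n → ℂ) → Matrix (Fin n) (Fin n) ℂ) (C : (Fin n → ℂ) → Fin n → Fin n → Fin n → ℂ)
    (t : (Fin n → ℂ) → (Fin n → ℂ)) (α β γ : Fin n) (y : Fin n → ℂ) : ℂ :=
  bil (η y) (prod (C y) (frame t y α) (frame t y β)) (frame t y γ)

/-- Homogeneous flat coordinates of a Frobenius structure of charge `1` with Euler field
`∑ x^i ∂_i`. -/
structure IsFrobChart (η : (Fin n → ℂ) → Matrix (Fin n) (Fin n) ℂ)
    (C : (Fin n → ℂ) → Fin n → Fin n → Fin n → ℂ) (V : Set (Fin n → ℂ))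
    (t : (Fin n → ℂ) → (Fin n → ℂ)) (d : Fin n → ℝ) (A : Matrix (Fin n) (Fin n) ℂ) : Prop where
  coords : IsLocalCoords V t
  gram : ∀ x ∈ V, ∀ α β, bil (η x) (frame t x α) (frame t x β) = A α β
  pos : ∀ α, 0 < d α
  euler : ∀ x ∈ V, ∀ α, fderiv ℂ t x x α = d α * t x α
  weight : ∀ α β, A α β * (1 - d α - d β) = 0
  diff : ∀ x ∈ V, ∀ α β γ, DifferentiableAt ℂ (cfun η C t α β γ) x
  potential : ∀ x ∈ V, ∀ α β γ ξ, pder t (cfun η C t α β γ) x ξ = pder t (cfun η C t ξ β γ) x α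
  scaling : ∀ x ∈ V, ∀ α β γ,
    fderiv ℂ (cfun η C t α β γ) x x = (2 - d α - d β - d γ) * cfun η C t α β γ x

/-- A Frobenius structure of charge `1` with Euler field `∑ x^i ∂_i`, with no unit required. -/
structure FrobData (U : Set (Fin n → ℂ)) (η : (Fin n → ℂ) → Matrix (Fin n) (Fin n) ℂ)
    (C : (Fin n → ℂ) → Fin n → Fin n → Fin n → ℂ) : Prop where
  isOpen : IsOpen U
  holo_metric : ∀ X Y, ∀ x ∈ U, DifferentiableAt ℂ (fun y => bil (η y) X Y) x
  holo_mul : ∀ X Y, ∀ x ∈ U, DifferentiableAt ℂ (fun y => prod (C y) X Y) x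
  symm : ∀ x ∈ U, (η x).IsSymm
  nondeg : ∀ x ∈ U, (η x).det ≠ 0
  comm : ∀ x ∈ U, ∀ X Y, prod (C x) X Y = prod (C x) Y X
  assoc : ∀ x ∈ U, ∀ X Y Z, prod (C x) (prod (C x) X Y) Z = prod (C x) X (prod (C x) Y Z)
  invariant : ∀ x ∈ U, ∀ X Y Z,
    bil (η x) (prod (C x) X Y) Z = bil (η x) X (prod (C x) Y Z)
  chart : ∀ x₀ ∈ U, ∃ V t d A, x₀ ∈ V ∧ V ⊆ U ∧ IsFrobChart η C V t d A
  lie_mul : ∀ x ∈ U, ∀ X Y, fderiv ℂ (fun y => prod (C y) X Y) x x = 0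
  lie_metric : ∀ x ∈ U, ∀ X Y, fderiv ℂ (fun y => bil (η y) X Y) x x = -bil (η x) X Y

variable {U V : Set (Fin n → ℂ)} {η : (Fin n → ℂ) → Matrix (Fin n) (Fin n) ℂ}
  {C : (Fin n → ℂ) → Fin n → Fin n → Fin n → ℂ} {t : (Fin n → ℂ) → (Fin n → ℂ)} {d : Fin n → ℝ}
  {A : Matrix (Fin n) (Fin n) ℂ}

theorem lieBracket_id_const (X x : Fin n → ℂ) :
    VectorField.lieBracket ℂ id (fun _ => X) x = -X := by
  simp [VectorField.lieBracket]

/-- For E = Σ x^i ∂_i and X constant, [E, X] = -X; so for charge 1 the axioms on Lie derivatives say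
that the multiplication is constant along E and the metric homogeneous of degree -1. -/
theorem FrobData.isGenFrobenius (h : FrobData U η C) {U' : Set (Fin n → ℂ)} (hU' : IsOpen U')
    (hsub : U' ⊆ U) {e : (Fin n → ℂ) → (Fin n → ℂ)} (he : DifferentiableOn ℂ e U')
    (hone : ∀ x ∈ U', ∀ X, prod (C x) (e x) X = X) : IsGenFrobenius U' η C e id 1 where
  isOpen := hU'
  holo_metric i j x hx := by
    have := h.holo_metric (Pi.single i 1) (Pi.single j 1) x (hsub hx)
    simp only [bil_single] at this
    exact this.differentiableWithinAt
  holo_mul i j k x hx := by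
    have := h.holo_mul (Pi.single i 1) (Pi.single j 1) x (hsub hx)
    simp only [prod_single] at this
    exact (differentiableAt_pi.mp this k).differentiableWithinAt
  holo_unit := he
  holo_euler := differentiableOn_id
  symm x hx := h.symm x (hsub hx)
  nondeg x hx := h.nondeg x (hsub hx)
  comm x hx := h.comm x (hsub hx)
  assoc x hx := h.assoc x (hsub hx)
  one_mul := hone
  invariant x hx := h.invariant x (hsub hx)
  flat x₀ hx₀ := by
    obtain ⟨V, t, d, A, hV, hVU, hc⟩ := h.chart x₀ (hsub hx₀)
    refine ⟨V ∩ U', t, ⟨hV, hx₀⟩, Set.inter_subset_right, ⟨⟨hc.coords.isOpen.inter hU',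
      hc.coords.holo.mono Set.inter_subset_left, fun x hx => hc.coords.jac_ne x hx.1⟩, A,
      fun x hx => hc.gram x hx.1⟩, fun x hx α β γ ξ => hc.potential x hx.1 α β γ ξ,
      Matrix.diagonal fun α => (d α : ℂ), 0, fun x hx => ?_⟩
    ext α
    rw [add_zero, Matrix.mulVec_diagonal]
    exact hc.euler x hx.1 α
  lie_mul x hx X Y := by
    have hX := lieBracket_id_const X x
    have hY := lieBracket_id_const Y x
    rw [hX, hY, VectorField.lieBracket]
    simp only [id_eq, fderiv_id, ContinuousLinearMap.id_apply]
    rw [h.lie_mul x (hsub hx), ← prodL_apply, ← prodL_apply, ← prodL_apply, map_neg, map_neg,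
      LinearMap.neg_apply]
    abel
  lie_metric x hx X Y := by
    rw [lieBracket_id_const, lieBracket_id_const, id_eq, h.lie_metric x (hsub hx), ← bilL_apply,
      ← bilL_apply, ← bilL_apply, map_neg, map_neg, LinearMap.neg_apply]
    push_cast
    ring

/-! ### Transport by a linear isomorphism -/

theorem fderiv_comp_symm {F : Type*} [NormedAddCommGroup F] [NormedSpace ℂ F]
    (h : (Fin n → ℂ) ≃L[ℂ] (Fin n → ℂ)) (f : (Fin n → ℂ) → F) (z Z : Fin n → ℂ) :
    fderiv ℂ (fun y => f (h.symm y)) z Z = fderiv ℂ f (h.symm z) (h.symm Z) := by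
  have := h.symm.comp_right_fderiv (f := f) (x := z)
  rw [show (fun y => f (h.symm y)) = f ∘ h.symm from rfl, this]
  rfl

theorem det_jac_comp_symm (h : (Fin n → ℂ) ≃L[ℂ] (Fin n → ℂ)) {z : Fin n → ℂ}
    (h0 : (jac t (h.symm z)).det ≠ 0) : (jac (fun y => t (h.symm y)) z).det ≠ 0 := by
  apply det_jac_ne_zero
  intro V hV
  rw [fderiv_comp_symm] at hV
  have := jac_injective h0 (W := 0) (by rw [hV, map_zero])
  simpa using this

theorem frame_comp_symm (h : (Fin n → ℂ) ≃L[ℂ] (Fin n → ℂ)) {z : Fin n → ℂ}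
    (h0 : (jac t (h.symm z)).det ≠ 0) (α : Fin n) :
    frame (fun y => t (h.symm y)) z α = h (frame t (h.symm z) α) := by
  apply frame_unique (det_jac_comp_symm h h0)
  rw [fderiv_comp_symm, h.symm_apply_apply, fderiv_frame h0]

section
variable {η' : (Fin n → ℂ) → Matrix (Fin n) (Fin n) ℂ} {C' : (Fin n → ℂ) → Fin n → Fin n → Fin n → ℂ}
  {s : ℂ} {h : (Fin n → ℂ) ≃L[ℂ] (Fin n → ℂ)}

/-- A linear isomorphism preserves the Euler field Σ x^i ∂_i, and a constant factor in the metric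
affects no identity; the degrees of the coordinates stay the same. -/
theorem IsFrobChart.transport (hc : IsFrobChart η C V t d A)
    (hη : ∀ z, h.symm z ∈ V → ∀ X Y, bil (η' z) X Y = s * bil (η (h.symm z)) (h.symm X) (h.symm Y))
    (hC : ∀ z, h.symm z ∈ V → ∀ X Y, prod (C' z) X Y = h (prod (C (h.symm z)) (h.symm X) (h.symm Y))) :
    IsFrobChart η' C' (h.symm ⁻¹' V) (fun y => t (h.symm y)) d (s • A) := by
  have hopen : IsOpen (h.symm ⁻¹' V) := hc.coords.isOpen.preimage h.symm.continuous
  have hframe : ∀ z, h.symm z ∈ V → ∀ α, frame (fun y => t (h.symm y)) z α =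
      h (frame t (h.symm z) α) := fun z hz α => frame_comp_symm h (hc.coords.jac_ne _ hz) α
  have hcf : ∀ α β γ z, h.symm z ∈ V → cfun η' C' (fun y => t (h.symm y)) α β γ z =
      s * cfun η C t α β γ (h.symm z) := by
    intro α β γ z hz
    rw [cfun, hη z hz, hC z hz, hframe z hz, hframe z hz, hframe z hz, h.symm_apply_apply,
      h.symm_apply_apply, h.symm_apply_apply, h.symm_apply_apply, cfun]
  have hev : ∀ α β γ z, h.symm z ∈ V → cfun η' C' (fun y => t (h.symm y)) α β γ =ᶠ[𝓝 z]
      fun y => s * cfun η C t α β γ (h.symm y) := by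
    intro α β γ z hz
    filter_upwards [hopen.mem_nhds hz] with y hy using hcf α β γ y hy
  have hd : ∀ α β γ z, h.symm z ∈ V →
      DifferentiableAt ℂ (fun y => cfun η C t α β γ (h.symm y)) z := fun α β γ z hz =>
    (hc.diff _ hz α β γ).comp z h.symm.differentiableAt
  have hfd : ∀ α β γ z, h.symm z ∈ V → ∀ Z, fderiv ℂ (cfun η' C' (fun y => t (h.symm y)) α β γ) z Z =
      s * fderiv ℂ (cfun η C t α β γ) (h.symm z) (h.symm Z) := by
    intro α β γ z hz Z
    rw [(hev α β γ z hz).fderiv_eq, fderiv_const_mul (hd α β γ z hz), smul_apply, smul_eq_mul,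
      fderiv_comp_symm]
  refine ⟨⟨hopen, ?_, ?_⟩, ?_, hc.pos, ?_, ?_, ?_, ?_, ?_⟩
  · exact hc.coords.holo.comp h.symm.differentiable.differentiableOn fun x hx => hx
  · exact fun z hz => det_jac_comp_symm h (hc.coords.jac_ne _ hz)
  · intro z hz α β
    rw [hη z hz, hframe z hz, hframe z hz, h.symm_apply_apply, h.symm_apply_apply,
      hc.gram _ hz, Matrix.smul_apply, smul_eq_mul]
  · intro z hz α
    rw [fderiv_comp_symm, hc.euler _ hz]
  · intro α β
    rw [Matrix.smul_apply, smul_eq_mul, mul_assoc, hc.weight, mul_zero]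
  · intro z hz α β γ
    exact ((hd α β γ z hz).const_mul s).congr_of_eventuallyEq (hev α β γ z hz)
  · intro z hz α β γ ξ
    rw [pder, pder, hfd _ _ _ z hz, hfd _ _ _ z hz, hframe z hz, hframe z hz, h.symm_apply_apply,
      h.symm_apply_apply]
    congr 1
    exact hc.potential _ hz α β γ ξ
  · intro z hz α β γ
    rw [hfd _ _ _ z hz, hcf _ _ _ z hz, hc.scaling _ hz]
    ring

theorem FrobData.transport (hF : FrobData U η C) (hs : s ≠ 0)
    (hη : ∀ z, h.symm z ∈ U → ∀ X Y, bil (η' z) X Y = s * bil (η (h.symm z)) (h.symm X) (h.symm Y))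
    (hC : ∀ z, h.symm z ∈ U → ∀ X Y, prod (C' z) X Y = h (prod (C (h.symm z)) (h.symm X) (h.symm Y))) :
    FrobData (h.symm ⁻¹' U) η' C' := by
  have hopen : IsOpen (h.symm ⁻¹' U) := hF.isOpen.preimage h.symm.continuous
  have hη1 : ∀ X Y z, h.symm z ∈ U → (fun y => bil (η' y) X Y) =ᶠ[𝓝 z]
      fun y => s * bil (η (h.symm y)) (h.symm X) (h.symm Y) := by
    intro X Y z hz
    filter_upwards [hopen.mem_nhds hz] with y hy using hη y hy X Y
  have hC1 : ∀ X Y z, h.symm z ∈ U → (fun y => prod (C' y) X Y) =ᶠ[𝓝 z]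
      fun y => h (prod (C (h.symm y)) (h.symm X) (h.symm Y)) := by
    intro X Y z hz
    filter_upwards [hopen.mem_nhds hz] with y hy using hC y hy X Y
  have hη2 : ∀ X Y z, h.symm z ∈ U → DifferentiableAt ℂ (fun y => bil (η (h.symm y)) X Y) z :=
    fun X Y z hz => (hF.holo_metric X Y _ hz).comp z h.symm.differentiableAt
  have hC2 : ∀ X Y z, h.symm z ∈ U → DifferentiableAt ℂ (fun y => prod (C (h.symm y)) X Y) z :=
    fun X Y z hz => (hF.holo_mul X Y _ hz).comp z h.symm.differentiableAt
  refine ⟨hopen, ?_, ?_, ?_, ?_, ?_, ?_, ?_, ?_, ?_, ?_⟩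
  · exact fun X Y z hz => ((hη2 _ _ z hz).const_mul s).congr_of_eventuallyEq (hη1 X Y z hz)
  · exact fun X Y z hz => (h.differentiableAt.comp z (hC2 _ _ z hz)).congr_of_eventuallyEq
      (hC1 X Y z hz)
  · intro z hz
    ext i j
    rw [Matrix.transpose_apply, ← bil_single (η' z), ← bil_single (η' z), hη z hz, hη z hz,
      bil_comm (hF.symm _ hz)]
  · intro z hz h0
    obtain ⟨v, hv, h1⟩ := Matrix.exists_mulVec_eq_zero_iff.mpr h0
    apply hv
    have : h.symm v = 0 := by
      apply bil_nondeg (hF.nondeg _ hz)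
      intro X
      have h2 := hη z hz (h X) v
      rw [h.symm_apply_apply, bil, h1, dotProduct_zero] at h2
      exact (mul_eq_zero.mp h2.symm).resolve_left hs
    simpa using this
  · intro z hz X Y
    rw [hC z hz, hC z hz, hF.comm _ hz]
  · intro z hz X Y Z
    rw [hC z hz, hC z hz, hC z hz, hC z hz, h.symm_apply_apply, h.symm_apply_apply, hF.assoc _ hz]
  · intro z hz X Y Z
    rw [hη z hz, hη z hz, hC z hz, hC z hz, h.symm_apply_apply, h.symm_apply_apply,
      hF.invariant _ hz]
  · intro z hz
    obtain ⟨V, t, d, A, hV, hVU, hc⟩ := hF.chart _ hz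
    exact ⟨_, _, _, _, hV, fun x hx => hVU hx, hc.transport (fun z hz => hη z (hVU hz))
      fun z hz => hC z (hVU hz)⟩
  · intro z hz X Y
    rw [(hC1 X Y z hz).fderiv_eq]
    have := h.comp_fderiv (f := fun y => prod (C (h.symm y)) (h.symm X) (h.symm Y)) (x := z)
    rw [show (fun y => h (prod (C (h.symm y)) (h.symm X) (h.symm Y))) =
      h ∘ fun y => prod (C (h.symm y)) (h.symm X) (h.symm Y) from rfl, this,
      ContinuousLinearMap.comp_apply,
      fderiv_comp_symm h (fun y => prod (C y) (h.symm X) (h.symm Y)), hF.lie_mul _ hz, map_zero]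
  · intro z hz X Y
    rw [(hη1 X Y z hz).fderiv_eq, fderiv_const_mul (hη2 _ _ z hz), smul_apply, smul_eq_mul,
      fderiv_comp_symm h (fun y => bil (η y) (h.symm X) (h.symm Y)), hF.lie_metric _ hz, hη z hz]
    ring

end

end

end GenFrob
end

noncomputable section
namespace GenFrob

section
variable {n : ℕ}

/-- The product rule for a field of linear maps. -/
theorem fderiv_lin {E F : Type*} [NormedAddCommGroup E] [NormedSpace ℂ E] [NormedAddCommGroup F]
    [NormedSpace ℂ F] {B : E → (Fin n → ℂ) →ₗ[ℂ] F} {u : E → Fin n → ℂ} {a : E}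
    (hB : ∀ V, DifferentiableAt ℂ (fun y => B y V) a) (hu : DifferentiableAt ℂ u a) :
    DifferentiableAt ℂ (fun y => B y (u y)) a ∧
      ∀ Z, fderiv ℂ (fun y => B y (u y)) a Z = fderiv ℂ (fun y => B y (u a)) a Z +
        B a (fderiv ℂ u a Z) := by
  have key : ∀ (y : E) (V : Fin n → ℂ), B y V = ∑ i, V i • B y (Pi.single i 1) := by
    intro y V
    conv_lhs => rw [pi_eq_sum_univ' V]
    simp only [map_sum, map_smul]
  have hu' := fun i => (hasFDerivAt_pi'.mp hu.hasFDerivAt) i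
  have h1 : HasFDerivAt (fun y => B y (u y)) (∑ i, (u a i • fderiv ℂ (fun y => B y (Pi.single i 1)) a +
      (ContinuousLinearMap.proj i ∘L fderiv ℂ u a).smulRight (B a (Pi.single i 1)))) a := by
    simp only [key _ (u _)]
    exact HasFDerivAt.fun_sum fun i _ => (hu' i).smul (hB _).hasFDerivAt
  have h2 : HasFDerivAt (fun y => B y (u a))
      (∑ i, (u a i • fderiv ℂ (fun y => B y (Pi.single i 1)) a)) a := by
    simp only [key _ (u a)]
    exact HasFDerivAt.fun_sum fun i _ => (hB _).hasFDerivAt.const_smul _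
  refine ⟨h1.differentiableAt, fun Z => ?_⟩
  rw [h1.fderiv, h2.fderiv, key a (fderiv ℂ u a Z)]
  simp only [sum_apply, add_apply, ← Finset.sum_add_distrib]
  rfl

end

/-! ### The Frobenius structure on the space of superpotentials -/

section
variable {ℓ m : ℕ} {a : Fin ℓ → ℂ}

theorem exists_root_branch {P : Prop} {f : (Fin ℓ → ℂ) → ℂ} (hf : Continuous f) {n : ℕ}
    (hn : P → 0 < n) (h0 : P → f a ≠ 0) :
    ∃ (V : Set (Fin ℓ → ℂ)) (r : (Fin ℓ → ℂ) → ℂ), IsOpen V ∧ a ∈ V ∧ ContinuousOn r V ∧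
      (P → ∀ b ∈ V, r b ^ n = f b) := by
  by_cases hP : P
  · have hn := hn hP
    have h0 := h0 hP
    obtain ⟨c, hc⟩ := IsAlgClosed.exists_pow_nat_eq (f a) hn
    have hcont : Continuous fun b => f b / f a := hf.div_const _
    refine ⟨(fun b => f b / f a) ⁻¹' Complex.slitPlane, fun b => c * (f b / f a) ^ (1 / (n : ℂ)),
      Complex.isOpen_slitPlane.preimage hcont, ?_, ?_, fun _ b _ => ?_⟩
    · rw [Set.mem_preimage, div_self h0]
      exact Complex.one_mem_slitPlane
    · exact continuousOn_const.mul (hcont.continuousOn.cpow continuousOn_const fun b hb => hb)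
    · have hn0 : (n : ℂ) ≠ 0 := by exact_mod_cast hn.ne'
      rw [mul_pow, hc, ← Complex.cpow_nat_mul, mul_one_div_cancel hn0, Complex.cpow_one,
        mul_div_cancel₀ _ h0]
  · exact ⟨Set.univ, 0, isOpen_univ, Set.mem_univ _, continuousOn_const, fun h => absurd h hP⟩

theorem exists_isRootBranch (ha : a ∈ spaceLG ℓ m) :
    ∃ V r₁ r₂, a ∈ V ∧ IsRootBranch ℓ m V r₁ r₂ := by
  obtain ⟨V₁, r₁, ho₁, ha₁, hc₁, hp₁⟩ := exists_root_branch (P := m < ℓ) (continuous_entry 0)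
    (n := 2 * (ℓ - m)) (fun h => by omega) ha.1
  obtain ⟨V₂, r₂, ho₂, ha₂, hc₂, hp₂⟩ := exists_root_branch (P := 0 < m)
    (continuous_entry (ℓ - 1)).neg (n := 2 * m) (fun h => by omega)
    (fun h => neg_ne_zero.mpr (ha.2 h))
  exact ⟨V₁ ∩ V₂ ∩ spaceLG ℓ m, r₁, r₂, ⟨⟨ha₁, ha₂⟩, ha⟩, (ho₁.inter ho₂).inter (isOpen_spaceLG ℓ m),
    fun b hb => hb.2, hc₁.mono fun b hb => hb.1.1, hc₂.mono fun b hb => hb.1.2,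
    fun h b hb => hp₁ h b hb.1.1, fun h b hb => hp₂ h b hb.1.2⟩

variable {r₁ r₂ : (Fin ℓ → ℂ) → ℂ} {U : Set (Fin ℓ → ℂ)}

theorem IsRootBranch.fderiv_apply (hℓ : 1 ≤ ℓ) (hm : m ≤ ℓ) (h : IsRootBranch ℓ m U r₁ r₂)
    (ha : a ∈ U) : DifferentiableAt ℂ (flatLG ℓ m r₁ r₂) a ∧
      ∀ V i, fderiv ℂ (flatLG ℓ m r₁ r₂) a V i = dt ℓ m r₁ r₂ a i V := by
  have h1 : DifferentiableAt ℂ (flatLG ℓ m r₁ r₂) a :=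
    differentiableAt_pi.mpr fun i => (h.fderiv_flatLG hℓ hm ha i).1
  refine ⟨h1, fun V i => ?_⟩
  rw [← (h.fderiv_flatLG hℓ hm ha i).2, (hasFDerivAt_pi'.mp h1.hasFDerivAt i).fderiv]
  rfl

/-- The metric is a form in the dt's, so a vector killed by all of them lies in its radical. -/
theorem IsRootBranch.det_jac_ne_zero (hℓ : 1 ≤ ℓ) (hm : m ≤ ℓ) (h : IsRootBranch ℓ m U r₁ r₂)
    (ha : a ∈ U) : (jac (flatLG ℓ m r₁ r₂) a).det ≠ 0 := by
  apply GenFrob.det_jac_ne_zero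
  intro V hV
  apply etaF_nondeg hℓ hm (h.subset ha)
  intro W
  have : (fun i => dt ℓ m r₁ r₂ a i V) = 0 := by
    ext i
    rw [← (h.fderiv_apply hℓ hm ha).2, hV]
  rw [h.etaF_eq hℓ hm ha, this, bil, Matrix.mulVec_zero, dotProduct_zero]

theorem differentiableAt_etaF (hm : m ≤ ℓ) (ha : a ∈ spaceLG ℓ m) (V W : Fin ℓ → ℂ) :
    DifferentiableAt ℂ (fun b => etaF ℓ m b V W) a ∧
      ∀ Z, fderiv ℂ (fun b => etaF ℓ m b V W) a Z =
        (1 / 2) * (vp ℓ (dgmap ℓ m a V W Z)).eval 1 := by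
  have h1 := (differentiableAt_gmap hm ha V W).hasFDerivAt
  have h2 := ((evCLM ℓ 1).hasFDerivAt.comp a h1).const_mul (1 / 2 : ℂ)
  have h3 : HasFDerivAt (fun b => etaF ℓ m b V W) _ a := h2
  exact ⟨h3.differentiableAt, fun Z => by rw [h3.fderiv]; rfl⟩

/-- The metric is covariantly constant. -/
theorem IsRootBranch.fderiv_etaF (hℓ : 1 ≤ ℓ) (hm : m ≤ ℓ) (h : IsRootBranch ℓ m U r₁ r₂)
    (ha : a ∈ U) (V W Z : Fin ℓ → ℂ) :
    fderiv ℂ (fun b => etaF ℓ m b V W) a Z =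
      etaF ℓ m a (gam ℓ m a Z V) W + etaF ℓ m a V (gam ℓ m a Z W) := by
  have he : (fun b => etaF ℓ m b V W) =ᶠ[𝓝 a] fun b => bilL (flatGramLG ℓ m)
      (fun i => dt ℓ m r₁ r₂ b i V) fun i => dt ℓ m r₁ r₂ b i W := by
    filter_upwards [h.isOpen.mem_nhds ha] with b hb using h.etaF_eq hℓ hm hb V W
  have hd : ∀ V, DifferentiableAt ℂ (fun b => fun i => dt ℓ m r₁ r₂ b i V) a := fun V =>
    differentiableAt_pi.mpr fun i => (h.fderiv_dt hℓ hm ha i V).1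
  have hd' : ∀ V, fderiv ℂ (fun b => fun i => dt ℓ m r₁ r₂ b i V) a Z =
      fun i => dt ℓ m r₁ r₂ a i (gam ℓ m a Z V) := by
    intro V
    ext i
    rw [← (h.fderiv_dt hℓ hm ha i V).2, (hasFDerivAt_pi'.mp (hd V).hasFDerivAt i).fderiv]
    rfl
  have h1 := (fderiv_bilin (B := fun _ : Fin ℓ → ℂ => bilL (flatGramLG ℓ m))
    (fun _ _ => differentiableAt_const _) (hd V) (hd W)).2 Z
  rw [he.fderiv_eq, h1, hd', hd', h.etaF_eq hℓ hm ha, h.etaF_eq hℓ hm ha]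
  simp [bilL_apply]

/-- Differentiating dt^β(∂_α) = δ along Z and using that the Hessian of t^β is dt^β(Γ) shows that
the frame is parallel. -/
theorem IsRootBranch.fderiv_frame (hℓ : 1 ≤ ℓ) (hm : m ≤ ℓ) (h : IsRootBranch ℓ m U r₁ r₂)
    (ha : a ∈ U) (α : Fin ℓ) : DifferentiableAt ℂ (fun b => frame (flatLG ℓ m r₁ r₂) b α) a ∧
      ∀ Z, fderiv ℂ (fun b => frame (flatLG ℓ m r₁ r₂) b α) a Z =
        -gam ℓ m a Z (frame (flatLG ℓ m r₁ r₂) a α) := by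
  have hU := h.isOpen.mem_nhds ha
  have hL : ∀ β V, (fun b => (fderiv ℂ (flatLG ℓ m r₁ r₂) b V) β) =ᶠ[𝓝 a]
      fun b => dt ℓ m r₁ r₂ b β V := by
    intro β V
    filter_upwards [hU] with b hb using (h.fderiv_apply hℓ hm hb).2 V β
  have hLd : ∀ β V, DifferentiableAt ℂ (fun b => (fderiv ℂ (flatLG ℓ m r₁ r₂) b V) β) a :=
    fun β V => (h.fderiv_dt hℓ hm ha β V).1.congr_of_eventuallyEq (hL β V)
  have hF := differentiableAt_frame (t := flatLG ℓ m r₁ r₂) (fun β i => hLd β (Pi.single i 1))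
    (h.det_jac_ne_zero hℓ hm ha) α
  refine ⟨hF, fun Z => ?_⟩
  apply jac_injective (h.det_jac_ne_zero hℓ hm ha)
  ext β
  have h1 := (fderiv_lin (B := fun b : Fin ℓ → ℂ => (LinearMap.proj (φ := fun _ => ℂ) β : (Fin ℓ → ℂ) →ₗ[ℂ] ℂ) ∘ₗ
    (fderiv ℂ (flatLG ℓ m r₁ r₂) b : (Fin ℓ → ℂ) →ₗ[ℂ] (Fin ℓ → ℂ))) (hLd β) hF).2 Z
  have h2 : (fun b : Fin ℓ → ℂ => ((LinearMap.proj (φ := fun _ => ℂ) β : (Fin ℓ → ℂ) →ₗ[ℂ] ℂ) ∘ₗ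
      (fderiv ℂ (flatLG ℓ m r₁ r₂) b : (Fin ℓ → ℂ) →ₗ[ℂ] (Fin ℓ → ℂ))) (frame (flatLG ℓ m r₁ r₂) b α)) =ᶠ[𝓝 a]
      fun _ => (Pi.single α 1 : Fin ℓ → ℂ) β := by
    filter_upwards [hU] with b hb
    exact congrFun (GenFrob.fderiv_frame (h.det_jac_ne_zero hℓ hm hb) α) β
  rw [h2.fderiv_eq] at h1
  have h3 : fderiv ℂ (fun b : Fin ℓ → ℂ => ((LinearMap.proj (φ := fun _ => ℂ) β : (Fin ℓ → ℂ) →ₗ[ℂ] ℂ) ∘ₗ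
      (fderiv ℂ (flatLG ℓ m r₁ r₂) b : (Fin ℓ → ℂ) →ₗ[ℂ] (Fin ℓ → ℂ))) (frame (flatLG ℓ m r₁ r₂) a α)) a Z =
      dt ℓ m r₁ r₂ a β (gam ℓ m a Z (frame (flatLG ℓ m r₁ r₂) a α)) := by
    rw [← (h.fderiv_dt hℓ hm ha β _).2]
    exact congrArg (fun L : (Fin ℓ → ℂ) →L[ℂ] ℂ => L Z) (hL β _).fderiv_eq
  rw [h3, ← (h.fderiv_apply hℓ hm ha).2] at h1
  simp only [fderiv_fun_const, Pi.zero_apply, zero_apply] at h1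
  rw [map_neg, Pi.neg_apply]
  exact (neg_eq_of_add_eq_zero_right h1.symm).symm

/-- Differentiating dt^β(E) = d_β t^β along ∂_α gives dt^β(Γ(∂_α,E)) + dt^β(∂_α) = d_β dt^β(∂_α). -/
theorem IsRootBranch.gam_frame (hℓ : 1 ≤ ℓ) (hm : m ≤ ℓ) (h : IsRootBranch ℓ m U r₁ r₂)
    (ha : a ∈ U) (α : Fin ℓ) : gam ℓ m a a (frame (flatLG ℓ m r₁ r₂) a α) =
      ((degLG ℓ m α : ℂ) - 1) • frame (flatLG ℓ m r₁ r₂) a α := by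
  have hU := h.isOpen.mem_nhds ha
  set F := frame (flatLG ℓ m r₁ r₂) a α with hFdef
  apply jac_injective (h.det_jac_ne_zero hℓ hm ha)
  rw [map_smul, GenFrob.fderiv_frame (h.det_jac_ne_zero hℓ hm ha)]
  ext β
  have hL : ∀ V, (fun b => (fderiv ℂ (flatLG ℓ m r₁ r₂) b V) β) =ᶠ[𝓝 a]
      fun b => dt ℓ m r₁ r₂ b β V := by
    intro V
    filter_upwards [hU] with b hb using (h.fderiv_apply hℓ hm hb).2 V β
  have hLd : ∀ V, DifferentiableAt ℂ (fun b => (fderiv ℂ (flatLG ℓ m r₁ r₂) b V) β) a :=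
    fun V => (h.fderiv_dt hℓ hm ha β V).1.congr_of_eventuallyEq (hL V)
  have h1 := (fderiv_lin (B := fun b : Fin ℓ → ℂ => (LinearMap.proj (φ := fun _ => ℂ) β : (Fin ℓ → ℂ) →ₗ[ℂ] ℂ) ∘ₗ
    (fderiv ℂ (flatLG ℓ m r₁ r₂) b : (Fin ℓ → ℂ) →ₗ[ℂ] (Fin ℓ → ℂ))) (u := fun b => b) hLd differentiableAt_id).2 F
  have h2 : (fun b : Fin ℓ → ℂ => ((LinearMap.proj (φ := fun _ => ℂ) β : (Fin ℓ → ℂ) →ₗ[ℂ] ℂ) ∘ₗ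
      (fderiv ℂ (flatLG ℓ m r₁ r₂) b : (Fin ℓ → ℂ) →ₗ[ℂ] (Fin ℓ → ℂ))) b) =ᶠ[𝓝 a]
      fun b => (degLG ℓ m β : ℂ) * flatLG ℓ m r₁ r₂ b β := by
    filter_upwards [hU] with b hb
    rw [← h.dt_self hℓ hm hb, ← (h.fderiv_apply hℓ hm hb).2]
    rfl
  have h3 : fderiv ℂ (fun b : Fin ℓ → ℂ => ((LinearMap.proj (φ := fun _ => ℂ) β : (Fin ℓ → ℂ) →ₗ[ℂ] ℂ) ∘ₗ
      (fderiv ℂ (flatLG ℓ m r₁ r₂) b : (Fin ℓ → ℂ) →ₗ[ℂ] (Fin ℓ → ℂ))) a) a F =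
      dt ℓ m r₁ r₂ a β (gam ℓ m a F a) := by
    rw [← (h.fderiv_dt hℓ hm ha β _).2]
    exact congrArg (fun L : (Fin ℓ → ℂ) →L[ℂ] ℂ => L F) (hL a).fderiv_eq
  have h4 : dt ℓ m r₁ r₂ a β F = (Pi.single α 1 : Fin ℓ → ℂ) β := by
    rw [← (h.fderiv_apply hℓ hm ha).2, hFdef, GenFrob.fderiv_frame (h.det_jac_ne_zero hℓ hm ha)]
  rw [h2.fderiv_eq, h3, fderiv_const_mul (h.fderiv_flatLG hℓ hm ha β).1, smul_apply,
    (h.fderiv_flatLG hℓ hm ha β).2, h4, smul_eq_mul, fderiv_fun_id] at h1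
  rw [(h.fderiv_apply hℓ hm ha).2, gam_comm, Pi.smul_apply, smul_eq_mul]
  have h5 : ((LinearMap.proj β : (Fin ℓ → ℂ) →ₗ[ℂ] ℂ) ∘ₗ
      (fderiv ℂ (flatLG ℓ m r₁ r₂) a : (Fin ℓ → ℂ) →ₗ[ℂ] (Fin ℓ → ℂ))) (ContinuousLinearMap.id ℂ (Fin ℓ → ℂ) F) =
      (Pi.single α 1 : Fin ℓ → ℂ) β := by
    rw [← h4, ← (h.fderiv_apply hℓ hm ha).2]
    rfl
  rw [h5] at h1
  by_cases hβ : β = α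
  · subst hβ
    linear_combination -h1
  · rw [Pi.single_eq_of_ne hβ] at h1 ⊢
    linear_combination -h1

/-- The covariant derivative of the multiplication. -/
def nablaS (ℓ m : ℕ) (a Z V Y : Fin ℓ → ℂ) : Fin ℓ → ℂ :=
  dsmap ℓ m a V Y Z + gam ℓ m a Z (smap ℓ m a V Y) - smap ℓ m a (gam ℓ m a Z V) Y -
    smap ℓ m a V (gam ℓ m a Z Y)

theorem nablaS_symm (hm : m ≤ ℓ) (ha : a ∈ spaceLG ℓ m) (Z V Y : Fin ℓ → ℂ) :
    nablaS ℓ m a Z V Y = nablaS ℓ m a V Z Y := by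
  have := nabla_smap_symm hm ha Z V Y
  rw [nablaS, nablaS, gam_comm V Z, sub_right_comm, this, sub_right_comm]

theorem cfunLG_eq (hℓ : 1 ≤ ℓ) (hm : m ≤ ℓ) (ha : a ∈ spaceLG ℓ m)
    (t : (Fin ℓ → ℂ) → (Fin ℓ → ℂ)) (α β γ : Fin ℓ) :
    cfun (etaMatLG ℓ m) (mulLG ℓ m) t α β γ a =
      etaL ℓ m a (smap ℓ m a (frame t a α) (frame t a β)) (frame t a γ) := by
  rw [cfun, bil_etaMatLG hℓ hm ha, prod_mulLG hℓ hm ha, etaL_apply]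

/-- The frame is parallel and the metric covariantly constant, so only the covariant derivative of
the product remains. -/
theorem IsRootBranch.fderiv_cfun (hℓ : 1 ≤ ℓ) (hm : m ≤ ℓ) (h : IsRootBranch ℓ m U r₁ r₂)
    (ha : a ∈ U) (α β γ : Fin ℓ) :
    DifferentiableAt ℂ (cfun (etaMatLG ℓ m) (mulLG ℓ m) (flatLG ℓ m r₁ r₂) α β γ) a ∧
    ∀ Z, fderiv ℂ (cfun (etaMatLG ℓ m) (mulLG ℓ m) (flatLG ℓ m r₁ r₂) α β γ) a Z =
      etaL ℓ m a (nablaS ℓ m a Z (frame (flatLG ℓ m r₁ r₂) a α) (frame (flatLG ℓ m r₁ r₂) a β))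
        (frame (flatLG ℓ m r₁ r₂) a γ) := by
  have ha' := h.subset ha
  have hF := fun α => h.fderiv_frame hℓ hm ha α
  have h1 := fderiv_bilin (B := fun b => smap ℓ m b) (differentiableAt_smap hm ha') (hF α).1 (hF β).1
  have h2 := fderiv_bilin (B := fun b => etaL ℓ m b)
    (fun V W => (differentiableAt_etaF hm ha' V W).1) h1.1 (hF γ).1
  have he : cfun (etaMatLG ℓ m) (mulLG ℓ m) (flatLG ℓ m r₁ r₂) α β γ =ᶠ[𝓝 a] fun b =>
      etaL ℓ m b (smap ℓ m b (frame (flatLG ℓ m r₁ r₂) b α) (frame (flatLG ℓ m r₁ r₂) b β))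
        (frame (flatLG ℓ m r₁ r₂) b γ) := by
    filter_upwards [h.isOpen.mem_nhds ha] with b hb using cfunLG_eq hℓ hm (h.subset hb) _ α β γ
  refine ⟨h2.1.congr_of_eventuallyEq he, fun Z => ?_⟩
  have h3 := h.fderiv_etaF hℓ hm ha (smap ℓ m a (frame (flatLG ℓ m r₁ r₂) a α)
    (frame (flatLG ℓ m r₁ r₂) a β)) (frame (flatLG ℓ m r₁ r₂) a γ) Z
  rw [he.fderiv_eq, h2.2, h1.2, (hF α).2, (hF β).2, (hF γ).2]
  simp only [etaL_apply]
  rw [h3]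
  simp only [← etaL_apply, nablaS, dsmap, map_add, map_sub, map_neg, LinearMap.add_apply,
    LinearMap.sub_apply, LinearMap.neg_apply]
  ring

theorem degLG_pos (hm : m ≤ ℓ) (i : Fin ℓ) : 0 < degLG ℓ m i := by
  have hi := i.isLt
  rw [degLG]
  split_ifs with h
  · have : 0 < 2 * (ℓ - m) := by omega
    positivity
  · have : 0 < 2 * m := by omega
    positivity

/-- In a block of size k the paired coordinates have degrees (2i+1)/(2k) and (2j+1)/(2k) with i + j
= k - 1, so the degrees add up to 1. -/
theorem flatGramLG_weight (hm : m ≤ ℓ) (α β : Fin ℓ) :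
    flatGramLG ℓ m α β * (1 - degLG ℓ m α - degLG ℓ m β) = 0 := by
  rw [flatGramLG_apply hm]
  split_ifs with h1 h2
  · have hα := α.isLt
    have h3 : ((dualIdx ℓ m α : Fin ℓ) : ℕ) = ℓ - m - 1 - α := by simp [dualIdx, h2]
    rw [h1, degLG, degLG, if_pos h2, h3, if_pos (by omega)]
    obtain ⟨k, hk⟩ : ∃ k, ℓ - m = α + k + 1 := ⟨ℓ - m - 1 - α, by omega⟩
    rw [hk, show (α : ℕ) + k + 1 - 1 - α = k by omega, show (α : ℕ) + k + 1 - 1 - k = α by omega]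
    have : ((α : ℂ) + k + 1) ≠ 0 := by exact_mod_cast ((α : ℕ) + k).succ_ne_zero
    push_cast
    field_simp
    ring
  · have hα := α.isLt
    have h3 : ((dualIdx ℓ m α : Fin ℓ) : ℕ) = ℓ - 1 + (ℓ - m) - α := by simp [dualIdx, h2]
    rw [h1, degLG, degLG, if_neg h2, h3, if_neg (by omega)]
    obtain ⟨k, hk⟩ : ∃ k, m = (ℓ - 1 - α) + k + 1 := ⟨m - 1 - (ℓ - 1 - α), by omega⟩
    rw [show ℓ - 1 - (ℓ - 1 + (ℓ - m) - (α : ℕ)) = k by omega]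
    set j := ℓ - 1 - (α : ℕ)
    have : (j + k + 1 : ℂ) ≠ 0 := by exact_mod_cast (j + k).succ_ne_zero
    rw [hk]
    push_cast
    field_simp
    ring
  · rw [zero_mul]

theorem IsRootBranch.isFrobChart (hℓ : 1 ≤ ℓ) (hm : m ≤ ℓ) (h : IsRootBranch ℓ m U r₁ r₂) :
    IsFrobChart (etaMatLG ℓ m) (mulLG ℓ m) U (flatLG ℓ m r₁ r₂) (degLG ℓ m) (flatGramLG ℓ m) where
  coords := ⟨h.isOpen, fun x hx => (h.fderiv_apply hℓ hm hx).1.differentiableWithinAt,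
    fun x hx => h.det_jac_ne_zero hℓ hm hx⟩
  gram x hx α β := by
    rw [bil_etaMatLG hℓ hm (h.subset hx), h.etaF_eq hℓ hm hx]
    simp only [← (h.fderiv_apply hℓ hm hx).2, GenFrob.fderiv_frame (h.det_jac_ne_zero hℓ hm hx)]
    exact bil_single _ _ _
  pos := degLG_pos hm
  euler x hx α := by rw [(h.fderiv_apply hℓ hm hx).2, h.dt_self hℓ hm hx]
  weight := flatGramLG_weight hm
  diff x hx α β γ := (h.fderiv_cfun hℓ hm hx α β γ).1
  potential x hx α β γ ξ := by
    rw [pder, pder, (h.fderiv_cfun hℓ hm hx _ _ _).2, (h.fderiv_cfun hℓ hm hx _ _ _).2,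
      nablaS_symm hm (h.subset hx)]
  scaling x hx α β γ := by
    have hx' := h.subset hx
    -- Homogeneity of the metric of degree -1 turns this into η(Γ(E, ∂_α·∂_β), ∂_γ) = -d_γ c_{αβγ},
    -- the only term not covered by the action of Γ(E,·) on the frame.
    have h1 := h.fderiv_etaF hℓ hm hx (smap ℓ m x (frame (flatLG ℓ m r₁ r₂) x α)
      (frame (flatLG ℓ m r₁ r₂) x β)) (frame (flatLG ℓ m r₁ r₂) x γ) x
    rw [(differentiableAt_etaF hm hx' _ _).2, (dsmap_self hm hx' _ _).2,
      h.gam_frame hℓ hm hx, map_neg, Polynomial.eval_neg, mul_neg, ← etaF] at h1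
    rw [(h.fderiv_cfun hℓ hm hx _ _ _).2, cfunLG_eq hℓ hm hx', nablaS, (dsmap_self hm hx' _ _).1,
      h.gam_frame hℓ hm hx, h.gam_frame hℓ hm hx]
    simp only [← etaL_apply, map_add, map_sub, map_smul, LinearMap.sub_apply,
      LinearMap.add_apply, LinearMap.smul_apply, smul_eq_mul, map_zero, LinearMap.zero_apply] at h1 ⊢
    linear_combination -h1

/-- The Frobenius structure on the space of superpotentials. -/
theorem frobDataLG (hℓ : 1 ≤ ℓ) (hm : m ≤ ℓ) :
    FrobData (spaceLG ℓ m) (etaMatLG ℓ m) (mulLG ℓ m) := by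
  have he : ∀ X Y, ∀ x ∈ spaceLG ℓ m, (fun y => bil (etaMatLG ℓ m y) X Y) =ᶠ[𝓝 x]
      fun y => etaF ℓ m y X Y := by
    intro X Y x hx
    filter_upwards [(isOpen_spaceLG ℓ m).mem_nhds hx] with y hy using bil_etaMatLG hℓ hm hy X Y
  have hs : ∀ X Y, ∀ x ∈ spaceLG ℓ m, (fun y => prod (mulLG ℓ m y) X Y) =ᶠ[𝓝 x]
      fun y => smap ℓ m y X Y := by
    intro X Y x hx
    filter_upwards [(isOpen_spaceLG ℓ m).mem_nhds hx] with y hy using prod_mulLG hℓ hm hy X Y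
  refine ⟨isOpen_spaceLG ℓ m, ?_, ?_, ?_, ?_, ?_, ?_, ?_, ?_, ?_, ?_⟩
  · exact fun X Y x hx => (differentiableAt_etaF hm hx X Y).1.congr_of_eventuallyEq (he X Y x hx)
  · exact fun X Y x hx => (differentiableAt_smap hm hx X Y).congr_of_eventuallyEq (hs X Y x hx)
  · exact fun x hx => etaMatLG_symm hℓ hm hx
  · exact fun x hx => det_etaMatLG_ne_zero hℓ hm hx
  · intro x hx X Y
    rw [prod_mulLG hℓ hm hx, prod_mulLG hℓ hm hx, smap_comm]
  · intro x hx X Y Z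
    simp only [prod_mulLG hℓ hm hx]
    exact smap_assoc hm hx X Y Z
  · intro x hx X Y Z
    rw [prod_mulLG hℓ hm hx, prod_mulLG hℓ hm hx, bil_etaMatLG hℓ hm hx, bil_etaMatLG hℓ hm hx,
      etaF_invariant hm hx]
  · intro x hx
    obtain ⟨V, r₁, r₂, hV, h⟩ := exists_isRootBranch hx
    exact ⟨V, _, _, _, hV, h.subset, h.isFrobChart hℓ hm⟩
  · intro x hx X Y
    rw [(hs X Y x hx).fderiv_eq]
    exact (dsmap_self hm hx X Y).1
  · intro x hx X Y
    rw [(he X Y x hx).fderiv_eq, (differentiableAt_etaF hm hx X Y).2, (dsmap_self hm hx X Y).2,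
      bil_etaMatLG hℓ hm hx, etaF, map_neg, Polynomial.eval_neg]
    ring

theorem isOpen_spaceLGUnit (ℓ m : ℕ) : IsOpen (spaceLGUnit ℓ m) := by
  refine (isOpen_spaceLG ℓ m).inter ?_
  have : Continuous fun a : Fin ℓ → ℂ => ∑ j, a j := by fun_prop
  exact isOpen_ne_fun this continuous_const

theorem dq_add (s : ℂ) (f g : Polynomial ℂ) : dq s (f + g) = dq s f + dq s g := by
  apply mul_left_cancel₀ (Polynomial.X_sub_C_ne_zero s)
  rw [mul_add, mul_dq, mul_dq, mul_dq, Polynomial.eval_add, map_add]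
  ring

theorem dq_smul (s c : ℂ) (f : Polynomial ℂ) : dq s (c • f) = c • dq s f := by
  apply mul_left_cancel₀ (Polynomial.X_sub_C_ne_zero s)
  rw [mul_smul_comm, mul_dq, mul_dq, Polynomial.eval_smul, smul_eq_mul, Polynomial.smul_eq_C_mul,
    Polynomial.smul_eq_C_mul, map_mul]
  ring

/-- The vector `ξ_1` is linear in `a`. -/
theorem differentiable_xiVec_one (ℓ m : ℕ) :
    Differentiable ℂ fun a : Fin ℓ → ℂ => xiVec m a 1 := by
  let L : (Fin ℓ → ℂ) →ₗ[ℂ] (Fin ℓ → ℂ) :=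
    { toFun := fun a => xiVec m a 1
      map_add' := fun a b => by
        ext j
        simp only [xiVec, vec, xiPoly, dPoly, bPoly_add, map_add, dq_add,
          Polynomial.eval_add, Polynomial.coeff_C_mul, Polynomial.coeff_sub, Polynomial.coeff_add,
          Pi.add_apply, add_mul]
        ring
      map_smul' := fun c a => by
        ext j
        simp only [xiVec, vec, xiPoly, dPoly, bPoly_smul, map_smul, dq_smul,
          Polynomial.eval_smul, Polynomial.coeff_C_mul, Polynomial.coeff_sub, Polynomial.coeff_smul,
          Pi.smul_apply, smul_eq_mul, RingHom.id_apply]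
        ring }
  exact (LinearMap.toContinuousLinearMap L).differentiable

theorem isGenFrobeniusLG (hℓ : 1 ≤ ℓ) (hm : m ≤ ℓ) :
    IsGenFrobenius (spaceLGUnit ℓ m) (etaMatLG ℓ m) (mulLG ℓ m) (unitLG ℓ m) id 1 := by
  refine (frobDataLG hℓ hm).isGenFrobenius (isOpen_spaceLGUnit ℓ m) (fun x hx => hx.1) ?_ ?_
  · have : DifferentiableOn ℂ (fun a : Fin ℓ → ℂ => (-(1 / 2) * (∑ j, a j)⁻¹) • xiVec m a 1)
        (spaceLGUnit ℓ m) := by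
      intro a ha
      have h1 : DifferentiableAt ℂ (fun a : Fin ℓ → ℂ => ∑ j, a j) a := by fun_prop
      exact (((h1.fun_inv ha.2).const_mul _).fun_smul
        (differentiable_xiVec_one ℓ m a)).differentiableWithinAt
    exact this.congr fun a ha => unitLG_eq hℓ hm ha.1
  · intro x hx X
    rw [prod_mulLG hℓ hm hx.1, smap_unitLG hℓ hm hx]

/-! ### The intersection form -/

/-- The i-th row of η⁻¹ is the gradient of x^i, so pairing with it reads off the i-th component;
invariance moves E into the product. -/
theorem intersectionForm_eq {n : ℕ} {η : (Fin n → ℂ) → Matrix (Fin n) (Fin n) ℂ}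
    {C : (Fin n → ℂ) → Fin n → Fin n → Fin n → ℂ} {x : Fin n → ℂ} (h0 : (η x).det ≠ 0)
    (hcomm : ∀ X Y, prod (C x) X Y = prod (C x) Y X)
    (hinv : ∀ X Y Z, bil (η x) (prod (C x) X Y) Z = bil (η x) X (prod (C x) Y Z)) (i j : Fin n) :
    intersectionForm η C id x i j = prod (C x) x ((η x)⁻¹ j) i := by
  have h : ∀ Y, bil (η x) ((η x)⁻¹ i) Y = Y i := by
    intro Y
    have h1 := congrFun (Matrix.one_mulVec Y) i
    rw [← Matrix.nonsing_inv_mul _ (isUnit_iff_ne_zero.mpr h0), ← Matrix.mulVec_mulVec] at h1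
    exact h1
  rw [intersectionForm, Matrix.of_apply, hinv, h, id, hcomm]

/-- By `gLG_smap` multiplication by E is injective, hence invertible, and the residue form is η(·,
E⁻¹·). This makes it bilinear and inverse to the intersection form. -/
theorem gLG_part (hℓ : 1 ≤ ℓ) (hm : m ≤ ℓ) (ha : a ∈ spaceLG ℓ m)
    (hc : ∀ q ∈ critPts ℓ m a, superpotential ℓ m a q ≠ 0) (h0 : m = ℓ → entry a 0 ≠ 0) :
    (∀ X Y, gLG ℓ m a X Y = bil (gMatLG ℓ m a) X Y) ∧
      gMatLG ℓ m a * intersectionForm (etaMatLG ℓ m) (mulLG ℓ m) id a = 1 := by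
  have hg := gLG_smap hℓ hm ha hc h0
  have hinj : Function.Injective (smap ℓ m a a) := by
    rw [← LinearMap.ker_eq_bot, LinearMap.ker_eq_bot']
    intro Z hZ
    apply etaF_nondeg hℓ hm ha
    intro V
    rw [← hg, hZ, ← (smap ℓ m a a).map_zero, hg, ← etaL_apply, map_zero]
  let e := LinearEquiv.ofInjectiveEndo (smap ℓ m a a) hinj
  have he : ∀ Y, smap ℓ m a a (e.symm Y) = Y := fun Y => e.apply_symm_apply Y
  let B : (Fin ℓ → ℂ) →ₗ[ℂ] (Fin ℓ → ℂ) →ₗ[ℂ] ℂ := (etaL ℓ m a).compl₂ e.symm.toLinearMap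
  have hB : ∀ V Y, gLG ℓ m a V Y = B V Y := by
    intro V Y
    conv_lhs => rw [← he Y, hg]
    rfl
  have hM : gMatLG ℓ m a = Matrix.of fun i j => B (Pi.single i 1) (Pi.single j 1) := by
    ext i j
    exact hB _ _
  have hbil : ∀ X Y, gLG ℓ m a X Y = bil (gMatLG ℓ m a) X Y := fun X Y => by
    rw [hM, bil_of_bilin, hB]
  refine ⟨hbil, ?_⟩
  have hdet := det_etaMatLG_ne_zero hℓ hm ha
  ext k j
  have h1 : (gMatLG ℓ m a * intersectionForm (etaMatLG ℓ m) (mulLG ℓ m) id a) k j =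
      bil (gMatLG ℓ m a) (Pi.single k 1) (smap ℓ m a a ((etaMatLG ℓ m a)⁻¹ j)) := by
    rw [Matrix.mul_apply, bil, single_dotProduct, one_mul]
    refine Finset.sum_congr rfl fun i _ => ?_
    rw [intersectionForm_eq hdet (fun X Y => (frobDataLG hℓ hm).comm a ha X Y)
      (fun X Y Z => (frobDataLG hℓ hm).invariant a ha X Y Z), prod_mulLG hℓ hm ha]
  rw [h1, ← hbil, hg, etaF_comm, ← bil_etaMatLG hℓ hm ha, bil, Matrix.dotProduct_mulVec]
  have h2 : ((etaMatLG ℓ m a)⁻¹ j) ᵥ* etaMatLG ℓ m a = (1 : Matrix (Fin ℓ) (Fin ℓ) ℂ) j := by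
    rw [← Matrix.nonsing_inv_mul _ (isUnit_iff_ne_zero.mpr hdet)]
    rfl
  rw [h2, dotProduct_single, mul_one, Matrix.one_apply, Matrix.one_apply]
  simp only [eq_comm]

end

end GenFrob
end

noncomputable section
namespace GenFrob

/-! ### The multiplication defined by a flat pencil -/

section
variable {n : ℕ}

/-- The Christoffel symbols are determined by their symmetries. -/
theorem christoffel_algebra {U L : Matrix (Fin n) (Fin n) ℂ} (hUL : U * L = 1) (hU : U.IsSymm)
    {d : Fin n → ℂ} {DL DU c T : Fin n → Fin n → Fin n → ℂ}
    (hDL : ∀ β γ ξ, ∑ δ, U β δ * DL δ γ ξ = -∑ b, DU β b ξ * L b γ)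
    (hDU : ∀ α β ξ, DU α β ξ = (d α + d β) * c α β ξ) (hc : ∀ α β ξ, c α β ξ = c β α ξ)
    (hT : ∀ α β b, ∑ ρ, U α ρ * c β b ρ = T α β b) (hT1 : ∀ α β b, T α β b = T b α β)
    (hT2 : ∀ α β b, T α β b = T β α b) (α β γ : Fin n) :
    -∑ ρ, U α ρ * ((1 / 2) * ∑ δ, U β δ * (DL δ γ ρ + DL δ ρ γ - DL ρ γ δ)) = d β * c α β γ := by
  have hLU : L * U = 1 := mul_eq_one_comm.mp hUL
  -- The three terms of the Christoffel symbol are rewritten through the derivative of the inverse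
  -- metric and ∂g^{αβ} = (d_α + d_β)c^{αβ}; T denotes g contracted into c.
  have S1 : ∑ ρ, U α ρ * ∑ δ, U β δ * DL δ γ ρ = -∑ b, (d β + d b) * T α β b * L b γ := by
    simp only [hDL, mul_neg, Finset.sum_neg_distrib, Finset.mul_sum]
    rw [Finset.sum_comm]
    congr 1
    refine Finset.sum_congr rfl fun b _ => ?_
    rw [← hT, Finset.mul_sum, Finset.sum_mul]
    exact Finset.sum_congr rfl fun ρ _ => by rw [hDU]; ring
  have S2 : ∑ ρ, U α ρ * ∑ δ, U β δ * DL δ ρ γ = -DU β α γ := by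
    simp only [hDL, mul_neg, Finset.sum_neg_distrib, Finset.mul_sum]
    rw [Finset.sum_comm]
    congr 1
    have : ∀ b, ∑ ρ, U α ρ * (DU β b γ * L b ρ) = DU β b γ * (L * U) b α := by
      intro b
      rw [Matrix.mul_apply, Finset.mul_sum]
      exact Finset.sum_congr rfl fun ρ _ => by rw [hU.apply]; ring
    simp only [this, hLU, Matrix.one_apply, mul_ite, mul_one, mul_zero, Finset.sum_ite_eq',
      Finset.mem_univ, if_true]
  have S3 : ∑ ρ, U α ρ * ∑ δ, U β δ * DL ρ γ δ = -∑ b, (d α + d b) * T β α b * L b γ := by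
    have : ∑ ρ, U α ρ * ∑ δ, U β δ * DL ρ γ δ = ∑ δ, U β δ * ∑ ρ, U α ρ * DL ρ γ δ := by
      simp only [Finset.mul_sum]
      rw [Finset.sum_comm]
      exact Finset.sum_congr rfl fun δ _ => Finset.sum_congr rfl fun ρ _ => by ring
    rw [this]
    simp only [hDL, mul_neg, Finset.sum_neg_distrib, Finset.mul_sum]
    rw [Finset.sum_comm]
    congr 1
    refine Finset.sum_congr rfl fun b _ => ?_
    rw [← hT, Finset.mul_sum, Finset.sum_mul]
    exact Finset.sum_congr rfl fun ρ _ => by rw [hDU]; ring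
  have S4 : ∑ b, T α β b * L b γ = c α β γ := by
    have : ∀ ρ, ∑ b, U b ρ * c α β ρ * L b γ = c α β ρ * (U * L) ρ γ := by
      intro ρ
      rw [Matrix.mul_apply, Finset.mul_sum]
      exact Finset.sum_congr rfl fun b _ => by rw [hU.apply]; ring
    simp only [hT1 α β, ← hT, Finset.sum_mul]
    rw [Finset.sum_comm]
    simp only [this, hUL, Matrix.one_apply, mul_ite, mul_one, mul_zero, Finset.sum_ite_eq',
      Finset.mem_univ, if_true]
  have e : ∑ ρ, U α ρ * ((1 / 2) * ∑ δ, U β δ * (DL δ γ ρ + DL δ ρ γ - DL ρ γ δ)) =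
      (1 / 2) * (∑ ρ, U α ρ * ∑ δ, U β δ * DL δ γ ρ + ∑ ρ, U α ρ * ∑ δ, U β δ * DL δ ρ γ -
        ∑ ρ, U α ρ * ∑ δ, U β δ * DL ρ γ δ) := by
    simp only [← Finset.sum_add_distrib, ← Finset.sum_sub_distrib, Finset.mul_sum]
    exact Finset.sum_congr rfl fun ρ _ => Finset.sum_congr rfl fun δ _ => by ring
  -- Symmetry of T makes the d_b cancel, and contracting T with the inverse metric returns c.
  have S5 : ∑ b, (d α + d b) * T β α b * L b γ - ∑ b, (d β + d b) * T α β b * L b γ =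
      (d α - d β) * c α β γ := by
    rw [← S4, ← Finset.sum_sub_distrib, Finset.mul_sum]
    exact Finset.sum_congr rfl fun b _ => by rw [hT2 β α]; ring
  rw [e, S1, S2, S3, hDU, hc β α]
  linear_combination (-1 / 2) * S5

theorem lower_eq_inv_upper (t : (Fin n → ℂ) → (Fin n → ℂ))
    (g : (Fin n → ℂ) → Matrix (Fin n) (Fin n) ℂ) (x : Fin n → ℂ) :
    lower t g x = (upper t g x)⁻¹ := by
  rw [upper, Matrix.mul_inv_rev, Matrix.mul_inv_rev]
  ext α β
  rw [lower, Matrix.of_apply, bil, ← Matrix.transpose_nonsing_inv, Matrix.mul_apply]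
  refine Finset.sum_congr rfl fun i _ => ?_
  rw [Matrix.mul_apply]
  rfl

theorem det_upper_ne_zero {t : (Fin n → ℂ) → (Fin n → ℂ)}
    {g : (Fin n → ℂ) → Matrix (Fin n) (Fin n) ℂ} {x : Fin n → ℂ} (h1 : (jac t x).det ≠ 0)
    (h2 : (g x).det ≠ 0) : (upper t g x).det ≠ 0 := by
  rw [upper, Matrix.det_mul, Matrix.det_mul, Matrix.det_transpose]
  exact mul_ne_zero (mul_ne_zero h1 h2) h1

variable {U V : Set (Fin n → ℂ)} {η : (Fin n → ℂ) → Matrix (Fin n) (Fin n) ℂ}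
  {C : (Fin n → ℂ) → Fin n → Fin n → Fin n → ℂ} {t : (Fin n → ℂ) → (Fin n → ℂ)} {d : Fin n → ℝ}
  {A : Matrix (Fin n) (Fin n) ℂ} {x : Fin n → ℂ}

theorem frame_nondeg (h0 : (η x).det ≠ 0) (hj : (jac t x).det ≠ 0) {Y : Fin n → ℂ}
    (h : ∀ α, bil (η x) (frame t x α) Y = 0) : Y = 0 := by
  apply bil_nondeg h0
  intro X
  rw [← sum_frame hj X, ← bilL_apply]
  simp only [map_sum, map_smul, LinearMap.sum_apply, LinearMap.smul_apply, bilL_apply, h, smul_zero,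
    Finset.sum_const_zero]

/-- The gradients of the flat coordinates. -/
def coframe (A : Matrix (Fin n) (Fin n) ℂ) (t : (Fin n → ℂ) → (Fin n → ℂ)) (x : Fin n → ℂ)
    (α : Fin n) : Fin n → ℂ := ∑ μ, A⁻¹ α μ • frame t x μ

theorem IsFrobChart.gram_symm (hF : FrobData U η C) (hc : IsFrobChart η C V t d A)
    (hVU : V ⊆ U) (hx : x ∈ V) : A.IsSymm := by
  ext α β
  rw [Matrix.transpose_apply, ← hc.gram x hx, ← hc.gram x hx, bil_comm (hF.symm x (hVU hx))]

theorem IsFrobChart.det_gram_ne_zero (hF : FrobData U η C) (hc : IsFrobChart η C V t d A)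
    (hVU : V ⊆ U) (hx : x ∈ V) : A.det ≠ 0 := by
  intro h0
  obtain ⟨v, hv, h1⟩ := Matrix.exists_mulVec_eq_zero_iff.mpr h0
  apply hv
  have hj := hc.coords.jac_ne x hx
  have h2 : ∑ β, v β • frame t x β = 0 := by
    apply frame_nondeg (hF.nondeg x (hVU hx)) hj
    intro α
    rw [← bilL_apply, map_sum]
    simp only [map_smul, bilL_apply, hc.gram x hx, smul_eq_mul]
    have h2 : ∑ β, A α β * v β = 0 := congrFun h1 α
    rw [← h2]
    exact Finset.sum_congr rfl fun β _ => mul_comm _ _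
  have h3 := congrArg (fderiv ℂ t x) h2
  rw [map_sum, map_zero] at h3
  simp only [map_smul, fderiv_frame hj] at h3
  rw [← h3]
  exact pi_eq_sum_univ' v

theorem IsFrobChart.inv_gram_symm (hF : FrobData U η C) (hc : IsFrobChart η C V t d A)
    (hVU : V ⊆ U) (hx : x ∈ V) : A⁻¹.IsSymm := by
  rw [Matrix.IsSymm, Matrix.transpose_nonsing_inv, (hc.gram_symm hF hVU hx).eq]

theorem IsFrobChart.bil_coframe (hF : FrobData U η C) (hc : IsFrobChart η C V t d A)
    (hVU : V ⊆ U) (hx : x ∈ V) (α β : Fin n) :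
    bil (η x) (frame t x α) (coframe A t x β) = if α = β then 1 else 0 := by
  rw [coframe, ← bilL_apply, map_sum]
  simp only [map_smul, bilL_apply, hc.gram x hx, smul_eq_mul]
  have h := congrFun (congrFun (Matrix.mul_nonsing_inv A
    (isUnit_iff_ne_zero.mpr (hc.det_gram_ne_zero hF hVU hx))) α) β
  rw [Matrix.one_apply, Matrix.mul_apply] at h
  rw [← h]
  exact Finset.sum_congr rfl fun μ _ => by rw [(hc.inv_gram_symm hF hVU hx).apply]; ring

theorem IsFrobChart.sum_coframe (hF : FrobData U η C) (hc : IsFrobChart η C V t d A)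
    (hVU : V ⊆ U) (hx : x ∈ V) (Y : Fin n → ℂ) :
    ∑ σ, bil (η x) (frame t x σ) Y • coframe A t x σ = Y := by
  rw [← sub_eq_zero]
  apply frame_nondeg (hF.nondeg x (hVU hx)) (hc.coords.jac_ne x hx)
  intro τ
  rw [← bilL_apply, map_sub, map_sum]
  simp only [map_smul, bilL_apply, hc.bil_coframe hF hVU hx, smul_eq_mul, mul_ite, mul_one, mul_zero,
    Finset.sum_ite_eq, Finset.mem_univ, if_true, sub_self]

theorem IsFrobChart.sum_coframe_frame (hF : FrobData U η C) (hc : IsFrobChart η C V t d A)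
    (hVU : V ⊆ U) (hx : x ∈ V) (Y : Fin n → ℂ) :
    ∑ γ, bil (η x) Y (coframe A t x γ) • frame t x γ = Y := by
  conv_rhs => rw [← sum_frame (hc.coords.jac_ne x hx) Y]
  refine Finset.sum_congr rfl fun γ _ => ?_
  congr 1
  nth_rewrite 1 [← sum_frame (hc.coords.jac_ne x hx) Y]
  rw [← bilL_apply]
  simp only [map_sum, map_smul, LinearMap.sum_apply, LinearMap.smul_apply, bilL_apply,
    hc.bil_coframe hF hVU hx, smul_eq_mul, mul_ite, mul_one, mul_zero, Finset.sum_ite_eq',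
    Finset.mem_univ, if_true]

theorem IsFrobChart.sum_gram_coframe (hF : FrobData U η C) (hc : IsFrobChart η C V t d A)
    (hVU : V ⊆ U) (hx : x ∈ V) (α : Fin n) :
    ∑ ν, A α ν • coframe A t x ν = frame t x α := by
  conv_rhs => rw [← hc.sum_coframe hF hVU hx (frame t x α)]
  simp only [hc.gram x hx]
  exact Finset.sum_congr rfl fun ν _ => by rw [(hc.gram_symm hF hVU hx).apply]

theorem IsFrobChart.sum_jac (hF : FrobData U η C) (hc : IsFrobChart η C V t d A)
    (hVU : V ⊆ U) (hx : x ∈ V) (α : Fin n) : ∑ i, jac t x α i • (η x)⁻¹ i = coframe A t x α := by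
  have h0 := hF.nondeg x (hVU hx)
  have hj := hc.coords.jac_ne x hx
  have hs := hF.symm x (hVU hx)
  rw [← sub_eq_zero]
  apply frame_nondeg h0 hj
  intro β
  rw [← bilL_apply, map_sub, map_sum]
  simp only [map_smul, bilL_apply, hc.bil_coframe hF hVU hx]
  have h : ∀ i, bil (η x) (frame t x β) ((η x)⁻¹ i) = frame t x β i := by
    intro i
    rw [bil_comm hs]
    have h1 := congrFun (Matrix.one_mulVec (frame t x β)) i
    rw [← Matrix.nonsing_inv_mul _ (isUnit_iff_ne_zero.mpr h0), ← Matrix.mulVec_mulVec] at h1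
    exact h1
  have h2 := congrFun (fderiv_frame hj β) α
  rw [fderiv_eq_jac_mulVec, Pi.single_apply] at h2
  simp only [h, smul_eq_mul, eq_comm (a := β)]
  rw [← h2, sub_eq_zero]
  rfl

/-! ### The intersection form and its Levi-Civita connection in homogeneous flat coordinates. -/

variable {g : (Fin n → ℂ) → Matrix (Fin n) (Fin n) ℂ}

theorem IsFrobChart.upper_eq (hF : FrobData U η C) (hc : IsFrobChart η C V t d A)
    (hVU : V ⊆ U) (hx : x ∈ V)
    (hg : ∀ y ∈ V, g y = intersectionForm η C id y) (α β : Fin n) :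
    upper t g x α β = bil (η x) (prod (C x) (coframe A t x α) (coframe A t x β)) x := by
  rw [← hc.sum_jac hF hVU hx, ← hc.sum_jac hF hVU hx, ← bilL_apply, ← prodL_apply]
  simp only [map_sum, map_smul, LinearMap.sum_apply, LinearMap.smul_apply, smul_eq_mul]
  rw [upper, Matrix.mul_apply]
  refine Finset.sum_congr rfl fun j _ => ?_
  rw [Matrix.mul_apply, Matrix.transpose_apply, mul_comm, Finset.mul_sum, Finset.mul_sum]
  refine Finset.sum_congr rfl fun i _ => ?_
  rw [hg x hx]
  rfl

theorem IsFrobChart.bil_prod_self (hc : IsFrobChart η C V t d A) (hx : x ∈ V) (P : Fin n → ℂ) :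
    bil (η x) P x = ∑ ρ, bil (η x) P (frame t x ρ) * (d ρ * t x ρ) := by
  have hE : bil (η x) P x = bilL (η x) P (∑ ρ, ((d ρ : ℂ) * t x ρ) • frame t x ρ) := by
    rw [← bilL_apply]
    congr 1
    conv_lhs => rw [← sum_frame (hc.coords.jac_ne x hx) x]
    exact Finset.sum_congr rfl fun ρ _ => by rw [hc.euler x hx]
  rw [hE]
  simp only [map_sum, map_smul, smul_eq_mul, bilL_apply]
  exact Finset.sum_congr rfl fun ρ _ => mul_comm _ _

theorem bil_prod_coframe (α β : Fin n) (Z : Fin n → ℂ) :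
    bil (η x) (prod (C x) (coframe A t x α) (coframe A t x β)) Z =
      ∑ μ, ∑ ν, A⁻¹ α μ * A⁻¹ β ν * bil (η x) (prod (C x) (frame t x μ) (frame t x ν)) Z := by
  rw [coframe, coframe, ← bilL_apply, ← prodL_apply]
  simp only [map_sum, map_smul, LinearMap.sum_apply, LinearMap.smul_apply, smul_eq_mul, prodL_apply,
    bilL_apply, Finset.mul_sum]
  rw [Finset.sum_comm]
  exact Finset.sum_congr rfl fun μ _ => Finset.sum_congr rfl fun ν _ => by ring

theorem IsFrobChart.upper_expand (hF : FrobData U η C) (hc : IsFrobChart η C V t d A)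
    (hVU : V ⊆ U) (hx : x ∈ V) (hg : ∀ y ∈ V, g y = intersectionForm η C id y) (α β : Fin n) :
    upper t g x α β = ∑ μ, ∑ ν, A⁻¹ α μ * A⁻¹ β ν * ∑ ρ, cfun η C t μ ν ρ x * (d ρ * t x ρ) := by
  rw [hc.upper_eq hF hVU hx hg, bil_prod_coframe]
  simp only [hc.bil_prod_self hx]
  rfl

/-- The structure constants with two raised indices. -/
def cup (η : (Fin n → ℂ) → Matrix (Fin n) (Fin n) ℂ) (C : (Fin n → ℂ) → Fin n → Fin n → Fin n → ℂ)
    (A : Matrix (Fin n) (Fin n) ℂ) (t : (Fin n → ℂ) → (Fin n → ℂ)) (x : Fin n → ℂ)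
    (α β γ : Fin n) : ℂ :=
  bil (η x) (prod (C x) (coframe A t x α) (coframe A t x β)) (frame t x γ)

theorem cfun_symm (hF : FrobData U η C) (hx : x ∈ U) (α β γ : Fin n) :
    cfun η C t α β γ x = cfun η C t γ β α x := by
  rw [cfun, hF.invariant x hx, bil_comm (hF.symm x hx), hF.comm x hx, cfun]

theorem IsFrobChart.pder_cfun (hF : FrobData U η C) (hc : IsFrobChart η C V t d A)
    (hVU : V ⊆ U) (hx : x ∈ V) (μ ν ρ ξ : Fin n) :
    pder t (cfun η C t μ ν ρ) x ξ = pder t (cfun η C t μ ν ξ) x ρ := by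
  have h1 : ∀ α β γ, cfun η C t α β γ =ᶠ[𝓝 x] cfun η C t γ β α := by
    intro α β γ
    filter_upwards [hc.coords.isOpen.mem_nhds hx] with y hy using cfun_symm hF (hVU hy) α β γ
  have h2 : ∀ α β γ ξ, pder t (cfun η C t α β γ) x ξ = pder t (cfun η C t γ β α) x ξ := by
    intro α β γ ξ
    rw [pder, pder, (h1 α β γ).fderiv_eq]
  rw [h2, hc.potential x hx, h2]

theorem IsFrobChart.weight_inv (hF : FrobData U η C) (hc : IsFrobChart η C V t d A)
    (hVU : V ⊆ U) (hx : x ∈ V) (α μ : Fin n) : A⁻¹ α μ * (1 - d α - d μ) = 0 := by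
  have hA := isUnit_iff_ne_zero.mpr (hc.det_gram_ne_zero hF hVU hx)
  set D : Matrix (Fin n) (Fin n) ℂ := Matrix.diagonal fun α => (d α : ℂ) with hD
  have h1 : A - D * A - A * D = 0 := by
    ext i j
    simp only [hD, Matrix.sub_apply, Matrix.diagonal_mul, Matrix.mul_diagonal, Matrix.zero_apply]
    linear_combination hc.weight i j
  have h2 : A⁻¹ - A⁻¹ * D - D * A⁻¹ = 0 := by
    have := congrArg (fun M => A⁻¹ * M * A⁻¹) h1
    simp only [mul_sub, sub_mul, Matrix.nonsing_inv_mul _ hA, mul_zero, zero_mul, one_mul] at this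
    rw [← this]
    simp only [mul_assoc, Matrix.mul_nonsing_inv _ hA, mul_one, ← mul_assoc A⁻¹ A,
      Matrix.nonsing_inv_mul _ hA, one_mul]
  have h3 := congrFun (congrFun h2 α) μ
  simp only [hD, Matrix.sub_apply, Matrix.diagonal_mul, Matrix.mul_diagonal, Matrix.zero_apply] at h3
  linear_combination h3

/-- Here g^{αβ} = Σ_ρ c^{αβ}_ρ d_ρ t^ρ. Its ξ-derivative is d_ξ c^{αβ}_ξ plus, by total symmetry,
the derivative of c along E. For lower indices μ, ν homogeneity gives the factor 2 - d_μ - d_ν in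
all, and raising an index replaces 1 - d_μ by d_α. -/
theorem IsFrobChart.fderiv_upper (hF : FrobData U η C) (hc : IsFrobChart η C V t d A)
    (hVU : V ⊆ U) (hx : x ∈ V) (hg : ∀ y ∈ V, g y = intersectionForm η C id y) (α β : Fin n) :
    DifferentiableAt ℂ (fun y => upper t g y α β) x ∧
      ∀ ξ, pder t (fun y => upper t g y α β) x ξ = (d α + d β) * cup η C A t x α β ξ := by
  have hj := hc.coords.jac_ne x hx
  have ht : DifferentiableAt ℂ t x := (hc.coords.holo x hx).differentiableAt
    (hc.coords.isOpen.mem_nhds hx)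
  have ht' : ∀ ρ, HasFDerivAt (fun y => t y ρ) (ContinuousLinearMap.proj ρ ∘L fderiv ℂ t x) x :=
    hasFDerivAt_pi'.mp ht.hasFDerivAt
  have he : (fun y => upper t g y α β) =ᶠ[𝓝 x] fun y =>
      ∑ μ, ∑ ν, A⁻¹ α μ * A⁻¹ β ν * ∑ ρ, cfun η C t μ ν ρ y * (d ρ * t y ρ) := by
    filter_upwards [hc.coords.isOpen.mem_nhds hx] with y hy using hc.upper_expand hF hVU hy hg α β
  have h1 : HasFDerivAt (fun y =>
      ∑ μ, ∑ ν, A⁻¹ α μ * A⁻¹ β ν * ∑ ρ, cfun η C t μ ν ρ y * (d ρ * t y ρ))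
      (∑ μ, ∑ ν, (A⁻¹ α μ * A⁻¹ β ν) • ∑ ρ, (cfun η C t μ ν ρ x • ((d ρ : ℂ) •
        (ContinuousLinearMap.proj ρ ∘L fderiv ℂ t x)) +
        ((d ρ : ℂ) * t x ρ) • fderiv ℂ (cfun η C t μ ν ρ) x)) x := by
    refine HasFDerivAt.fun_sum fun μ _ => HasFDerivAt.fun_sum fun ν _ => HasFDerivAt.const_mul ?_ _
    exact HasFDerivAt.fun_sum fun ρ _ =>
      (hc.diff x hx μ ν ρ).hasFDerivAt.mul ((ht' ρ).const_mul _)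
  refine ⟨h1.differentiableAt.congr_of_eventuallyEq he, fun ξ => ?_⟩
  have h2 : ∀ μ ν, ∑ ρ, ((d ρ : ℂ) * t x ρ) * fderiv ℂ (cfun η C t μ ν ρ) x (frame t x ξ) =
      (2 - d μ - d ν - d ξ) * cfun η C t μ ν ξ x := by
    intro μ ν
    rw [← hc.scaling x hx]
    conv_rhs => arg 2; rw [← sum_frame hj x]
    rw [map_sum]
    refine Finset.sum_congr rfl fun ρ _ => ?_
    rw [map_smul, hc.euler x hx, smul_eq_mul]
    congr 1
    exact hc.pder_cfun hF hVU hx μ ν ρ ξ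
  rw [pder, he.fderiv_eq, h1.fderiv, cup, bil_prod_coframe, Finset.mul_sum]
  simp only [sum_apply]
  refine Finset.sum_congr rfl fun μ _ => ?_
  rw [Finset.mul_sum]
  refine Finset.sum_congr rfl fun ν _ => ?_
  simp only [smul_apply, sum_apply, add_apply, ContinuousLinearMap.comp_apply,
    ContinuousLinearMap.proj_apply, fderiv_frame hj, smul_eq_mul, Finset.sum_add_distrib, h2]
  simp only [Pi.single_apply, mul_ite, mul_one, mul_zero, Finset.sum_ite_eq',
    Finset.mem_univ, if_true]
  change _ = (d α + d β : ℂ) * (_ * _ * cfun η C t μ ν ξ x)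
  linear_combination A⁻¹ β ν * cfun η C t μ ν ξ x * hc.weight_inv hF hVU hx α μ +
    A⁻¹ α μ * cfun η C t μ ν ξ x * hc.weight_inv hF hVU hx β ν

/-- The Levi-Civita connection of the intersection form. -/
theorem IsFrobChart.conChristoffel_eq (hF : FrobData U η C) (hc : IsFrobChart η C V t d A)
    (hVU : V ⊆ U) (hx : x ∈ V) (hg : ∀ y ∈ V, g y = intersectionForm η C id y)
    (hdet : ∀ y ∈ V, (g y).det ≠ 0) (α β γ : Fin n) :
    conChristoffel t g x α β γ = d β * cup η C A t x α β γ := by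
  have hj := hc.coords.jac_ne x hx
  have hxU := hVU hx
  have hup : ∀ y ∈ V, (upper t g y).det ≠ 0 := fun y hy =>
    det_upper_ne_zero (hc.coords.jac_ne y hy) (hdet y hy)
  have hUL : ∀ y ∈ V, upper t g y * lower t g y = 1 := fun y hy => by
    rw [lower_eq_inv_upper, Matrix.mul_nonsing_inv _ (isUnit_iff_ne_zero.mpr (hup y hy))]
  have hd := fun α β => hc.fderiv_upper hF hVU hx hg α β
  have hld : ∀ α β, DifferentiableAt ℂ (fun y => lower t g y α β) x := by
    intro α β
    simp only [lower_eq_inv_upper]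
    exact differentiableAt_matrix_inv (fun i j => (hd i j).1) (hup x hx) α β
  have hsymm := hF.symm x hxU
  have hcomm := hF.comm x hxU
  have hassoc := hF.assoc x hxU
  have hinv := hF.invariant x hxU
  have hUs : (upper t g x).IsSymm := by
    ext i j
    rw [Matrix.transpose_apply, hc.upper_eq hF hVU hx hg, hc.upper_eq hF hVU hx hg, hcomm]
  rw [conChristoffel]
  simp only [christoffel]
  refine christoffel_algebra (hUL x hx) hUs (d := fun α => (d α : ℂ))
    (DL := fun α β ξ => pder t (fun y => lower t g y α β) x ξ)
    (DU := fun α β ξ => pder t (fun y => upper t g y α β) x ξ)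
    (c := cup η C A t x) (T := fun α β b => bil (η x) (prod (C x) (coframe A t x α) x)
      (prod (C x) (coframe A t x β) (coframe A t x b))) ?_ ?_ ?_ ?_ ?_ ?_ α β γ
  · intro β γ ξ
    have he : (fun y => ∑ δ, upper t g y β δ * lower t g y δ γ) =ᶠ[𝓝 x]
        fun _ => (1 : Matrix (Fin n) (Fin n) ℂ) β γ := by
      filter_upwards [hc.coords.isOpen.mem_nhds hx] with y hy
      rw [← hUL y hy, Matrix.mul_apply]
    have h1 : HasFDerivAt (fun y => ∑ δ, upper t g y β δ * lower t g y δ γ)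
        (∑ δ, (upper t g x β δ • fderiv ℂ (fun y => lower t g y δ γ) x +
          lower t g x δ γ • fderiv ℂ (fun y => upper t g y β δ) x)) x :=
      HasFDerivAt.fun_sum fun δ _ => (hd β δ).1.hasFDerivAt.mul (hld δ γ).hasFDerivAt
    have h2 := h1.fderiv
    rw [he.fderiv_eq, fderiv_fun_const] at h2
    have h3 := congrArg (fun L : (Fin n → ℂ) →L[ℂ] ℂ => L (frame t x ξ)) h2
    simp only [Pi.zero_apply, zero_apply, sum_apply, add_apply, smul_apply, smul_eq_mul,
      Finset.sum_add_distrib] at h3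
    simp only [pder]
    rw [eq_neg_iff_add_eq_zero, h3]
    congr 1
    exact Finset.sum_congr rfl fun b _ => mul_comm _ _
  · exact fun α β ξ => (hd α β).2 ξ
  · intro α β ξ
    rw [cup, hcomm, cup]
  -- Both sides are the pairing of ∇t^α·E with ∇t^β·∇t^b, expanded in the dual frames. Its symmetry
  -- in α, β, b is commutativity and associativity.
  · intro α β b
    have h1 : ∀ ρ, upper t g x α ρ * cup η C A t x β b ρ =
        bil (η x) (prod (C x) (coframe A t x α) x)
          (bil (η x) (frame t x ρ) (prod (C x) (coframe A t x β) (coframe A t x b)) •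
            coframe A t x ρ) := by
      intro ρ
      rw [hc.upper_eq hF hVU hx hg, cup, ← bilL_apply _ _ (_ • _), map_smul, bilL_apply, smul_eq_mul,
        bil_comm hsymm _ (frame t x ρ), mul_comm, hcomm (coframe A t x α) x, hinv x,
        bil_comm hsymm x]
    simp only [h1]
    rw [← hc.sum_coframe hF hVU hx (prod (C x) (coframe A t x β) (coframe A t x b)), ← bilL_apply,
      map_sum]
    simp only [hc.sum_coframe hF hVU hx, bilL_apply]
  · intro α β b
    rw [hcomm _ x, hcomm _ x, hinv, hinv, ← hassoc, hcomm _ (coframe A t x b)]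
  · intro α β b
    rw [hcomm _ x, hcomm _ x, hinv, hinv, ← hassoc, ← hassoc, hcomm (coframe A t x α)]

end

/-- The multiplication of a Frobenius structure is recovered from the pencil of its intersection
form and its metric. -/
theorem FrobData.isPencilMul {n : ℕ} {U : Set (Fin n → ℂ)}
    {ηc g : (Fin n → ℂ) → Matrix (Fin n) (Fin n) ℂ}
    {C : (Fin n → ℂ) → Fin n → Fin n → Fin n → ℂ} (hF : FrobData U (fun z => (ηc z)⁻¹) C)
    (hgc : Continuous fun z => (g z).det)
    (hg : ∀ z ∈ U, g z = intersectionForm (fun z => (ηc z)⁻¹) C id z)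
    (hη : ∀ z ∈ U, (ηc z).det ≠ 0) : IsPencilMul U g ηc id C := by
  constructor
  · intro i j k z hz
    have := hF.holo_mul (Pi.single i 1) (Pi.single j 1) z hz
    simp only [prod_single] at this
    exact (differentiableAt_pi.mp this k).differentiableWithinAt
  · intro z₀ hz₀ hd
    obtain ⟨V₀, t, d, A, hz, hVU₀, hc₀⟩ := hF.chart z₀ hz₀
    set V := V₀ ∩ {z | (g z).det ≠ 0} with hV
    have hVV : V ⊆ V₀ := Set.inter_subset_left
    have hVU : V ⊆ U := hVV.trans hVU₀
    have hc : IsFrobChart (fun z => (ηc z)⁻¹) C V t d A :=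
      ⟨⟨hc₀.coords.isOpen.inter (isOpen_ne_fun hgc continuous_const), hc₀.coords.holo.mono hVV,
        fun x hx => hc₀.coords.jac_ne x (hVV hx)⟩, fun x hx => hc₀.gram x (hVV hx), hc₀.pos,
        fun x hx => hc₀.euler x (hVV hx), hc₀.weight, fun x hx => hc₀.diff x (hVV hx),
        fun x hx => hc₀.potential x (hVV hx), fun x hx => hc₀.scaling x (hVV hx)⟩
    refine ⟨V, t, d, ⟨hz, hd⟩, hVU, fun z hz => hz.2, ⟨hc.coords, A, hc.gram⟩, hc.pos, hc.euler, ?_⟩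
    intro z hz α β
    have hlow : lower t ηc z = A := by
      ext i j
      exact hc.gram z hz i j
    have hup : upper t ηc z = A⁻¹ := by
      rw [← hlow, lower_eq_inv_upper, Matrix.nonsing_inv_nonsing_inv _ (isUnit_iff_ne_zero.mpr
        (det_upper_ne_zero (hc.coords.jac_ne z hz) (hη z (hVU hz))))]
    set P := prod (C z) (frame t z α) (frame t z β) with hP
    -- Lowering two indices of c^{νρ}_ζ gives back the product of the frame vectors; the factor
    -- 1/d_ρ of the definition cancels the one in `IsFrobChart.conChristoffel_eq`.
    have h1 : ∀ ζ, ∑ ν, ∑ ρ, A α ν * A β ρ * cup (fun z => (ηc z)⁻¹) C A t z ν ρ ζ =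
        bil (ηc z)⁻¹ P (frame t z ζ) := by
      intro ζ
      have hα := (hc.sum_gram_coframe hF hVU hz α).symm
      have hβ := (hc.sum_gram_coframe hF hVU hz β).symm
      have hP' : P = ∑ ν, ∑ ρ, (A α ν * A β ρ) •
          prod (C z) (coframe A t z ν) (coframe A t z ρ) := by
        rw [hP, ← prodL_apply, hα, hβ]
        simp only [map_sum, map_smul, LinearMap.sum_apply, LinearMap.smul_apply, prodL_apply,
          Finset.smul_sum, smul_smul]
        rw [Finset.sum_comm]
        exact Finset.sum_congr rfl fun ν _ => Finset.sum_congr rfl fun ρ _ => by rw [mul_comm]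
      rw [hP', ← bilL_apply]
      simp only [map_sum, map_smul, LinearMap.sum_apply, LinearMap.smul_apply, smul_eq_mul,
        bilL_apply]
      rfl
    conv_lhs => rw [← hc.sum_coframe_frame hF hVU hz P]
    refine Finset.sum_congr rfl fun γ _ => ?_
    congr 1
    rw [coframe, ← bilL_apply, map_sum]
    simp only [map_smul, bilL_apply, smul_eq_mul, ← h1, Finset.mul_sum]
    rw [Finset.sum_comm]
    refine Finset.sum_congr rfl fun ν _ => ?_
    rw [Finset.sum_comm]
    refine Finset.sum_congr rfl fun ρ _ => Finset.sum_congr rfl fun ζ _ => ?_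
    have hρ : (d ρ : ℂ) ≠ 0 := by exact_mod_cast (hc.pos ρ).ne'
    rw [hlow, hup, hc.conChristoffel_eq hF hVU hz (fun y hy => hg y (hVU hy)) fun y hy => hy.2]
    field_simp

end GenFrob
end

noncomputable section
namespace GenFrob
open Polynomial

/-! ### Matrices determined by their generating functions -/

section
variable {ℓ : ℕ}

theorem eq_zero_of_evVec {v : Fin ℓ → ℂ} {S : Set ℂ} (hS : S.Finite)
    (h : ∀ s ∉ S, evVec ℓ s ⬝ᵥ v = 0) : v = 0 := by
  apply vp_injective ℓ
  rw [map_zero]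
  apply eq_zero_of_infinite_isRoot
  refine hS.infinite_compl.mono fun s hs => ?_
  change (vp ℓ v).eval s = 0
  rw [← evVec_dotProduct, h s hs]

/-- A polynomial in s with infinitely many zeros is zero. Allowing a finite exceptional set, and s ≠
t, makes it possible to divide by t - s and by s + 2. -/
theorem matrix_ext_evVec {M N : Matrix (Fin ℓ) (Fin ℓ) ℂ} {S : Set ℂ} (hS : S.Finite)
    (h : ∀ s ∉ S, ∀ t ∉ S, s ≠ t →
      bil M (evVec ℓ s) (evVec ℓ t) = bil N (evVec ℓ s) (evVec ℓ t)) : M = N := by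
  have h1 : ∀ t ∉ S, M *ᵥ evVec ℓ t = N *ᵥ evVec ℓ t := by
    intro t ht
    rw [← sub_eq_zero]
    refine eq_zero_of_evVec (hS.insert t) fun s hs => ?_
    rw [Set.mem_insert_iff, not_or] at hs
    rw [dotProduct_sub]
    exact sub_eq_zero.mpr (h s hs.2 t ht hs.1)
  ext i j
  have h2 : M i - N i = 0 := by
    refine eq_zero_of_evVec hS fun t ht => ?_
    rw [dotProduct_comm, sub_dotProduct]
    exact sub_eq_zero.mpr (congrFun (h1 t ht) i)
  exact congrFun (sub_eq_zero.mp h2) j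

theorem bil_conj (H N : Matrix (Fin ℓ) (Fin ℓ) ℂ) (X Y : Fin ℓ → ℂ) :
    bil (H * N * Hᵀ) X Y = bil N (Hᵀ *ᵥ X) (Hᵀ *ᵥ Y) := by
  rw [bil, bil, Matrix.mulVec_transpose H X, ← Matrix.dotProduct_mulVec, Matrix.mulVec_mulVec,
    Matrix.mulVec_mulVec, Matrix.mul_assoc]

theorem bil_vecMulVec (v w X Y : Fin ℓ → ℂ) :
    bil (Matrix.vecMulVec v w) X Y = (X ⬝ᵥ v) * (Y ⬝ᵥ w) := by
  rw [bil, Matrix.vecMulVec_mulVec, dotProduct_comm Y w, mul_comm]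
  simp [dotProduct_smul]

theorem bil_add_left (M N : Matrix (Fin ℓ) (Fin ℓ) ℂ) (X Y : Fin ℓ → ℂ) :
    bil (M + N) X Y = bil M X Y + bil N X Y := by
  rw [bil, Matrix.add_mulVec, dotProduct_add]; rfl

theorem bil_sub_left (M N : Matrix (Fin ℓ) (Fin ℓ) ℂ) (X Y : Fin ℓ → ℂ) :
    bil (M - N) X Y = bil M X Y - bil N X Y := by
  rw [bil, Matrix.sub_mulVec, dotProduct_sub]; rfl

theorem bil_smul_left (c : ℂ) (M : Matrix (Fin ℓ) (Fin ℓ) ℂ) (X Y : Fin ℓ → ℂ) :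
    bil (c • M) X Y = c * bil M X Y := by
  rw [bil, Matrix.smul_mulVec, dotProduct_smul]; rfl

theorem bil_sum_left {ι : Type*} (s : Finset ι) (M : ι → Matrix (Fin ℓ) (Fin ℓ) ℂ)
    (X Y : Fin ℓ → ℂ) : bil (∑ i ∈ s, M i) X Y = ∑ i ∈ s, bil (M i) X Y :=
  map_sum (AddMonoidHom.mk' (fun M => bil M X Y) fun M N => bil_add_left M N X Y) M s

/-! ### Bezout matrices -/

theorem evVec_vec_X_pow {e : ℕ} (he : e < ℓ) (s : ℂ) : evVec ℓ s ⬝ᵥ vec ℓ (X ^ e) = s ^ e := by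
  rw [evVec_dotProduct, vp_vec (by rw [degree_X_pow]; exact_mod_cast he), eval_pow, eval_X]

/-- The Bezout matrix of `X ^ p` and `X ^ q` for `q ≤ p`. -/
def bezMon (ℓ p q : ℕ) : Matrix (Fin ℓ) (Fin ℓ) ℂ :=
  ∑ r ∈ Finset.range (p - q), Matrix.vecMulVec (vec ℓ (X ^ (p - 1 - r))) (vec ℓ (X ^ (q + r)))

/-- The factor (st)^q splits off and the remaining geometric sum telescopes against t - s. -/
theorem bil_bezMon {p q : ℕ} (hp : p ≤ ℓ) (hq : q ≤ p) (s t : ℂ) :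
    (t - s) * bil (bezMon ℓ p q) (evVec ℓ s) (evVec ℓ t) = t ^ p * s ^ q - s ^ p * t ^ q := by
  obtain ⟨n, rfl⟩ := Nat.exists_eq_add_of_le hq
  rw [bezMon, bil_sum_left]
  have h : ∀ r ∈ Finset.range (q + n - q), bil (Matrix.vecMulVec (vec ℓ (X ^ (q + n - 1 - r)))
      (vec ℓ (X ^ (q + r)))) (evVec ℓ s) (evVec ℓ t) =
      (s * t) ^ q * (t ^ r * s ^ (q + n - q - 1 - r)) := by
    intro r hr
    have hr := Finset.mem_range.mp hr
    rw [bil_vecMulVec, evVec_vec_X_pow (by omega), evVec_vec_X_pow (by omega),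
      show q + n - 1 - r = q + (q + n - q - 1 - r) by omega]
    ring
  rw [Finset.sum_congr rfl h, ← Finset.mul_sum]
  have := geom_sum₂_mul t s (q + n - q)
  rw [Nat.add_sub_cancel_left] at this ⊢
  linear_combination (s * t) ^ q * this

/-- The matrix with generating function `(P(t) Q(s) - P(s) Q(t)) / (t - s)`. -/
def bezMat (ℓ : ℕ) (P Q : ℂ[X]) : Matrix (Fin ℓ) (Fin ℓ) ℂ :=
  ∑ p ∈ Finset.range (ℓ + 1), ∑ q ∈ Finset.range (ℓ + 1),
    (P.coeff p * Q.coeff q) • (bezMon ℓ p q - bezMon ℓ q p)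

theorem bil_bezMat {P Q : ℂ[X]} (hP : P.natDegree ≤ ℓ) (hQ : Q.natDegree ≤ ℓ) (s t : ℂ) :
    (t - s) * bil (bezMat ℓ P Q) (evVec ℓ s) (evVec ℓ t) =
      P.eval t * Q.eval s - P.eval s * Q.eval t := by
  have h : ∀ p ∈ Finset.range (ℓ + 1), ∀ q ∈ Finset.range (ℓ + 1),
      (t - s) * bil (bezMon ℓ p q - bezMon ℓ q p) (evVec ℓ s) (evVec ℓ t) =
        t ^ p * s ^ q - s ^ p * t ^ q := by
    intro p hp q hq
    rw [Finset.mem_range] at hp hq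
    have h0 : ∀ {p q}, q ≤ p → bil (bezMon ℓ q p) (evVec ℓ s) (evVec ℓ t) = 0 := by
      intro p q hqp
      rw [bezMon, Nat.sub_eq_zero_of_le hqp, Finset.range_zero, Finset.sum_empty]
      simp [bil]
    rw [bil_sub_left]
    rcases le_total q p with hqp | hqp
    · rw [h0 hqp, sub_zero, bil_bezMon (by omega) hqp]
    · rw [h0 hqp]
      linear_combination -bil_bezMon (show q ≤ ℓ by omega) hqp s t
  simp only [bezMat, bil_sum_left, bil_smul_left, Finset.mul_sum]
  rw [eval_eq_sum_range' (Nat.lt_succ_of_le hP), eval_eq_sum_range' (Nat.lt_succ_of_le hP),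
    eval_eq_sum_range' (Nat.lt_succ_of_le hQ), eval_eq_sum_range' (Nat.lt_succ_of_le hQ),
    Finset.sum_mul_sum, Finset.sum_mul_sum, ← Finset.sum_sub_distrib]
  refine Finset.sum_congr rfl fun p hp => ?_
  rw [← Finset.sum_sub_distrib]
  refine Finset.sum_congr rfl fun q hq => ?_
  linear_combination (P.coeff p * Q.coeff q) * h p hp q hq

theorem continuous_bezMat {α : Type*} [TopologicalSpace α] {P Q : α → ℂ[X]}
    (hP : ∀ k, Continuous fun x => (P x).coeff k) (hQ : ∀ k, Continuous fun x => (Q x).coeff k) :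
    Continuous fun x => bezMat ℓ (P x) (Q x) :=
  continuous_finsetSum _ fun p _ => continuous_finsetSum _ fun q _ =>
    ((hP p).mul (hQ q)).smul continuous_const

/-! ### The metrics on the orbit space -/

/-- The operator `P ↦ (4 - s²) P' + ℓ s P`. -/
def orbOp (ℓ : ℕ) (P : ℂ[X]) : ℂ[X] := (C 4 - X ^ 2) * derivative P + C (ℓ : ℂ) * (X * P)

theorem eval_orbOp (P : ℂ[X]) (s : ℂ) :
    (orbOp ℓ P).eval s = (4 - s ^ 2) * (derivative P).eval s + ℓ * (s * P.eval s) := by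
  simp [orbOp]

theorem natDegree_orbOp_le {P : ℂ[X]} (hP : P.degree < ℓ) : (orbOp ℓ P).natDegree ≤ ℓ := by
  by_cases h0 : P = 0
  · simp [orbOp, h0]
  have hP' : P.natDegree < ℓ := (natDegree_lt_iff_degree_lt h0).mpr hP
  refine (natDegree_add_le _ _).trans (max_le ?_ ?_)
  · by_cases h1 : P.natDegree = 0
    · rw [derivative_of_natDegree_zero h1]; simp
    · have h2 := natDegree_derivative_lt h1
      have h3 : (C 4 - X ^ 2 : ℂ[X]).natDegree ≤ 2 := by compute_degree
      exact natDegree_mul_le.trans (by omega)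
  · refine (natDegree_C_mul_le _ _).trans (natDegree_mul_le.trans ?_)
    rw [natDegree_X]
    omega

/-- The polynomial `(s + 2)^m (s - 2)^{ℓ-m}`. -/
def pencilBase (ℓ m : ℕ) : ℂ[X] := (X + C 2) ^ m * (X - C 2) ^ (ℓ - m)

theorem eval_pencilBase (m : ℕ) (s : ℂ) :
    (pencilBase ℓ m).eval s = (s + 2) ^ m * (s - 2) ^ (ℓ - m) := by
  simp [pencilBase]

theorem natDegree_pencilBase_le {m : ℕ} (hm : m ≤ ℓ) : (pencilBase ℓ m).natDegree ≤ ℓ := by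
  rw [pencilBase, natDegree_mul (pow_ne_zero _ (X_add_C_ne_zero _))
    (pow_ne_zero _ (X_sub_C_ne_zero _)), natDegree_pow, natDegree_pow, natDegree_X_add_C,
    natDegree_X_sub_C]
  omega

/-- Since (s+2)^m and (s-2)^{ℓ-m} have logarithmic derivatives m/(s+2) and (ℓ-m)/(s-2),
multiplication by 4-s² gives a linear polynomial whose s-part is cancelled by ℓs. Being an
eigenvector is what makes the pencil linear in λ. -/
theorem orbOp_pencilBase {m : ℕ} (hm : m ≤ ℓ) :
    orbOp ℓ (pencilBase ℓ m) = C (4 * m - 2 * ℓ : ℂ) * pencilBase ℓ m := by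
  obtain ⟨k, rfl⟩ := Nat.exists_eq_add_of_le hm
  have h : ∀ (n : ℕ) (p : ℂ[X]), p * derivative (p ^ n) = C (n : ℂ) * p ^ n * derivative p := by
    intro n p
    cases n with
    | zero => simp
    | succ n => rw [derivative_pow_succ]; push_cast; ring
  have h1 := h m (X + C 2)
  have h2 := h k (X - C 2)
  simp only [derivative_add, derivative_sub, derivative_X, derivative_C, add_zero, sub_zero,
    mul_one] at h1 h2
  rw [orbOp, pencilBase, Nat.add_sub_cancel_left, derivative_mul]
  simp only [map_sub, map_mul, Nat.cast_add, map_add, map_ofNat] at h1 h2 ⊢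
  linear_combination (2 - X) * (X - 2) ^ k * h1 + (-(2 + X)) * (X + 2) ^ m * h2

/-- The metric `g` on the orbit space. -/
def orbitG (ℓ : ℕ) (z : Fin ℓ → ℂ) : Matrix (Fin ℓ) (Fin ℓ) ℂ :=
  bezMat ℓ (vp ℓ z) (orbOp ℓ (vp ℓ z))

/-- The metric `η` on the orbit space. -/
def orbitEta (ℓ m : ℕ) (z : Fin ℓ → ℂ) : Matrix (Fin ℓ) (Fin ℓ) ℂ :=
  bezMat ℓ (pencilBase ℓ m) (orbOp ℓ (vp ℓ z) - C (4 * m - 2 * ℓ : ℂ) * vp ℓ z)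

theorem bil_orbitG (z : Fin ℓ → ℂ) (s t : ℂ) :
    (t - s) * bil (orbitG ℓ z) (evVec ℓ s) (evVec ℓ t) =
      (vp ℓ z).eval t * (orbOp ℓ (vp ℓ z)).eval s - (vp ℓ z).eval s * (orbOp ℓ (vp ℓ z)).eval t :=
  bil_bezMat ((natDegree_vp_le z).trans (Nat.sub_le _ _)) (natDegree_orbOp_le (degree_vp_lt z)) s t

theorem bil_orbitEta {m : ℕ} (hm : m ≤ ℓ) (z : Fin ℓ → ℂ) (s t : ℂ) :
    (t - s) * bil (orbitEta ℓ m z) (evVec ℓ s) (evVec ℓ t) =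
      (pencilBase ℓ m).eval t *
          ((orbOp ℓ (vp ℓ z)).eval s - (4 * m - 2 * ℓ) * (vp ℓ z).eval s) -
        (pencilBase ℓ m).eval s *
          ((orbOp ℓ (vp ℓ z)).eval t - (4 * m - 2 * ℓ) * (vp ℓ z).eval t) := by
  rw [orbitEta, bil_bezMat (natDegree_pencilBase_le hm) ((natDegree_sub_le _ _).trans (max_le
    (natDegree_orbOp_le (degree_vp_lt z)) ((natDegree_C_mul_le _ _).trans
    ((natDegree_vp_le z).trans (Nat.sub_le _ _)))))]
  simp only [eval_sub, eval_mul, eval_C]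

theorem continuous_coeff_vp (k : ℕ) : Continuous fun z : Fin ℓ → ℂ => (vp ℓ z).coeff k := by
  simp only [coeff_vp]
  split_ifs
  · exact continuous_entry _
  · exact continuous_const

theorem continuous_orbitG (ℓ : ℕ) : Continuous (orbitG ℓ) := by
  refine continuous_bezMat continuous_coeff_vp fun k => ?_
  have h : ∀ z : Fin ℓ → ℂ, (orbOp ℓ (vp ℓ z)).coeff k =
      4 * ((vp ℓ z).coeff (k + 1) * (k + 1)) -
        (if 2 ≤ k then (vp ℓ z).coeff (k - 2 + 1) * ((k - 2 : ℕ) + 1) else 0) +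
        ℓ * (if 1 ≤ k then (vp ℓ z).coeff (k - 1) else 0) := by
    intro z
    have := coeff_X_pow_mul' (vp ℓ z) 1 k
    rw [pow_one] at this
    rw [orbOp, coeff_add, sub_mul, coeff_sub, coeff_C_mul, coeff_C_mul, coeff_X_pow_mul', this]
    simp only [coeff_derivative]
  simp only [h]
  have h2 := fun k => continuous_coeff_vp (ℓ := ℓ) k
  split_ifs <;> fun_prop

end
end GenFrob
end

noncomputable section
namespace GenFrob
open Polynomial

/-! ### The linear map between the two spaces -/

section
variable {ℓ : ℕ}

theorem vp_hMap (a : Fin ℓ → ℂ) : vp ℓ (hMap ℓ a) = C (-4) * ∑ k : Fin ℓ,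
    C (a k) * (X - C 2) ^ (ℓ - 1 - (k : ℕ)) * (X + C 2) ^ (k : ℕ) := by
  rw [← vp_vec (ℓ := ℓ) (P := C (-4) * ∑ k : Fin ℓ,
    C (a k) * (X - C 2) ^ (ℓ - 1 - (k : ℕ)) * (X + C 2) ^ (k : ℕ))]
  · congr 1
    ext j
    rw [hMap, vec, coeff_C_mul]
  · rw [degree_lt_iff_coeff_zero]
    intro k hk
    rw [coeff_C_mul, finsetSum_coeff, Finset.sum_eq_zero, mul_zero]
    intro j _
    apply coeff_eq_zero_of_natDegree_lt
    have h1 : ((X - C 2 : ℂ[X]) ^ (ℓ - 1 - (j : ℕ))).natDegree ≤ ℓ - 1 - j := by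
      rw [natDegree_pow, natDegree_X_sub_C, mul_one]
    have h2 : ((X + C 2 : ℂ[X]) ^ (j : ℕ)).natDegree ≤ j := by
      rw [natDegree_pow, natDegree_X_add_C, mul_one]
    exact lt_of_le_of_lt (natDegree_mul_le.trans
      (add_le_add ((natDegree_C_mul_le _ _).trans h1) h2)) (by omega)

/-- The Cayley transform `s ↦ (s - 2) / (s + 2)`. -/
def cay (s : ℂ) : ℂ := (s - 2) / (s + 2)

theorem eval_vp_hMap (a : Fin ℓ → ℂ) {s : ℂ} (hs : s + 2 ≠ 0) :
    (vp ℓ (hMap ℓ a)).eval s = -4 * (s + 2) ^ (ℓ - 1) * (vp ℓ a).eval (cay s) := by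
  rw [vp_hMap, eval_mul, eval_C, eval_finsetSum, eval_vp, mul_assoc,
    Finset.mul_sum (f := fun j : Fin ℓ => a j * cay s ^ (ℓ - 1 - (j : ℕ)))]
  congr 1
  refine Finset.sum_congr rfl fun k _ => ?_
  simp only [eval_mul, eval_C, eval_pow, eval_sub, eval_add, eval_X]
  rw [cay, div_pow, show ℓ - 1 = (ℓ - 1 - (k : ℕ)) + k by omega, Nat.add_sub_cancel, pow_add]
  field_simp

theorem cay_sub {s t : ℂ} (hs : s + 2 ≠ 0) (ht : t + 2 ≠ 0) :
    (cay t - cay s) * ((s + 2) * (t + 2)) = 4 * (t - s) := by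
  rw [cay, cay]
  field_simp
  ring

/-- The linear map `hMap`. -/
def hLin (ℓ : ℕ) : (Fin ℓ → ℂ) →ₗ[ℂ] (Fin ℓ → ℂ) where
  toFun := hMap ℓ
  map_add' a b := by
    ext j
    simp only [hMap, Pi.add_apply, map_add, add_mul, Finset.sum_add_distrib, coeff_add, mul_add]
  map_smul' c a := by
    ext j
    simp only [hMap, Pi.smul_apply, smul_eq_mul, map_mul, mul_assoc, ← Finset.mul_sum, coeff_C_mul,
      RingHom.id_apply]
    ring

/-- The Cayley transform takes every value u ≠ 1, at s = 2(1+u)/(1-u), so a vanishing image forces A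
to vanish at all such u. -/
theorem hLin_injective (ℓ : ℕ) : Function.Injective (hLin ℓ) := by
  rw [← LinearMap.ker_eq_bot, LinearMap.ker_eq_bot']
  intro a ha
  refine eq_zero_of_evVec (Set.finite_singleton (1 : ℂ)) fun u hu => ?_
  have hu : 1 - u ≠ 0 := sub_ne_zero.mpr (Ne.symm hu)
  set s := 2 * (1 + u) / (1 - u) with hs
  have hs2 : s + 2 = 4 / (1 - u) := by rw [hs]; field_simp; ring
  have hs0 : s + 2 ≠ 0 := by rw [hs2]; exact div_ne_zero (by norm_num) hu
  have hc : cay s = u := by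
    rw [cay, div_eq_iff hs0, hs2, hs]; field_simp; ring
  have h := eval_vp_hMap a hs0
  rw [show hMap ℓ a = 0 from ha, map_zero, eval_zero, hc] at h
  rw [evVec_dotProduct]
  simpa [hs0] using h.symm

/-- The linear isomorphism `hMap`. -/
def hEquiv (ℓ : ℕ) : (Fin ℓ → ℂ) ≃L[ℂ] (Fin ℓ → ℂ) :=
  (LinearEquiv.ofInjectiveEndo (hLin ℓ) (hLin_injective ℓ)).toContinuousLinearEquiv

theorem hEquiv_apply (a : Fin ℓ → ℂ) : hEquiv ℓ a = hMap ℓ a := rfl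

/-- The matrix of `hMap`. -/
def hMat (ℓ : ℕ) : Matrix (Fin ℓ) (Fin ℓ) ℂ := LinearMap.toMatrix' (hLin ℓ)

theorem hMat_mulVec (a : Fin ℓ → ℂ) : hMat ℓ *ᵥ a = hMap ℓ a :=
  LinearMap.toMatrix'_mulVec (hLin ℓ) a

theorem det_hMat_ne_zero (ℓ : ℕ) : (hMat ℓ).det ≠ 0 := by
  intro h
  obtain ⟨v, hv, h1⟩ := Matrix.exists_mulVec_eq_zero_iff.mpr h
  exact hv (hLin_injective ℓ (by rw [map_zero]; exact (hMat_mulVec v).symm.trans h1))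

theorem hMat_transpose_mulVec_evVec {s : ℂ} (hs : s + 2 ≠ 0) :
    (hMat ℓ)ᵀ *ᵥ evVec ℓ s = (-4 * (s + 2) ^ (ℓ - 1)) • evVec ℓ (cay s) := by
  rw [Matrix.mulVec_transpose]
  apply dotProduct_eq
  intro X
  rw [← Matrix.dotProduct_mulVec, hMat_mulVec, evVec_dotProduct, eval_vp_hMap X hs, smul_dotProduct,
    evVec_dotProduct, smul_eq_mul]

/-- The constant -4 is chosen because cay s - 1 = -4/(s+2): it supplies the factor u - 1 and turns A
into b. -/
theorem eval_hMap (hℓ : 1 ≤ ℓ) (a : Fin ℓ → ℂ) {s : ℂ} (hs : s + 2 ≠ 0) :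
    (vp ℓ (hMap ℓ a)).eval s = (s + 2) ^ ℓ * (bPoly a).eval (cay s) := by
  obtain ⟨n, rfl⟩ := Nat.exists_eq_add_of_le' hℓ
  have h1 : cay s - 1 = -4 / (s + 2) := by rw [cay]; field_simp; ring
  rw [eval_vp_hMap a hs, bPoly, eval_mul, eval_sub, eval_X, eval_one, h1, Nat.add_sub_cancel]
  field_simp
  ring

theorem eval_derivative_hMap (hℓ : 1 ≤ ℓ) (a : Fin ℓ → ℂ) {s : ℂ} (hs : s + 2 ≠ 0) :
    (derivative (vp ℓ (hMap ℓ a))).eval s = ℓ * (s + 2) ^ (ℓ - 1) * (bPoly a).eval (cay s) +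
      (s + 2) ^ ℓ * ((derivative (bPoly a)).eval (cay s) * (4 / (s + 2) ^ 2)) := by
  have h1 : HasDerivAt (fun s => (vp ℓ (hMap ℓ a)).eval s)
      ((derivative (vp ℓ (hMap ℓ a))).eval s) s := Polynomial.hasDerivAt _ _
  have hc : HasDerivAt cay (4 / (s + 2) ^ 2) s := by
    have := ((hasDerivAt_id s).sub_const 2).div ((hasDerivAt_id s).add_const 2) hs
    refine this.congr_deriv ?_
    simp only [id]
    congr 1
    ring
  have h2 : HasDerivAt (fun s => (s + 2) ^ ℓ * (bPoly a).eval (cay s))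
      (ℓ * (s + 2) ^ (ℓ - 1) * 1 * (bPoly a).eval (cay s) +
        (s + 2) ^ ℓ * ((derivative (bPoly a)).eval (cay s) * (4 / (s + 2) ^ 2))) s :=
    (((hasDerivAt_id s).add_const 2).pow ℓ).mul
      ((Polynomial.hasDerivAt (bPoly a) (cay s)).comp s hc)
  have h3 : (fun s => (vp ℓ (hMap ℓ a)).eval s) =ᶠ[𝓝 s]
      fun s => (s + 2) ^ ℓ * (bPoly a).eval (cay s) := by
    have : {s : ℂ | s + 2 ≠ 0} ∈ 𝓝 s :=
      (isOpen_ne_fun (by fun_prop) continuous_const).mem_nhds hs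
    filter_upwards [this] with t ht using eval_hMap hℓ a ht
  rw [h1.unique (h2.congr_of_eventuallyEq h3), mul_one]

/-- Under u = (s-2)/(s+2) one has (4-s²)d/ds = -4u d/du, and differentiating (s+2)^ℓ turns ℓs into
the constant 2ℓ. The free parameter k only shifts by multiples of the polynomial, so the same
identity serves both metrics. -/
theorem eval_orbOp_hMap (hℓ : 1 ≤ ℓ) (a : Fin ℓ → ℂ) (k : ℕ) {s : ℂ} (hs : s + 2 ≠ 0) :
    (orbOp ℓ (vp ℓ (hMap ℓ a))).eval s - (2 * ℓ - 4 * k) * (vp ℓ (hMap ℓ a)).eval s =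
      -4 * (s + 2) ^ ℓ * (dPoly k a).eval (cay s) := by
  have h1 : (dPoly k a).eval (cay s) =
      cay s * (derivative (bPoly a)).eval (cay s) - k * (bPoly a).eval (cay s) := by
    simp [dPoly, mop_apply]
  rw [eval_orbOp, eval_derivative_hMap hℓ a hs, eval_hMap hℓ a hs, h1]
  generalize (derivative (bPoly a)).eval (cay s) = b'
  generalize (bPoly a).eval (cay s) = b
  obtain ⟨n, rfl⟩ := Nat.exists_eq_add_of_le' hℓ
  rw [cay, Nat.add_sub_cancel]
  field_simp
  ring

variable {m : ℕ}

theorem bil_smul_smul (M : Matrix (Fin ℓ) (Fin ℓ) ℂ) (c d : ℂ) (X Y : Fin ℓ → ℂ) :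
    bil M (c • X) (d • Y) = c * d * bil M X Y := by
  rw [bil, Matrix.mulVec_smul, dotProduct_smul, smul_dotProduct, smul_eq_mul, smul_eq_mul, bil]
  ring

theorem bil_inv_etaMatLG (hℓ : 1 ≤ ℓ) (hm : m ≤ ℓ) {a : Fin ℓ → ℂ} (ha : a ∈ spaceLG ℓ m) (s t : ℂ) :
    bil (etaMatLG ℓ m a)⁻¹ (evVec ℓ s) (evVec ℓ t) = (vp ℓ (xiVec m a t)).eval s := by
  rw [bil, etaMatLG_inv_mulVec hℓ hm ha, evVec_dotProduct]

/-- The pencil base becomes (s+2)^ℓ u^{ℓ-m}, so the Bezoutian defining η becomes that of u^{ℓ-m} and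
D, which is the inverse metric of the superpotentials with ℓ-m for m. -/
theorem orbitEta_hMap (hℓ : 1 ≤ ℓ) (hm : m ≤ ℓ) {a : Fin ℓ → ℂ} (ha : a ∈ spaceLG ℓ (ℓ - m)) :
    orbitEta ℓ m (hMap ℓ a) =
      (1 / 2 : ℂ) • (hMat ℓ * (etaMatLG ℓ (ℓ - m) a)⁻¹ * (hMat ℓ)ᵀ) := by
  refine matrix_ext_evVec (Set.finite_singleton (-2 : ℂ)) fun s hs t ht hst => ?_
  have hs : s + 2 ≠ 0 := fun h => hs (eq_neg_of_add_eq_zero_left h)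
  have ht : t + 2 ≠ 0 := fun h => ht (eq_neg_of_add_eq_zero_left h)
  have hts : t - s ≠ 0 := sub_ne_zero.mpr hst.symm
  rw [bil_smul_left, bil_conj, hMat_transpose_mulVec_evVec hs, hMat_transpose_mulVec_evVec ht,
    bil_smul_smul, bil_inv_etaMatLG hℓ (Nat.sub_le _ _) ha]
  have h1 := bil_orbitEta hm (hMap ℓ a) s t
  have h2 := eval_xiVec (a := a) hℓ (Nat.sub_le ℓ m) (cay t) (cay s)
  have h3 := cay_sub hs ht
  have e1 := eval_orbOp_hMap hℓ a (ℓ - m) hs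
  have e2 := eval_orbOp_hMap hℓ a (ℓ - m) ht
  have hB : ∀ s : ℂ, s + 2 ≠ 0 → (pencilBase ℓ m).eval s = (s + 2) ^ ℓ * cay s ^ (ℓ - m) := by
    intro s hs
    have h : (s + 2) ^ ℓ = (s + 2) ^ m * (s + 2) ^ (ℓ - m) := by
      rw [← pow_add, Nat.add_sub_of_le hm]
    rw [eval_pencilBase, cay, div_pow, h]
    field_simp
  have hc : (4 * m - 2 * ℓ : ℂ) = 2 * ℓ - 4 * (ℓ - m : ℕ) := by push_cast [hm]; ring
  rw [hB s hs, hB t ht, hc, e1, e2] at h1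
  apply mul_left_cancel₀ hts
  rw [h1]
  obtain ⟨n, rfl⟩ := Nat.exists_eq_add_of_le' hℓ
  rw [Nat.add_sub_cancel]
  have h3' : t - s = (cay t - cay s) * ((s + 2) * (t + 2)) / 4 := by rw [h3]; ring
  rw [h3']
  linear_combination (2 * (s + 2) ^ (n + 1) * (t + 2) ^ (n + 1)) * h2

/-- Both sides are Bezoutians of b and D. Changing m alters D by a multiple of b, which does not
affect them; so every m is admitted here, in accordance with g being independent of m. -/
theorem orbitG_hMap (hℓ : 1 ≤ ℓ) (hm : m ≤ ℓ) {a : Fin ℓ → ℂ} (ha : a ∈ spaceLG ℓ m) :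
    orbitG ℓ (hMap ℓ a) = (1 / 2 : ℂ) •
      (hMat ℓ * intersectionForm (etaMatLG ℓ m) (mulLG ℓ m) id a * (hMat ℓ)ᵀ) := by
  refine matrix_ext_evVec (Set.finite_singleton (-2 : ℂ)) fun s hs t ht hst => ?_
  have hs : s + 2 ≠ 0 := fun h => hs (eq_neg_of_add_eq_zero_left h)
  have ht : t + 2 ≠ 0 := fun h => ht (eq_neg_of_add_eq_zero_left h)
  have hts : t - s ≠ 0 := sub_ne_zero.mpr hst.symm
  have hF := frobDataLG hℓ hm
  have hI : ∀ u v, bil (intersectionForm (etaMatLG ℓ m) (mulLG ℓ m) id a) (evVec ℓ u) (evVec ℓ v) =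
      (vp ℓ (smap ℓ m a (xiVec m a v) a)).eval u := by
    intro u v
    have hM : intersectionForm (etaMatLG ℓ m) (mulLG ℓ m) id a *ᵥ evVec ℓ v =
        smap ℓ m a (xiVec m a v) a := by
      rw [← etaMatLG_inv_mulVec hℓ hm ha, smap_comm, ← prod_mulLG hℓ hm ha]
      have hsum : (etaMatLG ℓ m a)⁻¹ *ᵥ evVec ℓ v = ∑ j, evVec ℓ v j • (etaMatLG ℓ m a)⁻¹ j := by
        have hsymm : ((etaMatLG ℓ m a)⁻¹).IsSymm := by
          rw [Matrix.IsSymm, Matrix.transpose_nonsing_inv, (etaMatLG_symm hℓ hm ha).eq]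
        ext i
        rw [Finset.sum_apply, Matrix.mulVec, dotProduct]
        exact Finset.sum_congr rfl fun j _ => by
          rw [hsymm.apply, mul_comm, Pi.smul_apply, smul_eq_mul]
      rw [hsum, ← prodL_apply, map_sum]
      ext i
      rw [Finset.sum_apply, Matrix.mulVec, dotProduct]
      refine Finset.sum_congr rfl fun j _ => ?_
      rw [intersectionForm_eq (det_etaMatLG_ne_zero hℓ hm ha) (hF.comm a ha) (hF.invariant a ha),
        map_smul, prodL_apply, Pi.smul_apply, smul_eq_mul, mul_comm]
    rw [bil, hM, evVec_dotProduct]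
  rw [bil_smul_left, bil_conj, hMat_transpose_mulVec_evVec hs, hMat_transpose_mulVec_evVec ht,
    bil_smul_smul, hI]
  have h1 := bil_orbitG (hMap ℓ a) s t
  have h2 := eval_smap_xiVec hℓ hm ha (cay t) (cay s)
  have h3 := cay_sub hs ht
  have e1 := eval_orbOp_hMap hℓ a m hs
  have e2 := eval_orbOp_hMap hℓ a m ht
  rw [sub_eq_iff_eq_add] at e1 e2
  rw [e1, e2, eval_hMap hℓ a hs, eval_hMap hℓ a ht] at h1
  apply mul_left_cancel₀ hts
  rw [h1]
  obtain ⟨n, rfl⟩ := Nat.exists_eq_add_of_le' hℓ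
  rw [Nat.add_sub_cancel]
  have h3' : t - s = (cay t - cay s) * ((s + 2) * (t + 2)) / 4 := by rw [h3]; ring
  rw [h3']
  linear_combination (2 * (s + 2) ^ (n + 1) * (t + 2) ^ (n + 1)) * h2

/-- A vanishing end coefficient of a makes P_z vanish at s = -2 or s = 2. If the pencil base
vanishes there too, then so does every term of the Bezoutian, 4 - s² being zero, and the evaluation
vector at s lies in the kernel of η. -/
theorem mem_spaceLG_of_det_orbitEta (hℓ : 1 ≤ ℓ) (hm : m ≤ ℓ) {a : Fin ℓ → ℂ}
    (h : (orbitEta ℓ m (hMap ℓ a)).det ≠ 0) : a ∈ spaceLG ℓ (ℓ - m) := by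
  have key : ∀ s, (pencilBase ℓ m).eval s = 0 → s ^ 2 = 4 → (vp ℓ (hMap ℓ a)).eval s ≠ 0 := by
    intro s hB hs hz
    have hL : (orbOp ℓ (vp ℓ (hMap ℓ a))).eval s = 0 := by rw [eval_orbOp, hs, hz]; ring
    have h0 : evVec ℓ s = 0 := by
      refine bil_nondeg h fun X => ?_
      have h0 : orbitEta ℓ m (hMap ℓ a) *ᵥ evVec ℓ s = 0 := by
        refine eq_zero_of_evVec (Set.finite_singleton s) fun t ht => ?_
        have hts : s - t ≠ 0 := sub_ne_zero.mpr (Ne.symm ht)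
        apply mul_left_cancel₀ hts
        have := bil_orbitEta hm (hMap ℓ a) t s
        rw [hB, hL, hz] at this
        rw [bil] at this
        rw [this]
        ring
      rw [bil, h0, dotProduct_zero]
    have h1 : evVec ℓ s ⟨ℓ - 1, by omega⟩ = 1 := by simp [evVec]
    rw [h0] at h1
    exact zero_ne_one h1
  have hv : ∀ s, (vp ℓ (hMap ℓ a)).eval s = -4 * ∑ k : Fin ℓ,
      a k * (s - 2) ^ (ℓ - 1 - (k : ℕ)) * (s + 2) ^ (k : ℕ) := by
    intro s
    rw [vp_hMap, eval_mul, eval_C, eval_finsetSum]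
    simp only [eval_mul, eval_C, eval_pow, eval_sub, eval_add, eval_X]
  constructor
  · intro h1 h0
    refine key (-2) ?_ (by norm_num) ?_
    · rw [eval_pencilBase, neg_add_cancel, zero_pow (by omega), zero_mul]
    · rw [hv, Finset.sum_eq_zero, mul_zero]
      intro k _
      rcases Nat.eq_zero_or_pos k with hk | hk
      · rw [show a k = entry a 0 by rw [entry, dif_pos (by omega)]; congr; exact Fin.ext hk, h0]
        ring
      · rw [neg_add_cancel, zero_pow (by omega), mul_zero]
  · intro h1 h0
    refine key 2 ?_ (by norm_num) ?_
    · rw [eval_pencilBase, sub_self, zero_pow (by omega), mul_zero]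
    · rw [hv, Finset.sum_eq_zero, mul_zero]
      intro k _
      rcases Nat.lt_or_ge k (ℓ - 1) with hk | hk
      · rw [sub_self, zero_pow (by omega), mul_zero, zero_mul]
      · rw [show a k = entry a (ℓ - 1) by
          rw [entry, dif_pos (by omega)]; congr; apply Fin.ext; simp; omega, h0]
        ring

theorem det_orbitEta_ne_zero_iff (hℓ : 1 ≤ ℓ) (hm : m ≤ ℓ) (a : Fin ℓ → ℂ) :
    (orbitEta ℓ m (hMap ℓ a)).det ≠ 0 ↔ a ∈ spaceLG ℓ (ℓ - m) := by
  refine ⟨mem_spaceLG_of_det_orbitEta hℓ hm, fun ha => ?_⟩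
  rw [orbitEta_hMap hℓ hm ha, Matrix.det_smul, Matrix.det_mul, Matrix.det_mul, Matrix.det_transpose,
    Matrix.det_nonsing_inv, Ring.inverse_eq_inv]
  exact mul_ne_zero (pow_ne_zero _ (by norm_num)) (mul_ne_zero (mul_ne_zero (det_hMat_ne_zero ℓ)
    (inv_ne_zero (det_etaMatLG_ne_zero hℓ (Nat.sub_le _ _) ha))) (det_hMat_ne_zero ℓ))

end
end GenFrob
end

noncomputable section
namespace GenFrob
open Polynomial

/-! ### The basic generators -/

section
variable {ℓ : ℕ}

/-- Permutations are grouped by the image of K; all groups are cosets of the stabilizer and have the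
same size. -/
theorem sum_perm_map (K : Finset (Fin ℓ)) (F : Finset (Fin ℓ) → ℂ) :
    ∑ σ : Equiv.Perm (Fin ℓ), F (K.map σ.toEmbedding) =
      ({σ : Equiv.Perm (Fin ℓ) | K.map σ.toEmbedding = K} : Finset _).card *
        ∑ S ∈ Finset.powersetCard K.card Finset.univ, F S := by
  rw [← Finset.sum_fiberwise_of_maps_to (s := Finset.univ)
    (t := Finset.powersetCard K.card Finset.univ)
    (g := fun σ : Equiv.Perm (Fin ℓ) => K.map σ.toEmbedding), Finset.mul_sum]
  · refine Finset.sum_congr rfl fun S hS => ?_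
    obtain ⟨τ, hτ⟩ := Equiv.Perm.exists_map_finset_eq K S (Finset.mem_powersetCard.mp hS).2.symm
    have hcard : ({σ : Equiv.Perm (Fin ℓ) | K.map σ.toEmbedding = K} : Finset _).card =
        ({σ : Equiv.Perm (Fin ℓ) | K.map σ.toEmbedding = S} : Finset _).card := by
      refine Finset.card_equiv (Equiv.mulLeft τ) fun σ => ?_
      simp only [Finset.mem_filter, Finset.mem_univ, true_and, Equiv.coe_mulLeft]
      have h : K.map (τ * σ).toEmbedding = (K.map σ.toEmbedding).map τ.toEmbedding := by
        rw [Finset.map_map]; rfl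
      rw [h, ← hτ, Finset.map_inj]
    rw [hcard, ← nsmul_eq_mul, ← Finset.sum_const]
    exact Finset.sum_congr rfl fun σ hσ => by rw [(Finset.mem_filter.mp hσ).2]
  · intro σ _
    simp [Finset.mem_powersetCard]

theorem sum_signs (f : Fin ℓ → ℤˣ → ℂ) :
    ∑ ε : Fin ℓ → ℤˣ, ∏ k, f k (ε k) = ∏ k, (f k 1 + f k (-1)) := by
  rw [← Fintype.prod_sum]
  refine Finset.prod_congr rfl fun k _ => ?_
  rw [show (Finset.univ : Finset ℤˣ) = {1, -1} from rfl, Finset.sum_pair (by decide)]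

/-- The quantities `2 cos (2π v_k)`. -/
def xiFun (v : Fin ℓ → ℂ) (k : Fin ℓ) : ℂ := 2 * Complex.cos (2 * Real.pi * v k)

/-- The weight sees only the first entries: there the two signs add up to 2cos, and each sign on the
other entries contributes a factor 2. The stabilizer has the same factor, so dividing by its order
leaves an elementary symmetric function. -/
theorem sum_weyl_exp (j : ℕ) (v : Fin ℓ → ℂ) :
    ∑ w, Complex.exp (2 * Real.pi * Complex.I * (weight ℓ j ⬝ᵥ weylAct ℓ w v)) =
      2 ^ ({k : Fin ℓ | ¬ (k : ℕ) ≤ j} : Finset _).card *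
        ∑ σ : Equiv.Perm (Fin ℓ),
          ∏ k ∈ ({k : Fin ℓ | (k : ℕ) ≤ j} : Finset _).map σ.toEmbedding, xiFun v k := by
  rw [Fintype.sum_prod_type, Finset.mul_sum]
  refine Finset.sum_congr rfl fun σ _ => ?_
  have h1 : ∀ ε : Fin ℓ → ℤˣ,
      Complex.exp (2 * Real.pi * Complex.I * (weight ℓ j ⬝ᵥ weylAct ℓ (σ, ε) v)) =
        ∏ k : Fin ℓ, if (k : ℕ) ≤ j then
          Complex.exp (2 * Real.pi * Complex.I * (((ε k : ℤ) : ℂ) * v (σ k))) else 1 := by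
    intro ε
    rw [dotProduct, Finset.mul_sum, Complex.exp_sum]
    refine Finset.prod_congr rfl fun k _ => ?_
    rw [weight, weylAct]
    split_ifs
    · rw [one_mul]
    · rw [zero_mul, mul_zero, Complex.exp_zero]
  simp only [h1]
  rw [sum_signs fun k u => if (k : ℕ) ≤ j then
    Complex.exp (2 * Real.pi * Complex.I * (((u : ℤ) : ℂ) * v (σ k))) else 1, Finset.prod_map]
  have h2 : ∀ k : Fin ℓ, ((if (k : ℕ) ≤ j then
      Complex.exp (2 * Real.pi * Complex.I * ((((1 : ℤˣ) : ℤ) : ℂ) * v (σ k))) else 1) +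
      (if (k : ℕ) ≤ j then
        Complex.exp (2 * Real.pi * Complex.I * ((((-1 : ℤˣ) : ℤ) : ℂ) * v (σ k))) else 1)) =
      if (k : ℕ) ≤ j then xiFun v (σ k) else 2 := by
    intro k
    split_ifs
    · rw [xiFun, Complex.two_cos]
      push_cast
      congr 2 <;> ring
    · norm_num
  simp only [h2]
  rw [Finset.prod_ite, Finset.prod_const, mul_comm]
  rfl

theorem weylAct_weight_eq_iff (j : ℕ) (σ : Equiv.Perm (Fin ℓ)) (ε : Fin ℓ → ℤˣ) :
    weylAct ℓ (σ, ε) (weight ℓ j) = weight ℓ j ↔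
      ({k : Fin ℓ | (k : ℕ) ≤ j} : Finset _).map σ.toEmbedding =
        ({k : Fin ℓ | (k : ℕ) ≤ j} : Finset _) ∧ ∀ k : Fin ℓ, (k : ℕ) ≤ j → ε k = 1 := by
  constructor
  · intro h
    have h1 : ∀ k : Fin ℓ, (k : ℕ) ≤ j → ((σ k : Fin ℓ) : ℕ) ≤ j ∧ ε k = 1 := by
      intro k hk
      have := congrFun h k
      simp only [weylAct, weight, if_pos hk] at this
      split_ifs at this with h2
      · rw [mul_one] at this
        exact ⟨h2, Units.ext (Int.cast_injective (α := ℂ) (this.trans Int.cast_one.symm))⟩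
      · simp at this
    refine ⟨Finset.eq_of_subset_of_card_le ?_ (by rw [Finset.card_map]), fun k hk => (h1 k hk).2⟩
    intro k hk
    obtain ⟨i, hi, rfl⟩ := Finset.mem_map.mp hk
    exact Finset.mem_filter.mpr ⟨Finset.mem_univ _, (h1 i (Finset.mem_filter.mp hi).2).1⟩
  · rintro ⟨h1, h2⟩
    ext k
    have h3 : (σ k : ℕ) ≤ j ↔ (k : ℕ) ≤ j := by
      have := Finset.mem_map' σ.toEmbedding (a := k) (s := {k : Fin ℓ | (k : ℕ) ≤ j})
      rw [h1] at this
      simpa using this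
    simp only [weylAct, weight, h3]
    split_ifs with h4
    · simp [h2 k h4]
    · simp

theorem card_stabilizer (j : ℕ) :
    (Nat.card {w // weylAct ℓ w (weight ℓ j) = weight ℓ j} : ℂ) =
      ({σ : Equiv.Perm (Fin ℓ) | ({k : Fin ℓ | (k : ℕ) ≤ j} : Finset _).map σ.toEmbedding =
        ({k : Fin ℓ | (k : ℕ) ≤ j} : Finset _)} : Finset _).card *
        2 ^ ({k : Fin ℓ | ¬ (k : ℕ) ≤ j} : Finset _).card := by
  classical
  have h1 : ∀ σ ε, (if weylAct ℓ (σ, ε) (weight ℓ j) = weight ℓ j then (1 : ℂ) else 0) =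
      (if ({k : Fin ℓ | (k : ℕ) ≤ j} : Finset _).map σ.toEmbedding =
        ({k : Fin ℓ | (k : ℕ) ≤ j} : Finset _) then 1 else 0) *
        ∏ k : Fin ℓ, (if (k : ℕ) ≤ j then (if ε k = 1 then 1 else 0) else 1) := by
    intro σ ε
    simp only [weylAct_weight_eq_iff, ite_and]
    split_ifs with h2 h3
    · rw [one_mul, Finset.prod_eq_one]
      intro k _
      split_ifs with h4 h5
      · rfl
      · exact absurd (h3 k h4) h5
      · rfl
    · push Not at h3
      obtain ⟨k, hk, h4⟩ := h3
      rw [Finset.prod_eq_zero (Finset.mem_univ k), mul_zero]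
      rw [if_pos hk, if_neg h4]
    · rw [zero_mul]
  rw [Nat.card_eq_fintype_card, Fintype.card_subtype, ← Finset.sum_boole, Fintype.sum_prod_type]
  simp only [h1, ← Finset.mul_sum]
  rw [sum_signs fun k u => if (k : ℕ) ≤ j then (if u = 1 then 1 else 0) else 1, ← Finset.sum_mul,
    Finset.sum_boole]
  congr 1
  have hne : ¬ (-1 : ℤˣ) = 1 := by decide
  have h2 : ∀ k : Fin ℓ, ((if (k : ℕ) ≤ j then (1 : ℂ) else 1) +
      (if (k : ℕ) ≤ j then 0 else 1)) = if (k : ℕ) ≤ j then 1 else 2 := by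
    intro k
    split_ifs <;> norm_num
  simp only [hne, if_true, if_false, h2]
  rw [Finset.prod_ite, Finset.prod_const, Finset.prod_const, one_pow, one_mul]

/-- The polynomial `∏_k (s + 2 cos (2π v_k))`. -/
def weylPoly (v : Fin ℓ → ℂ) : ℂ[X] := ∏ k, (X + C (xiFun v k))

theorem basicGen_eq (c : ℂ) (x : Fin ℓ → ℂ) (j : Fin ℓ) :
    basicGen ℓ c x j = lam c * (weylPoly (point ℓ c x)).coeff (ℓ - 1 - (j : ℕ)) := by
  have hI : ({k : Fin ℓ | (k : ℕ) ≤ (j : ℕ)} : Finset (Fin ℓ)) = Finset.Iic j := by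
    ext k
    rw [Finset.mem_filter, Finset.mem_Iic, Fin.le_def]
    exact and_iff_right (Finset.mem_univ k)
  have hK : ({k : Fin ℓ | (k : ℕ) ≤ (j : ℕ)} : Finset (Fin ℓ)).card = ℓ - (ℓ - 1 - (j : ℕ)) := by
    rw [hI, Fin.card_Iic]
    omega
  have hM : (({σ : Equiv.Perm (Fin ℓ) |
      ({k : Fin ℓ | (k : ℕ) ≤ (j : ℕ)} : Finset _).map σ.toEmbedding =
        ({k : Fin ℓ | (k : ℕ) ≤ (j : ℕ)} : Finset _)} : Finset _).card : ℂ) ≠ 0 := by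
    rw [Nat.cast_ne_zero, Finset.card_ne_zero]
    exact ⟨1, Finset.mem_filter.mpr ⟨Finset.mem_univ _, Finset.map_refl⟩⟩
  rw [basicGen, sum_weyl_exp, card_stabilizer,
    sum_perm_map _ fun S => ∏ k ∈ S, xiFun (point ℓ c x) k, weylPoly,
    Finset.prod_X_add_C_coeff _ _ (by rw [Finset.card_univ, Fintype.card_fin]; omega),
    Finset.card_univ, Fintype.card_fin, hK]
  field_simp

/-! ### The pencil -/

theorem monic_pencilBase (m : ℕ) : (pencilBase ℓ m).Monic :=
  ((monic_X_add_C 2).pow m).mul ((monic_X_sub_C 2).pow (ℓ - m))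

/-- The constants c_j are those for which z is λ times the difference of two monic polynomials of
degree ℓ, so that the top coefficients cancel. -/
theorem vp_pencilGen {m : ℕ} (hm : m ≤ ℓ) (c : ℂ) (x : Fin ℓ → ℂ) :
    vp ℓ (pencilGen ℓ m c x) =
      C (lam c) * (weylPoly (point ℓ c x) - pencilBase ℓ m) := by
  have hR : (weylPoly (point ℓ c x)).Monic :=
    monic_prod_of_monic _ _ fun k _ => monic_X_add_C _
  have hd : (weylPoly (point ℓ c x)).degree = ℓ := by
    rw [weylPoly, degree_prod]; simp
  have hB : (pencilBase ℓ m).degree = ℓ := by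
    rw [pencilBase, degree_mul, degree_pow, degree_pow, degree_X_add_C, degree_X_sub_C]
    simp only [nsmul_eq_mul, mul_one]
    rw [← Nat.cast_add, Nat.add_sub_of_le hm]
  rw [← vp_vec (ℓ := ℓ) (P := C (lam c) * (weylPoly (point ℓ c x) - pencilBase ℓ m))]
  · congr 1
    ext j
    rw [pencilGen, basicGen_eq, shiftCoeff, vec, coeff_C_mul, coeff_sub, coeff_sub, coeff_X_pow,
      if_neg (by omega)]
    rw [pencilBase]
    ring
  · rw [← smul_eq_C_mul]
    refine lt_of_le_of_lt (degree_smul_le _ _) ?_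
    refine (degree_sub_lt_left (hd.trans hB.symm) hR.ne_zero ?_).trans_eq hd
    rw [hR.leadingCoeff, (monic_pencilBase m).leadingCoeff]

theorem differentiable_pencilGen (m : ℕ) (c : ℂ) : Differentiable ℂ (pencilGen ℓ m c) := by
  rw [differentiable_pi]
  intro j
  simp only [pencilGen, basicGen, dotProduct, weylAct, point, Pi.add_apply, Pi.smul_apply,
    Finset.sum_apply, smul_eq_mul]
  fun_prop

/-- The coroots as the rows of a matrix. -/
def corootMat (ℓ : ℕ) : Matrix (Fin ℓ) (Fin ℓ) ℂ := Matrix.of fun r => coroot ℓ r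

theorem det_corootMat (ℓ : ℕ) : (corootMat ℓ).det = 1 := by
  rw [Matrix.det_of_isUpperTriangular]
  · exact Finset.prod_eq_one fun i _ => by simp [corootMat, coroot]
  · intro i j hij
    have hij : j < i := hij
    simp only [corootMat, coroot, Matrix.of_apply]
    rw [if_neg hij.ne, if_neg (by rw [Fin.lt_def] at hij; omega)]

/-- The derivatives of `λ ∏_k (s + ξ_k)` with respect to the `v_k`. -/
def gradVec (c : ℂ) (v : Fin ℓ → ℂ) (s : ℂ) (k : Fin ℓ) : ℂ :=
  lam c * ((∏ i ∈ Finset.univ.erase k, (s + xiFun v i)) *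
    (-(4 * Real.pi) * Complex.sin (2 * Real.pi * v k)))

theorem jac_transpose_mulVec_evVec {m : ℕ} (hm : m ≤ ℓ) (c : ℂ) (x : Fin ℓ → ℂ) (s : ℂ) :
    (jac (pencilGen ℓ m c) x)ᵀ *ᵥ evVec ℓ s = corootMat ℓ *ᵥ gradVec c (point ℓ c x) s := by
  have hp : ∀ k, HasFDerivAt (fun x => point ℓ c x k)
      (∑ j, coroot ℓ j k • ContinuousLinearMap.proj (R := ℂ) (φ := fun _ : Fin ℓ => ℂ) j) x := by
    intro k
    have : ∀ y : Fin ℓ → ℂ, point ℓ c y k =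
        (∑ j, coroot ℓ j k • ContinuousLinearMap.proj (R := ℂ) (φ := fun _ : Fin ℓ => ℂ) j) y +
          c * weight ℓ 0 k := by
      intro y
      simp [point, add_comm, mul_comm]
    simp only [this]
    exact (ContinuousLinearMap.hasFDerivAt _).add_const _
  have hξ : ∀ k, HasFDerivAt (fun x => s + xiFun (point ℓ c x) k)
      ((-(4 * Real.pi) * Complex.sin (2 * Real.pi * point ℓ c x k)) • ∑ j, coroot ℓ j k •
        ContinuousLinearMap.proj (R := ℂ) (φ := fun _ : Fin ℓ => ℂ) j) x := by
    intro k
    have h1 := (((hp k).const_mul (2 * Real.pi : ℂ)).ccos.const_mul 2).const_add s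
    refine h1.congr_fderiv ?_
    rw [smul_smul, smul_smul]
    congr 1
    ring
  have h1 := ((HasFDerivAt.finsetProd (u := Finset.univ) fun k _ => hξ k).sub_const
    ((pencilBase ℓ m).eval s)).const_mul (lam c)
  have h2 : (fun x => evVec ℓ s ⬝ᵥ pencilGen ℓ m c x) = fun x =>
      lam c * (∏ k, (s + xiFun (point ℓ c x) k) - (pencilBase ℓ m).eval s) := by
    ext y
    rw [evVec_dotProduct, vp_pencilGen hm]
    simp [weylPoly, eval_prod]
  have h3 : HasFDerivAt (fun x => evVec ℓ s ⬝ᵥ pencilGen ℓ m c x)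
      (∑ i, evVec ℓ s i • (ContinuousLinearMap.proj i ∘L fderiv ℂ (pencilGen ℓ m c) x)) x :=
    HasFDerivAt.fun_sum fun i _ =>
      (hasFDerivAt_pi'.mp (differentiable_pencilGen m c x).hasFDerivAt i).const_mul _
  rw [h2] at h3
  have h4 := h3.unique h1
  ext r
  have h5 := congrArg (fun L => L (Pi.single r 1)) h4
  simp only [sum_apply, smul_apply, ContinuousLinearMap.comp_apply,
    ContinuousLinearMap.proj_apply, smul_eq_mul] at h5
  rw [Matrix.mulVec, dotProduct, Matrix.mulVec, dotProduct]
  refine Eq.trans ?_ (h5.trans ?_)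
  · exact Finset.sum_congr rfl fun i _ => mul_comm _ _
  · rw [Finset.mul_sum]
    refine Finset.sum_congr rfl fun k _ => ?_
    simp only [Pi.single_apply, mul_ite, mul_one, mul_zero, Finset.sum_ite_eq', Finset.mem_univ,
      if_true]
    rw [gradVec, corootMat, Matrix.of_apply]
    ring

/-- The Jacobian factors through the coroot matrix K and the Gram matrix is KKᵀ, so its inverse
cancels K and the Euclidean product of the gradients in v remains. -/
theorem bil_pushMetric {m : ℕ} (hm : m ≤ ℓ) (c : ℂ) (x : Fin ℓ → ℂ) (s t : ℂ) :
    bil (pushMetric ℓ m c x) (evVec ℓ s) (evVec ℓ t) = 1 / (4 * (Real.pi : ℂ) ^ 2) *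
      (gradVec c (point ℓ c x) s ⬝ᵥ gradVec c (point ℓ c x) t) := by
  have hK : IsUnit (corootMat ℓ).det := by rw [det_corootMat]; exact isUnit_one
  have hG : (Matrix.of fun r s => coroot ℓ r ⬝ᵥ coroot ℓ s) = corootMat ℓ * (corootMat ℓ)ᵀ := rfl
  rw [pushMetric, bil_smul_left, bil_conj, jac_transpose_mulVec_evVec hm,
    jac_transpose_mulVec_evVec hm, hG, Matrix.mul_inv_rev, bil, ← Matrix.mulVec_mulVec,
    Matrix.mulVec_mulVec _ _ (corootMat ℓ), Matrix.nonsing_inv_mul _ hK, Matrix.one_mulVec,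
    Matrix.dotProduct_mulVec, ← Matrix.mulVec_transpose, Matrix.mulVec_mulVec,
    ← Matrix.transpose_nonsing_inv, Matrix.transpose_transpose, Matrix.nonsing_inv_mul _ hK,
    Matrix.one_mulVec]

theorem isMetricPencil {m : ℕ} (hm : m ≤ ℓ) : IsMetricPencil ℓ m (orbitG ℓ) (orbitEta ℓ m) := by
  intro c x
  refine matrix_ext_evVec Set.finite_empty fun s _ t _ hst => ?_
  have hts : t - s ≠ 0 := sub_ne_zero.mpr hst.symm
  apply mul_left_cancel₀ hts
  set z := pencilGen ℓ m c x with hz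
  set v := point ℓ c x with hv
  set R : ℂ[X] := weylPoly v with hR
  have hP : C (lam c) * R = vp ℓ z + C (lam c) * pencilBase ℓ m := by
    rw [hz, vp_pencilGen hm]; ring
  have hadd : ∀ P Q : ℂ[X], orbOp ℓ (P + Q) = orbOp ℓ P + orbOp ℓ Q := by
    intro P Q; simp only [orbOp, derivative_add]; ring
  have hsmul : ∀ P : ℂ[X], orbOp ℓ (C (lam c) * P) = C (lam c) * orbOp ℓ P := by
    intro P; simp only [orbOp, derivative_C_mul]; ring
  have hL := congrArg (orbOp ℓ) hP
  rw [hadd, hsmul, hsmul, orbOp_pencilBase hm] at hL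
  have hPe : ∀ u, lam c * R.eval u = (vp ℓ z).eval u + lam c * (pencilBase ℓ m).eval u := by
    intro u; simpa using congrArg (eval u) hP
  have hLe : ∀ u, lam c * (orbOp ℓ R).eval u = (orbOp ℓ (vp ℓ z)).eval u +
      lam c * ((4 * m - 2 * ℓ) * (pencilBase ℓ m).eval u) := by
    intro u; simpa using congrArg (eval u) hL
  have hR1 : ∀ u, R.eval u = ∏ k, (u + xiFun v k) := by
    intro u; simp [hR, weylPoly, eval_prod]
  have hR2 : ∀ u, (derivative R).eval u = ∑ k, ∏ i ∈ Finset.univ.erase k, (u + xiFun v i) := by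
    intro u
    rw [hR, weylPoly, derivative_prod_finset, eval_finsetSum]
    simp [eval_prod]
  have hR3 : ∀ u k, R.eval u = (u + xiFun v k) * ∏ i ∈ Finset.univ.erase k, (u + xiFun v i) := by
    intro u k
    rw [hR1, Finset.mul_prod_erase _ (fun i => u + xiFun v i) (Finset.mem_univ k)]
  have hO : ∀ u, (orbOp ℓ R).eval u = ∑ k, ((4 - u ^ 2) + u * (u + xiFun v k)) *
      ∏ i ∈ Finset.univ.erase k, (u + xiFun v i) := by
    intro u
    simp only [add_mul, mul_assoc, ← hR3, Finset.sum_add_distrib, ← Finset.mul_sum, Finset.sum_const,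
      Finset.card_univ, Fintype.card_fin, nsmul_eq_mul]
    rw [eval_orbOp, hR2]
    ring
  -- Termwise this is (t+ξ)(4+sξ) - (s+ξ)(4+tξ) = (t-s)(4-ξ²).
  have key : R.eval t * (orbOp ℓ R).eval s - R.eval s * (orbOp ℓ R).eval t =
      (t - s) * ∑ k, (4 - xiFun v k ^ 2) * ((∏ i ∈ Finset.univ.erase k, (s + xiFun v i)) *
        ∏ i ∈ Finset.univ.erase k, (t + xiFun v i)) := by
    rw [hO, hO, Finset.mul_sum, Finset.mul_sum, Finset.mul_sum, ← Finset.sum_sub_distrib]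
    refine Finset.sum_congr rfl fun k _ => ?_
    rw [hR3 t k, hR3 s k]
    ring
  have hq : bil (pushMetric ℓ m c x) (evVec ℓ s) (evVec ℓ t) = lam c ^ 2 *
      ∑ k, (4 - xiFun v k ^ 2) * ((∏ i ∈ Finset.univ.erase k, (s + xiFun v i)) *
        ∏ i ∈ Finset.univ.erase k, (t + xiFun v i)) := by
    rw [bil_pushMetric hm, dotProduct, Finset.mul_sum, Finset.mul_sum]
    refine Finset.sum_congr rfl fun k _ => ?_
    have hπ : (Real.pi : ℂ) ≠ 0 := by exact_mod_cast Real.pi_ne_zero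
    -- The factor 4 - ξ² is (dξ/dv)²/(4π²) for ξ = 2cos(2πv), in agreement with the normalization of
    -- the metric.
    have h4 : 4 - xiFun v k ^ 2 = 4 * Complex.sin (2 * Real.pi * v k) ^ 2 := by
      rw [xiFun, mul_pow, Complex.cos_sq']; ring
    rw [h4, gradVec, gradVec]
    field_simp
    ring
  rw [hq, bil_add_left, bil_smul_left]
  -- Substituting P = P_z + λB and its image under L expands the Bezoutian into g + λη; the λ² term
  -- is the Bezoutian of B with a multiple of itself and vanishes.
  linear_combination (-lam c ^ 2) * key + lam c * (orbOp ℓ R).eval s * hPe t +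
    ((vp ℓ z).eval t + lam c * (pencilBase ℓ m).eval t) * hLe s -
    lam c * (orbOp ℓ R).eval t * hPe s -
    ((vp ℓ z).eval s + lam c * (pencilBase ℓ m).eval s) * hLe t -
    bil_orbitG z s t - lam c * bil_orbitEta hm z s t

end
end GenFrob
end

noncomputable section
namespace GenFrob
open Polynomial

/-! ### Linear isomorphisms -/

section
variable {n : ℕ} {f : (Fin n → ℂ) ≃L[ℂ] (Fin n → ℂ)} {s : ℂ}
  {η η' : (Fin n → ℂ) → Matrix (Fin n) (Fin n) ℂ} {C C' : (Fin n → ℂ) → Fin n → Fin n → Fin n → ℂ}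

theorem fderiv_equiv (f : (Fin n → ℂ) ≃L[ℂ] (Fin n → ℂ)) (a X : Fin n → ℂ) :
    fderiv ℂ f a X = f X := by
  rw [f.fderiv]; rfl

theorem jac_equiv_mulVec (f : (Fin n → ℂ) ≃L[ℂ] (Fin n → ℂ)) (a X : Fin n → ℂ) :
    jac f a *ᵥ X = f X := by
  rw [← fderiv_eq_jac_mulVec, fderiv_equiv]

theorem det_jac_equiv_ne_zero (f : (Fin n → ℂ) ≃L[ℂ] (Fin n → ℂ)) (a : Fin n → ℂ) :
    (jac f a).det ≠ 0 :=
  det_jac_ne_zero fun V hV => f.injective (by rw [← fderiv_equiv f a, hV, map_zero])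

/-- Scaling the covariant metric by s divides each gradient by s: two inverse factors and one direct
factor leave 1/s in the intersection form on covectors. -/
theorem intersectionForm_transport (f : (Fin n → ℂ) ≃L[ℂ] (Fin n → ℂ)) {a : Fin n → ℂ} (hs : s ≠ 0)
    (hd : (η a).det ≠ 0) (hη : ∀ X Y, bil (η' (f a)) (f X) (f Y) = s * bil (η a) X Y)
    (hC : ∀ X Y, prod (C' (f a)) (f X) (f Y) = f (prod (C a) X Y)) :
    jac f a * intersectionForm η C id a * (jac f a)ᵀ = s • intersectionForm η' C' id (f a) := by
  set F := jac f a with hF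
  have hFu : IsUnit F.det := isUnit_iff_ne_zero.mpr (det_jac_equiv_ne_zero f a)
  have hN : IsUnit (η a).det := isUnit_iff_ne_zero.mpr hd
  have h1 : Fᵀ * η' (f a) * F = s • η a := by
    ext i j
    have h := hη (Pi.single i 1) (Pi.single j 1)
    rw [bil_single, ← jac_equiv_mulVec f a (Pi.single i 1),
      ← jac_equiv_mulVec f a (Pi.single j 1)] at h
    have h' := bil_conj Fᵀ (η' (f a)) (Pi.single i 1) (Pi.single j 1)
    rw [Matrix.transpose_transpose] at h'
    rw [← bil_single (Fᵀ * η' (f a) * F), h', h, Matrix.smul_apply, smul_eq_mul]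
  have h2 : (η' (f a))⁻¹ = s⁻¹ • (F * (η a)⁻¹ * Fᵀ) := by
    apply Matrix.inv_eq_left_inv
    have h3 : F * (η a)⁻¹ * Fᵀ * η' (f a) * F = s • F := by
      rw [Matrix.mul_assoc, Matrix.mul_assoc, ← Matrix.mul_assoc Fᵀ, h1, Matrix.mul_smul,
        Matrix.mul_assoc, Matrix.nonsing_inv_mul _ hN, Matrix.mul_one]
    rw [Matrix.smul_mul, ← Matrix.mul_one (F * (η a)⁻¹ * Fᵀ * η' (f a)),
      ← Matrix.mul_nonsing_inv _ hFu, ← Matrix.mul_assoc, h3, Matrix.smul_mul, smul_smul,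
      inv_mul_cancel₀ hs, one_smul]
  have hrow : ∀ i, (η' (f a))⁻¹ i = s⁻¹ • f (∑ k, F i k • (η a)⁻¹ k) := by
    intro i
    have h3 : ∑ k, F i k • (η a)⁻¹ k = (F * (η a)⁻¹) i := by
      ext j
      rw [Finset.sum_apply, Matrix.mul_apply]
      rfl
    rw [h3, h2, ← jac_equiv_mulVec f a]
    ext j
    rw [Matrix.smul_apply, Pi.smul_apply, Matrix.mul_apply, Matrix.mulVec, dotProduct]
    congr 1
    exact Finset.sum_congr rfl fun r _ => mul_comm _ _
  ext i j
  have h3 : intersectionForm η' C' id (f a) i j = s⁻¹ *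
      bil (η a) (prod (C a) (∑ k, F i k • (η a)⁻¹ k) (∑ k, F j k • (η a)⁻¹ k)) a := by
    rw [intersectionForm, Matrix.of_apply, hrow, hrow, ← map_smul, ← map_smul, hC, id, hη,
      ← prodL_apply, map_smul, map_smul, LinearMap.smul_apply, ← bilL_apply, map_smul, map_smul]
    simp only [LinearMap.smul_apply, smul_eq_mul, bilL_apply, prodL_apply]
    field_simp
  rw [Matrix.smul_apply, h3, smul_eq_mul, mul_inv_cancel_left₀ hs, ← prodL_apply, ← bilL_apply]
  simp only [map_sum, map_smul, LinearMap.sum_apply, LinearMap.smul_apply, smul_eq_mul]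
  rw [Matrix.mul_apply]
  refine Finset.sum_congr rfl fun k _ => ?_
  rw [Matrix.mul_apply, Matrix.transpose_apply, mul_comm, Finset.mul_sum, Finset.mul_sum]
  exact Finset.sum_congr rfl fun l _ => rfl

theorem isFrobeniusIso_of_equiv (f : (Fin n → ℂ) ≃L[ℂ] (Fin n → ℂ)) {U U₀ U' U₀' : Set (Fin n → ℂ)}
    {e e' : (Fin n → ℂ) → (Fin n → ℂ)} (hU : ∀ a, f a ∈ U' ↔ a ∈ U) (hU₀ : ∀ a, f a ∈ U₀' ↔ a ∈ U₀)
    (hopen : IsOpen U)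
    (hη : ∀ a ∈ U, ∀ X Y, bil (η' (f a)) (f X) (f Y) = s * bil (η a) X Y)
    (hC : ∀ a ∈ U, ∀ X Y, prod (C' (f a)) (f X) (f Y) = f (prod (C a) X Y))
    (he : ∀ a ∈ U₀, f (e a) = e' (f a)) :
    IsFrobeniusIso f s U U₀ η C e id U' U₀' η' C' e' id where
  bij := ⟨fun a ha => (hU a).mpr ha, f.injective.injOn, fun z hz =>
    ⟨f.symm z, (hU _).mp (by rwa [f.apply_symm_apply]), f.apply_symm_apply z⟩⟩
  bij_unit := ⟨fun a ha => (hU₀ a).mpr ha, f.injective.injOn, fun z hz =>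
    ⟨f.symm z, (hU₀ _).mp (by rwa [f.apply_symm_apply]), f.apply_symm_apply z⟩⟩
  coords := ⟨hopen, f.differentiable.differentiableOn, fun a _ => det_jac_equiv_ne_zero f a⟩
  metric a ha X Y := by rw [fderiv_equiv, fderiv_equiv, hη a ha]
  mul a ha X Y := by rw [fderiv_equiv, fderiv_equiv, fderiv_equiv, hC a ha]
  euler a _ := fderiv_equiv f a a
  unit a ha := by rw [fderiv_equiv, he a ha]

end

/-! ### The structures on the orbit space -/

section
variable {ℓ m : ℕ}

/-- The multiplication on the orbit space. -/
def orbitMul (ℓ m : ℕ) (z : Fin ℓ → ℂ) (i j : Fin ℓ) : Fin ℓ → ℂ :=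
  ((smap ℓ (ℓ - m) ((hEquiv ℓ).symm z)).compl₁₂ (hEquiv ℓ).symm.toLinearMap
    (hEquiv ℓ).symm.toLinearMap).compr₂ (hEquiv ℓ).toLinearMap (Pi.single i 1) (Pi.single j 1)

theorem prod_orbitMul (hℓ : 1 ≤ ℓ) {a : Fin ℓ → ℂ} (ha : a ∈ spaceLG ℓ (ℓ - m)) (X Y : Fin ℓ → ℂ) :
    prod (orbitMul ℓ m (hEquiv ℓ a)) (hEquiv ℓ X) (hEquiv ℓ Y) =
      hEquiv ℓ (prod (mulLG ℓ (ℓ - m) a) X Y) := by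
  unfold orbitMul
  rw [prod_of_bilin, prod_mulLG hℓ (Nat.sub_le _ _) ha]
  simp

theorem bil_orbitEta_inv (hℓ : 1 ≤ ℓ) (hm : m ≤ ℓ) {a : Fin ℓ → ℂ} (ha : a ∈ spaceLG ℓ (ℓ - m))
    (X Y : Fin ℓ → ℂ) :
    bil (orbitEta ℓ m (hEquiv ℓ a))⁻¹ (hEquiv ℓ X) (hEquiv ℓ Y) =
      2 * bil (etaMatLG ℓ (ℓ - m) a) X Y := by
  have hH : IsUnit (hMat ℓ)ᵀ.det := by
    rw [Matrix.det_transpose]; exact isUnit_iff_ne_zero.mpr (det_hMat_ne_zero ℓ)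
  have hN : IsUnit (etaMatLG ℓ (ℓ - m) a).det :=
    isUnit_iff_ne_zero.mpr (det_etaMatLG_ne_zero hℓ (Nat.sub_le _ _) ha)
  have h1 : (orbitEta ℓ m (hMap ℓ a))⁻¹ *ᵥ (hMat ℓ *ᵥ Y) =
      (2 : ℂ) • (((hMat ℓ)ᵀ)⁻¹ *ᵥ (etaMatLG ℓ (ℓ - m) a *ᵥ Y)) := by
    apply inv_mulVec_eq ((det_orbitEta_ne_zero_iff hℓ hm a).mpr ha)
    rw [orbitEta_hMap hℓ hm ha, Matrix.smul_mulVec, Matrix.mulVec_smul, smul_smul,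
      Matrix.mulVec_mulVec, Matrix.mulVec_mulVec, Matrix.mul_assoc, Matrix.mul_assoc,
      ← Matrix.mul_assoc (hMat ℓ)ᵀ, Matrix.mul_nonsing_inv _ hH, Matrix.one_mul,
      Matrix.mul_assoc (hMat ℓ), Matrix.nonsing_inv_mul _ hN, Matrix.mul_one]
    norm_num
  rw [hEquiv_apply, hEquiv_apply, hEquiv_apply, ← hMat_mulVec Y, bil, h1, dotProduct_smul,
    ← hMat_mulVec X, dotProduct_comm, Matrix.dotProduct_mulVec, ← Matrix.mulVec_transpose,
    Matrix.mulVec_mulVec, Matrix.mul_nonsing_inv _ hH, Matrix.one_mulVec, dotProduct_comm,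
    smul_eq_mul, bil]

theorem preimage_spaceLG (hℓ : 1 ≤ ℓ) (hm : m ≤ ℓ) :
    (hEquiv ℓ).symm ⁻¹' spaceLG ℓ (ℓ - m) = {z | (orbitEta ℓ m z).det ≠ 0} := by
  ext z
  have := det_orbitEta_ne_zero_iff hℓ hm ((hEquiv ℓ).symm z)
  rw [← hEquiv_apply, (hEquiv ℓ).apply_symm_apply] at this
  exact this.symm

theorem frobData_orbit (hℓ : 1 ≤ ℓ) (hm : m ≤ ℓ) :
    FrobData {z | (orbitEta ℓ m z).det ≠ 0} (fun z => (orbitEta ℓ m z)⁻¹) (orbitMul ℓ m) := by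
  rw [← preimage_spaceLG hℓ hm]
  refine (frobDataLG hℓ (Nat.sub_le ℓ m)).transport (two_ne_zero) ?_ ?_
  · intro z hz X Y
    rw [← bil_orbitEta_inv hℓ hm hz]
    simp only [ContinuousLinearEquiv.apply_symm_apply]
  · intro z hz X Y
    rw [← prod_orbitMul hℓ hz]
    simp only [ContinuousLinearEquiv.apply_symm_apply]

theorem intersectionForm_orbit (hℓ : 1 ≤ ℓ) (hm : m ≤ ℓ) {z : Fin ℓ → ℂ}
    (hz : (orbitEta ℓ m z).det ≠ 0) :
    intersectionForm (fun y => (orbitEta ℓ m y)⁻¹) (orbitMul ℓ m) id z = orbitG ℓ z := by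
  obtain ⟨a, rfl⟩ := (hEquiv ℓ).surjective z
  have ha : a ∈ spaceLG ℓ (ℓ - m) := (det_orbitEta_ne_zero_iff hℓ hm a).mp hz
  have h := intersectionForm_transport (η' := fun y => (orbitEta ℓ m y)⁻¹) (C' := orbitMul ℓ m)
    (hEquiv ℓ) two_ne_zero (det_etaMatLG_ne_zero hℓ (Nat.sub_le _ _) ha)
    (bil_orbitEta_inv hℓ hm ha) (prod_orbitMul hℓ ha)
  have hj : jac (hEquiv ℓ) a = hMat ℓ := by
    apply Matrix.mulVec_injective
    ext1 X
    rw [jac_equiv_mulVec, hMat_mulVec, hEquiv_apply]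
  rw [hEquiv_apply a, orbitG_hMap hℓ (Nat.sub_le _ _) ha, ← hEquiv_apply, ← hj, h, smul_smul]
  norm_num

theorem hMap_zero (hℓ : 1 ≤ ℓ) (a : Fin ℓ → ℂ) : hMap ℓ a ⟨0, hℓ⟩ = -4 * ∑ j, a j := by
  rw [hMap, finsetSum_coeff]
  congr 1
  refine Finset.sum_congr rfl fun k _ => ?_
  have h1 : ((X - C 2 : ℂ[X]) ^ (ℓ - 1 - (k : ℕ)) * (X + C 2) ^ (k : ℕ)).Monic :=
    ((monic_X_sub_C 2).pow _).mul ((monic_X_add_C 2).pow _)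
  have h2 : ((X - C 2 : ℂ[X]) ^ (ℓ - 1 - (k : ℕ)) * (X + C 2) ^ (k : ℕ)).natDegree =
      ℓ - 1 - 0 := by
    rw [natDegree_mul (pow_ne_zero _ (X_sub_C_ne_zero _)) (pow_ne_zero _ (X_add_C_ne_zero _)),
      natDegree_pow, natDegree_pow, natDegree_X_add_C, natDegree_X_sub_C]
    omega
  rw [mul_assoc, coeff_C_mul, ← h2, h1.coeff_natDegree, mul_one]

/-- The first entry of the image is -4Σa_j, so the logarithms have the same differential, and the
factor 1/2 between the contravariant metrics matches the 1/2 in the definition of ẽ. -/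
theorem unitOrbit_hEquiv (hℓ : 1 ≤ ℓ) (hm : m ≤ ℓ) {a : Fin ℓ → ℂ} (ha : a ∈ spaceLG ℓ (ℓ - m)) :
    unitOrbit (orbitEta ℓ m) (hEquiv ℓ a) = hEquiv ℓ (unitLG ℓ (ℓ - m) a) := by
  have he : (fun y : Fin ℓ → ℂ => entry y 0) =
      ContinuousLinearMap.proj (R := ℂ) (φ := fun _ : Fin ℓ => ℂ) ⟨0, hℓ⟩ := by
    ext y
    rw [entry, dif_pos (by omega)]
    rfl
  have h1 : (fun j => fderiv ℂ (fun y : Fin ℓ → ℂ => entry y 0) (hEquiv ℓ a) (Pi.single j 1)) =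
      Pi.single ⟨0, hℓ⟩ 1 := by
    ext j
    rw [he, ContinuousLinearMap.fderiv, ContinuousLinearMap.proj_apply, Pi.single_comm]
  have h2 : (hMat ℓ)ᵀ *ᵥ Pi.single ⟨0, hℓ⟩ 1 = (-4 : ℂ) • evVec ℓ 1 := by
    apply dotProduct_eq
    intro X
    rw [Matrix.mulVec_transpose, ← Matrix.dotProduct_mulVec, hMat_mulVec, single_dotProduct,
      hMap_zero, smul_dotProduct, evVec_dotProduct, eval_vp]
    simp
  have h3 : entry (hMap ℓ a) 0 = -4 * ∑ j, a j := by
    rw [← hMap_zero hℓ, entry, dif_pos (by omega)]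
  rw [unitOrbit, gradLog, h1, hEquiv_apply, orbitEta_hMap hℓ hm ha, Matrix.smul_mulVec,
    ← Matrix.mulVec_mulVec, h2, ← Matrix.mulVec_mulVec, Matrix.mulVec_smul,
    etaMatLG_inv_mulVec hℓ (Nat.sub_le _ _) ha, hMat_mulVec, h3, ← hEquiv_apply,
    unitLG_eq hℓ (Nat.sub_le _ _) ha, map_smul, map_smul, smul_smul, smul_smul, ← neg_smul]
  congr 1
  rw [mul_inv]
  ring

theorem mem_unit_iff (hℓ : 1 ≤ ℓ) (hm : m ≤ ℓ) (a : Fin ℓ → ℂ) :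
    hEquiv ℓ a ∈ {z | (orbitEta ℓ m z).det ≠ 0 ∧ entry z 0 ≠ 0} ↔ a ∈ spaceLGUnit ℓ (ℓ - m) := by
  have h3 : entry (hMap ℓ a) 0 = -4 * ∑ j, a j := by
    rw [← hMap_zero hℓ, entry, dif_pos (by omega)]
  rw [Set.mem_ofPred_eq, hEquiv_apply, det_orbitEta_ne_zero_iff hℓ hm, h3, spaceLGUnit,
    Set.mem_ofPred_eq]
  simp

theorem isGenFrobenius_orbit (hℓ : 1 ≤ ℓ) (hm : m ≤ ℓ) :
    IsGenFrobenius {z | (orbitEta ℓ m z).det ≠ 0 ∧ entry z 0 ≠ 0}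
      (fun z => (orbitEta ℓ m z)⁻¹) (orbitMul ℓ m) (unitOrbit (orbitEta ℓ m)) id 1 := by
  have hF := frobData_orbit hℓ hm
  have hG := isGenFrobeniusLG hℓ (Nat.sub_le ℓ m)
  have hmaps : ∀ z ∈ {z | (orbitEta ℓ m z).det ≠ 0 ∧ entry z 0 ≠ 0},
      (hEquiv ℓ).symm z ∈ spaceLGUnit ℓ (ℓ - m) := by
    intro z hz
    rw [← mem_unit_iff hℓ hm, (hEquiv ℓ).apply_symm_apply]
    exact hz
  refine hF.isGenFrobenius (hF.isOpen.inter (isOpen_ne_fun (continuous_entry 0) continuous_const))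
    (fun z hz => hz.1) ?_ ?_
  · have h1 : DifferentiableOn ℂ (fun z => hEquiv ℓ (unitLG ℓ (ℓ - m) ((hEquiv ℓ).symm z)))
        {z | (orbitEta ℓ m z).det ≠ 0 ∧ entry z 0 ≠ 0} :=
      (hEquiv ℓ).differentiable.comp_differentiableOn
        (hG.holo_unit.comp (hEquiv ℓ).symm.differentiable.differentiableOn hmaps)
    refine h1.congr fun z hz => ?_
    rw [← unitOrbit_hEquiv hℓ hm (hmaps z hz).1, (hEquiv ℓ).apply_symm_apply]
  · intro z hz X
    obtain ⟨a, rfl⟩ := (hEquiv ℓ).surjective z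
    obtain ⟨Y, rfl⟩ := (hEquiv ℓ).surjective X
    have ha := (mem_unit_iff hℓ hm a).mp hz
    rw [unitOrbit_hEquiv hℓ hm ha.1, prod_orbitMul hℓ ha.1, hG.one_mul a ha]

/-! ### The isomorphisms -/

/-- The involution `sig` as an isomorphism. -/
def sigEquiv (ℓ : ℕ) : (Fin ℓ → ℂ) ≃L[ℂ] (Fin ℓ → ℂ) :=
  ContinuousLinearEquiv.equivOfInverse (sig ℓ) (sig ℓ) sig_sig sig_sig

/-- Replacing s by -s exchanges s-2 and s+2 up to sign, that is, inverts u; so the reflection of the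
z's is the reflection of the a's seen through the Cayley transform. -/
theorem hMapRefl_eq (a : Fin ℓ → ℂ) : hMapRefl ℓ a = hMap ℓ (sig ℓ a) := by
  have h : vp ℓ (hMap ℓ (sig ℓ a)) = C ((-1) ^ ℓ) * (vp ℓ (hMap ℓ a)).comp (-X) := by
    rw [vp_hMap, vp_hMap, mul_comp, C_comp, Polynomial.sum_comp, mul_left_comm]
    congr 1
    rw [Finset.mul_sum, ← Equiv.sum_comp Fin.revPerm]
    refine Finset.sum_congr rfl fun k _ => ?_
    rw [Fin.revPerm_apply, sig_apply, Fin.rev_rev, Fin.val_rev]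
    simp only [mul_comp, C_comp, pow_comp, sub_comp, add_comp, X_comp]
    rw [show ℓ - 1 - (ℓ - (k + 1)) = (k : ℕ) by omega, show ℓ - ((k : ℕ) + 1) = ℓ - 1 - k by omega,
      show (-X - C 2 : ℂ[X]) = -1 * (X + C 2) by ring,
      show (-X + C 2 : ℂ[X]) = -1 * (X - C 2) by ring, mul_pow, mul_pow]
    have h1 : (-1 : ℂ[X]) ^ ℓ * (-1) ^ (ℓ - 1 - (k : ℕ)) * (-1) ^ (k : ℕ) = -1 := by
      rw [← pow_add, ← pow_add, show ℓ + (ℓ - 1 - (k : ℕ)) + k = 2 * (ℓ - 1) + 1 by omega, pow_succ,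
        pow_mul]
      simp
    simp only [map_neg, map_pow, map_one]
    linear_combination (-C (a k) * (X + C 2) ^ (ℓ - 1 - (k : ℕ)) * (X - C 2) ^ (k : ℕ)) * h1
  ext j
  rw [← coeff_vp_fin (hMap ℓ (sig ℓ a)), h, coeff_C_mul,
    show (-X : ℂ[X]) = C (-1) * X by simp, comp_C_mul_X_coeff, coeff_vp_fin, hMapRefl,
    mul_comm (hMap ℓ a j), ← mul_assoc, ← pow_add]
  congr 1
  rw [show ℓ + (ℓ - 1 - (j : ℕ)) = ((j : ℕ) + 1) + 2 * (ℓ - 1 - j) by omega, pow_add _ _ (2 * _), pow_mul]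
  simp

theorem isGenFrobenius_unit_unique {n : ℕ} {U : Set (Fin n → ℂ)}
    {η : (Fin n → ℂ) → Matrix (Fin n) (Fin n) ℂ} {C : (Fin n → ℂ) → Fin n → Fin n → Fin n → ℂ}
    {e E : (Fin n → ℂ) → (Fin n → ℂ)} {d : ℝ} (h : IsGenFrobenius U η C e E d) {x : Fin n → ℂ}
    (hx : x ∈ U) {Y : Fin n → ℂ} (hY : ∀ X, prod (C x) Y X = X) : Y = e x := by
  rw [← h.one_mul x hx Y, h.comm x hx, hY]

theorem sig_isos (hℓ : 1 ≤ ℓ) (hm : m ≤ ℓ) {a : Fin ℓ → ℂ} (ha : a ∈ spaceLG ℓ m) :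
    (∀ X Y, bil (etaMatLG ℓ (ℓ - m) (sig ℓ a)) (sig ℓ X) (sig ℓ Y) = bil (etaMatLG ℓ m a) X Y) ∧
      ∀ X Y, prod (mulLG ℓ (ℓ - m) (sig ℓ a)) (sig ℓ X) (sig ℓ Y) =
        sig ℓ (prod (mulLG ℓ m a) X Y) := by
  have ha' := sig_mem_spaceLG hℓ hm ha
  refine ⟨fun X Y => ?_, fun X Y => ?_⟩
  · rw [bil_etaMatLG hℓ (Nat.sub_le _ _) ha', bil_etaMatLG hℓ hm ha, etaF_sig hℓ hm ha]
  · rw [prod_mulLG hℓ (Nat.sub_le _ _) ha', prod_mulLG hℓ hm ha, (sg_sig hℓ hm ha X Y).1]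

theorem sig_mem_spaceLG_iff (hℓ : 1 ≤ ℓ) (hm : m ≤ ℓ) (a : Fin ℓ → ℂ) :
    sig ℓ a ∈ spaceLG ℓ (ℓ - m) ↔ a ∈ spaceLG ℓ m := by
  refine ⟨fun h => ?_, sig_mem_spaceLG hℓ hm⟩
  have := sig_mem_spaceLG hℓ (Nat.sub_le ℓ m) h
  rwa [sig_sig, Nat.sub_sub_self hm] at this

theorem sig_mem_spaceLGUnit_iff (hℓ : 1 ≤ ℓ) (hm : m ≤ ℓ) (a : Fin ℓ → ℂ) :
    sig ℓ a ∈ spaceLGUnit ℓ (ℓ - m) ↔ a ∈ spaceLGUnit ℓ m := by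
  have h := eval_one_vp_sig a
  simp only [eval_vp, one_pow, mul_one] at h
  rw [spaceLGUnit, spaceLGUnit, Set.mem_ofPred_eq, Set.mem_ofPred_eq, sig_mem_spaceLG_iff hℓ hm, h,
    neg_ne_zero]

/-- The reflection is multiplicative, so it carries the unit to a unit, and a unit is unique. -/
theorem sig_unitLG (hℓ : 1 ≤ ℓ) (hm : m ≤ ℓ) {a : Fin ℓ → ℂ} (ha : a ∈ spaceLGUnit ℓ m) :
    sig ℓ (unitLG ℓ m a) = unitLG ℓ (ℓ - m) (sig ℓ a) := by
  refine isGenFrobenius_unit_unique (isGenFrobeniusLG hℓ (Nat.sub_le ℓ m))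
    ((sig_mem_spaceLGUnit_iff hℓ hm a).mpr ha) fun X => ?_
  rw [← sig_sig X, (sig_isos hℓ hm ha.1).2, (isGenFrobeniusLG hℓ hm).one_mul a ha]

theorem isFrobeniusIso_hMap (hℓ : 1 ≤ ℓ) (hm : m ≤ ℓ) :
    IsFrobeniusIso (hMap ℓ) 2 (spaceLG ℓ (ℓ - m)) (spaceLGUnit ℓ (ℓ - m)) (etaMatLG ℓ (ℓ - m))
      (mulLG ℓ (ℓ - m)) (unitLG ℓ (ℓ - m)) id {z | (orbitEta ℓ m z).det ≠ 0}
      {z | (orbitEta ℓ m z).det ≠ 0 ∧ entry z 0 ≠ 0} (fun z => (orbitEta ℓ m z)⁻¹) (orbitMul ℓ m)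
      (unitOrbit (orbitEta ℓ m)) id :=
  isFrobeniusIso_of_equiv (hEquiv ℓ) (det_orbitEta_ne_zero_iff hℓ hm) (mem_unit_iff hℓ hm)
    (isOpen_spaceLG ℓ _) (fun _ ha => bil_orbitEta_inv hℓ hm ha) (fun _ ha => prod_orbitMul hℓ ha)
    fun _ ha => (unitOrbit_hEquiv hℓ hm ha.1).symm

theorem jac_hMap_intersectionForm (hℓ : 1 ≤ ℓ) (hm : m ≤ ℓ) {a : Fin ℓ → ℂ}
    (ha : a ∈ spaceLG ℓ (ℓ - m)) :
    jac (hMap ℓ) a * intersectionForm (etaMatLG ℓ (ℓ - m)) (mulLG ℓ (ℓ - m)) id a *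
      (jac (hMap ℓ) a)ᵀ = (2 : ℂ) • orbitG ℓ (hMap ℓ a) := by
  rw [← intersectionForm_orbit hℓ hm ((det_orbitEta_ne_zero_iff hℓ hm a).mpr ha)]
  exact intersectionForm_transport (hEquiv ℓ) two_ne_zero
    (det_etaMatLG_ne_zero hℓ (Nat.sub_le _ _) ha) (bil_orbitEta_inv hℓ hm ha) (prod_orbitMul hℓ ha)

/-- The map `hMapRefl` as an isomorphism. -/
def hReflEquiv (ℓ : ℕ) : (Fin ℓ → ℂ) ≃L[ℂ] (Fin ℓ → ℂ) := (sigEquiv ℓ).trans (hEquiv ℓ)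

theorem coe_hReflEquiv (ℓ : ℕ) : ⇑(hReflEquiv ℓ) = hMapRefl ℓ := by
  ext1 a
  rw [hMapRefl_eq]
  rfl

theorem hReflEquiv_apply (a : Fin ℓ → ℂ) : hReflEquiv ℓ a = hEquiv ℓ (sig ℓ a) := rfl

theorem bil_hReflEquiv (hℓ : 1 ≤ ℓ) (hm : m ≤ ℓ) {a : Fin ℓ → ℂ} (ha : a ∈ spaceLG ℓ m)
    (X Y : Fin ℓ → ℂ) :
    bil (orbitEta ℓ m (hReflEquiv ℓ a))⁻¹ (hReflEquiv ℓ X) (hReflEquiv ℓ Y) =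
      2 * bil (etaMatLG ℓ m a) X Y := by
  simp only [hReflEquiv_apply]
  rw [bil_orbitEta_inv hℓ hm (sig_mem_spaceLG hℓ hm ha), (sig_isos hℓ hm ha).1]

theorem prod_hReflEquiv (hℓ : 1 ≤ ℓ) (hm : m ≤ ℓ) {a : Fin ℓ → ℂ} (ha : a ∈ spaceLG ℓ m)
    (X Y : Fin ℓ → ℂ) :
    prod (orbitMul ℓ m (hReflEquiv ℓ a)) (hReflEquiv ℓ X) (hReflEquiv ℓ Y) =
      hReflEquiv ℓ (prod (mulLG ℓ m a) X Y) := by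
  simp only [hReflEquiv_apply]
  rw [prod_orbitMul hℓ (sig_mem_spaceLG hℓ hm ha), (sig_isos hℓ hm ha).2]

theorem hReflEquiv_mem_iff (hℓ : 1 ≤ ℓ) (hm : m ≤ ℓ) (a : Fin ℓ → ℂ) :
    (orbitEta ℓ m (hReflEquiv ℓ a)).det ≠ 0 ↔ a ∈ spaceLG ℓ m :=
  (det_orbitEta_ne_zero_iff hℓ hm (sig ℓ a)).trans (sig_mem_spaceLG_iff hℓ hm a)

theorem isFrobeniusIso_hMapRefl (hℓ : 1 ≤ ℓ) (hm : m ≤ ℓ) :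
    IsFrobeniusIso (hMapRefl ℓ) 2 (spaceLG ℓ m) (spaceLGUnit ℓ m) (etaMatLG ℓ m)
      (mulLG ℓ m) (unitLG ℓ m) id {z | (orbitEta ℓ m z).det ≠ 0}
      {z | (orbitEta ℓ m z).det ≠ 0 ∧ entry z 0 ≠ 0} (fun z => (orbitEta ℓ m z)⁻¹) (orbitMul ℓ m)
      (unitOrbit (orbitEta ℓ m)) id := by
  rw [← coe_hReflEquiv]
  refine isFrobeniusIso_of_equiv (hReflEquiv ℓ) (hReflEquiv_mem_iff hℓ hm)
    (fun a => (mem_unit_iff hℓ hm (sig ℓ a)).trans (sig_mem_spaceLGUnit_iff hℓ hm a))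
    (isOpen_spaceLG ℓ _) (fun _ ha => bil_hReflEquiv hℓ hm ha)
    (fun _ ha => prod_hReflEquiv hℓ hm ha) fun a ha => ?_
  rw [hReflEquiv_apply, hReflEquiv_apply, sig_unitLG hℓ hm ha,
    unitOrbit_hEquiv hℓ hm (sig_mem_spaceLG hℓ hm ha.1)]

theorem jac_hMapRefl_intersectionForm (hℓ : 1 ≤ ℓ) (hm : m ≤ ℓ) {a : Fin ℓ → ℂ}
    (ha : a ∈ spaceLG ℓ m) :
    jac (hMapRefl ℓ) a * intersectionForm (etaMatLG ℓ m) (mulLG ℓ m) id a *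
      (jac (hMapRefl ℓ) a)ᵀ = (2 : ℂ) • orbitG ℓ (hMapRefl ℓ a) := by
  rw [← coe_hReflEquiv, ← intersectionForm_orbit hℓ hm ((hReflEquiv_mem_iff hℓ hm a).mpr ha)]
  exact intersectionForm_transport (hReflEquiv ℓ) two_ne_zero (det_etaMatLG_ne_zero hℓ hm ha)
    (bil_hReflEquiv hℓ hm ha) (prod_hReflEquiv hℓ hm ha)

end
end GenFrob
end

theorem mainTheorem8 (ℓ m : ℕ) (hℓ : 1 ≤ ℓ) (hm : m ≤ ℓ) :
    -- The residue formulas define a metric and a multiplication on the space of superpotentials.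
    ((∀ a ∈ GenFrob.spaceLG ℓ m, ∀ X Y,
        GenFrob.etaLG ℓ m a X Y = GenFrob.bil (GenFrob.etaMatLG ℓ m a) X Y) ∧
      (∀ a ∈ GenFrob.spaceLG ℓ m, ∀ X Y Z,
        GenFrob.etaLG ℓ m a (GenFrob.prod (GenFrob.mulLG ℓ m a) X Y) Z =
          GenFrob.cLG ℓ m a X Y Z)) ∧
    -- They form a generalized Frobenius manifold of charge `1`.
    GenFrob.IsGenFrobenius (GenFrob.spaceLGUnit ℓ m) (GenFrob.etaMatLG ℓ m) (GenFrob.mulLG ℓ m)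
      (GenFrob.unitLG ℓ m) id 1 ∧
    -- Explicit flat coordinates.
    ((∀ a ∈ GenFrob.spaceLG ℓ m, ∃ V r₁ r₂, a ∈ V ∧ GenFrob.IsRootBranch ℓ m V r₁ r₂) ∧
      ∀ V r₁ r₂, GenFrob.IsRootBranch ℓ m V r₁ r₂ →
        GenFrob.IsLocalCoords V (GenFrob.flatLG ℓ m r₁ r₂) ∧
        (∀ a ∈ V, ∀ α β,
          GenFrob.bil (GenFrob.etaMatLG ℓ m a)
            (GenFrob.frame (GenFrob.flatLG ℓ m r₁ r₂) a α)
            (GenFrob.frame (GenFrob.flatLG ℓ m r₁ r₂) a β) = GenFrob.flatGramLG ℓ m α β) ∧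
        (∀ a ∈ V, ∀ α, fderiv ℂ (GenFrob.flatLG ℓ m r₁ r₂) a a α =
          GenFrob.degLG ℓ m α * GenFrob.flatLG ℓ m r₁ r₂ a α)) ∧
    -- The residue formula for the intersection form, where `Λ` and `Λ'` have no common zero.
    (∀ a ∈ GenFrob.spaceLG ℓ m,
      (∀ q ∈ GenFrob.critPts ℓ m a, GenFrob.superpotential ℓ m a q ≠ 0) →
      (m = ℓ → GenFrob.entry a 0 ≠ 0) →
      (∀ X Y, GenFrob.gLG ℓ m a X Y = GenFrob.bil (GenFrob.gMatLG ℓ m a) X Y) ∧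
      GenFrob.gMatLG ℓ m a *
        GenFrob.intersectionForm (GenFrob.etaMatLG ℓ m) (GenFrob.mulLG ℓ m) id a = 1) ∧
    -- The generalized Frobenius manifold of `(C_ℓ, ω₁)`, and the isomorphisms onto it.
    ∃ (g η : (Fin ℓ → ℂ) → Matrix (Fin ℓ) (Fin ℓ) ℂ)
      (C : (Fin ℓ → ℂ) → Fin ℓ → Fin ℓ → Fin ℓ → ℂ),
      GenFrob.IsMetricPencil ℓ m g η ∧
      GenFrob.IsPencilMul {z | (η z).det ≠ 0} g η id C ∧
      GenFrob.IsGenFrobenius {z | (η z).det ≠ 0 ∧ GenFrob.entry z 0 ≠ 0} (fun z => (η z)⁻¹) C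
        (GenFrob.unitOrbit η) id 1 ∧
      (∀ z, (η z).det ≠ 0 → GenFrob.intersectionForm (fun y => (η y)⁻¹) C id z = g z) ∧
      ∀ (m' : ℕ) (h : (Fin ℓ → ℂ) → (Fin ℓ → ℂ)),
        (m' = ℓ - m ∧ h = GenFrob.hMap ℓ) ∨ (m' = m ∧ h = GenFrob.hMapRefl ℓ) →
        GenFrob.IsFrobeniusIso h 2
          (GenFrob.spaceLG ℓ m') (GenFrob.spaceLGUnit ℓ m') (GenFrob.etaMatLG ℓ m')
          (GenFrob.mulLG ℓ m') (GenFrob.unitLG ℓ m') id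
          {z | (η z).det ≠ 0} {z | (η z).det ≠ 0 ∧ GenFrob.entry z 0 ≠ 0} (fun z => (η z)⁻¹) C
          (GenFrob.unitOrbit η) id ∧
        ∀ a ∈ GenFrob.spaceLG ℓ m',
          GenFrob.jac h a *
              GenFrob.intersectionForm (GenFrob.etaMatLG ℓ m') (GenFrob.mulLG ℓ m') id a *
              (GenFrob.jac h a)ᵀ =
            (2 : ℂ) • g (h a) := by
  have hpos := GenFrob.frobData_orbit hℓ hm
  refine ⟨⟨fun a ha X Y => ?_, fun a ha X Y Z => ?_⟩, GenFrob.isGenFrobeniusLG hℓ hm,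
    ⟨fun a ha => GenFrob.exists_isRootBranch ha, fun V r₁ r₂ h => ?_⟩,
    fun a ha hc h0 => GenFrob.gLG_part hℓ hm ha hc h0,
    GenFrob.orbitG ℓ, GenFrob.orbitEta ℓ m, GenFrob.orbitMul ℓ m, GenFrob.isMetricPencil hm,
    hpos.isPencilMul (GenFrob.continuous_orbitG ℓ).matrix_det
      (fun z hz => (GenFrob.intersectionForm_orbit hℓ hm hz).symm) fun z hz => hz,
    GenFrob.isGenFrobenius_orbit hℓ hm, fun z hz => GenFrob.intersectionForm_orbit hℓ hm hz, ?_⟩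
  · rw [GenFrob.bil_etaMatLG hℓ hm ha, GenFrob.etaLG_eq hℓ hm ha]
  · rw [GenFrob.etaLG_eq hℓ hm ha, GenFrob.cLG_eq hℓ hm ha, GenFrob.prod_mulLG hℓ hm ha]
  · have hc := h.isFrobChart hℓ hm
    exact ⟨hc.coords, hc.gram, hc.euler⟩
  · rintro m' h (⟨rfl, rfl⟩ | ⟨rfl, rfl⟩)
    · exact ⟨GenFrob.isFrobeniusIso_hMap hℓ hm,
        fun a ha => GenFrob.jac_hMap_intersectionForm hℓ hm ha⟩
    · exact ⟨GenFrob.isFrobeniusIso_hMapRefl hℓ hm,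
        fun a ha => GenFrob.jac_hMapRefl_intersectionForm hℓ hm ha⟩
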